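/- Consider a rooted tree $T$ that initially consists of a single root and grows by operations *add_leaf*$(x,y)$, which make a new vertex $y$ a leaf whose parent is the vertex $x$ of the current tree. For vertices $x,y$ of $T$ let $a$ be their nearest common ancestor, and for $z\in\{x,y\}$ let $a_z$ be the ancestor of $z$ immediately preceding $a$ (that is, the child of $a$ that is an ancestor of $z$) if $a\neq z$, and $a_z=a$ if $a=z$. The operation *ca*$(x,y)$ returns the characteristic ancestors $(a,a_x,a_y)$ of $x$ and $y$ in the current tree. The operations are presented online in an arbitrary order. The nearest common ancestors problem with *add_leaf* and *ca* operations can be solved in $O(m+n\log^2 n)$ time and $O(n\log n)$ space, where $n$ is the number of vertices of the final tree, $m$ is the number of *ca* operations, and $n$ need not be known in advance. Precisely: there are an online data structure (one fixed program for the initialization and one for each of the two operations) and a constant $C$ such that for every sequence of operations whose vertices are named, in an arbitrary order, by the integers in $[0,n)$, with $\ell=\lfloor\log_2 n\rfloor+1$, the data structure answers every *ca* correctly before the next operation is presented and performs all the operations in at most $C(m+n\ell^2)$ steps, using at most $Cn\ell$ memory words. The model is a random access machine with words of $C\ell$ bits, a constant number of registers, memory that is initially $0$, and the unit-cost instructions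 assignment, addition, subtraction, multiplication, integer division, comparison, and indirect load and store. -/

import Mathlib

namespace IncNca

/-! ### Incremental rooted trees and characteristic ancestors -/

/-- A finite rooted tree given by its vertex set (vertices are named by natural numbers), its root
and its parent pointers.  The value `parent v` is meaningful only for `v ∈ verts`, `v ≠ root`. -/
structure IncTree where
  root : ℕ
  verts : Finset ℕ
  parent : ℕ → ℕ

namespace IncTree

/-- The tree that consists of the single vertex `r`. -/
def single (r : ℕ) : IncTree where
  root := r
  verts := {r}
  parent := fun _ => r

/-- `add_leaf(x, y)`: the new vertex `y` becomes a leaf with parent `x`. -/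
def addLeaf (T : IncTree) (x y : ℕ) : IncTree where
  root := T.root
  verts := insert y T.verts
  parent := Function.update T.parent y x

/-- `u` is the parent of `v` in `T`. -/
def IsParent (T : IncTree) (u v : ℕ) : Prop :=
  v ∈ T.verts ∧ v ≠ T.root ∧ u = T.parent v

/-- `a` is an ancestor of `v` in `T` (every vertex is an ancestor of itself). -/
def Anc (T : IncTree) (a v : ℕ) : Prop :=
  Relation.ReflTransGen T.IsParent a v

/-- `a` is the nearest common ancestor of `x` and `y`: it is a common ancestor, and every common
ancestor of `x` and `y` is an ancestor of `a`. -/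
def IsNca (T : IncTree) (x y a : ℕ) : Prop :=
  T.Anc a x ∧ T.Anc a y ∧ ∀ b, T.Anc b x → T.Anc b y → T.Anc b a

/-- `az` is the ancestor of `z` that immediately precedes the ancestor `a` of `z` on the path from
`z` up to `a`; if `a = z`, then `az = a`. -/
def IsPreceding (T : IncTree) (a z az : ℕ) : Prop :=
  (a = z ∧ az = a) ∨ (a ≠ z ∧ T.IsParent a az ∧ T.Anc az z)

/-- `ca(x, y) = (a, ax, ay)`: the characteristic ancestors of `x` and `y`. -/
def IsCa (T : IncTree) (x y a ax ay : ℕ) : Prop :=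
  T.IsNca x y a ∧ T.IsPreceding a x ax ∧ T.IsPreceding a y ay

end IncTree

/-- The operations of the problem. -/
inductive Op where
  | addLeaf (x y : ℕ)
  | ca (x y : ℕ)

namespace Op

/-- `1` for an `add_leaf`, `0` for a `ca`. -/
def leafCount : Op → ℕ
  | addLeaf _ _ => 1
  | ca _ _ => 0

/-- `1` for a `ca`, `0` for an `add_leaf`. -/
def caCount : Op → ℕ
  | addLeaf _ _ => 0
  | ca _ _ => 1

end Op

/-- The number `n` of vertices of the final tree: the initial root and one for each `add_leaf`. -/
def numVerts (ops : List Op) : ℕ := 1 + (ops.map Op.leafCount).sum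

/-- The number `m` of `ca` operations. -/
def numCa (ops : List Op) : ℕ := (ops.map Op.caCount).sum

/-- The operations `ops` are legal when performed on `T`, one after the other: `add_leaf(x, y)`
joins a new vertex `y`, whose name is less than `N`, to a vertex `x` of the current tree, and the
arguments of a `ca` are vertices of the current tree. -/
def Legal (N : ℕ) : IncTree → List Op → Prop
  | _, [] => True
  | T, Op.addLeaf x y :: ops =>
      x ∈ T.verts ∧ y ∉ T.verts ∧ y < N ∧ Legal N (T.addLeaf x y) ops
  | T, Op.ca x y :: ops => x ∈ T.verts ∧ y ∈ T.verts ∧ Legal N T ops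

/-! ### The random access machine -/

/-- A configuration of the machine: registers (a program uses finitely many of them) and a
memory of addressable words. -/
structure Config where
  reg : ℕ → ℕ
  mem : ℕ → ℕ

namespace Config

/-- The configuration in which every register and every memory word is `0`. -/
def zero : Config where
  reg := fun _ => 0
  mem := fun _ => 0

def setReg (s : Config) (i v : ℕ) : Config where
  reg := Function.update s.reg i v
  mem := s.mem

def setMem (s : Config) (p v : ℕ) : Config where
  reg := s.reg
  mem := Function.update s.mem p v

end Config

/-- The arithmetic operations of the machine; `sub` is truncated at `0`, `div` is integer division
(with value `0` if the divisor is `0`). -/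
inductive Arith where
  | add
  | sub
  | mul
  | div

def Arith.eval : Arith → ℕ → ℕ → ℕ
  | add, a, b => a + b
  | sub, a, b => a - b
  | mul, a, b => a * b
  | div, a, b => a / b

/-- The tests of the machine; each compares the contents of two registers. -/
inductive Test where
  | lt (i j : ℕ)
  | le (i j : ℕ)
  | eq (i j : ℕ)
  | ne (i j : ℕ)

def Test.Holds : Test → Config → Prop
  | lt i j, s => s.reg i < s.reg j
  | le i j, s => s.reg i ≤ s.reg j
  | eq i j, s => s.reg i = s.reg j
  | ne i j, s => s.reg i ≠ s.reg j

/-- Programs: the instructions of a random access machine, with structured control flow. -/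
inductive Prog where
  /-- do nothing -/
  | skip
  /-- `reg d := k` for a constant `k` -/
  | const (d k : ℕ)
  /-- `reg d := reg i` -/
  | copy (d i : ℕ)
  /-- `reg d := reg i ∘ reg j` for an arithmetic operation `∘` -/
  | arith (o : Arith) (d i j : ℕ)
  /-- `reg d := mem (reg i)` -/
  | load (d i : ℕ)
  /-- `mem (reg i) := reg j` -/
  | store (i j : ℕ)
  /-- sequential composition -/
  | seq (p q : Prog)
  /-- conditional -/
  | ite (b : Test) (p q : Prog)
  /-- loop -/
  | loop (b : Test) (p : Prog)

/-- `Exec W S p s s' t`: on a machine whose words hold the integers in `[0, W)` and whose memory has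
the addresses `[0, S)`, the program `p`, started in `s`, halts in `s'` after `t` steps.  Every
instruction and every evaluation of a test is one step.  Overflow of a word and access outside the
memory are faults (an execution with a fault does not halt), so that a program cannot learn
anything about `W` and `S`. -/
inductive Exec (W S : ℕ) : Prog → Config → Config → ℕ → Prop where
  | skip (s : Config) : Exec W S Prog.skip s s 1
  | const (s : Config) (d k : ℕ) (hk : k < W) :
      Exec W S (Prog.const d k) s (s.setReg d k) 1
  | copy (s : Config) (d i : ℕ) :
      Exec W S (Prog.copy d i) s (s.setReg d (s.reg i)) 1
  | arith (s : Config) (o : Arith) (d i j : ℕ) (hv : o.eval (s.reg i) (s.reg j) < W) :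
      Exec W S (Prog.arith o d i j) s (s.setReg d (o.eval (s.reg i) (s.reg j))) 1
  | load (s : Config) (d i : ℕ) (hi : s.reg i < S) :
      Exec W S (Prog.load d i) s (s.setReg d (s.mem (s.reg i))) 1
  | store (s : Config) (i j : ℕ) (hi : s.reg i < S) :
      Exec W S (Prog.store i j) s (s.setMem (s.reg i) (s.reg j)) 1
  | seq (s s₁ s₂ : Config) (p q : Prog) (t₁ t₂ : ℕ)
      (hp : Exec W S p s s₁ t₁) (hq : Exec W S q s₁ s₂ t₂) :
      Exec W S (Prog.seq p q) s s₂ (t₁ + t₂)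
  | ite_true (s s' : Config) (b : Test) (p q : Prog) (t : ℕ)
      (hb : b.Holds s) (hp : Exec W S p s s' t) :
      Exec W S (Prog.ite b p q) s s' (1 + t)
  | ite_false (s s' : Config) (b : Test) (p q : Prog) (t : ℕ)
      (hb : ¬ b.Holds s) (hq : Exec W S q s s' t) :
      Exec W S (Prog.ite b p q) s s' (1 + t)
  | loop_false (s : Config) (b : Test) (p : Prog) (hb : ¬ b.Holds s) :
      Exec W S (Prog.loop b p) s s 1
  | loop_true (s s₁ s₂ : Config) (b : Test) (p : Prog) (t₁ t₂ : ℕ)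
      (hb : b.Holds s) (hp : Exec W S p s s₁ t₁)
      (hl : Exec W S (Prog.loop b p) s₁ s₂ t₂) :
      Exec W S (Prog.loop b p) s s₂ (1 + t₁ + t₂)

/-! ### Online data structures -/

/-- A data structure for the problem: a program that initializes it and one for each kind of
operation.  Registers and memory persist from one operation to the next.  The arguments are
delivered in the registers `0` and `1`; a `ca` leaves its answer in the registers `0`, `1`, `2`. -/
structure DataStructure where
  init : Prog
  addLeaf : Prog
  ca : Prog

/-- Starting from the configuration `s`, where `T` is the current tree, the data structure performs
the operations one after the other (none of them is available before it is performed), answers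
every `ca` correctly and uses `t` steps in total. -/
def Performs (W S : ℕ) (D : DataStructure) : IncTree → Config → List Op → ℕ → Prop
  | _, _, [], t => t = 0
  | T, s, Op.addLeaf x y :: ops, t =>
      x < W ∧ y < W ∧ ∃ s' t₁ t₂,
        Exec W S D.addLeaf ((s.setReg 0 x).setReg 1 y) s' t₁ ∧
        Performs W S D (T.addLeaf x y) s' ops t₂ ∧ t = t₁ + t₂
  | T, s, Op.ca x y :: ops, t =>
      x < W ∧ y < W ∧ ∃ s' t₁ t₂,
        Exec W S D.ca ((s.setReg 0 x).setReg 1 y) s' t₁ ∧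
        T.IsCa x y (s'.reg 0) (s'.reg 1) (s'.reg 2) ∧
        Performs W S D T s' ops t₂ ∧ t = t₁ + t₂

/-- Starting with all registers and memory words `0`, the data structure is initialized for the tree
with the single vertex `r` and then performs all the operations; `t` steps are used in total. -/
def Solves (W S : ℕ) (D : DataStructure) (r : ℕ) (ops : List Op) (t : ℕ) : Prop :=
  r < W ∧ ∃ s t₀ t₁,
    Exec W S D.init (Config.zero.setReg 0 r) s t₀ ∧
    Performs W S D (IncTree.single r) s ops t₁ ∧ t = t₀ + t₁

/-- `⌊log₂ n⌋ + 1`, the number of bits of `n ≥ 1`. -/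
def lg (n : ℕ) : ℕ := Nat.log 2 n + 1

end IncNca

namespace IncNca

/-! ### A small array language on top of the machine -/

/-! The vertex set is decomposed recursively. A node of the decomposition is a set `K` of vertices
such that the parent of every member lies in `K` or is one fixed vertex `t`. Call a member heavy if
more than half of `K` lies below it. Heavy vertices form a path (`SplitData.heavy_iff`); its lowest
vertex is the separator `c`, and `c = t` if there is none. Every subtree that hangs off `c` contains
at most half of `K`, so moving such subtrees to side `1` until they make up a quarter of `K` leaves
at most three quarters on either side unless `K` is a singleton (`SplitData.balanced`). For every
level a vertex stores its characteristic ancestors with respect to the separator of its node.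

For a query, take the level on which the two vertices are separated. One of them hangs off `c` in a
branch that the other one does not enter, so the two stored triples determine the answer
(`Ordered.isCa_join`). To find this level in constant time, every vertex carries the code of its
path in the decomposition, written in base three with the digits `0` and `2`. As the digit `1` is
missing, the number of ternary digits of the difference of two codes tells where the codes first
differ (`Inv.query`). That number comes from a table, after at most five divisions.

A new leaf joins the nodes of its parent from level `0` downwards, and each of these nodes counts
its insertions. The first node whose counter reaches an eighth of its size is built anew, together
with all that is below it. Insertions preserve `4 * child ≤ 3 * node + counter`; with `8 * counter <
node` the sizes shrink by `25 / 32` per level, and as `3 * 25 ^ 5 ≤ 32 ^ 5`, height `5 * x` suffices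
for `3 ^ x` vertices. Building a node of size `s` anew costs `O(s log n)`, which is paid by its
counter; an insertion increases `O(log n)` counters, whence `O(log² n)` amortized (`pot_rebuilt`,
`insert_wp`).

As `n` is unknown, the names are kept below a capacity `3 ^ x` that is raised when a larger name
arrives; then everything is built anew, at most `lg n` times, for `O(n log n)` each
(`Ready.addLeaf`). All programs are compiled from a small array language whose rules bound the
number of steps (`blk_wp`, `whl_wp`). -/

/-- Parameters of an execution: the machine has words in `[0, W)` and addresses in `[0, S)`; all
stored values are below `V`; the arrays have the rows `0, …, L` of length `N`. -/
structure Env where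
  W : ℕ
  S : ℕ
  V : ℕ
  N : ℕ
  L : ℕ

/-- The exponent `40` is the allowance for intermediate results: an expression of weight at most
`40` cannot overflow a word. The number `19` is that of the arrays, which are interleaved in the
memory. -/
structure Env.Ok (e : Env) : Prop where
  pow_le : e.V ^ 40 ≤ e.W
  le_V : 100 ≤ e.V
  N_pos : 0 < e.N
  space : (e.L + 1) * e.N * 19 ≤ e.S

/-- A state with registers and two-dimensional arrays `arr f`. -/
structure HS where
  reg : ℕ → ℕ
  arr : ℕ → ℕ → ℕ → ℕ

namespace HS

def set (st : HS) (i x : ℕ) : HS where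
  reg := fun j => if j = i then x else st.reg j
  arr := st.arr

def wr (st : HS) (f k v x : ℕ) : HS where
  reg := st.reg
  arr := fun f' k' v' => if f' = f ∧ k' = k ∧ v' = v then x else st.arr f' k' v'

@[simp] theorem set_reg (st : HS) (i x j : ℕ) :
    (st.set i x).reg j = if j = i then x else st.reg j := rfl

@[simp] theorem set_arr (st : HS) (i x : ℕ) : (st.set i x).arr = st.arr := rfl

@[simp] theorem wr_reg (st : HS) (f k v x : ℕ) : (st.wr f k v x).reg = st.reg := rfl

@[simp] theorem wr_arr (st : HS) (f k v x f' k' v' : ℕ) :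
    (st.wr f k v x).arr f' k' v' = if f' = f ∧ k' = k ∧ v' = v then x else st.arr f' k' v' := rfl

end HS

/-- The machine configuration `s` represents the state `st`. -/
structure Rel (e : Env) (st : HS) (s : Config) : Prop where
  reg : ∀ i < 40, s.reg i = st.reg i
  reg_lt : ∀ i < 40, st.reg i < e.V
  stride : st.reg 3 = e.N
  arr : ∀ f < 19, ∀ k, ∀ v < e.N, s.mem ((k * e.N + v) * 19 + f) = st.arr f k v
  mem_lt : ∀ p, s.mem p < e.V

theorem Rel.arr_lt {e : Env} {st : HS} {s : Config} (h : Rel e st s) {f k v : ℕ} (hf : f < 19)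
    (hv : v < e.N) : st.arr f k v < e.V := by
  rw [← h.arr f hf k v hv]; exact h.mem_lt _

inductive Cmp where
  | lt
  | le
  | eq
  | ne

namespace Cmp

def Holds : Cmp → ℕ → ℕ → Prop
  | lt, a, b => a < b
  | le, a, b => a ≤ b
  | eq, a, b => a = b
  | ne, a, b => a ≠ b

def test : Cmp → ℕ → ℕ → Test
  | lt, i, j => Test.lt i j
  | le, i, j => Test.le i j
  | eq, i, j => Test.eq i j
  | ne, i, j => Test.ne i j

def pick (m : Cmp) (a b x y : ℕ) : ℕ :=
  match m with
  | lt => if a < b then x else y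
  | le => if a ≤ b then x else y
  | eq => if a = b then x else y
  | ne => if a ≠ b then x else y

theorem test_holds (m : Cmp) (i j : ℕ) (s : Config) :
    (m.test i j).Holds s ↔ m.Holds (s.reg i) (s.reg j) := by
  cases m <;> rfl

theorem pick_pos {m : Cmp} {a b : ℕ} (h : m.Holds a b) (x y : ℕ) : m.pick a b x y = x := by
  cases m <;> exact if_pos h

theorem pick_neg {m : Cmp} {a b : ℕ} (h : ¬ m.Holds a b) (x y : ℕ) : m.pick a b x y = y := by
  cases m <;> exact if_neg h

end Cmp

/-- Expressions; `rd f k v` is the entry `v` of row `k` of the array `f`. -/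
inductive Ex where
  | reg (i : ℕ)
  | num (k : ℕ)
  | op (o : Arith) (a b : Ex)
  | rd (f : ℕ) (k v : Ex)
  | ite (m : Cmp) (a b x y : Ex)

namespace Ex

def eval (st : HS) : Ex → ℕ
  | reg i => st.reg i
  | num k => k
  | op o a b => o.eval (a.eval st) (b.eval st)
  | rd f k v => st.arr f (k.eval st) (v.eval st)
  | ite m a b x y => m.pick (a.eval st) (b.eval st) (x.eval st) (y.eval st)

def Ok (e : Env) (st : HS) : Ex → Prop
  | reg _ => True
  | num _ => True
  | op _ a b => a.Ok e st ∧ b.Ok e st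
  | rd _ k v => k.Ok e st ∧ v.Ok e st ∧ k.eval st ≤ e.L ∧ v.eval st < e.N
  | ite m a b x y => a.Ok e st ∧ b.Ok e st ∧ (m.Holds (a.eval st) (b.eval st) → x.Ok e st) ∧
      (¬ m.Holds (a.eval st) (b.eval st) → y.Ok e st)

/-- Static well-formedness. -/
def wf : Ex → Bool
  | reg i => decide (i < 40)
  | num k => decide (k < 100)
  | op _ a b => a.wf && b.wf
  | rd f k v => decide (f < 19) && k.wf && v.wf
  | ite _ a b x y => a.wf && b.wf && x.wf && y.wf

/-- The value of the expression is below `V ^ wgt`. -/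
def wgt : Ex → ℕ
  | reg _ => 1
  | num _ => 1
  | op _ a b => a.wgt + b.wgt
  | rd _ k v => k.wgt + v.wgt + 3
  | ite _ a b x y => a.wgt + b.wgt + x.wgt + y.wgt

/-- Expressions whose value is below `V` whenever all stored values are. -/
def small : Ex → Bool
  | reg _ => true
  | num _ => true
  | op Arith.sub a _ => a.small
  | op Arith.div a _ => a.small
  | op _ _ _ => false
  | rd _ _ _ => true
  | ite _ _ _ x y => x.small && y.small

def cost : Ex → ℕ
  | reg _ => 1
  | num _ => 1
  | op _ a b => a.cost + b.cost + 1
  | rd _ k v => k.cost + v.cost + 7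
  | ite _ a b x y => a.cost + b.cost + 1 + x.cost + y.cost

/-- From the row number in register `d` and the column in register `d + 1` to the address. -/
def addrTail (f d : ℕ) : Prog :=
  .seq (.arith .mul d d 3) (.seq (.arith .add d d (d + 1)) (.seq (.const (d + 1) 19)
    (.seq (.arith .mul d d (d + 1)) (.seq (.const (d + 1) f) (.arith .add d d (d + 1))))))

/-- The program that computes the value of the expression into register `d`, using only the
registers from `d` on. -/
def comp : Ex → ℕ → Prog
  | reg i, d => .copy d i
  | num k, d => .const d k
  | op o a b, d => .seq (a.comp d) (.seq (b.comp (d + 1)) (.arith o d d (d + 1)))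
  | rd f k v, d => .seq (k.comp d) (.seq (v.comp (d + 1)) (.seq (addrTail f d) (.load d d)))
  | ite m a b x y, d => .seq (a.comp d) (.seq (b.comp (d + 1))
      (.ite (m.test d (d + 1)) (x.comp d) (y.comp d)))

instance : Add Ex := ⟨op .add⟩
instance : Sub Ex := ⟨op .sub⟩
instance : Mul Ex := ⟨op .mul⟩
instance : Div Ex := ⟨op .div⟩

@[simp] theorem eval_reg (st : HS) (i : ℕ) : (reg i).eval st = st.reg i := rfl
@[simp] theorem eval_num (st : HS) (k : ℕ) : (num k).eval st = k := rfl
@[simp] theorem eval_add (st : HS) (a b : Ex) : (a + b).eval st = a.eval st + b.eval st := rfl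
@[simp] theorem eval_sub (st : HS) (a b : Ex) : (a - b).eval st = a.eval st - b.eval st := rfl
@[simp] theorem eval_mul (st : HS) (a b : Ex) : (a * b).eval st = a.eval st * b.eval st := rfl
@[simp] theorem eval_div (st : HS) (a b : Ex) : (a / b).eval st = a.eval st / b.eval st := rfl
@[simp] theorem eval_rd (st : HS) (f : ℕ) (k v : Ex) :
    (rd f k v).eval st = st.arr f (k.eval st) (v.eval st) := rfl
@[simp] theorem eval_ite_lt (st : HS) (a b x y : Ex) : (ite .lt a b x y).eval st =
    if a.eval st < b.eval st then x.eval st else y.eval st := rfl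
@[simp] theorem eval_ite_le (st : HS) (a b x y : Ex) : (ite .le a b x y).eval st =
    if a.eval st ≤ b.eval st then x.eval st else y.eval st := rfl
@[simp] theorem eval_ite_eq (st : HS) (a b x y : Ex) : (ite .eq a b x y).eval st =
    if a.eval st = b.eval st then x.eval st else y.eval st := rfl
@[simp] theorem eval_ite_ne (st : HS) (a b x y : Ex) : (ite .ne a b x y).eval st =
    if a.eval st ≠ b.eval st then x.eval st else y.eval st := rfl

@[simp] theorem ok_reg (e : Env) (st : HS) (i : ℕ) : (reg i).Ok e st ↔ True := Iff.rfl
@[simp] theorem ok_num (e : Env) (st : HS) (k : ℕ) : (num k).Ok e st ↔ True := Iff.rfl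
@[simp] theorem ok_add (e : Env) (st : HS) (a b : Ex) :
    (a + b).Ok e st ↔ a.Ok e st ∧ b.Ok e st := Iff.rfl
@[simp] theorem ok_sub (e : Env) (st : HS) (a b : Ex) :
    (a - b).Ok e st ↔ a.Ok e st ∧ b.Ok e st := Iff.rfl
@[simp] theorem ok_mul (e : Env) (st : HS) (a b : Ex) :
    (a * b).Ok e st ↔ a.Ok e st ∧ b.Ok e st := Iff.rfl
@[simp] theorem ok_div (e : Env) (st : HS) (a b : Ex) :
    (a / b).Ok e st ↔ a.Ok e st ∧ b.Ok e st := Iff.rfl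
@[simp] theorem ok_rd (e : Env) (st : HS) (f : ℕ) (k v : Ex) : (rd f k v).Ok e st ↔
    k.Ok e st ∧ v.Ok e st ∧ k.eval st ≤ e.L ∧ v.eval st < e.N := Iff.rfl
@[simp] theorem ok_ite_lt (e : Env) (st : HS) (a b x y : Ex) : (ite .lt a b x y).Ok e st ↔
    a.Ok e st ∧ b.Ok e st ∧ (a.eval st < b.eval st → x.Ok e st) ∧
      (¬ a.eval st < b.eval st → y.Ok e st) := Iff.rfl
@[simp] theorem ok_ite_le (e : Env) (st : HS) (a b x y : Ex) : (ite .le a b x y).Ok e st ↔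
    a.Ok e st ∧ b.Ok e st ∧ (a.eval st ≤ b.eval st → x.Ok e st) ∧
      (¬ a.eval st ≤ b.eval st → y.Ok e st) := Iff.rfl
@[simp] theorem ok_ite_eq (e : Env) (st : HS) (a b x y : Ex) : (ite .eq a b x y).Ok e st ↔
    a.Ok e st ∧ b.Ok e st ∧ (a.eval st = b.eval st → x.Ok e st) ∧
      (¬ a.eval st = b.eval st → y.Ok e st) := Iff.rfl
@[simp] theorem ok_ite_ne (e : Env) (st : HS) (a b x y : Ex) : (ite .ne a b x y).Ok e st ↔
    a.Ok e st ∧ b.Ok e st ∧ (a.eval st ≠ b.eval st → x.Ok e st) ∧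
      (¬ a.eval st ≠ b.eval st → y.Ok e st) := Iff.rfl

@[simp] theorem small_reg (i : ℕ) : (reg i).small = true := rfl
@[simp] theorem small_num (k : ℕ) : (num k).small = true := rfl
@[simp] theorem small_rd (f : ℕ) (k v : Ex) : (rd f k v).small = true := rfl
@[simp] theorem small_add (a b : Ex) : (a + b).small = false := rfl
@[simp] theorem small_mul (a b : Ex) : (a * b).small = false := rfl
@[simp] theorem small_sub (a b : Ex) : (a - b).small = a.small := rfl
@[simp] theorem small_div (a b : Ex) : (a / b).small = a.small := rfl
@[simp] theorem small_ite (m : Cmp) (a b x y : Ex) :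
    (ite m a b x y).small = (x.small && y.small) := rfl

theorem one_le_wgt (x : Ex) : 1 ≤ x.wgt := by
  induction x <;> simp only [wgt] <;> omega

theorem eval_small {e : Env} (he : e.Ok) {st : HS} {s : Config} (h : Rel e st s) (x : Ex)
    (hw : x.wf = true) (ho : x.Ok e st) (hs : x.small = true) : x.eval st < e.V := by
  induction x with
  | reg i => exact h.reg_lt i (by simpa [wf] using hw)
  | num k =>
    have : k < 100 := by simpa [wf] using hw
    exact this.trans_le he.le_V
  | op o a b iha ihb =>
    simp only [wf, Bool.and_eq_true] at hw
    cases o with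
    | add => simp [small] at hs
    | mul => simp [small] at hs
    | sub => exact (Nat.sub_le _ _).trans_lt (iha hw.1 ho.1 hs)
    | div => exact (Nat.div_le_self _ _).trans_lt (iha hw.1 ho.1 hs)
  | rd f k v _ _ =>
    simp only [wf, Bool.and_eq_true, decide_eq_true_eq] at hw
    exact h.arr_lt hw.1.1 ho.2.2.2
  | ite m a b x y _ _ ihx ihy =>
    simp only [wf, Bool.and_eq_true] at hw
    simp only [small, Bool.and_eq_true] at hs
    obtain ⟨_, _, ho1, ho2⟩ := ho
    by_cases hm : m.Holds (a.eval st) (b.eval st)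
    · simp only [eval, Cmp.pick_pos hm]; exact ihx hw.1.2 (ho1 hm) hs.1
    · simp only [eval, Cmp.pick_neg hm]; exact ihy hw.2 (ho2 hm) hs.2

/-- Each operation is bounded by the product of the two bounds. For a sum this uses that both powers
are at least `2`. -/
theorem arith_lt_pow {V : ℕ} (hV : 2 ≤ V) (o : Arith) {x y a b : ℕ} (ha : 1 ≤ a) (hb : 1 ≤ b)
    (hx : x < V ^ a) (hy : y < V ^ b) : o.eval x y < V ^ (a + b) := by
  have h1 : 2 ≤ V ^ a := hV.trans (Nat.le_self_pow (by omega) V)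
  have h2 : 2 ≤ V ^ b := hV.trans (Nat.le_self_pow (by omega) V)
  rw [pow_add]
  cases o with
  | add => simp only [Arith.eval]; nlinarith
  | sub => simp only [Arith.eval]; exact (Nat.sub_le _ _).trans_lt (by nlinarith)
  | mul => simp only [Arith.eval]; exact Nat.mul_lt_mul'' hx hy
  | div => simp only [Arith.eval]; exact (Nat.div_le_self _ _).trans_lt (by nlinarith)

theorem addrTail_exec {W S : ℕ} (f d N : ℕ) (hd : 40 ≤ d) (s : Config)
    (h3 : s.reg 3 = N) (h19 : 19 < W) (hf : f < W)
    (hW : (s.reg d * N + s.reg (d + 1)) * 19 + f < W) :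
    ∃ s', Exec W S (addrTail f d) s s' 6 ∧ s'.mem = s.mem ∧ (∀ i < d, s'.reg i = s.reg i) ∧
      s'.reg d = (s.reg d * N + s.reg (d + 1)) * 19 + f := by
  have hd3 : (3 : ℕ) ≠ d := by omega
  have hd1 : d + 1 ≠ d := by omega
  refine ⟨_, Exec.seq _ _ _ _ _ 1 5 (Exec.arith _ _ _ _ _ ?_)
    (Exec.seq _ _ _ _ _ 1 4 (Exec.arith _ _ _ _ _ ?_)
    (Exec.seq _ _ _ _ _ 1 3 (Exec.const _ _ _ h19)
    (Exec.seq _ _ _ _ _ 1 2 (Exec.arith _ _ _ _ _ ?_)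
    (Exec.seq _ _ _ _ _ 1 1 (Exec.const _ _ _ hf) (Exec.arith _ _ _ _ _ ?_))))), ?_, ?_, ?_⟩
  · simp only [Arith.eval, h3]; nlinarith
  · simp [Arith.eval, Config.setReg, h3]; nlinarith
  · simp [Arith.eval, Config.setReg, h3]; nlinarith
  · simpa [Arith.eval, Config.setReg, h3] using hW
  · simp [Config.setReg]
  · intro i hi
    have h1 : i ≠ d := by omega
    have h2 : i ≠ d + 1 := by omega
    simp [Config.setReg, h1, h2]
  · simp [Arith.eval, Config.setReg, h3]

/-- The registers from `40` on serve as a stack: the first operand stays in `d` while the second is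
computed from `d + 1` on. Hence the induction speaks of a configuration `s₁` that agrees with `s`
only in the memory and in the registers below `40`. The bound `e.V ^ x.wgt` is proved along with the
execution because it excludes overflow. -/
theorem comp_exec {e : Env} (he : e.Ok) {st : HS} {s : Config} (hR : Rel e st s) (x : Ex) :
    ∀ (d : ℕ) (s₁ : Config), 40 ≤ d → s₁.mem = s.mem → (∀ i < 40, s₁.reg i = s.reg i) →
      x.wgt ≤ 40 → x.wf = true → x.Ok e st →
      x.eval st < e.V ^ x.wgt ∧
      ∃ s₂ t, Exec e.W e.S (x.comp d) s₁ s₂ t ∧ t ≤ x.cost ∧ s₂.mem = s₁.mem ∧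
        (∀ i < d, s₂.reg i = s₁.reg i) ∧ s₂.reg d = x.eval st := by
  have hV := he.le_V
  have hVW : e.V ≤ e.W := (Nat.le_self_pow (by norm_num) e.V).trans he.pow_le
  have hle : ∀ {a}, a ≤ 40 → e.V ^ a ≤ e.W := fun h =>
    (Nat.pow_le_pow_right (by omega) h).trans he.pow_le
  have hmono : ∀ {a b y}, a ≤ b → y < e.V ^ a → y < e.V ^ b := fun h h' =>
    h'.trans_le (Nat.pow_le_pow_right (by omega) h)
  induction x with
  | reg i =>
    intro d s₁ hd hm hr _ hw _
    have hi : i < 40 := by simpa [wf] using hw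
    refine ⟨by simpa [wgt] using hR.reg_lt i hi, _, _, Exec.copy _ _ _, le_rfl, rfl, ?_, ?_⟩
    · intro j hj
      simp [Config.setReg, hj.ne]
    · simp [Config.setReg, hr i hi, hR.reg i hi]
  | num k =>
    intro d s₁ hd hm hr _ hw _
    have hk : k < 100 := by simpa [wf] using hw
    refine ⟨by simpa [wgt] using hk.trans_le hV, _, _, Exec.const _ _ _ (by omega), le_rfl, rfl,
      ?_, ?_⟩
    · intro j hj
      simp [Config.setReg, hj.ne]
    · simp [Config.setReg]
  | op o a b iha ihb =>
    intro d s₁ hd hm hr hg hw ho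
    simp only [wf, Bool.and_eq_true] at hw
    simp only [wgt] at hg
    obtain ⟨va, s₂, t₂, h₂, c₂, m₂, r₂, e₂⟩ := iha d s₁ hd hm hr (by omega) hw.1 ho.1
    obtain ⟨vb, s₃, t₃, h₃, c₃, m₃, r₃, e₃⟩ := ihb (d + 1) s₂ (by omega) (m₂.trans hm)
      (fun i hi => (r₂ i (by omega)).trans (hr i hi)) (by omega) hw.2 ho.2
    have hv := arith_lt_pow (by omega : 2 ≤ e.V) o a.one_le_wgt b.one_le_wgt va vb
    have e₂' : s₃.reg d = a.eval st := (r₃ d (by omega)).trans e₂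
    refine ⟨hv, _, _, Exec.seq _ _ _ _ _ _ _ h₂ (Exec.seq _ _ _ _ _ _ _ h₃
      (Exec.arith _ _ _ _ _ ?_)), ?_, ?_, ?_, ?_⟩
    · rw [e₂', e₃]; exact hv.trans_le (hle hg)
    · simp only [cost]; omega
    · simp [Config.setReg, m₃, m₂]
    · intro i hi
      simp only [Config.setReg, Function.update_of_ne hi.ne]
      rw [r₃ i (by omega), r₂ i hi]
    · simp [Config.setReg, e₂', e₃, eval]
  | rd f a b iha ihb =>
    intro d s₁ hd hm hr hg hw ho
    simp only [wf, Bool.and_eq_true, decide_eq_true_eq] at hw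
    simp only [wgt] at hg
    obtain ⟨ho1, ho2, hL, hN⟩ := ho
    obtain ⟨va, s₂, t₂, h₂, c₂, m₂, r₂, e₂⟩ := iha d s₁ hd hm hr (by omega) hw.1.2 ho1
    obtain ⟨vb, s₃, t₃, h₃, c₃, m₃, r₃, e₃⟩ := ihb (d + 1) s₂ (by omega) (m₂.trans hm)
      (fun i hi => (r₂ i (by omega)).trans (hr i hi)) (by omega) hw.2 ho2
    have e₂' : s₃.reg d = a.eval st := (r₃ d (by omega)).trans e₂
    -- The row length is the content of register `3`, so it obeys the bound for registers.
    have hNV : e.N < e.V := hR.stride ▸ hR.reg_lt 3 (by norm_num)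
    have h3 : s₃.reg 3 = e.N := by
      rw [r₃ 3 (by omega), r₂ 3 (by omega), hr 3 (by norm_num), hR.reg 3 (by norm_num), hR.stride]
    -- The three extra units in the weight of `rd` pay for the factor `N`, the factor `19` and the
    -- summand `f`.
    have hbig : (a.eval st * e.N + b.eval st) * 19 + f < e.W := by
      have h1 : a.eval st * e.N < e.V ^ (a.wgt + 1) := by
        rw [pow_succ]; exact Nat.mul_lt_mul'' va hNV
      have h2 := arith_lt_pow (by omega : 2 ≤ e.V) .add (by omega) b.one_le_wgt h1 vb
      have h3 := arith_lt_pow (by omega : 2 ≤ e.V) .mul (by omega) le_rfl h2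
        (by rw [pow_one]; omega : 19 < e.V ^ 1)
      have h4 := arith_lt_pow (by omega : 2 ≤ e.V) .add (by omega) le_rfl h3
        (by rw [pow_one]; omega : f < e.V ^ 1)
      exact h4.trans_le (hle (by omega))
    have hadr : (a.eval st * e.N + b.eval st) * 19 + f < e.S := by
      refine lt_of_lt_of_le ?_ he.space
      have : a.eval st * e.N + b.eval st + 1 ≤ (e.L + 1) * e.N := by nlinarith
      omega
    obtain ⟨s₄, h₄, m₄, r₄, e₄⟩ := addrTail_exec (S := e.S) f d e.N hd s₃ h3
      (by omega : 19 < e.W) (by omega) (by rw [e₂', e₃]; exact hbig)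
    rw [e₂', e₃] at e₄
    have hval : s₄.mem (s₄.reg d) = st.arr f (a.eval st) (b.eval st) := by
      rw [e₄, m₄, m₃, m₂, hm, hR.arr f hw.1.1 _ _ hN]
    refine ⟨?_, _, _, Exec.seq _ _ _ _ _ _ _ h₂ (Exec.seq _ _ _ _ _ _ _ h₃
      (Exec.seq _ _ _ _ _ _ _ h₄ (Exec.load _ _ _ ?_))), ?_, ?_, ?_, ?_⟩
    · exact (hR.arr_lt hw.1.1 hN).trans_le (Nat.le_self_pow (by simp only [wgt]; omega) _)
    · rw [e₄]; exact hadr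
    · simp only [cost]; omega
    · simp [Config.setReg, m₄, m₃, m₂]
    · intro i hi
      simp only [Config.setReg, Function.update_of_ne hi.ne]
      rw [r₄ i hi, r₃ i (by omega), r₂ i hi]
    · simp [Config.setReg, hval, eval]
  | ite m a b x y iha ihb ihx ihy =>
    intro d s₁ hd hm hr hg hw ho
    simp only [wf, Bool.and_eq_true] at hw
    simp only [wgt] at hg
    obtain ⟨ho1, ho2, hox, hoy⟩ := ho
    obtain ⟨va, s₂, t₂, h₂, c₂, m₂, r₂, e₂⟩ := iha d s₁ hd hm hr (by omega) hw.1.1.1 ho1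
    have hr₂ : ∀ i < 40, s₂.reg i = s.reg i := fun i hi => (r₂ i (by omega)).trans (hr i hi)
    obtain ⟨vb, s₃, t₃, h₃, c₃, m₃, r₃, e₃⟩ := ihb (d + 1) s₂ (by omega) (m₂.trans hm) hr₂
      (by omega) hw.1.1.2 ho2
    have hr₃ : ∀ i < 40, s₃.reg i = s.reg i := fun i hi => (r₃ i (by omega)).trans (hr₂ i hi)
    have e₂' : s₃.reg d = a.eval st := (r₃ d (by omega)).trans e₂
    have htest : (m.test d (d + 1)).Holds s₃ ↔ m.Holds (a.eval st) (b.eval st) := by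
      rw [Cmp.test_holds, e₂', e₃]
    by_cases hc : m.Holds (a.eval st) (b.eval st)
    · obtain ⟨vx, s₄, t₄, h₄, c₄, m₄, r₄, e₄⟩ := ihx d s₃ hd (m₃.trans (m₂.trans hm)) hr₃
        (by omega) hw.1.2 (hox hc)
      refine ⟨?_, _, _, Exec.seq _ _ _ _ _ _ _ h₂ (Exec.seq _ _ _ _ _ _ _ h₃
        (Exec.ite_true _ _ _ _ _ _ (htest.2 hc) h₄)), ?_, ?_, ?_, ?_⟩
      · simp only [eval, Cmp.pick_pos hc]; exact hmono (by simp only [wgt]; omega) vx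
      · simp only [cost]; omega
      · rw [m₄, m₃, m₂]
      · intro i hi; rw [r₄ i hi, r₃ i (by omega), r₂ i hi]
      · simp only [eval, Cmp.pick_pos hc]; exact e₄
    · obtain ⟨vx, s₄, t₄, h₄, c₄, m₄, r₄, e₄⟩ := ihy d s₃ hd (m₃.trans (m₂.trans hm)) hr₃
        (by omega) hw.2 (hoy hc)
      refine ⟨?_, _, _, Exec.seq _ _ _ _ _ _ _ h₂ (Exec.seq _ _ _ _ _ _ _ h₃
        (Exec.ite_false _ _ _ _ _ _ (fun h => hc (htest.1 h)) h₄)), ?_, ?_, ?_, ?_⟩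
      · simp only [eval, Cmp.pick_neg hc]; exact hmono (by simp only [wgt]; omega) vx
      · simp only [cost]; omega
      · rw [m₄, m₃, m₂]
      · intro i hi; rw [r₄ i hi, r₃ i (by omega), r₂ i hi]
      · simp only [eval, Cmp.pick_neg hc]; exact e₄

end Ex

/-! ### Total correctness with a bound on the number of steps -/

/-- Started in a configuration that represents `st`, the program halts within `T` steps in a
configuration that represents a state with property `Q`. -/
def WP (e : Env) (p : Prog) (T : ℕ) (st : HS) (Q : HS → Prop) : Prop :=
  ∀ s, Rel e st s → ∃ s' st' t, Exec e.W e.S p s s' t ∧ t ≤ T ∧ Rel e st' s' ∧ Q st'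

theorem WP.mono {e : Env} {p : Prog} {T T' : ℕ} {st : HS} {Q Q' : HS → Prop}
    (h : WP e p T st Q) (hT : T ≤ T') (hQ : ∀ st, Q st → Q' st) : WP e p T' st Q' := by
  intro s hs
  obtain ⟨s', st', t, h1, h2, h3, h4⟩ := h s hs
  exact ⟨s', st', t, h1, h2.trans hT, h3, hQ _ h4⟩

theorem WP.seq {e : Env} {p q : Prog} {T₁ T₂ : ℕ} {st : HS} {Q R : HS → Prop}
    (h : WP e p T₁ st R) (h' : ∀ st', R st' → WP e q T₂ st' Q) :
    WP e (.seq p q) (T₁ + T₂) st Q := by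
  intro s hs
  obtain ⟨s', st', t, h1, h2, h3, h4⟩ := h s hs
  obtain ⟨s'', st'', t', h5, h6, h7, h8⟩ := h' st' h4 s' h3
  exact ⟨s'', st'', t + t', Exec.seq _ _ _ _ _ _ _ h1 h5, by omega, h7, h8⟩

/-- Assignments and array updates. -/
inductive At where
  | set (i : ℕ) (x : Ex)
  | wr (f : ℕ) (k v x : Ex)

namespace At

def comp : At → Prog
  | set i x => .seq (x.comp 40) (.copy i 40)
  | wr f k v x => .seq (k.comp 40) (.seq (v.comp 41) (.seq (Ex.addrTail f 40)
      (.seq (x.comp 41) (.store 40 41))))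

def cost : At → ℕ
  | set _ x => x.cost + 1
  | wr _ k v x => k.cost + v.cost + 6 + x.cost + 1

def wf : At → Bool
  | set i x => decide (i < 40) && decide (i ≠ 3) && decide (x.wgt ≤ 40) && x.wf
  | wr f k v x => decide (f < 19) && decide (k.wgt + v.wgt + 3 ≤ 40) && decide (x.wgt ≤ 40) &&
      k.wf && v.wf && x.wf

end At

/-- A straight-line program. -/
def blk : List At → Prog
  | [] => .skip
  | a :: l => .seq a.comp (blk l)

def blkCost : List At → ℕ
  | [] => 1
  | a :: l => a.cost + blkCost l

def blkWf : List At → Bool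
  | [] => true
  | a :: l => a.wf && blkWf l

/-- The verification condition of a straight-line program. -/
def vc (e : Env) : List At → HS → (HS → Prop) → Prop
  | [], st, Q => Q st
  | .set i x :: l, st, Q => x.Ok e st ∧ (x.small = true ∨ x.eval st < e.V) ∧
      -- A fresh name for the value keeps the terms small along the program and provides the bound
      -- `y < e.V` to the conditions that follow.
      ∀ y, y = x.eval st → y < e.V → vc e l (st.set i y) Q
  | .wr f k v x :: l, st, Q => (k.Ok e st ∧ v.Ok e st ∧ x.Ok e st) ∧
      (k.eval st ≤ e.L ∧ v.eval st < e.N ∧ (x.small = true ∨ x.eval st < e.V)) ∧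
      vc e l (st.wr f (k.eval st) (v.eval st) (x.eval st)) Q

theorem Rel.set {e : Env} {st : HS} {s s' : Config} (h : Rel e st s) {i x : ℕ} (hi3 : i ≠ 3)
    (hx : x < e.V) (hm : s'.mem = s.mem) (hr : ∀ j < 40, j ≠ i → s'.reg j = s.reg j)
    (hri : s'.reg i = x) : Rel e (st.set i x) s' where
  reg j hj := by
    rw [HS.set_reg]
    split_ifs with hji
    · rw [hji, hri]
    · rw [hr j hj hji, h.reg j hj]
  reg_lt j hj := by
    rw [HS.set_reg]
    split_ifs with hji
    · exact hx
    · exact h.reg_lt j hj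
  stride := by
    rw [HS.set_reg, if_neg hi3.symm]; exact h.stride
  arr f hf k v hv := by rw [hm]; exact h.arr f hf k v hv
  mem_lt p := by rw [hm]; exact h.mem_lt p

/-- An address is a number in mixed radix with the digits `v < N` and `f < 19`. -/
theorem addr_inj {N f f' k k' v v' : ℕ} (hf : f < 19) (hf' : f' < 19) (hv : v < N) (hv' : v' < N)
    (h : (k * N + v) * 19 + f = (k' * N + v') * 19 + f') : f = f' ∧ k = k' ∧ v = v' := by
  have h1 : k * N + v = k' * N + v' := by omega
  have h2 : f = f' := by omega
  have h3 : k = k' := by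
    have e1 : (k * N + v) / N = k := by
      rw [mul_comm, Nat.mul_add_div (by omega), Nat.div_eq_of_lt hv, add_zero]
    have e2 : (k' * N + v') / N = k' := by
      rw [mul_comm, Nat.mul_add_div (by omega), Nat.div_eq_of_lt hv', add_zero]
    rw [← e1, ← e2, h1]
  subst h3
  exact ⟨h2, rfl, by omega⟩

theorem Rel.wr {e : Env} {st : HS} {s s' : Config} (h : Rel e st s) {f k v x : ℕ} (hf : f < 19)
    (hv : v < e.N) (hx : x < e.V) (hr : ∀ j < 40, s'.reg j = s.reg j)
    (hm : s'.mem = Function.update s.mem ((k * e.N + v) * 19 + f) x) :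
    Rel e (st.wr f k v x) s' where
  reg j hj := by rw [hr j hj, h.reg j hj]; rfl
  reg_lt j hj := h.reg_lt j hj
  stride := h.stride
  arr f' hf' k' v' hv' := by
    rw [hm, HS.wr_arr]
    split_ifs with hc
    · obtain ⟨rfl, rfl, rfl⟩ := hc
      rw [Function.update_self]
    · rw [Function.update_of_ne, h.arr f' hf' k' v' hv']
      intro heq
      exact hc (addr_inj hf' hf hv' hv heq)
  mem_lt p := by
    rw [hm]
    by_cases hp : p = (k * e.N + v) * 19 + f
    · rw [hp, Function.update_self]; exact hx
    · rw [Function.update_of_ne hp]; exact h.mem_lt p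

theorem blk_wp {e : Env} (he : e.Ok) (l : List At) : ∀ (st : HS) (Q : HS → Prop),
    blkWf l = true → vc e l st Q → WP e (blk l) (blkCost l) st Q := by
  induction l with
  | nil =>
    intro st Q _ h s hs
    exact ⟨s, st, 1, Exec.skip s, le_rfl, hs, h⟩
  | cons a l ih =>
    intro st Q hw h s hs
    simp only [blkWf, Bool.and_eq_true] at hw
    cases a with
    | set i x =>
      simp only [At.wf, Bool.and_eq_true, decide_eq_true_eq] at hw
      obtain ⟨⟨⟨⟨hi, hi3⟩, hg⟩, hx⟩, hl⟩ := hw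
      obtain ⟨ho, hsm, hrest⟩ := h
      have hlt : x.eval st < e.V := hsm.elim (Ex.eval_small he hs x hx ho) id
      obtain ⟨_, s₁, t₁, h₁, c₁, m₁, r₁, e₁⟩ :=
        Ex.comp_exec he hs x 40 s le_rfl rfl (fun _ _ => rfl) hg hx ho
      have hR : Rel e (st.set i (x.eval st)) (s₁.setReg i (s₁.reg 40)) := by
        refine hs.set hi3 hlt (by simp [Config.setReg, m₁]) ?_ (by simp [Config.setReg, e₁])
        intro j hj hji
        simp only [Config.setReg, Function.update_of_ne hji]
        exact r₁ j hj
      obtain ⟨s₂, st₂, t₂, h₂, c₂, R₂, q₂⟩ := ih _ Q hl (hrest _ rfl hlt) _ hR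
      refine ⟨s₂, st₂, _, Exec.seq _ _ _ _ _ _ _
        (Exec.seq _ _ _ _ _ _ _ h₁ (Exec.copy _ _ _)) h₂, ?_, R₂, q₂⟩
      simp only [blkCost, At.cost]; omega
    | wr f k v x =>
      simp only [At.wf, Bool.and_eq_true, decide_eq_true_eq] at hw
      obtain ⟨⟨⟨⟨⟨⟨hf, hg⟩, hgx⟩, hk⟩, hv⟩, hx⟩, hl⟩ := hw
      obtain ⟨⟨hok, hov, hox⟩, ⟨hL, hN, hsm⟩, hrest⟩ := h
      have hlt : x.eval st < e.V := hsm.elim (Ex.eval_small he hs x hx hox) id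
      have hV := he.le_V
      have hle : ∀ {a}, a ≤ 40 → e.V ^ a ≤ e.W := fun h =>
        (Nat.pow_le_pow_right (by omega) h).trans he.pow_le
      have hVW : e.V ≤ e.W := (Nat.le_self_pow (by norm_num) e.V).trans he.pow_le
      obtain ⟨vk, s₁, t₁, h₁, c₁, m₁, r₁, e₁⟩ :=
        Ex.comp_exec he hs k 40 s le_rfl rfl (fun _ _ => rfl) (by omega) hk hok
      obtain ⟨vv, s₂, t₂, h₂, c₂, m₂, r₂, e₂⟩ :=
        Ex.comp_exec he hs v 41 s₁ (by norm_num) m₁ (fun i hi => r₁ i hi) (by omega) hv hov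
      have e₁' : s₂.reg 40 = k.eval st := (r₂ 40 (by norm_num)).trans e₁
      have hr₂ : ∀ i < 40, s₂.reg i = s.reg i := fun i hi =>
        (r₂ i (by omega)).trans (r₁ i hi)
      have h3 : s₂.reg 3 = e.N := by
        rw [hr₂ 3 (by norm_num), hs.reg 3 (by norm_num), hs.stride]
      have hNV : e.N < e.V := hs.stride ▸ hs.reg_lt 3 (by norm_num)
      have hbig : (k.eval st * e.N + v.eval st) * 19 + f < e.W := by
        have h1 : k.eval st * e.N < e.V ^ (k.wgt + 1) := by
          rw [pow_succ]; exact Nat.mul_lt_mul'' vk hNV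
        have h2 := Ex.arith_lt_pow (by omega : 2 ≤ e.V) .add (by omega) v.one_le_wgt h1 vv
        have h3 := Ex.arith_lt_pow (by omega : 2 ≤ e.V) .mul (by omega) le_rfl h2
          (by rw [pow_one]; omega : 19 < e.V ^ 1)
        have h4 := Ex.arith_lt_pow (by omega : 2 ≤ e.V) .add (by omega) le_rfl h3
          (by rw [pow_one]; omega : f < e.V ^ 1)
        exact h4.trans_le (hle (by omega))
      have hadr : (k.eval st * e.N + v.eval st) * 19 + f < e.S := by
        refine lt_of_lt_of_le ?_ he.space
        have : k.eval st * e.N + v.eval st + 1 ≤ (e.L + 1) * e.N := by nlinarith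
        omega
      obtain ⟨s₃, h₃, m₃, r₃, e₃⟩ := Ex.addrTail_exec (S := e.S) f 40 e.N le_rfl s₂ h3
        (by omega : 19 < e.W) (by omega) (by rw [e₁', e₂]; exact hbig)
      rw [e₁', e₂] at e₃
      have hr₃ : ∀ i < 40, s₃.reg i = s.reg i := fun i hi => (r₃ i hi).trans (hr₂ i hi)
      have hm₃ : s₃.mem = s.mem := m₃.trans (m₂.trans m₁)
      obtain ⟨_, s₄, t₄, h₄, c₄, m₄, r₄, e₄⟩ :=
        Ex.comp_exec he hs x 41 s₃ (by norm_num) hm₃ hr₃ hgx hx hox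
      have e₃' : s₄.reg 40 = (k.eval st * e.N + v.eval st) * 19 + f :=
        (r₄ 40 (by norm_num)).trans e₃
      have hR : Rel e (st.wr f (k.eval st) (v.eval st) (x.eval st))
          (s₄.setMem (s₄.reg 40) (s₄.reg 41)) := by
        refine hs.wr hf hN hlt ?_ ?_
        · intro j hj
          exact (r₄ j (by omega)).trans (hr₃ j hj)
        · simp only [Config.setMem, e₃', e₄, m₄, hm₃]
      obtain ⟨s₅, st₅, t₅, h₅, c₅, R₅, q₅⟩ := ih _ Q hl hrest _ hR
      refine ⟨s₅, st₅, _, Exec.seq _ _ _ _ _ _ _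
        (Exec.seq _ _ _ _ _ _ _ h₁ (Exec.seq _ _ _ _ _ _ _ h₂ (Exec.seq _ _ _ _ _ _ _ h₃
          (Exec.seq _ _ _ _ _ _ _ h₄ (Exec.store _ _ _ (by rw [e₃']; exact hadr)))))) h₅, ?_,
        R₅, q₅⟩
      simp only [blkCost, At.cost]; omega

/-- The loop that runs `p` as long as `m` holds between two expressions. -/
def whl (m : Cmp) (a b : Ex) (p : Prog) : Prog :=
  .seq (.seq (a.comp 40) (b.comp 41)) (.loop (m.test 40 41) (.seq p (.seq (a.comp 40) (b.comp 41))))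

theorem Rel.of_eq {e : Env} {st : HS} {s s' : Config} (h : Rel e st s)
    (hr : ∀ j < 40, s'.reg j = s.reg j) (hm : s'.mem = s.mem) : Rel e st s' where
  reg j hj := by rw [hr j hj, h.reg j hj]
  reg_lt := h.reg_lt
  stride := h.stride
  arr f hf k v hv := by rw [hm]; exact h.arr f hf k v hv
  mem_lt p := by rw [hm]; exact h.mem_lt p

/-- The index of `J` bounds the number of iterations that remain: if the guard holds, `hJ` requires
the index to be positive and to drop. On exit the index is arbitrary, so a loop may stop early. The
summand `1` in `n + 1` covers the first evaluation of the guard. -/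
theorem whl_wp {e : Env} (he : e.Ok) {m : Cmp} {a b : Ex} {p : Prog} (J : ℕ → HS → Prop)
    (T : ℕ) (ha : a.wf = true ∧ a.wgt ≤ 40) (hb : b.wf = true ∧ b.wgt ≤ 40)
    (hJ : ∀ n st, J n st → a.Ok e st ∧ b.Ok e st ∧
      (m.Holds (a.eval st) (b.eval st) → ∃ n', n = n' + 1 ∧ WP e p T st (J n')))
    {n : ℕ} {st : HS} (h : J n st) :
    WP e (whl m a b p) ((n + 1) * (T + a.cost + b.cost + 1)) st
      (fun st' => (∃ n', J n' st') ∧ ¬ m.Holds (a.eval st') (b.eval st')) := by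
  have key : ∀ st s, a.Ok e st → b.Ok e st → Rel e st s → ∃ s' t,
      Exec e.W e.S (.seq (a.comp 40) (b.comp 41)) s s' t ∧ t ≤ a.cost + b.cost ∧ Rel e st s' ∧
      ((m.test 40 41).Holds s' ↔ m.Holds (a.eval st) (b.eval st)) := by
    intro st s hao hbo hs
    obtain ⟨_, s₁, t₁, h₁, c₁, m₁, r₁, e₁⟩ :=
      Ex.comp_exec he hs a 40 s le_rfl rfl (fun _ _ => rfl) ha.2 ha.1 hao
    obtain ⟨_, s₂, t₂, h₂, c₂, m₂, r₂, e₂⟩ :=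
      Ex.comp_exec he hs b 41 s₁ (by norm_num) m₁ (fun i hi => r₁ i hi) hb.2 hb.1 hbo
    refine ⟨s₂, _, Exec.seq _ _ _ _ _ _ _ h₁ h₂, by omega,
      hs.of_eq (fun j hj => (r₂ j (by omega)).trans (r₁ j hj)) (m₂.trans m₁), ?_⟩
    rw [Cmp.test_holds, e₂, (r₂ 40 (by norm_num)).trans e₁]
  have main : ∀ n st s, J n st → Rel e st s →
      ((m.test 40 41).Holds s ↔ m.Holds (a.eval st) (b.eval st)) →
      ∃ s' st' t, Exec e.W e.S (.loop (m.test 40 41) (.seq p (.seq (a.comp 40) (b.comp 41))))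
        s s' t ∧ t ≤ n * (T + a.cost + b.cost + 1) + 1 ∧ Rel e st' s' ∧
        (∃ n', J n' st') ∧ ¬ m.Holds (a.eval st') (b.eval st') := by
    intro n
    induction n with
    | zero =>
      intro st s hj hs ht
      obtain ⟨_, _, hc⟩ := hJ 0 st hj
      have hn : ¬ m.Holds (a.eval st) (b.eval st) := by
        intro h
        obtain ⟨n', hn', _⟩ := hc h
        omega
      exact ⟨s, st, 1, Exec.loop_false _ _ _ (fun h => hn (ht.1 h)), by omega, hs, ⟨0, hj⟩, hn⟩
    | succ n ih =>
      intro st s hj hs ht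
      obtain ⟨_, _, hc⟩ := hJ _ st hj
      by_cases hh : m.Holds (a.eval st) (b.eval st)
      · obtain ⟨n', hn', hw⟩ := hc hh
        obtain rfl : n = n' := by omega
        obtain ⟨s₁, st₁, t₁, h₁, c₁, R₁, j₁⟩ := hw s hs
        obtain ⟨hao, hbo, _⟩ := hJ _ st₁ j₁
        obtain ⟨s₂, t₂, h₂, c₂, R₂, e₂⟩ := key st₁ s₁ hao hbo R₁
        obtain ⟨s₃, st₃, t₃, h₃, c₃, R₃, q₃⟩ := ih st₁ s₂ j₁ R₂ e₂
        refine ⟨s₃, st₃, _, Exec.loop_true _ _ _ _ _ _ _ (ht.2 hh)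
          (Exec.seq _ _ _ _ _ _ _ h₁ h₂) h₃, ?_, R₃, q₃⟩
        rw [add_mul]; omega
      · exact ⟨s, st, 1, Exec.loop_false _ _ _ (fun h => hh (ht.1 h)), by omega, hs, ⟨_, hj⟩, hh⟩
  intro s hs
  obtain ⟨hao, hbo, _⟩ := hJ n st h
  obtain ⟨s₁, t₁, h₁, c₁, R₁, e₁⟩ := key st s hao hbo hs
  obtain ⟨s₂, st₂, t₂, h₂, c₂, R₂, q₂⟩ := main n st s₁ h R₁ e₁
  refine ⟨s₂, st₂, _, Exec.seq _ _ _ _ _ _ _ h₁ h₂, ?_, R₂, q₂⟩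
  rw [add_mul]; omega

/-! ### Ancestors and characteristic ancestors in a tree with a topological order -/

namespace IncTree

/-- `ord` lists the vertices of `T`, parents before their children. -/
structure Ordered (T : IncTree) (ord : List ℕ) : Prop where
  nodup : ord.Nodup
  mem : ∀ v, v ∈ ord ↔ v ∈ T.verts
  root_mem : T.root ∈ T.verts
  parent_root : T.parent T.root = T.root
  parent_mem : ∀ v ∈ T.verts, T.parent v ∈ T.verts
  parent_ne : ∀ v ∈ T.verts, v ≠ T.root → T.parent v ≠ v
  topo : ord.Pairwise (fun a b => T.parent a ≠ b)

variable {T : IncTree} {ord : List ℕ}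

theorem Ordered.idx_parent (h : T.Ordered ord) {v : ℕ} (hv : v ∈ T.verts) (hr : v ≠ T.root) :
    ord.idxOf (T.parent v) < ord.idxOf v := by
  have h1 : v ∈ ord := (h.mem v).2 hv
  have h2 : T.parent v ∈ ord := (h.mem _).2 (h.parent_mem v hv)
  rcases lt_trichotomy (ord.idxOf (T.parent v)) (ord.idxOf v) with hlt | heq | hgt
  · exact hlt
  · exact absurd ((List.idxOf_inj h2).1 heq) (h.parent_ne v hv hr)
  · have := List.pairwise_iff_getElem.1 h.topo _ _ (List.idxOf_lt_length_of_mem h1)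
      (List.idxOf_lt_length_of_mem h2) hgt
    simp at this

theorem anc_parent {v : ℕ} (hv : v ∈ T.verts) (hr : v ≠ T.root) : T.Anc (T.parent v) v :=
  Relation.ReflTransGen.single ⟨hv, hr, rfl⟩

theorem anc_refl (v : ℕ) : T.Anc v v := Relation.ReflTransGen.refl

theorem Anc.trans {a b c : ℕ} (h : T.Anc a b) (h' : T.Anc b c) : T.Anc a c :=
  Relation.ReflTransGen.trans h h'

theorem Anc.cases {a v : ℕ} (h : T.Anc a v) :
    a = v ∨ (v ∈ T.verts ∧ v ≠ T.root ∧ T.Anc a (T.parent v)) := by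
  rcases Relation.ReflTransGen.cases_tail h with h | ⟨u, h1, h2, h3, rfl⟩
  · exact Or.inl h.symm
  · exact Or.inr ⟨h2, h3, h1⟩

theorem Anc.head_cases {a v : ℕ} (h : T.Anc a v) :
    a = v ∨ ∃ e, T.IsParent a e ∧ T.Anc e v := by
  rcases Relation.ReflTransGen.cases_head h with h | ⟨u, h1, h2⟩
  · exact Or.inl h
  · exact Or.inr ⟨u, h1, h2⟩

theorem Ordered.idx_anc (h : T.Ordered ord) {a v : ℕ} (ha : T.Anc a v) :
    a = v ∨ ord.idxOf a < ord.idxOf v := by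
  induction ha with
  | refl => exact Or.inl rfl
  | tail _ hb ih =>
    obtain ⟨h1, h2, rfl⟩ := hb
    right
    have := h.idx_parent h1 h2
    rcases ih with rfl | ih
    · exact this
    · omega

theorem Ordered.antisymm (h : T.Ordered ord) {a v : ℕ} (h1 : T.Anc a v) (h2 : T.Anc v a) :
    a = v := by
  rcases h.idx_anc h1 with e | e
  · exact e
  · rcases h.idx_anc h2 with e' | e'
    · exact e'.symm
    · omega

/-- The ancestors of a vertex form a chain, because the way from a vertex to the root is unique. -/
theorem Anc.total {a b v : ℕ} (h1 : T.Anc a v) (h2 : T.Anc b v) : T.Anc a b ∨ T.Anc b a := by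
  induction h1 with
  | refl => exact Or.inr h2
  | tail hab hp ih =>
    obtain ⟨hv, hr, rfl⟩ := hp
    rcases h2.cases with rfl | ⟨_, _, h2⟩
    · exact Or.inl (Relation.ReflTransGen.tail hab ⟨hv, hr, rfl⟩)
    · exact ih h2

theorem Ordered.isParent_ne (h : T.Ordered ord) {a b : ℕ} (hp : T.IsParent a b) : a ≠ b := by
  obtain ⟨h1, h2, rfl⟩ := hp
  exact h.parent_ne b h1 h2

/-- Two children of `a` that are ancestors of the same vertex are equal. -/
theorem Ordered.child_unique (h : T.Ordered ord) {a e e' v : ℕ} (h1 : T.IsParent a e)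
    (h2 : T.IsParent a e') (h3 : T.Anc e v) (h4 : T.Anc e' v) : e = e' := by
  have key : ∀ {e e'}, T.IsParent a e → T.IsParent a e' → T.Anc e e' → e = e' := by
    intro e e' h1 h2 h5
    rcases h5.cases with rfl | ⟨_, _, h6⟩
    · rfl
    · rw [← h2.2.2] at h6
      exact absurd (h.antisymm h6 (Relation.ReflTransGen.single h1)).symm (h.isParent_ne h1)
  rcases h3.total h4 with h5 | h5
  · exact key h1 h2 h5
  · exact (key h2 h1 h5).symm

theorem Ordered.verts_of_anc (h : T.Ordered ord) {a v : ℕ} (ha : T.Anc a v) (hv : v ∈ T.verts) :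
    a ∈ T.verts := by
  induction ha with
  | refl => exact hv
  | tail _ hp ih => exact ih (hp.2.2 ▸ h.parent_mem _ hp.1)

theorem IsPreceding.anc {a z az : ℕ} (h : T.IsPreceding a z az) : T.Anc az z := by
  rcases h with ⟨h, rfl⟩ | ⟨_, _, h⟩
  · rw [h]; exact anc_refl _
  · exact h

theorem isCa_self (x : ℕ) : T.IsCa x x x x x :=
  ⟨⟨anc_refl x, anc_refl x, fun _ h _ => h⟩, Or.inl ⟨rfl, rfl⟩, Or.inl ⟨rfl, rfl⟩⟩

theorem isCa_of_anc {v c d : ℕ} (h : T.Anc v c) (hd : T.IsPreceding v c d) : T.IsCa v c v v d :=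
  ⟨⟨anc_refl v, h, fun _ h _ => h⟩, Or.inl ⟨rfl, rfl⟩, hd⟩

theorem IsCa.symm {x y a ax ay : ℕ} (h : T.IsCa x y a ax ay) : T.IsCa y x a ay ax :=
  ⟨⟨h.1.2.1, h.1.1, fun b h1 h2 => h.1.2.2 b h2 h1⟩, h.2.2, h.2.1⟩

/-- From the parent of `v` to `v`, if `v` is not an ancestor of `c`. -/
theorem IsCa.step {v c a au ac : ℕ} (hv : v ∈ T.verts) (hr : v ≠ T.root) (hc : ¬ T.Anc v c)
    (h : T.IsCa (T.parent v) c a au ac) :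
    T.IsCa v c a (if a = T.parent v then v else au) ac := by
  obtain ⟨⟨h1, h2, h3⟩, h4, h5⟩ := h
  have hav : a ≠ v := by rintro rfl; exact hc h2
  refine ⟨⟨h1.trans (anc_parent hv hr), h2, ?_⟩, ?_, h5⟩
  · intro b hb hbc
    rcases hb.cases with rfl | ⟨_, _, hb⟩
    · exact absurd hbc hc
    · exact h3 b hb hbc
  · right
    split_ifs with ha
    · exact ⟨hav, ⟨hv, hr, ha⟩, anc_refl v⟩
    · rcases h4 with ⟨h4, _⟩ | ⟨_, h6, h7⟩
      · exact absurd h4 ha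
      · exact ⟨hav, h6, h7.trans (anc_parent hv hr)⟩

/-- The characteristic ancestors of `x` and `y` from those of `x`, `c` and of `y`, `c`, for a
proper ancestor `c` of `x` on the path from `x` to `y`. -/
theorem Ordered.isCa_join (h : T.Ordered ord) {x y c ax ac b bY bc : ℕ} (hx : T.IsCa x c c ax ac)
    (hxc : x ≠ c) (hy : T.IsCa y c b bY bc) (hne : ax ≠ bY) :
    T.IsCa x y b (if bc = b then ax else bc) bY := by
  obtain ⟨⟨hcx, _, _⟩, hax, _⟩ := hx
  obtain ⟨⟨hby, hbc, hb⟩, hbY, hbC⟩ := hy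
  have hax' : T.IsParent c ax ∧ T.Anc ax x := by
    rcases hax with ⟨e, _⟩ | ⟨_, h1, h2⟩
    · exact absurd e.symm hxc
    · exact ⟨h1, h2⟩
  refine ⟨⟨hbc.trans hcx, hby, ?_⟩, ?_, hbY⟩
  · intro b' h1 h2
    rcases h1.total hcx with h3 | h3
    · exact hb b' h2 h3
    -- Here `b'` is below `c`, so `c` is an ancestor of `y` and `b = c`. If `b'` were strictly below
    -- `c`, the child of `c` towards `b'` would be both `ax` and `bY`.
    · have hcy : T.Anc c y := h3.trans h2
      obtain rfl : b = c := h.antisymm hbc (hb c hcy (anc_refl c))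
      rcases h3.head_cases with rfl | ⟨e, he, heb⟩
      · exact anc_refl _
      · exfalso
        have e1 : e = ax := h.child_unique he hax'.1 (heb.trans h1) hax'.2
        rcases hbY with ⟨rfl, _⟩ | ⟨_, h4, h5⟩
        · have : b = e := h.antisymm (Relation.ReflTransGen.single he) (heb.trans h2)
          exact h.isParent_ne he this
        · exact hne (e1 ▸ h.child_unique he h4 (heb.trans h2) h5)
  -- The test `bc = b` amounts to `b = c`. In that case `x` leaves `b` through `ax`; otherwise it
  -- leaves `b` through the same child as `c`.
  · split_ifs with hbb
    · rcases hbC with ⟨rfl, _⟩ | ⟨_, h4, _⟩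
      · exact Or.inr ⟨fun e => hxc e.symm, hax'⟩
      · exact absurd hbb.symm (h.isParent_ne h4)
    · rcases hbC with ⟨_, h4⟩ | ⟨_, h4, h5⟩
      · exact absurd h4 hbb
      · refine Or.inr ⟨?_, h4, h5.trans hcx⟩
        rintro rfl
        exact hxc (h.antisymm hbc hcx)

/-! ### Adding a leaf -/

theorem single_ordered (r : ℕ) : (single r).Ordered [r] where
  nodup := by simp
  mem v := by simp [single]
  root_mem := by simp [single]
  parent_root := rfl
  parent_mem v _ := by simp [single]
  parent_ne v hv hr := absurd (by simpa [single] using hv) hr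
  topo := by simp

theorem Ordered.addLeaf (h : T.Ordered ord) {x y : ℕ} (hx : x ∈ T.verts) (hy : y ∉ T.verts) :
    (T.addLeaf x y).Ordered (ord ++ [y]) := by
  have hne : ∀ {v}, v ∈ T.verts → v ≠ y := by rintro v hv rfl; exact hy hv
  have hp : ∀ {v}, v ∈ T.verts → (T.addLeaf x y).parent v = T.parent v := fun hv =>
    Function.update_of_ne (hne hv) _ _
  have hpy : (T.addLeaf x y).parent y = x := Function.update_self _ _ _
  constructor
  · rw [List.nodup_append]
    refine ⟨h.nodup, by simp, ?_⟩
    rintro a ha b hb rfl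
    simp only [List.mem_singleton] at hb
    exact hy (hb ▸ (h.mem _).1 ha)
  · intro v
    simp [IncTree.addLeaf, h.mem, or_comm]
  · exact Finset.mem_insert_of_mem h.root_mem
  · exact (hp h.root_mem).trans h.parent_root
  · intro v hv
    rcases Finset.mem_insert.1 hv with rfl | hv
    · rw [hpy]; exact Finset.mem_insert_of_mem hx
    · rw [hp hv]; exact Finset.mem_insert_of_mem (h.parent_mem v hv)
  · intro v hv hr
    rcases Finset.mem_insert.1 hv with rfl | hv
    · rw [hpy]; exact hne hx
    · rw [hp hv]; exact h.parent_ne v hv hr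
  · rw [List.pairwise_append]
    refine ⟨h.topo.imp_of_mem ?_, by simp, ?_⟩
    · intro a b ha _ hab
      rwa [hp ((h.mem a).1 ha)]
    · intro a ha b hb
      rw [List.mem_singleton.1 hb, hp ((h.mem a).1 ha)]
      exact hne (h.parent_mem a ((h.mem a).1 ha))

theorem isParent_addLeaf {x y : ℕ} (hy : y ∉ T.verts) {a v : ℕ}
    (hv : v ∈ T.verts) : (T.addLeaf x y).IsParent a v ↔ T.IsParent a v := by
  have hne : v ≠ y := by rintro rfl; exact hy hv
  simp [IsParent, IncTree.addLeaf, hne, hv]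

theorem Ordered.anc_addLeaf (h : T.Ordered ord) {x y : ℕ} (hy : y ∉ T.verts) {a v : ℕ}
    (hv : v ∈ T.verts) : (T.addLeaf x y).Anc a v ↔ T.Anc a v := by
  constructor
  · intro ha
    induction ha with
    | refl => exact anc_refl _
    | tail _ hp ih =>
      have hp' := (isParent_addLeaf hy hv).1 hp
      exact Relation.ReflTransGen.tail (ih (hp'.2.2 ▸ h.parent_mem _ hv)) hp'
  · intro ha
    induction ha with
    | refl => exact anc_refl _
    | tail _ hp ih =>
      exact Relation.ReflTransGen.tail (ih (hp.2.2 ▸ h.parent_mem _ hv))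
        ((isParent_addLeaf hy hv).2 hp)

theorem Ordered.isPreceding_addLeaf (h : T.Ordered ord) {x y : ℕ} (hy : y ∉ T.verts)
    {a z az : ℕ} (hz : z ∈ T.verts) (hp : T.IsPreceding a z az) :
    (T.addLeaf x y).IsPreceding a z az := by
  rcases hp with hp | ⟨h1, h2, h3⟩
  · exact Or.inl hp
  · exact Or.inr ⟨h1, (isParent_addLeaf hy h2.1).2 h2, (h.anc_addLeaf hy hz).2 h3⟩

theorem Ordered.isCa_addLeaf (h : T.Ordered ord) {x y : ℕ} (hy : y ∉ T.verts) {v c a av ac : ℕ}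
    (hv : v ∈ T.verts) (hc : c ∈ T.verts) (hca : T.IsCa v c a av ac) :
    (T.addLeaf x y).IsCa v c a av ac := by
  obtain ⟨⟨h1, h2, h3⟩, h4, h5⟩ := hca
  refine ⟨⟨(h.anc_addLeaf hy hv).2 h1, (h.anc_addLeaf hy hc).2 h2, ?_⟩,
    h.isPreceding_addLeaf hy hv h4, h.isPreceding_addLeaf hy hc h5⟩
  intro b hb hb'
  exact (h.anc_addLeaf hy (h.verts_of_anc h1 hv)).2
    (h3 b ((h.anc_addLeaf hy hv).1 hb) ((h.anc_addLeaf hy hc).1 hb'))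

/-- Characteristic ancestors with respect to the new leaf. -/
theorem Ordered.isCa_leaf (h : T.Ordered ord) {x y : ℕ} (hx : x ∈ T.verts) (hy : y ∉ T.verts)
    {c a ax ac : ℕ} (hc : c ∈ T.verts) (hca : T.IsCa x c a ax ac) :
    (T.addLeaf x y).IsCa y c a (if a = x then y else ax) ac := by
  have hpy : (T.addLeaf x y).parent y = x := Function.update_self _ _ _
  have hyr : y ≠ (T.addLeaf x y).root := by
    intro e; exact hy (e ▸ h.root_mem)
  have := IsCa.step (T := T.addLeaf x y) (v := y) (c := c) (a := a) (au := ax) (ac := ac)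
    (Finset.mem_insert_self _ _) hyr ?_ (by rw [hpy]; exact h.isCa_addLeaf hy hx hc hca)
  · rwa [hpy] at this
  · rw [h.anc_addLeaf hy hc]
    intro hyc
    exact hy (h.verts_of_anc hyc hc)

end IncTree
-- Clusters and subtree sizes within a cluster
namespace IncTree

variable {T : IncTree} {ord : List ℕ}

theorem Ordered.parent_ne_iff (h : T.Ordered ord) {v : ℕ} (hv : v ∈ T.verts) :
    T.parent v ≠ v ↔ v ≠ T.root := by
  constructor
  · rintro h1 rfl; exact h1 h.parent_root
  · exact h.parent_ne v hv

/-- Induction along the positions in `ord`, restricted to `K`: the hypothesis is available for the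
parent only if the parent is a member and is not the vertex itself. -/
theorem Ordered.induct (h : T.Ordered ord) {K : Finset ℕ} (hK : ∀ v ∈ K, v ∈ T.verts)
    {P : ℕ → Prop}
    (step : ∀ v ∈ K, (T.parent v ∈ K → T.parent v ≠ v → P (T.parent v)) → P v) :
    ∀ v ∈ K, P v := by
  have : ∀ n, ∀ v ∈ K, ord.idxOf v = n → P v := by
    intro n
    induction n using Nat.strong_induction_on with
    | _ n ih =>
      intro v hv hn
      refine step v hv fun h1 h2 => ih _ ?_ _ h1 rfl
      rw [← hn]
      exact h.idx_parent (hK v hv) ((h.parent_ne_iff (hK v hv)).1 h2)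
  exact fun v hv => this _ v hv rfl

theorem Ordered.root_anc (h : T.Ordered ord) : ∀ v ∈ T.verts, T.Anc T.root v := by
  refine h.induct (fun _ hv => hv) fun v hv ih => ?_
  by_cases hr : v = T.root
  · rw [hr]; exact anc_refl _
  · exact (ih (h.parent_mem v hv) (h.parent_ne v hv hr)).trans (anc_parent hv hr)

/-- A set of vertices whose members have their parents in the set, except that the parent may be
the vertex `t` outside the set. -/
structure Cluster (T : IncTree) (K : Finset ℕ) (t : ℕ) : Prop where
  verts : ∀ v ∈ K, v ∈ T.verts
  top_mem : t ∈ T.verts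
  parent : ∀ v ∈ K, T.parent v ∈ K ∨ T.parent v = t
  -- The second case is the cluster of the root, where `t` is the root by the convention that the
  -- root is its own parent.
  top : (t ∉ K ∧ ∀ v ∈ K, ¬ T.Anc v t) ∨ T.root ∈ K ∧ t ∈ K

/-- `sub v` is the number of descendants of `v` in the cluster, given by its recurrence. -/
def Sized (T : IncTree) (K : Finset ℕ) (sub : ℕ → ℕ) : Prop :=
  ∀ v ∈ K, sub v = 1 + ∑ u ∈ K with T.parent u = v ∧ u ≠ v, sub u

section
variable {K : Finset ℕ} {t : ℕ} {sub : ℕ → ℕ}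

/-- The recurrence, summed over a set `M` that is closed under children in `K`, gives `M.card` plus
the sizes of the members whose parent is another member. What remains after cancelling are the sizes
of the topmost members. -/
theorem Sized.card_closed (hs : Sized T K sub) {M : Finset ℕ} (hM : M ⊆ K)
    (hcl : ∀ u ∈ K, T.parent u ∈ M → u ∈ M) :
    M.card = ∑ u ∈ M with ¬ (T.parent u ∈ M ∧ T.parent u ≠ u), sub u := by
  have h1 : ∑ v ∈ M, sub v =
      M.card + ∑ v ∈ M, ∑ u ∈ K with T.parent u = v ∧ u ≠ v, sub u := by
    rw [Finset.card_eq_sum_ones, ← Finset.sum_add_distrib]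
    exact Finset.sum_congr rfl fun v hv => hs v (hM hv)
  have h2 : ∑ v ∈ M, ∑ u ∈ K with T.parent u = v ∧ u ≠ v, sub u =
      ∑ u ∈ M with T.parent u ∈ M ∧ T.parent u ≠ u, sub u := by
    rw [← Finset.sum_fiberwise_of_maps_to (s := {u ∈ M | T.parent u ∈ M ∧ T.parent u ≠ u})
      (t := M) (g := T.parent) (fun u hu => (Finset.mem_filter.1 hu).2.1)]
    refine Finset.sum_congr rfl fun v hv => Finset.sum_congr ?_ fun _ _ => rfl
    ext u
    simp only [Finset.mem_filter]
    constructor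
    · rintro ⟨h1, rfl, h3⟩
      exact ⟨⟨hcl u h1 hv, hv, h3.symm⟩, rfl⟩
    · rintro ⟨⟨h1, _, h3⟩, rfl⟩
      exact ⟨hM h1, rfl, h3.symm⟩
  have h3 := Finset.sum_filter_add_sum_filter_not M
    (fun u => T.parent u ∈ M ∧ T.parent u ≠ u) sub
  omega

theorem Cluster.parent_mem (hK : T.Cluster K t) {v w : ℕ} (hv : v ∈ K)
    (hw : w ∈ K) (ha : T.Anc v w) (hne : v ≠ w) : T.parent w ∈ K := by
  rcases hK.parent w hw with h1 | h1
  · exact h1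
  · rcases hK.top with ⟨h2, h3⟩ | ⟨_, h2⟩
    · rcases ha.cases with rfl | ⟨_, _, h4⟩
      · exact absurd rfl hne
      · exact absurd (h1 ▸ h4) (h3 v hv)
    · rw [h1]; exact h2

/-- On the way up from `w` the cluster can be left only through `t`, but if `t` is outside the
cluster, no member is an ancestor of it. -/
theorem Cluster.convex (hK : T.Cluster K t) (h : T.Ordered ord) {v a w : ℕ} (hv : v ∈ K)
    (hw : w ∈ K) (h1 : T.Anc v a) (h2 : T.Anc a w) : a ∈ K := by
  induction h2 with
  | refl => exact hw
  | tail hab hp ih =>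
    rename_i b w
    refine ih ?_
    by_cases hvw : v = w
    · exfalso
      subst hvw
      have h3 := h.antisymm (h1.trans hab) (Relation.ReflTransGen.single hp)
      exact h.isParent_ne hp h3.symm
    · rw [hp.2.2]
      exact hK.parent_mem hv hw ((h1.trans hab).trans (Relation.ReflTransGen.single hp)) hvw

/-- The descendants of `v` in the cluster are closed under children, and `v` is the only topmost
one. So `Sized.card_closed` turns the recurrence into a cardinality. -/
theorem Cluster.sub_eq (hK : T.Cluster K t) (h : T.Ordered ord) (hs : Sized T K sub) {v : ℕ}
    (hv : v ∈ K) : ∀ M : Finset ℕ, (∀ w, w ∈ M ↔ w ∈ K ∧ T.Anc v w) → sub v = M.card := by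
  intro M hM
  rw [hs.card_closed (M := M) (fun w hw => ((hM w).1 hw).1)]
  · have : {u ∈ M | ¬ (T.parent u ∈ M ∧ T.parent u ≠ u)} = {v} := by
      ext u
      simp only [Finset.mem_filter, Finset.mem_singleton]
      constructor
      · rintro ⟨h1, h2⟩
        by_contra hne
        obtain ⟨hu, ha⟩ := (hM u).1 h1
        have hpu := hK.parent_mem hv hu ha (Ne.symm hne)
        rcases ha.cases with rfl | ⟨h3, h4, h5⟩
        · exact hne rfl
        · exact h2 ⟨(hM _).2 ⟨hpu, h5⟩, h.parent_ne u h3 h4⟩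
      · rintro rfl
        refine ⟨(hM u).2 ⟨hv, anc_refl u⟩, ?_⟩
        rintro ⟨h1, h2⟩
        have h3 := ((hM _).1 h1).2
        have h4 := (h.parent_ne_iff (hK.verts u hv)).1 h2
        exact h2 (h.antisymm h3 (anc_parent (hK.verts u hv) h4)).symm
    rw [this, Finset.sum_singleton]
  · intro u hu hp
    obtain ⟨h1, h2⟩ := (hM _).1 hp
    refine (hM u).2 ⟨hu, ?_⟩
    by_cases hr : u = T.root
    · rw [hr, h.parent_root] at h2; rwa [hr]
    · exact h2.trans (anc_parent (hK.verts u hu) hr)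

open Classical in
theorem Cluster.sub_eq_card (hK : T.Cluster K t) (h : T.Ordered ord) (hs : Sized T K sub) {v : ℕ}
    (hv : v ∈ K) : sub v = {w ∈ K | T.Anc v w}.card :=
  hK.sub_eq h hs hv _ fun w => by simp

theorem Cluster.sub_le (hK : T.Cluster K t) (h : T.Ordered ord) (hs : Sized T K sub) {v w : ℕ}
    (hv : v ∈ K) (hw : w ∈ K) (ha : T.Anc v w) : sub w ≤ sub v := by
  classical
  rw [hK.sub_eq_card h hs hv, hK.sub_eq_card h hs hw]
  refine Finset.card_le_card fun u hu => ?_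
  simp only [Finset.mem_filter] at hu ⊢
  exact ⟨hu.1, ha.trans hu.2⟩

/-- Two incomparable vertices have disjoint subtrees, which cannot both contain more than half of
the cluster. -/
theorem Cluster.comparable (hK : T.Cluster K t) (h : T.Ordered ord) (hs : Sized T K sub)
    {v w : ℕ} (hv : v ∈ K) (hw : w ∈ K) (h1 : K.card < 2 * sub v) (h2 : K.card < 2 * sub w) :
    T.Anc v w ∨ T.Anc w v := by
  classical
  rw [hK.sub_eq_card h hs hv] at h1
  rw [hK.sub_eq_card h hs hw] at h2
  by_contra hc
  have hd : Disjoint {u ∈ K | T.Anc v u} {u ∈ K | T.Anc w u} := by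
    rw [Finset.disjoint_left]
    intro u hu hu'
    simp only [Finset.mem_filter] at hu hu'
    exact hc (hu.2.total hu'.2)
  have h3 := Finset.card_union_of_disjoint hd
  have h4 : ({u ∈ K | T.Anc v u} ∪ {u ∈ K | T.Anc w u}).card ≤ K.card :=
    Finset.card_le_card (Finset.union_subset (Finset.filter_subset _ _) (Finset.filter_subset _ _))
  omega

theorem Sized.child_lt (hs : Sized T K sub) {u : ℕ} (hu : u ∈ K) (hp : T.parent u ∈ K)
    (hne : T.parent u ≠ u) : sub u < sub (T.parent u) := by
  rw [hs _ hp]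
  have := Finset.single_le_sum (f := sub) (fun _ _ => Nat.zero_le _)
    (Finset.mem_filter.2 ⟨hu, rfl, hne.symm⟩ :
      u ∈ K.filter (fun w => T.parent w = T.parent u ∧ w ≠ T.parent u))
  omega

end

/-! ### The separator of a cluster and the two sides of a split -/

/-- The data that describe a split of the cluster `K` at the separator `c`: `sub` are the subtree
sizes, `(ia, ix, ic)` the characteristic ancestors with respect to `c`, and `sd v = 1` for the
members that are split off; a vertex is heavy if its subtree has more than half of the members. -/
structure SplitData (T : IncTree) (K : Finset ℕ) (t : ℕ) (sub : ℕ → ℕ) (c tp : ℕ)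
    (dn ia ix ic sd : ℕ → ℕ) : Prop where
  sized : Sized T K sub
  sep : (c ∈ K ∧ K.card < 2 * sub c ∧
      ∀ u ∈ K, T.parent u = c → u ≠ c → ¬ K.card < 2 * sub u) ∨
    (c = t ∧ ∀ v ∈ K, K.card < 2 * sub v →
      ∃ u ∈ K, T.parent u = v ∧ u ≠ v ∧ K.card < 2 * sub u)
  down : ∀ v ∈ K, K.card < 2 * sub v →
    (∃ u ∈ K, T.parent u = v ∧ u ≠ v ∧ K.card < 2 * sub u ∧ dn v = u) ∨
    ((∀ u ∈ K, T.parent u = v → u ≠ v → ¬ K.card < 2 * sub u) ∧ dn v = v)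
  top : (∃ v ∈ K, K.card < 2 * sub v ∧ ¬ (T.parent v ∈ K ∧ T.parent v ≠ v) ∧ tp = v) ∨
    ((∀ v ∈ K, K.card < 2 * sub v → T.parent v ∈ K ∧ T.parent v ≠ v) ∧ tp = t)
  info_heavy : ∀ v ∈ K, K.card < 2 * sub v → ia v = v ∧ ix v = v ∧ ic v = dn v
  info_inner : ∀ v ∈ K, ¬ K.card < 2 * sub v → T.parent v ∈ K →
    ia v = ia (T.parent v) ∧
    ix v = (if ia (T.parent v) = T.parent v then v else ix (T.parent v)) ∧
    ic v = ic (T.parent v)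
  info_outer : ∀ v ∈ K, ¬ K.card < 2 * sub v → T.parent v ∉ K →
    ia v = T.parent v ∧ ix v = v ∧ ic v = tp
  side_heavy : ∀ v ∈ K, K.card < 2 * sub v → sd v = 0
  side_child : ∀ v ∈ K, ¬ K.card < 2 * sub v → T.parent v = c → sd v = 0 ∨ sd v = 1
  side_inner : ∀ v ∈ K, ¬ K.card < 2 * sub v → T.parent v ≠ c → T.parent v ∈ K →
    sd v = sd (T.parent v)
  side_outer : ∀ v ∈ K, ¬ K.card < 2 * sub v → T.parent v ≠ c → T.parent v ∉ K → sd v = 0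
  acc_le : 4 * ∑ v ∈ K with ¬ K.card < 2 * sub v ∧ T.parent v = c ∧ sd v = 1, sub v ≤ 3 * K.card
  acc_full : 4 * ∑ v ∈ K with ¬ K.card < 2 * sub v ∧ T.parent v = c ∧ sd v = 1, sub v < K.card →
    ∀ v ∈ K, ¬ K.card < 2 * sub v → T.parent v = c → sd v = 1

namespace SplitData

variable {K : Finset ℕ} {t c tp : ℕ} {sub dn ia ix ic sd : ℕ → ℕ}

theorem root_heavy (hK : T.Cluster K t) (h : T.Ordered ord)
    (hd : SplitData T K t sub c tp dn ia ix ic sd) (hr : T.root ∈ K) :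
    K.card < 2 * sub T.root := by
  have h1 := hK.sub_eq h hd.sized hr K fun w =>
    ⟨fun hw => ⟨hw, h.root_anc w (hK.verts w hw)⟩, fun hw => hw.1⟩
  have : 0 < K.card := Finset.card_pos.2 ⟨_, hr⟩
  omega

theorem ne_root (hK : T.Cluster K t) (h : T.Ordered ord)
    (hd : SplitData T K t sub c tp dn ia ix ic sd) {v : ℕ} (hv : v ∈ K)
    (hl : ¬ K.card < 2 * sub v) : v ≠ T.root := by
  rintro rfl
  exact hl (hd.root_heavy hK h hv)

/-- In the second case of `sep` there is no heavy vertex at all: a heavy vertex with the smallest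
subtree would have a heavy child with a smaller one. Then the root is not a member either, since its
subtree would be the whole cluster, so `t` is outside. -/
theorem sep' (hK : T.Cluster K t) (h : T.Ordered ord)
    (hd : SplitData T K t sub c tp dn ia ix ic sd) :
    (c ∈ K ∧ K.card < 2 * sub c ∧
      ∀ u ∈ K, T.parent u = c → u ≠ c → ¬ K.card < 2 * sub u) ∨
    (c = t ∧ t ∉ K ∧ (∀ v ∈ K, ¬ T.Anc v t) ∧ ∀ v ∈ K, ¬ K.card < 2 * sub v) := by
  rcases hd.sep with h1 | ⟨h1, h2⟩
  · exact Or.inl h1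
  · right
    have h3 : ∀ v ∈ K, ¬ K.card < 2 * sub v := by
      intro v hv hh
      obtain ⟨w, hw, hmin⟩ := Finset.exists_min_image {v ∈ K | K.card < 2 * sub v} sub
        ⟨v, Finset.mem_filter.2 ⟨hv, hh⟩⟩
      obtain ⟨hwK, hwh⟩ := Finset.mem_filter.1 hw
      obtain ⟨u, hu, rfl, hne, huh⟩ := h2 w hwK hwh
      have h4 := hmin u (Finset.mem_filter.2 ⟨hu, huh⟩)
      have h5 := hd.sized.child_lt hu hwK hne.symm
      omega
    refine ⟨h1, ?_, ?_, h3⟩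
    · rcases hK.top with h4 | h4
      · exact h4.1
      · exact absurd (hd.root_heavy hK h h4.1) (h3 _ h4.1)
    · rcases hK.top with h4 | h4
      · exact h4.2
      · exact absurd (hd.root_heavy hK h h4.1) (h3 _ h4.1)

theorem sep_mem (hK : T.Cluster K t) (h : T.Ordered ord)
    (hd : SplitData T K t sub c tp dn ia ix ic sd) : c ∈ T.verts := by
  rcases hd.sep' hK h with h1 | h1
  · exact hK.verts c h1.1
  · rw [h1.1]; exact hK.top_mem

/-- Heavy vertices are pairwise comparable and sizes grow towards the root, so the heavy vertices
are the members on the path down to the lowest one, which is `c`. -/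
theorem heavy_iff (hK : T.Cluster K t) (h : T.Ordered ord)
    (hd : SplitData T K t sub c tp dn ia ix ic sd) {v : ℕ} (hv : v ∈ K) :
    K.card < 2 * sub v ↔ T.Anc v c := by
  rcases hd.sep' hK h with ⟨hc, hh, hch⟩ | ⟨rfl, _, hn, hl⟩
  · constructor
    · intro hvh
      rcases hK.comparable h hd.sized hv hc hvh hh with h1 | h1
      · exact h1
      · rcases h1.head_cases with rfl | ⟨e, he, hev⟩
        · exact anc_refl _
        · have heK := hK.convex h hc hv (Relation.ReflTransGen.single he) hev
          have h2 := hK.sub_le h hd.sized heK hv hev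
          exact absurd (by omega) (hch e heK he.2.2.symm (h.isParent_ne he).symm)
    · intro ha
      have := hK.sub_le h hd.sized hv hc ha
      omega
  · exact iff_of_false (hl v hv) (hn v hv)

/-- The triples are passed from parents to children. A heavy vertex is an ancestor of `c`, and the
next vertex towards `c` is its heavy child; below a light vertex there is no `c`, so `IsCa.step`
applies. -/
theorem isCa (hK : T.Cluster K t) (h : T.Ordered ord)
    (hd : SplitData T K t sub c tp dn ia ix ic sd) :
    ∀ v ∈ K, T.IsCa v c (ia v) (ix v) (ic v) := by
  refine h.induct hK.verts fun v hv ih => ?_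
  by_cases hh : K.card < 2 * sub v
  · obtain ⟨e1, e2, e3⟩ := hd.info_heavy v hv hh
    rw [e1, e2, e3]
    have hvc := (hd.heavy_iff hK h hv).1 hh
    refine isCa_of_anc hvc ?_
    rcases hd.sep' hK h with ⟨hc, hch, hcc⟩ | ⟨_, _, _, hl⟩
    · rcases hd.down v hv hh with ⟨u, hu, hp, hne, huh, hdu⟩ | ⟨h1, h2⟩
      · rw [hdu]
        refine Or.inr ⟨?_, ⟨hK.verts u hu, ?_, hp.symm⟩, (hd.heavy_iff hK h hu).1 huh⟩
        · rintro rfl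
          exact hcc u hu hp hne huh
        · rintro rfl
          exact hne (hp ▸ h.parent_root.symm)
      · rw [h2]
        rcases hvc.head_cases with rfl | ⟨e, he, hec⟩
        · exact Or.inl ⟨rfl, rfl⟩
        · have heK := hK.convex h hv hc (Relation.ReflTransGen.single he) hec
          exact absurd ((hd.heavy_iff hK h heK).2 hec)
            (h1 e heK he.2.2.symm (h.isParent_ne he).symm)
    · exact absurd hh (hl v hv)
  · have hvr := hd.ne_root hK h hv hh
    have hvv := hK.verts v hv
    have hnc : ¬ T.Anc v c := fun ha => hh ((hd.heavy_iff hK h hv).2 ha)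
    by_cases hp : T.parent v ∈ K
    · obtain ⟨e1, e2, e3⟩ := hd.info_inner v hv hh hp
      rw [e1, e2, e3]
      exact IsCa.step hvv hvr hnc (ih hp (h.parent_ne v hvv hvr))
    · obtain ⟨e1, e2, e3⟩ := hd.info_outer v hv hh hp
      rw [e1, e2, e3]
      have hpt : T.parent v = t := (hK.parent v hv).resolve_left hp
      -- The light vertex `v` hangs directly off `t`, so it suffices to know the triple of `t`. This
      -- vertex is an ancestor of `c`; the next vertex towards `c` is the topmost heavy vertex, or
      -- `c = t` if nothing is heavy.
      suffices hs : T.IsCa (T.parent v) c (T.parent v) (T.parent v) tp by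
        have := IsCa.step hvv hvr hnc hs
        rwa [if_pos rfl] at this
      rw [hpt]
      have htK : t ∉ K := hpt ▸ hp
      rcases hd.top with ⟨w, hw, hwh, hwt, rfl⟩ | ⟨h1, rfl⟩
      · have hwr : tp ≠ T.root := by
          rintro rfl
          rcases hK.top with h2 | h2
          · exact h2.2 _ hw (h.root_anc _ hK.top_mem)
          · exact htK h2.2
        have hwv := hK.verts tp hw
        have hpw : T.parent tp = t := by
          refine (hK.parent tp hw).resolve_left fun h2 => hwt ⟨h2, h.parent_ne tp hwv hwr⟩
        have hwc := (hd.heavy_iff hK h hw).1 hwh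
        have hpar : T.IsParent t tp := ⟨hwv, hwr, hpw.symm⟩
        refine isCa_of_anc ((Relation.ReflTransGen.single hpar : T.Anc t tp).trans hwc)
          (Or.inr ⟨?_, hpar, hwc⟩)
        rintro rfl
        exact h.isParent_ne hpar (h.antisymm (Relation.ReflTransGen.single hpar) hwc)
      · have hno : ∀ v ∈ K, ¬ K.card < 2 * sub v := by
          refine h.induct hK.verts fun v hv ih hvh => ?_
          obtain ⟨h2, h3⟩ := h1 v hv hvh
          have := hd.sized.child_lt hv h2 h3
          exact ih h2 h3 (by omega)
        rcases hd.sep' hK h with ⟨hc, hch, _⟩ | ⟨rfl, _⟩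
        · exact absurd hch (hno c hc)
        · exact isCa_self _

theorem side_le (hK : T.Cluster K t) (h : T.Ordered ord)
    (hd : SplitData T K t sub c tp dn ia ix ic sd) : ∀ v ∈ K, sd v = 0 ∨ sd v = 1 := by
  refine h.induct hK.verts fun v hv ih => ?_
  by_cases hh : K.card < 2 * sub v
  · exact Or.inl (hd.side_heavy v hv hh)
  · by_cases hc : T.parent v = c
    · exact hd.side_child v hv hh hc
    · by_cases hp : T.parent v ∈ K
      · rw [hd.side_inner v hv hh hc hp]
        exact ih hp (h.parent_ne v (hK.verts v hv) (hd.ne_root hK h hv hh))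
      · exact Or.inl (hd.side_outer v hv hh hc hp)

/-- Members on side `1` hang off `c` below a child of `c` on side `1`; the others do not. -/
theorem side_iff (hK : T.Cluster K t) (h : T.Ordered ord)
    (hd : SplitData T K t sub c tp dn ia ix ic sd) :
    ∀ v ∈ K, (sd v = 1 ↔ ix v ∈ K ∧ ¬ K.card < 2 * sub (ix v) ∧ T.parent (ix v) = c ∧
      sd (ix v) = 1) ∧ (sd v = 1 → ia v = c ∧ ¬ T.Anc v c) := by
  refine h.induct hK.verts fun v hv ih => ?_
  by_cases hh : K.card < 2 * sub v
  · have h1 := hd.side_heavy v hv hh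
    have h2 := (hd.info_heavy v hv hh).2.1
    rw [h1, h2]
    simp [hh]
  · have hvr := hd.ne_root hK h hv hh
    have hvv := hK.verts v hv
    have hnc : ¬ T.Anc v c := fun ha => hh ((hd.heavy_iff hK h hv).2 ha)
    by_cases hc : T.parent v = c
    · have key : ix v = v ∧ ia v = c := by
        by_cases hp : T.parent v ∈ K
        · obtain ⟨e1, e2, e3⟩ := hd.info_inner v hv hh hp
          have h3 : ia (T.parent v) = T.parent v :=
            (hd.info_heavy _ hp ((hd.heavy_iff hK h hp).2 (by rw [hc]; exact anc_refl c))).1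
          rw [e1, e2, if_pos h3, h3]
          exact ⟨rfl, hc⟩
        · obtain ⟨e1, e2, e3⟩ := hd.info_outer v hv hh hp
          exact ⟨e2, e1.trans hc⟩
      rw [key.1, key.2]
      simp [hv, hh, hc, hnc]
    · by_cases hp : T.parent v ∈ K
      · obtain ⟨e1, e2, e3⟩ := hd.info_inner v hv hh hp
        have hsd := hd.side_inner v hv hh hc hp
        obtain ⟨i1, i2⟩ := ih hp (h.parent_ne v hvv hvr)
        by_cases hia : ia (T.parent v) = T.parent v
        · rw [e2, if_pos hia, e1]
          have hpc : T.Anc (T.parent v) c := by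
            have := (hd.isCa hK h _ hp).1.2.1
            rwa [hia] at this
          have := hd.side_heavy _ hp ((hd.heavy_iff hK h hp).2 hpc)
          simp [hsd, this, hc]
        · rw [e2, if_neg hia, e1, hsd]
          exact ⟨i1, fun hs => ⟨(i2 hs).1, hnc⟩⟩
      · obtain ⟨e1, e2, e3⟩ := hd.info_outer v hv hh hp
        rw [e2, hd.side_outer v hv hh hc hp]
        simp [hc]

theorem side_anc (hK : T.Cluster K t) (h : T.Ordered ord)
    (hd : SplitData T K t sub c tp dn ia ix ic sd) {v : ℕ} (hv : v ∈ K) (hs : sd v = 1) :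
    ia v = c ∧ v ≠ c := by
  obtain ⟨h1, h2⟩ := (hd.side_iff hK h v hv).2 hs
  refine ⟨h1, ?_⟩
  rintro rfl
  exact h2 (anc_refl _)

/-- By `side_iff` the side of a vertex is determined by its second characteristic ancestor. This
difference is what `Ordered.isCa_join` needs for two vertices on different sides. -/
theorem side_ne (hK : T.Cluster K t) (h : T.Ordered ord)
    (hd : SplitData T K t sub c tp dn ia ix ic sd) {v w : ℕ} (hv : v ∈ K) (hw : w ∈ K)
    (hs : sd v = 1) (hs' : sd w = 0) : ix v ≠ ix w := by
  intro e
  have h1 := (hd.side_iff hK h v hv).1.1 hs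
  rw [e] at h1
  have h2 := (hd.side_iff hK h w hw).1.2 h1
  omega

/-- A vertex on side `1` is light and thus different from `c`, so its children are light, are not
children of `c`, and inherit the side. -/
theorem side_closed (hK : T.Cluster K t) (h : T.Ordered ord)
    (hd : SplitData T K t sub c tp dn ia ix ic sd) {v : ℕ} (hv : v ∈ K) (hp : T.parent v ∈ K)
    (hs : sd (T.parent v) = 1) : sd v = 1 := by
  have hph : ¬ K.card < 2 * sub (T.parent v) := fun hh => by
    have := hd.side_heavy _ hp hh
    omega
  have hpr := hd.ne_root hK h hp hph
  have hvr : v ≠ T.root := by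
    rintro rfl
    exact hpr h.parent_root
  have := hd.sized.child_lt hv hp (h.parent_ne v (hK.verts v hv) hvr)
  rw [hd.side_inner v hv (by omega) ?_ hp, hs]
  intro hc
  exact hph ((hd.heavy_iff hK h hp).2 (by rw [hc]; exact anc_refl c))

theorem side_one_parent (hd : SplitData T K t sub c tp dn ia ix ic sd) {v : ℕ} (hv : v ∈ K)
    (hs : sd v = 1) : T.parent v = c ∨ (T.parent v ∈ K ∧ sd (T.parent v) = 1) := by
  by_cases hc : T.parent v = c
  · exact Or.inl hc
  · right
    have hh : ¬ K.card < 2 * sub v := fun hh => by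
      have := hd.side_heavy _ hv hh
      omega
    by_cases hp : T.parent v ∈ K
    · exact ⟨hp, (hd.side_inner v hv hh hc hp).symm.trans hs⟩
    · have := hd.side_outer v hv hh hc hp
      omega

theorem sep_side (hK : T.Cluster K t) (h : T.Ordered ord)
    (hd : SplitData T K t sub c tp dn ia ix ic sd) (hc : c ∈ K) : sd c = 0 :=
  hd.side_heavy c hc ((hd.heavy_iff hK h hc).2 (anc_refl c))

theorem side_zero_parent (hK : T.Cluster K t) (h : T.Ordered ord)
    (hd : SplitData T K t sub c tp dn ia ix ic sd) {v : ℕ} (hv : v ∈ K) (hs : sd v = 0) :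
    (T.parent v ∈ K ∧ sd (T.parent v) = 0) ∨ (T.parent v ∉ K ∧ T.parent v = t) := by
  by_cases hp : T.parent v ∈ K
  · left
    refine ⟨hp, (hd.side_le hK h _ hp).resolve_right fun h1 => ?_⟩
    have := hd.side_closed hK h hv hp h1
    omega
  · exact Or.inr ⟨hp, (hK.parent v hv).resolve_left hp⟩

/-- Side `1` is closed under children and its topmost members are the chosen children of `c`, so its
cardinality is the accumulated sum. If the sum is at least a quarter of the cluster, both bounds
follow; otherwise no subtree was refused. -/
theorem balanced (hK : T.Cluster K t) (h : T.Ordered ord)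
    (hd : SplitData T K t sub c tp dn ia ix ic sd) :
    K.card = 1 ∨ (4 * {v ∈ K | sd v = 0}.card ≤ 3 * K.card ∧
      4 * {v ∈ K | sd v = 1}.card ≤ 3 * K.card) := by
  have hsplit : {v ∈ K | sd v = 0}.card + {v ∈ K | sd v = 1}.card = K.card := by
    rw [← Finset.card_filter_add_card_filter_not (s := K) (fun v => sd v = 0)]
    congr 2
    refine Finset.filter_congr fun v hv => ?_
    rcases hd.side_le hK h v hv with h1 | h1 <;> simp [h1]
  have hR : {v ∈ K | sd v = 1}.card =
      ∑ v ∈ K with ¬ K.card < 2 * sub v ∧ T.parent v = c ∧ sd v = 1, sub v := by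
    rw [hd.sized.card_closed (M := {v ∈ K | sd v = 1}) (Finset.filter_subset _ _)]
    · refine Finset.sum_congr ?_ fun _ _ => rfl
      ext v
      simp only [Finset.mem_filter, ne_eq, not_and, not_not, and_imp]
      constructor
      · rintro ⟨⟨hv, hs⟩, h1⟩
        refine ⟨hv, fun hh => by have := hd.side_heavy v hv hh; omega, ?_, hs⟩
        rcases hd.side_one_parent hv hs with h2 | ⟨h2, h3⟩
        · exact h2
        · exfalso
          have := h1 h2 h3
          exact (h.parent_ne_iff (hK.verts v hv)).2 (hd.ne_root hK h hv
            (fun hh => by have := hd.side_heavy v hv hh; omega)) this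
      · rintro ⟨hv, hh, hc, hs⟩
        refine ⟨⟨hv, hs⟩, fun h1 h2 => ?_⟩
        rw [hc] at h1 h2
        have := hd.sep_side hK h h1
        omega
    · intro u hu hp
      simp only [Finset.mem_filter] at hp ⊢
      exact ⟨hu, hd.side_closed hK h hu hp.1 hp.2⟩
  have h1 := hd.acc_le
  have h2 := hd.acc_full
  rw [← hR] at h1 h2
  -- Below a quarter, all the light children of `c` are on side `1`. If `c` is a member, its subtree
  -- has one more vertex than side `1` but more than half of the cluster, which forces a singleton.
  -- If `c = t`, side `1` is the whole cluster, a contradiction.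
  by_cases h3 : 4 * {v ∈ K | sd v = 1}.card < K.card
  · left
    have h4 := h2 h3
    have hall : ∑ v ∈ K with ¬ K.card < 2 * sub v ∧ T.parent v = c, sub v =
        {v ∈ K | sd v = 1}.card := by
      rw [hR]
      refine Finset.sum_congr (Finset.filter_congr fun v hv => ?_) fun _ _ => rfl
      constructor
      · rintro ⟨h5, h6⟩
        exact ⟨h5, h6, h4 v hv h5 h6⟩
      · rintro ⟨h5, h6, _⟩
        exact ⟨h5, h6⟩
    rcases hd.sep' hK h with ⟨hc, hch, hcc⟩ | ⟨rfl, ht, _, hl⟩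
    · have h5 : sub c = 1 + {v ∈ K | sd v = 1}.card := by
        rw [hd.sized c hc, ← hall]
        congr 1
        refine Finset.sum_congr (Finset.filter_congr fun v hv => ?_) fun _ _ => rfl
        constructor
        · rintro ⟨h6, h7⟩
          exact ⟨hcc v hv h6 h7, h6⟩
        · rintro ⟨h6, h7⟩
          refine ⟨h7, ?_⟩
          rintro rfl
          exact h6 hch
      have : 0 < K.card := Finset.card_pos.2 ⟨_, hc⟩
      omega
    · exfalso
      have h5 : K.card = {v ∈ K | sd v = 1}.card := by
        rw [← hall]
        conv_lhs => rw [hd.sized.card_closed (M := K) subset_rfl (fun u hu _ => hu)]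
        refine Finset.sum_congr (Finset.filter_congr fun v hv => ?_) fun _ _ => rfl
        constructor
        · intro h6
          refine ⟨hl v hv, (hK.parent v hv).resolve_left fun h7 => h6 ⟨h7, ?_⟩⟩
          exact h.parent_ne v (hK.verts v hv) (hd.ne_root hK h hv (hl v hv))
        · rintro ⟨_, h6⟩ ⟨h7, _⟩
          rw [h6] at h7
          exact ht h7
      omega
  · right
    omega

end SplitData
end IncTree
/-! ### The arrays and the programs -/

-- The first nine arrays have a row for each level. `aHD` is the head, that is, the oldest member,
-- of the node of a vertex, and `aNX` the preceding member. The last member `aLS`, the size `aSZ`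
-- and the counter of insertions `aCR` are kept at the head. `aIA`, `aIX`, `aIC` are the
-- characteristic ancestors with respect to the separator, `aPP` is the code of the node. `aPAR`
-- holds the parents, `aTB` the numbers of ternary digits, `aARR` the members of the node to be
-- rebuilt. The others are scratch data of a split: subtree size, separator, topmost heavy vertex,
-- accumulated size, side, and the heads of the two halves plus one.
notation "aHD" => (0 : ℕ)
notation "aNX" => (1 : ℕ)
notation "aLS" => (2 : ℕ)
notation "aSZ" => (3 : ℕ)
notation "aCR" => (4 : ℕ)
notation "aIA" => (5 : ℕ)
notation "aIX" => (6 : ℕ)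
notation "aIC" => (7 : ℕ)
notation "aPP" => (8 : ℕ)
notation "aPAR" => (9 : ℕ)
notation "aTB" => (10 : ℕ)
notation "aARR" => (11 : ℕ)
notation "aSUB" => (12 : ℕ)
notation "aCS" => (13 : ℕ)
notation "aTOP" => (14 : ℕ)
notation "aACC" => (15 : ℕ)
notation "aSIDE" => (16 : ℕ)
notation "aFH" => (17 : ℕ)

-- Register `7` is the level, `8` the position in the list, `9` the vertex, `10` its head, `11` its
-- parent, `15` its subtree size; `16` and `17` are flags for a heavy vertex and for a parent in the
-- same node. Elsewhere, `3` is the row length, `4` the exponent of the capacity, `5` the last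
-- level, `12` the length of the list, and `13`, `14` are the head and the level of the node to be
-- rebuilt.
notation "xJ" => Ex.reg 7
notation "xI" => Ex.reg 8
notation "xV" => Ex.reg 9
notation "xH" => Ex.reg 10
notation "xU" => Ex.reg 11
notation "xZ" => Ex.reg 15
notation "xHV" => Ex.reg 16
notation "xIN" => Ex.reg 17

/-- An entry of a one-dimensional array. -/
abbrev Ex.rd0 (f : ℕ) (v : Ex) : Ex := .rd f (.num 0) v

/-- At the head, the parent is the vertex `t` outside the node; it is the default for the separator
and for the topmost heavy vertex. The default `v` in `aIC` means that no heavy child is known. -/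
def resetBody : List At :=
  [.set 9 (.rd0 aARR xI), .set 11 (.rd0 aPAR xV), .wr aSUB (.num 0) xV (.num 0),
   .wr aCS (.num 0) xV xU, .wr aTOP (.num 0) xV xU, .wr aACC (.num 0) xV (.num 0),
   .wr aFH (.num 0) xV (.num 0), .wr aFH (.num 1) xV (.num 0), .wr aIC xJ xV xV,
   .set 8 (xI + .num 1)]

/-- Run backwards, so that the sizes of the children have been added before a vertex is reached. The
root, which is its own parent, must not be added to itself. -/
def sizeBody : List At :=
  [.set 8 (xI - .num 1), .set 9 (.rd0 aARR xI), .set 10 (.rd aHD xJ xV), .set 11 (.rd0 aPAR xV),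
   .set 15 (.rd0 aSUB xV + .num 1), .wr aSUB (.num 0) xV xZ,
   .set 17 (.ite .eq xU xV (.num 0) (.ite .eq (.rd aHD xJ xU) xH (.num 1) (.num 0))),
   .set 23 (.ite .eq xIN (.num 1) (.rd0 aSUB xU + xZ) (.num 0)),
   .wr aSUB (.num 0) xU (.ite .eq xIN (.num 1) (.reg 23) (.rd0 aSUB xU))]

/-- A heavy vertex enters itself as the heavy child of its parent, temporarily in `aIC`, or as the
topmost heavy vertex of the node. -/
def heavyBody : List At :=
  [.set 9 (.rd0 aARR xI), .set 10 (.rd aHD xJ xV), .set 11 (.rd0 aPAR xV),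
   .set 17 (.ite .eq xU xV (.num 0) (.ite .eq (.rd aHD xJ xU) xH (.num 1) (.num 0))),
   .set 16 (.ite .lt (.rd aSZ xJ xH) (.num 2 * .rd0 aSUB xV) (.num 1) (.num 0)),
   .wr aTOP (.num 0) xH (.ite .eq xHV (.num 1) (.ite .eq xIN (.num 1) (.rd0 aTOP xH) xV)
     (.rd0 aTOP xH)),
   .wr aIC xJ xU (.ite .eq xHV (.num 1) (.ite .eq xIN (.num 1) xV (.rd aIC xJ xU))
     (.rd aIC xJ xU)),
   .set 8 (xI + .num 1)]

def sepBody : List At :=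
  [.set 9 (.rd0 aARR xI), .set 10 (.rd aHD xJ xV),
   .set 16 (.ite .lt (.rd aSZ xJ xH) (.num 2 * .rd0 aSUB xV) (.num 1) (.num 0)),
   .wr aCS (.num 0) xH (.ite .eq xHV (.num 1) (.ite .eq (.rd aIC xJ xV) xV xV (.rd0 aCS xH))
     (.rd0 aCS xH)),
   .set 8 (xI + .num 1)]

/-- Parents precede children, so the entries of the parent are final. For a heavy vertex, `aIC`
already holds the heavy child, which is the correct third component. A light child of the separator
goes to side `1` as long as less than a quarter of the node has been accumulated. -/
def infoBody : List At :=
  [.set 9 (.rd0 aARR xI), .set 10 (.rd aHD xJ xV), .set 11 (.rd0 aPAR xV),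
   .set 15 (.rd0 aSUB xV), .set 18 (.rd aSZ xJ xH),
   .set 16 (.ite .lt (.reg 18) (.num 2 * xZ) (.num 1) (.num 0)),
   .set 17 (.ite .eq (.rd aHD xJ xU) xH (.num 1) (.num 0)),
   .set 24 (.rd aIA xJ xU), .set 25 (.rd aIX xJ xU), .set 26 (.rd aIC xJ xU),
   .wr aIC xJ xV (.ite .eq xHV (.num 1) (.rd aIC xJ xV)
     (.ite .eq xIN (.num 1) (.reg 26) (.rd0 aTOP xH))),
   .wr aIA xJ xV (.ite .eq xHV (.num 1) xV (.ite .eq xIN (.num 1) (.reg 24) xU)),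
   .wr aIX xJ xV (.ite .eq xHV (.num 1) xV (.ite .eq xIN (.num 1)
     (.ite .eq (.reg 24) xU xV (.reg 25)) xV)),
   .set 27 (.rd0 aACC xH),
   .set 28 (.ite .eq xHV (.num 1) (.num 0) (.ite .eq xU (.rd0 aCS xH)
     (.ite .lt (.num 4 * .reg 27) (.reg 18) (.num 1) (.num 0)) (.num 0))),
   .set 29 (.reg 27 + .ite .eq (.reg 28) (.num 1) xZ (.num 0)),
   .wr aACC (.num 0) xH (.reg 29),
   .wr aSIDE (.num 0) xV (.ite .eq xHV (.num 1) (.num 0) (.ite .eq xU (.rd0 aCS xH) (.reg 28)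
     (.ite .eq xIN (.num 1) (.rd0 aSIDE xU) (.num 0)))),
   .set 8 (xI + .num 1)]

/-- The code is extended by the digit `0` or `2`. An entry `0` of `aFH` says that the half has no
head yet; then the vertex becomes the head, and the value stored in its `aNX` is meaningless. -/
def linkBody : List At :=
  [.set 9 (.rd0 aARR xI), .set 10 (.rd aHD xJ xV), .set 19 (.rd0 aSIDE xV),
   .set 23 (.num 3 * .rd aPP xJ xV + .num 2 * .reg 19), .set 26 (xJ + .num 1),
   .wr aPP (.reg 26) xV (.reg 23), .wr aCR (.reg 26) xV (.num 0),
   .set 24 (.rd aFH (.reg 19) xH), .set 25 (xV + .num 1),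
   .set 22 (.ite .eq (.reg 24) (.num 0) (.reg 25) (.reg 24)),
   .wr aFH (.reg 19) xH (.reg 22), .set 22 (.reg 22 - .num 1),
   .set 23 (.ite .eq (.reg 24) (.num 0) (.num 0) (.rd aSZ (.reg 26) (.reg 22)) + .num 1),
   .wr aSZ (.reg 26) (.reg 22) (.reg 23),
   .wr aNX (.reg 26) xV (.rd aLS (.reg 26) (.reg 22)),
   .wr aLS (.reg 26) (.reg 22) xV, .wr aHD (.reg 26) xV (.reg 22), .set 8 (xI + .num 1)]

/-- Run the body for the members of the list in `aARR`, forwards. -/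
def forward (l : List At) : Prog :=
  .seq (blk [.set 8 (.num 0)]) (whl .lt xI (.reg 12) (blk l))

def backward (l : List At) : Prog :=
  .seq (blk [.set 8 (.reg 12)]) (whl .lt (.num 0) xI (blk l))

/-- Split all nodes of the current level. -/
def splitLevel : Prog :=
  .seq (forward resetBody) (.seq (backward sizeBody) (.seq (forward heavyBody)
    (.seq (forward sepBody) (.seq (forward infoBody) (forward linkBody)))))

def listBody : List At :=
  [.set 8 (xI - .num 1), .wr aARR (.num 0) xI xV, .set 9 (.rd aNX (.reg 14) xV)]

/-- Rebuild the node with head `reg 13` on level `reg 14`. -/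
def rebuild : Prog :=
  .seq (blk [.set 12 (.rd aSZ (.reg 14) (.reg 13)), .wr aCR (.reg 14) (.reg 13) (.num 0),
    .set 9 (.rd aLS (.reg 14) (.reg 13)), .set 8 (.reg 12)])
  (.seq (whl .lt (.num 0) xI (blk listBody))
  (.seq (blk [.set 7 (.reg 14)])
    (whl .lt xJ (.reg 5) (.seq splitLevel (blk [.set 7 (xJ + .num 1)])))))

/-! ### Loops over a list -/

/-- The invariant `I` refers to the prefix of the list that has been processed. -/
theorem fwd_wp {e : Env} (he : e.Ok) {l : List At} (lst : List ℕ)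
    (I : List ℕ → HS → Prop) (hwf : blkWf l = true)
    (hset : ∀ st x, I [] st → I [] (st.set 8 x))
    (hbody : ∀ l1 v l2 st, lst = l1 ++ v :: l2 → st.reg 8 = l1.length →
      st.reg 12 = lst.length → I l1 st →
      vc e l st (fun st' => I (l1 ++ [v]) st' ∧ st'.reg 8 = l1.length + 1 ∧
        st'.reg 12 = lst.length))
    {st : HS} (h12 : st.reg 12 = lst.length) (hI : I [] st) :
    WP e (forward l) ((lst.length + 1) * (blkCost l + 10)) st
      (fun st' => I lst st' ∧ st'.reg 12 = lst.length) := by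
  have h1 : WP e (blk [.set 8 (.num 0)]) 3 st (fun st' => st' = st.set 8 0) :=
    blk_wp he _ _ _ rfl (by simp +contextual [vc, Ex.small])
  refine (h1.seq (T₂ := (lst.length + 1) * (blkCost l + 3)) ?_).mono (by nlinarith)
    (fun _ h => h)
  rintro _ rfl
  refine (whl_wp he (fun n st => ∃ l1 l2, lst = l1 ++ l2 ∧ l2.length = n ∧
    st.reg 8 = l1.length ∧ st.reg 12 = lst.length ∧ I l1 st) (blkCost l) (by simp [Ex.wf, Ex.wgt])
    (by simp [Ex.wf, Ex.wgt]) ?_ (n := lst.length) ⟨[], lst, rfl, rfl, rfl, ?_, ?_⟩).mono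
    (by simp [Ex.cost]) ?_
  · rintro n st ⟨l1, l2, hl12, hn, h8, h12, hI⟩
    refine ⟨trivial, trivial, fun hc => ?_⟩
    simp only [Cmp.Holds, Ex.eval_reg, h8, h12, hl12, List.length_append] at hc
    cases l2 with
    | nil => simp at hc
    | cons v l2 =>
      refine ⟨l2.length, by simpa using hn.symm, (blk_wp he _ _ _ hwf
        (hbody l1 v l2 st hl12 h8 h12 hI)).mono le_rfl ?_⟩
      rintro st' ⟨h1, h2, h3⟩
      exact ⟨l1 ++ [v], l2, by simp [hl12], rfl, by simpa using h2, h3, h1⟩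
  · simpa using h12
  · exact hset _ _ hI
  · rintro st' ⟨⟨n, l1, l2, hl12, hn, h8, h12, hI⟩, hc⟩
    simp only [Cmp.Holds, Ex.eval_reg, h8, h12, hl12, List.length_append] at hc
    obtain rfl : l2 = [] := List.eq_nil_of_length_eq_zero (by omega)
    rw [List.append_nil] at hl12
    exact ⟨hl12 ▸ hI, h12⟩

theorem bwd_loop_wp {e : Env} (he : e.Ok) {l : List At} (lst : List ℕ)
    (I : List ℕ → HS → Prop) (hwf : blkWf l = true)
    (hbody : ∀ l1 v l2 st, lst = l1 ++ v :: l2 → st.reg 8 = l1.length + 1 →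
      st.reg 12 = lst.length → I l2 st →
      vc e l st (fun st' => I (v :: l2) st' ∧ st'.reg 8 = l1.length ∧
        st'.reg 12 = lst.length))
    {st : HS} (h8 : st.reg 8 = lst.length) (h12 : st.reg 12 = lst.length) (hI : I [] st) :
    WP e (whl .lt (.num 0) xI (blk l)) ((lst.length + 1) * (blkCost l + 3)) st
      (fun st' => I lst st' ∧ st'.reg 12 = lst.length) := by
  refine (whl_wp he (fun n st => ∃ l1 l2, lst = l1 ++ l2 ∧ l1.length = n ∧
    st.reg 8 = l1.length ∧ st.reg 12 = lst.length ∧ I l2 st) (blkCost l) (by simp [Ex.wf, Ex.wgt])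
    (by simp [Ex.wf, Ex.wgt]) ?_ (n := lst.length)
    ⟨lst, [], by simp, rfl, h8, h12, hI⟩).mono (by simp [Ex.cost]) ?_
  · rintro n st ⟨l1, l2, hl12, hn, h8, h12, hI⟩
    refine ⟨trivial, trivial, fun hc => ?_⟩
    simp only [Cmp.Holds, Ex.eval_reg, Ex.eval_num, h8] at hc
    rcases List.eq_nil_or_concat l1 with rfl | ⟨l1, v, rfl⟩
    · simp at hc
    · rw [List.concat_eq_append] at *
      refine ⟨l1.length, by simpa using hn.symm, (blk_wp he _ _ _ hwf
        (hbody l1 v l2 st (by simp [hl12]) (by simpa using h8) h12 hI)).mono le_rfl ?_⟩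
      rintro st' ⟨h1, h2, h3⟩
      exact ⟨l1, v :: l2, by simp [hl12], rfl, h2, h3, h1⟩
  · rintro st' ⟨⟨n, l1, l2, hl12, hn, h8, h12, hI⟩, hc⟩
    simp only [Cmp.Holds, Ex.eval_reg, Ex.eval_num, h8] at hc
    obtain rfl : l1 = [] := List.eq_nil_of_length_eq_zero (by omega)
    rw [List.nil_append] at hl12
    exact ⟨hl12 ▸ hI, h12⟩

theorem bwd_wp {e : Env} (he : e.Ok) {l : List At} (lst : List ℕ) (I : List ℕ → HS → Prop)
    (hwf : blkWf l = true) (hset : ∀ st x, I [] st → I [] (st.set 8 x))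
    (hbody : ∀ l1 v l2 st, lst = l1 ++ v :: l2 → st.reg 8 = l1.length + 1 →
      st.reg 12 = lst.length → I l2 st →
      vc e l st (fun st' => I (v :: l2) st' ∧ st'.reg 8 = l1.length ∧
        st'.reg 12 = lst.length))
    {st : HS} (h12 : st.reg 12 = lst.length) (hI : I [] st) :
    WP e (backward l) ((lst.length + 1) * (blkCost l + 10)) st
      (fun st' => I lst st' ∧ st'.reg 12 = lst.length) := by
  have h1 : WP e (blk [.set 8 (.reg 12)]) 3 st (fun st' => st' = st.set 8 lst.length) :=
    blk_wp he _ _ _ rfl (by simp +contextual [vc, Ex.small, h12])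
  refine (h1.seq (T₂ := (lst.length + 1) * (blkCost l + 3)) ?_).mono (by nlinarith)
    (fun _ h => h)
  rintro _ rfl
  exact bwd_loop_wp he lst I hwf hbody rfl (by simpa using h12) (hset _ _ hI)

/-! ### Frame conditions and context of a split -/

/-- The entries below field `12` that are written when the nodes of level `j` are split. -/
def Wr (j : ℕ) (lst : List ℕ) (f k v : ℕ) : Prop :=
  v ∈ lst ∧ (5 ≤ f ∧ f ≤ 7 ∧ k = j ∨ (f ≤ 4 ∨ f = 8) ∧ k = j + 1)

/-- `st` arises from `st₀` by changing scratch data and entries that may be written on level `j`. -/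
structure Fr (j : ℕ) (lst : List ℕ) (st₀ st : HS) : Prop where
  reg : ∀ i ∈ [3, 4, 5, 7], st.reg i = st₀.reg i
  arr : ∀ f < 12, ∀ k v, ¬ Wr j lst f k v → st.arr f k v = st₀.arr f k v

namespace Fr

variable {j : ℕ} {lst : List ℕ} {st₀ st : HS}

theorem refl : Fr j lst st st := ⟨fun _ _ => rfl, fun _ _ _ _ _ => rfl⟩

theorem trans {st₁ : HS} (h : Fr j lst st₀ st₁) (h' : Fr j lst st₁ st) : Fr j lst st₀ st :=
  ⟨fun i hi => (h'.reg i hi).trans (h.reg i hi),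
    fun f hf k v hw => (h'.arr f hf k v hw).trans (h.arr f hf k v hw)⟩

theorem set (h : Fr j lst st₀ st) {i x : ℕ} (hi : i ∉ [3, 4, 5, 7]) :
    Fr j lst st₀ (st.set i x) := by
  refine ⟨fun i' hi' => ?_, h.arr⟩
  rw [HS.set_reg, if_neg (by rintro rfl; exact hi hi')]
  exact h.reg i' hi'

theorem wr (h : Fr j lst st₀ st) {f k v x : ℕ}
    (hw : 12 ≤ f ∨ Wr j lst f k v ∨ x = st.arr f k v) : Fr j lst st₀ (st.wr f k v x) := by
  refine ⟨h.reg, fun f' hf' k' v' hw' => ?_⟩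
  rw [HS.wr_arr]
  split_ifs with hc
  · obtain ⟨rfl, rfl, rfl⟩ := hc
    rcases hw with hw | hw | hw
    · omega
    · exact absurd hw hw'
    · rw [hw]; exact h.arr f' hf' k' v' hw'
  · exact h.arr f' hf' k' v' hw'

end Fr

/-- What the split of level `j` uses: `lst` is a union of nodes of level `j`. -/
structure LCtx (e : Env) (T : IncTree) (lst : List ℕ) (j : ℕ) (st : HS) : Prop where
  level : j + 1 ≤ e.L
  regJ : st.reg 7 = j
  lt : ∀ v ∈ lst, v < e.N
  parent_lt : ∀ v ∈ lst, T.parent v < e.N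
  arr : ∀ i (h : i < lst.length), st.arr aARR 0 i = lst[i]
  par : ∀ v ∈ lst, st.arr aPAR 0 v = T.parent v
  hd_mem : ∀ v ∈ lst, st.arr aHD j v ∈ lst
  hd_hd : ∀ v ∈ lst, st.arr aHD j (st.arr aHD j v) = st.arr aHD j v
  -- Row `j` may hold anything for a parent outside the list except a head from the list. Thus
  -- comparing heads decides whether the parent is in the same node.
  out : ∀ v ∈ lst, T.parent v ∉ lst → st.arr aHD j (T.parent v) ∉ lst
  nodup : lst.Nodup
  topo : lst.Pairwise (fun a b => T.parent a ≠ b)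
  length_le : lst.length ≤ e.N
  N_lt : 8 * e.N + 8 < e.V

namespace LCtx

variable {e : Env} {T : IncTree} {lst : List ℕ} {j : ℕ} {st st' : HS}

theorem of_fr (h : LCtx e T lst j st) (hf : Fr j lst st st') : LCtx e T lst j st' where
  level := h.level
  regJ := by rw [hf.reg 7 (by simp), h.regJ]
  lt := h.lt
  parent_lt := h.parent_lt
  arr i hi := by rw [hf.arr _ (by norm_num) _ _ (by simp [Wr]), h.arr i hi]
  par v hv := by rw [hf.arr _ (by norm_num) _ _ (by simp [Wr]), h.par v hv]
  hd_mem v hv := by rw [hf.arr _ (by norm_num) _ _ (by simp [Wr])]; exact h.hd_mem v hv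
  hd_hd v hv := by
    rw [hf.arr _ (by norm_num) _ _ (by simp [Wr]), hf.arr _ (by norm_num) _ _ (by simp [Wr])]
    exact h.hd_hd v hv
  out v hv := by rw [hf.arr _ (by norm_num) _ _ (by simp [Wr])]; exact h.out v hv
  nodup := h.nodup
  topo := h.topo
  length_le := h.length_le
  N_lt := h.N_lt

theorem arr_at (h : LCtx e T lst j st) {l1 l2 : List ℕ} {v : ℕ} (hl : lst = l1 ++ v :: l2) :
    st.arr aARR 0 l1.length = v := by
  rw [h.arr l1.length (by simp [hl])]
  simp [hl]

theorem idx_lt (h : LCtx e T lst j st) {l1 l2 : List ℕ} {v : ℕ} (hl : lst = l1 ++ v :: l2) :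
    l1.length + 1 ≤ e.N := by
  have := h.length_le
  simp [hl] at this
  omega

end LCtx

/-! ### The passes of a split, up to the choice of the sides -/

theorem reset_wp {e : Env} (he : e.Ok) {T : IncTree} {lst : List ℕ} {j : ℕ} {st : HS}
    (hc : LCtx e T lst j st) (h12 : st.reg 12 = lst.length) :
    WP e (forward resetBody) ((lst.length + 1) * (blkCost resetBody + 10)) st (fun st' =>
      (Fr j lst st st' ∧ ∀ v ∈ lst, st'.arr aSUB 0 v = 0 ∧ st'.arr aCS 0 v = T.parent v ∧
        st'.arr aTOP 0 v = T.parent v ∧ st'.arr aACC 0 v = 0 ∧ st'.arr aFH 0 v = 0 ∧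
        st'.arr aFH 1 v = 0 ∧ st'.arr aIC j v = v) ∧ st'.reg 12 = lst.length) := by
  refine fwd_wp he lst (fun l1 st' => Fr j lst st st' ∧ ∀ v ∈ l1, st'.arr aSUB 0 v = 0 ∧
      st'.arr aCS 0 v = T.parent v ∧
      st'.arr aTOP 0 v = T.parent v ∧ st'.arr aACC 0 v = 0 ∧ st'.arr aFH 0 v = 0 ∧
      st'.arr aFH 1 v = 0 ∧ st'.arr aIC j v = v) rfl ?_ ?_ h12 ⟨Fr.refl, by simp⟩
  · rintro st' x ⟨h1, _⟩
    exact ⟨h1.set (by simp), by simp⟩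
  · rintro l1 v l2 st' hl h8 h12 ⟨hf, hI⟩
    have hc' := hc.of_fr hf
    have hv : v ∈ lst := by simp [hl]
    have hvN := hc.lt v hv
    have hA := hc'.arr_at hl
    have hP := hc'.par v hv
    have hj := hc'.regJ
    have hlen := hc'.idx_lt hl
    have hL := hc.level
    have hN := hc.N_lt
    have hlV : l1.length + 1 < e.V := by omega
    have hjL : j ≤ e.L := by omega
    have h1L : 1 ≤ e.L := by omega
    have hlN : l1.length < e.N := by omega
    simp only [resetBody, vc, Ex.rd0]
    simp +contextual [h8, hA, hP, hj, hvN, h12, hlV, hjL, h1L, hlN]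
    refine fun _ _ => ⟨?_, ?_⟩
    · repeat first | exact hf | refine Fr.set ?_ (by simp) | refine Fr.wr ?_ (by simp [Wr, hv])
    · rintro w (hw | rfl)
      · obtain ⟨h1, h2, h3, h4, h5, h6, h7⟩ := hI w hw
        simp only [h1, h2, h3, h4, h5, h6, h7, implies_true, true_and]
        refine ⟨?_, ?_, ?_⟩ <;> split_ifs with hwv <;> simp [hwv]
      · simp

/-- `u` is a child of `v` in the same node. -/
def Ch (T : IncTree) (hd : ℕ → ℕ) (u v : ℕ) : Prop := T.parent u = v ∧ u ≠ v ∧ hd u = hd v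

instance (T : IncTree) (hd : ℕ → ℕ) (u v : ℕ) : Decidable (Ch T hd u v) := by
  unfold Ch; infer_instance

/-- The sum of `f` over the children of `v` that occur in `l`. -/
def chSum (T : IncTree) (hd : ℕ → ℕ) (f : ℕ → ℕ) (v : ℕ) (l : List ℕ) : ℕ :=
  (l.map (fun u => if Ch T hd u v then f u else 0)).sum

theorem chSum_congr {T : IncTree} {hd f g : ℕ → ℕ} {v : ℕ} {l : List ℕ}
    (h : ∀ u ∈ l, f u = g u) : chSum T hd f v l = chSum T hd g v l := by
  unfold chSum
  congr 1
  refine List.map_congr_left fun u hu => ?_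
  rw [h u hu]

theorem chSum_cons {T : IncTree} {hd f : ℕ → ℕ} {u v : ℕ} {l : List ℕ} :
    chSum T hd f v (u :: l) = (if Ch T hd u v then f u else 0) + chSum T hd f v l := by
  simp [chSum]

theorem LCtx.parent_split {e : Env} {T : IncTree} {lst : List ℕ} {j : ℕ} {st : HS}
    (hc : LCtx e T lst j st) {l1 l2 : List ℕ} {v : ℕ} (hl : lst = l1 ++ v :: l2) :
    T.parent v ∉ l2 ∧ v ∉ l1 ∧ v ∉ l2 ∧ (∀ w ∈ l1, w ∉ l2) := by
  have h1 := hc.topo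
  have h2 := hc.nodup
  rw [hl] at h1 h2
  rw [List.pairwise_append, List.pairwise_cons] at h1
  rw [List.nodup_append, List.nodup_cons] at h2
  refine ⟨fun h => h1.2.1.1 _ h rfl, fun h => h2.2.2 v h v (by simp) rfl, h2.2.1.1,
    fun w hw hw' => h2.2.2 w hw w (by simp [hw']) rfl⟩

theorem LCtx.hd_parent {e : Env} {T : IncTree} {lst : List ℕ} {j : ℕ} {st : HS}
    (hc : LCtx e T lst j st) {v : ℕ} (hv : v ∈ lst)
    (h : st.arr aHD j (T.parent v) = st.arr aHD j v) : T.parent v ∈ lst := by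
  by_contra hn
  exact hc.out v hv hn (h ▸ hc.hd_mem v hv)

theorem sum_map_update_le {l : List ℕ} (hl : l.Nodup) (f : ℕ → ℕ) (u z : ℕ) :
    (l.map (fun w => if w = u then f u + z else f w)).sum ≤ (l.map f).sum + z := by
  induction l with
  | nil => simp
  | cons x l ih =>
    rw [List.nodup_cons] at hl
    have := ih hl.2
    by_cases hx : x = u
    · subst hx
      have h2 : l.map (fun w => if w = x then f x + z else f w) = l.map f :=
        List.map_congr_left fun w hw => if_neg (by rintro rfl; exact hl.1 hw)
      simp [h2]
      omega
    · simp only [List.map_cons, List.sum_cons, if_neg hx]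
      omega

theorem le_sum_map {l : List ℕ} (f : ℕ → ℕ) {u : ℕ} (hu : u ∈ l) : f u ≤ (l.map f).sum :=
  List.single_le_sum (fun _ _ => Nat.zero_le _) _ (List.mem_map_of_mem hu)

/-- In the invariant, the summand `1` and the sum over children count only the processed suffix. As
`topo` puts children behind their parents, the entry of a vertex is complete when it is processed.
-/
theorem size_wp {e : Env} (he : e.Ok) {T : IncTree} {lst : List ℕ} {j : ℕ} {st : HS}
    (hc : LCtx e T lst j st) (h12 : st.reg 12 = lst.length)
    (hz : ∀ v ∈ lst, st.arr aSUB 0 v = 0) :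
    WP e (backward sizeBody) ((lst.length + 1) * (blkCost sizeBody + 10)) st (fun st' =>
      (Fr j lst st st' ∧ (∀ f k v, f ≠ aSUB → st'.arr f k v = st.arr f k v) ∧
        ∀ v ∈ lst, st'.arr aSUB 0 v = (if v ∈ lst then 1 else 0) +
          chSum T (st.arr aHD j) (st'.arr aSUB 0) v lst) ∧ st'.reg 12 = lst.length) := by
  refine (bwd_wp he lst (fun l2 st' => Fr j lst st st' ∧
      (∀ f k v, f ≠ aSUB → st'.arr f k v = st.arr f k v) ∧
      (∀ v ∈ lst, st'.arr aSUB 0 v = (if v ∈ l2 then 1 else 0) +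
        chSum T (st.arr aHD j) (st'.arr aSUB 0) v l2) ∧
      -- The sizes still to be passed on are those of disjoint parts of the processed suffix. This
      -- bound excludes overflow.
      ∀ l1, lst = l1 ++ l2 → (l1.map (st'.arr aSUB 0)).sum ≤ l2.length) rfl ?_ ?_ h12
    ⟨Fr.refl, fun _ _ _ _ => rfl, fun v hv => by simp [chSum, hz v hv], ?_⟩).mono le_rfl ?_
  · rintro st' x ⟨h1, h2, h3⟩
    exact ⟨h1.set (by simp), h2, h3⟩
  · rintro l1 v l2 st' hl h8 h12 ⟨hf, hS, hI, hsum⟩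
    have hc' := hc.of_fr hf
    have hv : v ∈ lst := by simp [hl]
    have hvN := hc.lt v hv
    have huN := hc.parent_lt v hv
    have hA := hc'.arr_at hl
    have hP := hc'.par v hv
    have hj := hc'.regJ
    have hlen := hc'.idx_lt hl
    have hL := hc.level
    have hN := hc.N_lt
    have hjL : j ≤ e.L := by omega
    have hlN : l1.length < e.N := by omega
    obtain ⟨hu2, hv1, hv2, h12'⟩ := hc.parent_split hl
    have hHD : ∀ w, st'.arr aHD j w = st.arr aHD j w := fun w => hS _ _ _ (by norm_num)
    have hs1 := hsum (l1 ++ [v]) (by simp [hl])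
    have hlenl : l1.length + (l2.length + 1) ≤ e.N := by simpa [hl] using hc.length_le
    rw [List.map_append, List.sum_append] at hs1
    simp only [List.map_cons, List.map_nil, List.sum_cons, List.sum_nil, add_zero] at hs1
    have hz1 : st'.arr aSUB 0 v + 1 < e.V := by omega
    simp only [sizeBody, vc, Ex.rd0]
    by_cases hin : Ch T (st.arr aHD j) v (T.parent v)
    · have hne : T.parent v ≠ v := hin.2.1.symm
      have hul := hc.hd_parent hv hin.2.2.symm
      have hul1 : T.parent v ∈ l1 := by
        rw [hl] at hul
        rcases List.mem_append.1 hul with h | h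
        · exact h
        · rcases List.mem_cons.1 h with h | h
          · exact absurd h hne
          · exact absurd h hu2
      have hs2 := le_sum_map (st'.arr aSUB 0) hul1
      have hz2 : st'.arr aSUB 0 (T.parent v) + (st'.arr aSUB 0 v + 1) < e.V := by omega
      simp +contextual [h8, hA, hP, hj, hvN, huN, h12, hHD, hne, hjL, ← hin.2.2, hz1, hz2, hlN, hS]
      intros
      refine ⟨?_, ?_, ?_⟩
      · repeat first | exact hf | refine Fr.set ?_ (by simp) | refine Fr.wr ?_ (by simp)
      · intro w hw
        rw [chSum_cons, chSum_congr (g := st'.arr aSUB 0) fun u hu => ?_]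
        · have := hI w hw
          by_cases hwu : w = T.parent v
          · subst hwu
            have h3 : T.parent v ∉ l2 := hu2
            simp [hne, hin, h3, hne.symm] at this ⊢
            omega
          · have hnc : ¬ Ch T (st.arr aHD j) v w := fun h => hwu h.1.symm
            by_cases hwv : w = v
            · subst hwv
              simp [hv2, hnc, hwu] at this ⊢
              omega
            · simpa [hwu, hwv, hnc] using this
        · have h3 : u ≠ T.parent v := by rintro rfl; exact hu2 hu
          have h4 : u ≠ v := by rintro rfl; exact hv2 hu
          simp [h3, h4]
      · intro l1' hl'
        obtain rfl : l1 = l1' := List.append_cancel_right (hl.symm.trans hl')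
        have hnd : l1.Nodup := by
          have := hc.nodup
          rw [hl, List.nodup_append] at this
          exact this.1
        have := sum_map_update_le hnd (st'.arr aSUB 0) (T.parent v) (st'.arr aSUB 0 v + 1)
        refine le_trans (le_of_eq ?_) (this.trans (by omega))
        congr 1
        refine List.map_congr_left fun w hw => ?_
        have h4 : w ≠ v := by rintro rfl; exact hv1 hw
        simp [h4]
    · have hval : (if T.parent v = v then 0 else if st.arr aHD j (T.parent v) = st.arr aHD j v
          then 1 else 0) = 0 := by
        split_ifs with h1 h2
        · rfl
        · exact absurd ⟨rfl, Ne.symm h1, h2.symm⟩ hin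
        · rfl
      have h0V : 0 < e.V := by omega
      simp +contextual [h8, hA, hP, hj, hvN, huN, h12, hHD, hjL, hz1, hlN, hS, hval, h0V]
      intros
      refine ⟨?_, ?_, ?_⟩
      · repeat first | exact hf | refine Fr.set ?_ (by simp) | refine Fr.wr ?_ (by simp)
      · intro w hw
        rw [chSum_cons, chSum_congr (g := st'.arr aSUB 0) fun u hu => ?_]
        · have := hI w hw
          have hnc : ¬ Ch T (st.arr aHD j) v w := fun h => hin (by rw [h.1]; exact h)
          by_cases hwv : w = v
          · subst hwv
            simp [hv2, hnc] at this ⊢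
            split_ifs <;> omega
          · simp [hwv, hnc] at this ⊢
            rw [this]
            split_ifs with h1 <;> simp_all
        · have h3 : u ≠ T.parent v := by rintro rfl; exact hu2 hu
          have h4 : u ≠ v := by rintro rfl; exact hv2 hu
          simp [h3, h4]
      · intro l1' hl'
        obtain rfl : l1 = l1' := List.append_cancel_right (hl.symm.trans hl')
        refine le_trans (le_of_eq ?_) (by omega : (l1.map (st'.arr aSUB 0)).sum ≤ l2.length + 1)
        congr 1
        refine List.map_congr_left fun w hw => ?_
        have h4 : w ≠ v := by rintro rfl; exact hv1 hw
        simp [h4]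
        split_ifs with h1 <;> simp_all
  · intro l1 hl
    refine (List.sum_eq_zero (M := ℕ) fun x hx => ?_).le
    obtain ⟨w, hw, rfl⟩ := List.mem_map.1 hx
    exact hz w (by rw [hl]; simpa using hw)
  · rintro st' ⟨⟨h1, h2, h3, _⟩, h4⟩
    exact ⟨⟨h1, h2, h3⟩, h4⟩
-- The postcondition `Q` is opaque here, so the invariant stays folded while the body is evaluated
-- symbolically.
theorem fwd_wp' {e : Env} (he : e.Ok) {l : List At} (lst : List ℕ)
    (I : List ℕ → HS → Prop) (hwf : blkWf l = true)
    (hset : ∀ st x, I [] st → I [] (st.set 8 x))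
    (hbody : ∀ l1 v l2 st (Q : HS → Prop), lst = l1 ++ v :: l2 → st.reg 8 = l1.length →
      st.reg 12 = lst.length → I l1 st →
      (∀ st', st'.reg 8 = l1.length + 1 → st'.reg 12 = lst.length → I (l1 ++ [v]) st' → Q st') →
      vc e l st Q)
    {st : HS} (h12 : st.reg 12 = lst.length) (hI : I [] st) :
    WP e (forward l) ((lst.length + 1) * (blkCost l + 10)) st
      (fun st' => I lst st' ∧ st'.reg 12 = lst.length) :=
  fwd_wp he lst I hwf hset (fun l1 v l2 st h1 h2 h3 h4 =>
    hbody l1 v l2 st _ h1 h2 h3 h4 fun _ h5 h6 h7 => ⟨h7, h5, h6⟩) h12 hI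

/-- If several vertices qualified, the last one would win. Only existence is claimed, and uniqueness
is left to the theory of clusters. -/
theorem heavy_wp {e : Env} (he : e.Ok) {T : IncTree} {lst : List ℕ} {j : ℕ} {st : HS}
    (hc : LCtx e T lst j st) (h12 : st.reg 12 = lst.length)
    (hz : ∀ v ∈ lst, st.arr aIC j v = v ∧ st.arr aTOP 0 v = T.parent v)
    {hd sub : ℕ → ℕ} {hv : ℕ → Prop} (hhd : st.arr aHD j = hd) (hsub : st.arr aSUB 0 = sub)
    (hhv : ∀ v, hv v ↔ st.arr aSZ j (hd v) < 2 * sub v) :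
    WP e (forward heavyBody) ((lst.length + 1) * (blkCost heavyBody + 10)) st (fun st' =>
      (Fr j lst st st' ∧ (∀ f k v, f ≠ aTOP → f ≠ aIC → st'.arr f k v = st.arr f k v) ∧
        (∀ v ∈ lst, (∃ u ∈ lst, Ch T hd u v ∧ hv u ∧ st'.arr aIC j v = u) ∨
          ((∀ u ∈ lst, Ch T hd u v → ¬ hv u) ∧ st'.arr aIC j v = v)) ∧
        ∀ h ∈ lst, (∃ v ∈ lst, hd v = h ∧ hv v ∧ ¬ Ch T hd v (T.parent v) ∧
            st'.arr aTOP 0 h = v) ∨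
          ((∀ v ∈ lst, hd v = h → hv v → Ch T hd v (T.parent v)) ∧
            st'.arr aTOP 0 h = T.parent h)) ∧ st'.reg 12 = lst.length) := by
  refine fwd_wp' he lst (fun l1 st' =>
      (Fr j lst st st' ∧ (∀ f k v, f ≠ aTOP → f ≠ aIC → st'.arr f k v = st.arr f k v) ∧
        (∀ v ∈ lst, (∃ u ∈ l1, Ch T hd u v ∧ hv u ∧ st'.arr aIC j v = u) ∨
          ((∀ u ∈ l1, Ch T hd u v → ¬ hv u) ∧ st'.arr aIC j v = v)) ∧
        ∀ h ∈ lst, (∃ v ∈ l1, hd v = h ∧ hv v ∧ ¬ Ch T hd v (T.parent v) ∧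
            st'.arr aTOP 0 h = v) ∨
          ((∀ v ∈ l1, hd v = h → hv v → Ch T hd v (T.parent v)) ∧
            st'.arr aTOP 0 h = T.parent h))) rfl ?_ ?_ h12
      ⟨Fr.refl, fun _ _ _ _ _ => rfl, fun v hv => Or.inr ⟨by simp, (hz v hv).1⟩,
        fun v hv => Or.inr ⟨by simp, (hz v hv).2⟩⟩
  · rintro st' x ⟨h1, h2, h3⟩
    exact ⟨h1.set (by simp), h2, h3⟩
  · rintro l1 v l2 st' Q hl h8 h12 ⟨hf, hS, hIC, hTOP⟩ hQ
    have hc' := hc.of_fr hf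
    have hvl : v ∈ lst := by simp [hl]
    have hvN := hc.lt v hvl
    have huN := hc.parent_lt v hvl
    have hA := hc'.arr_at hl
    have hP := hc'.par v hvl
    have hj := hc'.regJ
    have hlen := hc'.idx_lt hl
    have hL := hc.level
    have hN := hc.N_lt
    have hjL : j ≤ e.L := by omega
    have hlN : l1.length < e.N := by omega
    have hlV : l1.length + 1 < e.V := by omega
    have hHD : ∀ w, st'.arr aHD j w = hd w := fun w => by
      rw [hS _ _ _ (by norm_num) (by norm_num), hhd]
    have hSUB : ∀ w, st'.arr aSUB 0 w = sub w := fun w => by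
      rw [hS _ _ _ (by norm_num) (by norm_num), hsub]
    have hSZ : ∀ w, st'.arr aSZ j w = st.arr aSZ j w := fun w => by
      rw [hS _ _ _ (by norm_num) (by norm_num)]
    have hhm : hd v ∈ lst := hhd ▸ hc.hd_mem v hvl
    have hhN := hc.lt _ hhm
    have hin : ∃ q, (if T.parent v = v then 0 else if hd (T.parent v) = hd v then 1 else 0) = q :=
      ⟨_, rfl⟩
    obtain ⟨q, hq⟩ := hin
    have hq' : (q = 1 ∧ Ch T hd v (T.parent v)) ∨ (q ≠ 1 ∧ ¬ Ch T hd v (T.parent v)) := by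
      rw [← hq]
      unfold Ch
      by_cases h1 : T.parent v = v
      · simp [h1]
      · by_cases h2 : hd (T.parent v) = hd v
        · simp [h1, h2, Ne.symm h1]
        · simp [h1, h2, Ne.symm h2]
    have huNh : hd (T.parent v) = hd v → hd (T.parent v) < e.N := fun h => h ▸ hhN
    have key : ∀ st'' : HS, st''.reg 8 = l1.length + 1 → st''.reg 12 = lst.length →
        Fr j lst st st'' → (∀ f k v, f ≠ aTOP → f ≠ aIC → st''.arr f k v = st'.arr f k v) →
        (∀ w, hv v → Ch T hd v w → st''.arr aIC j w = v) →
        (∀ w, ¬ (hv v ∧ Ch T hd v w) → st''.arr aIC j w = st'.arr aIC j w) →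
        (hv v → ¬ Ch T hd v (T.parent v) → st''.arr aTOP 0 (hd v) = v) →
        (∀ h, ¬ (hv v ∧ ¬ Ch T hd v (T.parent v) ∧ hd v = h) →
          st''.arr aTOP 0 h = st'.arr aTOP 0 h) → Q st'' := by
      intro st'' h8' h12' hf' hS' hi1 hi2 ht1 ht2
      refine hQ st'' h8' h12' ⟨hf', fun f k v h1 h2 => by rw [hS' f k v h1 h2, hS f k v h1 h2],
        fun w hw => ?_, fun h hhl => ?_⟩
      · by_cases hx : hv v ∧ Ch T hd v w
        · exact Or.inl ⟨v, by simp, hx.2, hx.1, hi1 w hx.1 hx.2⟩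
        · rw [hi2 w hx]
          rcases hIC w hw with ⟨u, h1, h2, h3, h4⟩ | ⟨h1, h2⟩
          · exact Or.inl ⟨u, by simp [h1], h2, h3, h4⟩
          · refine Or.inr ⟨fun u hu hc => ?_, h2⟩
            rcases List.mem_append.1 hu with hu | hu
            · exact h1 u hu hc
            · obtain rfl : u = v := by simpa using hu
              exact fun hh => hx ⟨hh, hc⟩
      · by_cases hx : hv v ∧ ¬ Ch T hd v (T.parent v) ∧ hd v = h
        · exact Or.inl ⟨v, by simp, hx.2.2, hx.1, hx.2.1, hx.2.2 ▸ ht1 hx.1 hx.2.1⟩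
        · rw [ht2 h hx]
          rcases hTOP h hhl with ⟨u, h1, h2, h3, h4⟩ | ⟨h1, h2⟩
          · exact Or.inl ⟨u, by simp [h1], h2, h3, h4⟩
          · refine Or.inr ⟨fun u hu hc hh => ?_, h2⟩
            rcases List.mem_append.1 hu with hu | hu
            · exact h1 u hu hc hh
            · obtain rfl : u = v := by simpa using hu
              by_contra hcc
              exact hx ⟨hh, hcc, hc⟩
    have hch : ∀ w, Ch T hd v w → w = T.parent v := fun w h => h.1.symm
    simp only [heavyBody, vc, Ex.rd0]
    by_cases hh : hv v
    · have hh' := (hhv v).1 hh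
      rcases hq' with ⟨rfl, hin⟩ | ⟨hq1, hin⟩
      · have hul : T.parent v ∈ lst := hc.hd_parent hvl (by rw [hhd]; exact hin.2.2.symm)
        simp +contextual [h8, hA, hP, hj, hvN, huN, hHD, hSUB, hSZ, hjL,
          hh', hlN, hlV, hhN, hS, hq]
        intros
        refine key _ (by simp) (by simp [h12]) ?_ ?_ ?_ ?_ ?_ ?_
        · repeat first | exact hf | refine Fr.set ?_ (by simp) | refine Fr.wr ?_ (by simp [Wr, hul])
        · simp +contextual
        · intro w _ hw
          simp [hch w hw]
        · intro w hw
          have : w ≠ T.parent v := by rintro rfl; exact hw ⟨hh, hin⟩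
          simp [this]
        · exact fun _ h => absurd hin h
        · intro h _
          by_cases hx : h = hd v <;> simp [hx]
      · simp +contextual [h8, hA, hP, hj, hvN, huN, hHD, hSUB, hSZ, hjL,
          hh', hlN, hlV, hhN, hq, hq1]
        intros
        refine key _ (by simp) (by simp [h12]) ?_ ?_ ?_ ?_ ?_ ?_
        · repeat first | exact hf | refine Fr.set ?_ (by simp) | refine Fr.wr ?_ (by simp)
        · simp +contextual
        · intro w _ hw
          exact absurd (hch w hw ▸ hw) hin
        · intro w _
          by_cases hx : w = T.parent v <;> simp [hx]
        · simp
        · intro h hx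
          have : h ≠ hd v := by rintro rfl; exact hx ⟨hh, hin, rfl⟩
          simp [this]
    · have hh' : ¬ st.arr aSZ j (hd v) < 2 * sub v := fun h => hh ((hhv v).2 h)
      simp +contextual [h8, hA, hP, hj, hvN, huN, hHD, hSUB, hSZ, hjL,
          hh', hlN, hlV, hhN, hS, hq]
      intros
      refine key _ (by simp) (by simp [h12]) ?_ ?_ ?_ ?_ ?_ ?_
      · repeat first | exact hf | refine Fr.set ?_ (by simp) | refine Fr.wr ?_ (by simp)
      · simp +contextual
      · exact fun _ h => absurd h hh
      · intro w _
        by_cases hx : w = T.parent v <;> simp [hx]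
      · exact fun h => absurd h hh
      · intro h _
        by_cases hx : h = hd v <;> simp [hx]

/-- The separator is recognized as a heavy vertex whose heavy child is still the default, namely the
vertex itself. -/
theorem sep_wp {e : Env} (he : e.Ok) {T : IncTree} {lst : List ℕ} {j : ℕ} {st : HS}
    (hc : LCtx e T lst j st) (h12 : st.reg 12 = lst.length)
    {hd sub dn : ℕ → ℕ} {hv : ℕ → Prop} (hhd : st.arr aHD j = hd) (hsub : st.arr aSUB 0 = sub)
    (hdn : st.arr aIC j = dn)
    (hhv : ∀ v, hv v ↔ st.arr aSZ j (hd v) < 2 * sub v) :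
    WP e (forward sepBody) ((lst.length + 1) * (blkCost sepBody + 10)) st (fun st' =>
      (Fr j lst st st' ∧ (∀ f k v, f ≠ aCS → st'.arr f k v = st.arr f k v) ∧
        ∀ h ∈ lst, (∃ v ∈ lst, hd v = h ∧ hv v ∧ dn v = v ∧ st'.arr aCS 0 h = v) ∨
          ((∀ v ∈ lst, hd v = h → hv v → dn v ≠ v) ∧
            st'.arr aCS 0 h = st.arr aCS 0 h)) ∧ st'.reg 12 = lst.length) := by
  refine fwd_wp' he lst (fun l1 st' =>
      (Fr j lst st st' ∧ (∀ f k v, f ≠ aCS → st'.arr f k v = st.arr f k v) ∧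
        ∀ h ∈ lst, (∃ v ∈ l1, hd v = h ∧ hv v ∧ dn v = v ∧ st'.arr aCS 0 h = v) ∨
          ((∀ v ∈ l1, hd v = h → hv v → dn v ≠ v) ∧
            st'.arr aCS 0 h = st.arr aCS 0 h))) rfl ?_ ?_ h12
      ⟨Fr.refl, fun _ _ _ _ => rfl, fun v hv => Or.inr ⟨by simp, rfl⟩⟩
  · rintro st' x ⟨h1, h2, h3⟩
    exact ⟨h1.set (by simp), h2, h3⟩
  · rintro l1 v l2 st' Q hl h8 h12 ⟨hf, hS, hCS⟩ hQ
    have hc' := hc.of_fr hf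
    have hvl : v ∈ lst := by simp [hl]
    have hvN := hc.lt v hvl
    have hA := hc'.arr_at hl
    have hj := hc'.regJ
    have hlen := hc'.idx_lt hl
    have hL := hc.level
    have hN := hc.N_lt
    have hjL : j ≤ e.L := by omega
    have hlN : l1.length < e.N := by omega
    have hlV : l1.length + 1 < e.V := by omega
    have hHD : ∀ w, st'.arr aHD j w = hd w := fun w => by
      rw [hS _ _ _ (by norm_num), hhd]
    have hSUB : ∀ w, st'.arr aSUB 0 w = sub w := fun w => by
      rw [hS _ _ _ (by norm_num), hsub]
    have hIC : ∀ w, st'.arr aIC j w = dn w := fun w => by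
      rw [hS _ _ _ (by norm_num), hdn]
    have hSZ : ∀ w, st'.arr aSZ j w = st.arr aSZ j w := fun w => by
      rw [hS _ _ _ (by norm_num)]
    have hhm : hd v ∈ lst := hhd ▸ hc.hd_mem v hvl
    have hhN := hc.lt _ hhm
    have key : ∀ st'' : HS, st''.reg 8 = l1.length + 1 → st''.reg 12 = lst.length →
        Fr j lst st st'' → (∀ f k v, f ≠ aCS → st''.arr f k v = st'.arr f k v) →
        (hv v → dn v = v → st''.arr aCS 0 (hd v) = v) →
        (∀ h, ¬ (hv v ∧ dn v = v ∧ hd v = h) →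
          st''.arr aCS 0 h = st'.arr aCS 0 h) → Q st'' := by
      intro st'' h8' h12' hf' hS' ht1 ht2
      refine hQ st'' h8' h12' ⟨hf', fun f k v h1 => by rw [hS' f k v h1, hS f k v h1],
        fun h hhl => ?_⟩
      by_cases hx : hv v ∧ dn v = v ∧ hd v = h
      · exact Or.inl ⟨v, by simp, hx.2.2, hx.1, hx.2.1, hx.2.2 ▸ ht1 hx.1 hx.2.1⟩
      · rw [ht2 h hx]
        rcases hCS h hhl with ⟨u, h1, h2, h3, h4⟩ | ⟨h1, h2⟩
        · exact Or.inl ⟨u, by simp [h1], h2, h3, h4⟩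
        · refine Or.inr ⟨fun u hu hc hh => ?_, h2⟩
          rcases List.mem_append.1 hu with hu | hu
          · exact h1 u hu hc hh
          · obtain rfl : u = v := by simpa using hu
            exact fun hcc => hx ⟨hh, hcc, hc⟩
    simp only [sepBody, vc, Ex.rd0]
    by_cases hh : hv v
    · have hh' := (hhv v).1 hh
      by_cases hd' : dn v = v
      · simp +contextual [h8, hA, hj, hvN, hHD, hSUB, hSZ, hjL, hIC,
          hh', hlN, hlV, hhN, hd']
        intros
        refine key _ (by simp) (by simp [h12]) ?_ ?_ ?_ ?_
        · repeat first | exact hf | refine Fr.set ?_ (by simp) | refine Fr.wr ?_ (by simp)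
        · simp +contextual
        · simp
        · intro h hx
          have : h ≠ hd v := by rintro rfl; exact hx ⟨hh, hd', rfl⟩
          simp [this]
      · simp +contextual [h8, hA, hj, hvN, hHD, hSUB, hSZ, hjL, hIC,
          hh', hlN, hlV, hhN, hd']
        intros
        refine key _ (by simp) (by simp [h12]) ?_ ?_ ?_ ?_
        · repeat first | exact hf | refine Fr.set ?_ (by simp) | refine Fr.wr ?_ (by simp)
        · simp +contextual
        · exact fun _ h => absurd h hd'
        · intro h _
          by_cases hx : h = hd v <;> simp [hx]
    · have hh' : ¬ st.arr aSZ j (hd v) < 2 * sub v := fun h => hh ((hhv v).2 h)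
      simp +contextual [h8, hA, hj, hvN, hHD, hSUB, hSZ, hjL, hIC,
          hh', hlN, hlV, hhN]
      intros
      refine key _ (by simp) (by simp [h12]) ?_ ?_ ?_ ?_
      · repeat first | exact hf | refine Fr.set ?_ (by simp) | refine Fr.wr ?_ (by simp)
      · simp +contextual
      · exact fun h => absurd h hh
      · intro h _
        by_cases hx : h = hd v <;> simp [hx]

/-- The recurrence for the information about `v` and the separator. -/
def InfoAt (T : IncTree) (hd : ℕ → ℕ) (hv : ℕ → Prop) (dn tp cs ia ix ic sd : ℕ → ℕ) (v : ℕ) :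
    Prop :=
  (hv v → ia v = v ∧ ix v = v ∧ ic v = dn v ∧ sd v = 0) ∧
  (¬ hv v → hd (T.parent v) = hd v → ia v = ia (T.parent v) ∧
    ix v = (if ia (T.parent v) = T.parent v then v else ix (T.parent v)) ∧
    ic v = ic (T.parent v)) ∧
  (¬ hv v → hd (T.parent v) ≠ hd v → ia v = T.parent v ∧ ix v = v ∧ ic v = tp (hd v)) ∧
  (¬ hv v → T.parent v ≠ cs (hd v) → hd (T.parent v) = hd v → sd v = sd (T.parent v)) ∧
  (¬ hv v → T.parent v ≠ cs (hd v) → hd (T.parent v) ≠ hd v → sd v = 0) ∧ sd v ≤ 1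

theorem InfoAt.congr {T : IncTree} {hd : ℕ → ℕ} {hv : ℕ → Prop}
    {dn tp cs ia ix ic sd ia' ix' ic' sd' : ℕ → ℕ} {v : ℕ}
    (h : InfoAt T hd hv dn tp cs ia ix ic sd v)
    (hw : ∀ w, w = v ∨ w = T.parent v → ia' w = ia w ∧ ix' w = ix w ∧ ic' w = ic w ∧ sd' w = sd w) :
    InfoAt T hd hv dn tp cs ia' ix' ic' sd' v := by
  obtain ⟨h1, h2, h3, h4⟩ := hw v (Or.inl rfl)
  obtain ⟨h5, h6, h7, h8⟩ := hw _ (Or.inr rfl)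
  unfold InfoAt at *
  rw [h1, h2, h3, h4, h5, h6, h7, h8]
  exact h

-- The bounds on `aACC` express the greedy rule: a light child is added only below a quarter of the
-- node and has at most half of it, so three quarters are never exceeded. As the sum only grows, a
-- final value below a quarter means that nothing was refused.
set_option maxHeartbeats 1000000 in
theorem info_wp {e : Env} (he : e.Ok) {T : IncTree} {lst : List ℕ} {j : ℕ} {st : HS}
    (hc : LCtx e T lst j st) (h12 : st.reg 12 = lst.length)
    {hd sub dn tp cs sz : ℕ → ℕ} {hv : ℕ → Prop} (hhd : st.arr aHD j = hd)
    (hsub : st.arr aSUB 0 = sub) (hdn : st.arr aIC j = dn) (htp : st.arr aTOP 0 = tp)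
    (hcs : st.arr aCS 0 = cs) (hsz : st.arr aSZ j = sz)
    (hhv : ∀ v, hv v ↔ sz (hd v) < 2 * sub v) (hszN : ∀ v ∈ lst, sz (hd v) ≤ e.N)
    (hroot : ∀ v ∈ lst, ¬ hv v → T.parent v ≠ v) (hacc0 : ∀ h ∈ lst, st.arr aACC 0 h = 0) :
    WP e (forward infoBody) ((lst.length + 1) * (blkCost infoBody + 10)) st (fun st' =>
      (Fr j lst st st' ∧ (∀ f k v, f ≠ aIA → f ≠ aIX → f ≠ aIC → f ≠ aACC → f ≠ aSIDE →
          st'.arr f k v = st.arr f k v) ∧ (∀ v ∉ lst, st'.arr aIC j v = dn v) ∧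
        (∀ v ∈ lst, InfoAt T hd hv dn tp cs (st'.arr aIA j) (st'.arr aIX j) (st'.arr aIC j)
          (st'.arr aSIDE 0) v) ∧
        ∀ h ∈ lst, st'.arr aACC 0 h = (lst.map (fun v => if hd v = h ∧ ¬ sz h < 2 * sub v ∧
            T.parent v = cs h ∧ st'.arr aSIDE 0 v = 1 then sub v else 0)).sum ∧
          4 * st'.arr aACC 0 h ≤ 3 * sz h ∧
          (4 * st'.arr aACC 0 h < sz h → ∀ v ∈ lst, hd v = h → ¬ hv v → T.parent v = cs h →
            st'.arr aSIDE 0 v = 1)) ∧ st'.reg 12 = lst.length) := by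
  refine fwd_wp' he lst (fun l1 st' =>
      (Fr j lst st st' ∧ (∀ f k v, f ≠ aIA → f ≠ aIX → f ≠ aIC → f ≠ aACC → f ≠ aSIDE →
          st'.arr f k v = st.arr f k v) ∧ (∀ v ∉ l1, st'.arr aIC j v = dn v) ∧
        (∀ v ∈ l1, InfoAt T hd hv dn tp cs (st'.arr aIA j) (st'.arr aIX j) (st'.arr aIC j)
          (st'.arr aSIDE 0) v) ∧
        ∀ h ∈ lst, st'.arr aACC 0 h = (l1.map (fun v => if hd v = h ∧ ¬ sz h < 2 * sub v ∧
            T.parent v = cs h ∧ st'.arr aSIDE 0 v = 1 then sub v else 0)).sum ∧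
          4 * st'.arr aACC 0 h ≤ 3 * sz h ∧
          (4 * st'.arr aACC 0 h < sz h → ∀ v ∈ l1, hd v = h → ¬ hv v → T.parent v = cs h →
            st'.arr aSIDE 0 v = 1))) rfl ?_ ?_ h12
      ⟨Fr.refl, fun _ _ _ _ _ _ _ _ => rfl, fun v _ => hdn ▸ rfl, by simp, fun h hh => by
        simp [hacc0 h hh]⟩
  · rintro st' x ⟨h1, h2, h3⟩
    exact ⟨h1.set (by simp), h2, h3⟩
  · rintro l1 v l2 st' Q hl h8 h12 ⟨hf, hS, hIC, hI, hG⟩ hQ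
    have hc' := hc.of_fr hf
    have hvl : v ∈ lst := by simp [hl]
    have hvN := hc.lt v hvl
    have huN := hc.parent_lt v hvl
    have hA := hc'.arr_at hl
    have hP := hc'.par v hvl
    have hj := hc'.regJ
    have hlen := hc'.idx_lt hl
    have hL := hc.level
    have hN := hc.N_lt
    have hjL : j ≤ e.L := by omega
    have hlN : l1.length < e.N := by omega
    have hlV : l1.length + 1 < e.V := by omega
    have hHD : ∀ w, st'.arr aHD j w = hd w := fun w => by
      rw [hS _ _ _ (by norm_num) (by norm_num) (by norm_num) (by norm_num) (by norm_num), hhd]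
    have hSUB : ∀ w, st'.arr aSUB 0 w = sub w := fun w => by
      rw [hS _ _ _ (by norm_num) (by norm_num) (by norm_num) (by norm_num) (by norm_num), hsub]
    have hTP : ∀ w, st'.arr aTOP 0 w = tp w := fun w => by
      rw [hS _ _ _ (by norm_num) (by norm_num) (by norm_num) (by norm_num) (by norm_num), htp]
    have hCS : ∀ w, st'.arr aCS 0 w = cs w := fun w => by
      rw [hS _ _ _ (by norm_num) (by norm_num) (by norm_num) (by norm_num) (by norm_num), hcs]
    have hSZ : ∀ w, st'.arr aSZ j w = sz w := fun w => by
      rw [hS _ _ _ (by norm_num) (by norm_num) (by norm_num) (by norm_num) (by norm_num), hsz]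
    have hhm : hd v ∈ lst := hhd ▸ hc.hd_mem v hvl
    have hhN := hc.lt _ hhm
    obtain ⟨hu2, hv1, hv2, hl12⟩ := hc.parent_split hl
    have hICv := hIC v hv1
    -- The vertex `v` is not the parent of an earlier vertex, so writing its entries does not affect
    -- the recurrences established before.
    have htopo : ∀ w ∈ l1, T.parent w ≠ v := by
      intro w hw
      have := hc.topo
      rw [hl, List.pairwise_append] at this
      exact this.2.2 w hw v (by simp)
    obtain ⟨hG1, hG2, hG3⟩ := hG _ hhm
    have hszv := hszN v hvl
    have hz1 : st'.arr aACC 0 (hd v) < e.V := by omega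
    have key : ∀ st'' : HS, st''.reg 8 = l1.length + 1 → st''.reg 12 = lst.length →
        Fr j lst st st'' → (∀ f k v, f ≠ aIA → f ≠ aIX → f ≠ aIC → f ≠ aACC → f ≠ aSIDE →
          st''.arr f k v = st'.arr f k v) →
        (∀ w, w ≠ v → st''.arr aIA j w = st'.arr aIA j w ∧ st''.arr aIX j w = st'.arr aIX j w ∧
          st''.arr aIC j w = st'.arr aIC j w ∧ st''.arr aSIDE 0 w = st'.arr aSIDE 0 w) →
        (∀ h, h ≠ hd v → st''.arr aACC 0 h = st'.arr aACC 0 h) →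
        st''.arr aACC 0 (hd v) = st'.arr aACC 0 (hd v) + (if ¬ sz (hd v) < 2 * sub v ∧
          T.parent v = cs (hd v) ∧ 4 * st'.arr aACC 0 (hd v) < sz (hd v) then sub v else 0) →
        (¬ hv v → T.parent v = cs (hd v) → st''.arr aSIDE 0 v =
          if 4 * st'.arr aACC 0 (hd v) < sz (hd v) then 1 else 0) →
        InfoAt T hd hv dn tp cs (st''.arr aIA j) (st''.arr aIX j) (st''.arr aIC j)
          (st''.arr aSIDE 0) v → Q st'' := by
      intro st'' h8' h12' hf' hS' hne hacc hz hsd hinfo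
      refine hQ st'' h8' h12' ⟨hf', fun f k w h1 h2 h3 h4 h5 => by
        rw [hS' f k w h1 h2 h3 h4 h5, hS f k w h1 h2 h3 h4 h5], fun w hw => ?_, fun w hw => ?_,
        fun h hhl => ?_⟩
      · simp only [List.mem_append, List.mem_singleton, not_or] at hw
        rw [(hne w hw.2).2.2.1, hIC w hw.1]
      · rcases List.mem_append.1 hw with hw' | hw
        · refine (hI w hw').congr ?_
          rintro x (rfl | rfl)
          · exact hne _ (by rintro rfl; exact hv1 ‹_›)
          · exact hne _ (htopo _ hw')
        · obtain rfl : w = v := by simpa using hw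
          exact hinfo
      · have hmap : ∀ h, (l1.map (fun v => if hd v = h ∧ ¬ sz h < 2 * sub v ∧
            T.parent v = cs h ∧ st''.arr aSIDE 0 v = 1 then sub v else 0)) =
            (l1.map (fun v => if hd v = h ∧ ¬ sz h < 2 * sub v ∧
            T.parent v = cs h ∧ st'.arr aSIDE 0 v = 1 then sub v else 0)) := by
          intro h
          refine List.map_congr_left fun w hw => ?_
          rw [(hne w (by rintro rfl; exact hv1 hw)).2.2.2]
        rw [List.map_append, List.sum_append, hmap]
        have hold : ∀ w ∈ l1, st''.arr aSIDE 0 w = st'.arr aSIDE 0 w := fun w hw =>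
          (hne w (by rintro rfl; exact hv1 hw)).2.2.2
        obtain ⟨g1, g2, g3⟩ := hG h hhl
        by_cases hx : h = hd v
        · subst hx
          by_cases hch : ¬ sz (hd v) < 2 * sub v ∧ T.parent v = cs (hd v) ∧ 4 * st'.arr aACC 0 (hd v) < sz (hd v)
          · have h1 := hsd (fun h => hch.1 ((hhv v).1 h)) hch.2.1
            rw [if_pos hch.2.2] at h1
            have h2 := hch.1
            rw [if_pos hch] at hz
            refine ⟨?_, by omega, fun h3 w hw h4 h5 h6 => ?_⟩
            · simp [h1, h2, hch.2.1, hz, g1]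
            · rcases List.mem_append.1 hw with hw | hw
              · rw [hold w hw]
                exact g3 hch.2.2 w hw h4 h5 h6
              · obtain rfl : w = v := by simpa using hw
                exact h1
          · rw [if_neg hch, add_zero] at hz
            rw [hz]
            refine ⟨?_, g2, fun h3 w hw h4 h5 h6 => ?_⟩
            · have : ¬ (hd v = hd v ∧ ¬ sz (hd v) < 2 * sub v ∧ T.parent v = cs (hd v) ∧
                  st''.arr aSIDE 0 v = 1) := by
                rintro ⟨_, h1, h2, h3⟩
                have h4 : ¬ hv v := fun h => h1 ((hhv v).1 h)
                rw [hsd h4 h2] at h3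
                exact hch ⟨h1, h2, by by_contra h5; simp [h5] at h3⟩
              rw [List.map_singleton, List.sum_singleton, if_neg this]
              exact g1
            · rcases List.mem_append.1 hw with hw | hw
              · rw [hold w hw]
                exact g3 h3 w hw h4 h5 h6
              · obtain rfl : w = v := by simpa using hw
                exact absurd ⟨fun h => h5 ((hhv _).2 h), h6, h3⟩ hch
        · rw [hacc h hx]
          refine ⟨?_, g2, fun h3 w hw h4 h5 h6 => ?_⟩
          · simp [Ne.symm hx, g1]
          · rcases List.mem_append.1 hw with hw | hw
            · rw [hold w hw]
              exact g3 h3 w hw h4 h5 h6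
            · obtain rfl : w = v := by simpa using hw
              exact absurd h4.symm hx
    simp only [infoBody, vc, Ex.rd0]
    by_cases hh : hv v
    · have hh' := (hhv v).1 hh
      simp +contextual [h8, hA, hP, hj, hvN, huN, hHD, hSUB, hSZ, hjL,
          hh', hlN, hlV, hhN, hz1]
      intros
      refine key _ (by simp) (by simp [h12]) ?_ ?_ ?_ ?_ ?_ ?_ ?_
      · repeat first | exact hf | refine Fr.set ?_ (by simp) | refine Fr.wr ?_ (by simp [Wr, hvl])
      · simp +contextual
      · intro w hw; simp [hw]
      · intro h hx; simp [hx]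
      · simp [hh']
      · exact fun h => absurd hh h
      · simp [InfoAt, hh, hICv]
    · have hh' : ¬ sz (hd v) < 2 * sub v := fun h => hh ((hhv v).2 h)
      have hpv := hroot v hvl hh
      have hz2 : 4 * st'.arr aACC 0 (hd v) < sz (hd v) →
          st'.arr aACC 0 (hd v) + sub v < e.V := by omega
      by_cases hin : hd (T.parent v) = hd v
      · have hul : T.parent v ∈ l1 := by
          have hul := hc.hd_parent hvl (by rw [hhd]; exact hin)
          rw [hl] at hul
          rcases List.mem_append.1 hul with h | h
          · exact h
          · rcases List.mem_cons.1 h with h | h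
            · exact absurd h hpv
            · exact absurd h hu2
        have hsu := (hI _ hul).2.2.2.2.2
        by_cases hcv : T.parent v = cs (hd v)
        · by_cases hlt : 4 * st'.arr aACC 0 (hd v) < sz (hd v)
          · have hz2' := hz2 hlt
            simp +contextual [h8, hA, hP, hj, hvN, huN, hHD, hSUB, hSZ, hCS, hjL,
              hh', hlN, hlV, hhN, hz1, hin, hcv.symm, hlt, hz2']
            intros
            refine key _ (by simp) (by simp [h12]) ?_ ?_ ?_ ?_ ?_ ?_ ?_
            · repeat first | exact hf | refine Fr.set ?_ (by simp) | refine Fr.wr ?_ (by simp [Wr, hvl])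
            · simp +contextual
            · intro w hw; simp [hw]
            · intro h hx; simp [hx]
            · simp [hh', hcv.symm, hlt]
            · simp [hlt]
            · simp [InfoAt, hh, hin, hpv, hcv.symm]
          · simp +contextual [h8, hA, hP, hj, hvN, huN, hHD, hSUB, hSZ, hCS, hjL,
              hh', hlN, hlV, hhN, hz1, hin, hcv.symm, hlt]
            intros
            refine key _ (by simp) (by simp [h12]) ?_ ?_ ?_ ?_ ?_ ?_ ?_
            · repeat first | exact hf | refine Fr.set ?_ (by simp) | refine Fr.wr ?_ (by simp [Wr, hvl])
            · simp +contextual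
            · intro w hw; simp [hw]
            · intro h hx; simp [hx]
            · simp [hh', hcv.symm, hlt]
            · simp [hlt]
            · simp [InfoAt, hh, hin, hpv, hcv.symm]
        · simp +contextual [h8, hA, hP, hj, hvN, huN, hHD, hSUB, hSZ, hCS, hjL,
            hh', hlN, hlV, hhN, hz1, hin, hcv]
          intros
          refine key _ (by simp) (by simp [h12]) ?_ ?_ ?_ ?_ ?_ ?_ ?_
          · repeat first | exact hf | refine Fr.set ?_ (by simp) | refine Fr.wr ?_ (by simp [Wr, hvl])
          · simp +contextual
          · intro w hw; simp [hw]
          · intro h hx; simp [hx]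
          · simp [hcv]
          · exact fun _ h => absurd h hcv
          · simp [InfoAt, hh, hin, hpv, hcv, hsu]
      · by_cases hcv : T.parent v = cs (hd v)
        · by_cases hlt : 4 * st'.arr aACC 0 (hd v) < sz (hd v)
          · have hz2' := hz2 hlt
            simp +contextual [h8, hA, hP, hj, hvN, huN, hHD, hSUB, hSZ, hTP, hCS, hjL,
              hh', hlN, hlV, hhN, hz1, hin, hcv.symm, hlt, hz2']
            intros
            refine key _ (by simp) (by simp [h12]) ?_ ?_ ?_ ?_ ?_ ?_ ?_
            · repeat first | exact hf | refine Fr.set ?_ (by simp) | refine Fr.wr ?_ (by simp [Wr, hvl])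
            · simp +contextual
            · intro w hw; simp [hw]
            · intro h hx; simp [hx]
            · simp [hh', hcv.symm, hlt]
            · simp [hlt]
            · simp [InfoAt, hh, hin, hpv, hcv.symm]
          · simp +contextual [h8, hA, hP, hj, hvN, huN, hHD, hSUB, hSZ, hTP, hCS, hjL,
              hh', hlN, hlV, hhN, hz1, hin, hcv.symm, hlt]
            intros
            refine key _ (by simp) (by simp [h12]) ?_ ?_ ?_ ?_ ?_ ?_ ?_
            · repeat first | exact hf | refine Fr.set ?_ (by simp) | refine Fr.wr ?_ (by simp [Wr, hvl])
            · simp +contextual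
            · intro w hw; simp [hw]
            · intro h hx; simp [hx]
            · simp [hh', hcv.symm, hlt]
            · simp [hlt]
            · simp [InfoAt, hh, hin, hpv, hcv.symm]
        · simp +contextual [h8, hA, hP, hj, hvN, huN, hHD, hSUB, hSZ, hTP, hCS, hjL,
            hh', hlN, hlV, hhN, hz1, hin, hcv]
          intros
          refine key _ (by simp) (by simp [h12]) ?_ ?_ ?_ ?_ ?_ ?_ ?_
          · repeat first | exact hf | refine Fr.set ?_ (by simp) | refine Fr.wr ?_ (by simp [Wr, hvl])
          · simp +contextual
          · intro w hw; simp [hw]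
          · intro h hx; simp [hx]
          · simp [hcv]
          · exact fun _ h => absurd h hcv
          · simp [InfoAt, hh, hin, hpv, hcv]

/-! ### Linking the two halves of the nodes -/

/-- The members of `l` are linked: `h` is the first one, `sz h` the number, `ls h` the last one, and
`nx` maps every other member to its predecessor. -/
structure Linked (l : List ℕ) (h : ℕ) (sz ls nx : ℕ → ℕ) : Prop where
  head : l.head? = some h
  size : sz h = l.length
  last : l.getLast? = some (ls h)
  chain : l.IsChain (fun a b => nx b = a)

namespace Linked

variable {l : List ℕ} {g v : ℕ} {sz ls nx sz' ls' nx' : ℕ → ℕ}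

theorem single (h1 : sz v = 1) (h2 : ls v = v) : Linked [v] v sz ls nx :=
  ⟨rfl, by simpa using h1, by simp [h2], by simp⟩

theorem congr (h : Linked l g sz ls nx) (h1 : sz' g = sz g) (h2 : ls' g = ls g)
    (h3 : ∀ w ∈ l, nx' w = nx w) : Linked l g sz' ls' nx' where
  head := h.head
  size := h1.trans h.size
  last := by rw [h2]; exact h.last
  chain := by
    refine h.chain.imp_of_mem_imp fun a b _ hb hab => ?_
    rw [h3 b hb, hab]

theorem mem (h : Linked l g sz ls nx) : g ∈ l := List.mem_of_head? h.head

theorem snoc (h : Linked l g sz ls nx) (hv : v ∉ l) (h1 : sz' g = sz g + 1) (h2 : ls' g = v)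
    (h3 : nx' v = ls g) (h4 : ∀ w ≠ v, nx' w = nx w) : Linked (l ++ [v]) g sz' ls' nx' where
  head := by simp [h.head]
  size := by simp [h1, h.size]
  last := by simp [h2]
  chain := by
    rw [List.isChain_append]
    refine ⟨?_, by simp, ?_⟩
    · refine h.chain.imp_of_mem_imp fun a b _ hb hab => ?_
      rw [h4 b (by rintro rfl; exact hv hb), hab]
    · intro x hx y hy
      have hx' : ls g = x := by simpa [h.last] using hx
      have hy' : v = y := by simpa using hy
      rw [← hx', ← hy', h3]

end Linked

/-- The group of the members of `l` with `f w = h` and `s w = d`; its head plus one is `fh`. -/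
def Group (f s : ℕ → ℕ) (l : List ℕ) (h d fh : ℕ) (sz ls nx : ℕ → ℕ) : Prop :=
  (fh = 0 ∧ l.filter (fun w => f w = h ∧ s w = d) = []) ∨
    ∃ g, fh = g + 1 ∧ Linked (l.filter (fun w => f w = h ∧ s w = d)) g sz ls nx

-- The head of a group is its first vertex in the list and never changes, so the heads assigned to
-- earlier vertices remain valid when the group is extended at the end.
set_option maxHeartbeats 1000000 in
theorem link_wp {e : Env} (he : e.Ok) {T : IncTree} {lst : List ℕ} {j : ℕ} {st : HS}
    (hc : LCtx e T lst j st) (h12 : st.reg 12 = lst.length) (hLV : e.L < e.V)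
    {hd sd pp : ℕ → ℕ} (hhd : st.arr aHD j = hd) (hsd : st.arr aSIDE 0 = sd)
    (hpp : st.arr aPP j = pp) (hppV : ∀ v ∈ lst, 3 * pp v + 2 < e.V) (hsd1 : ∀ v ∈ lst, sd v ≤ 1)
    (hfh : ∀ v ∈ lst, st.arr aFH 0 v = 0 ∧ st.arr aFH 1 v = 0) :
    WP e (forward linkBody) ((lst.length + 1) * (blkCost linkBody + 10)) st (fun st' =>
      (Fr j lst st st' ∧ (∀ f k v, f ≠ aPP → f ≠ aCR → f ≠ aFH → f ≠ aSZ → f ≠ aNX → f ≠ aLS →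
          f ≠ aHD → st'.arr f k v = st.arr f k v) ∧
        (∀ v ∈ lst, st'.arr aPP (j + 1) v = 3 * pp v + 2 * sd v ∧ st'.arr aCR (j + 1) v = 0 ∧
          st'.arr aHD (j + 1) v + 1 = st'.arr aFH (sd v) (hd v)) ∧
        ∀ h ∈ lst, ∀ d ≤ 1, Group hd sd lst h d (st'.arr aFH d h) (st'.arr aSZ (j + 1))
          (st'.arr aLS (j + 1)) (st'.arr aNX (j + 1))) ∧ st'.reg 12 = lst.length) := by
  refine fwd_wp' he lst (fun l1 st' =>
      (Fr j lst st st' ∧ (∀ f k v, f ≠ aPP → f ≠ aCR → f ≠ aFH → f ≠ aSZ → f ≠ aNX → f ≠ aLS →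
          f ≠ aHD → st'.arr f k v = st.arr f k v) ∧
        (∀ v ∈ l1, st'.arr aPP (j + 1) v = 3 * pp v + 2 * sd v ∧ st'.arr aCR (j + 1) v = 0 ∧
          st'.arr aHD (j + 1) v + 1 = st'.arr aFH (sd v) (hd v)) ∧
        ∀ h ∈ lst, ∀ d ≤ 1, Group hd sd l1 h d (st'.arr aFH d h) (st'.arr aSZ (j + 1))
          (st'.arr aLS (j + 1)) (st'.arr aNX (j + 1)))) rfl ?_ ?_ h12
      ⟨Fr.refl, fun _ _ _ _ _ _ _ _ _ _ => rfl, by simp, fun h hh d hd => Or.inl ⟨?_, rfl⟩⟩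
  · rintro st' x ⟨h1, h2, h3⟩
    exact ⟨h1.set (by simp), h2, h3⟩
  swap
  · obtain rfl | rfl : d = 0 ∨ d = 1 := by omega
    · exact (hfh h hh).1
    · exact (hfh h hh).2
  · rintro l1 v l2 st' Q hl h8 h12 ⟨hf, hS, hI, hG⟩ hQ
    have hc' := hc.of_fr hf
    have hvl : v ∈ lst := by simp [hl]
    have hvN := hc.lt v hvl
    have hA := hc'.arr_at hl
    have hj := hc'.regJ
    have hlen := hc'.idx_lt hl
    have hL := hc.level
    have hN := hc.N_lt
    have hjL : j ≤ e.L := by omega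
    have hlN : l1.length < e.N := by omega
    have hlV : l1.length + 1 < e.V := by omega
    have hvV : v + 1 < e.V := by omega
    have hHD : ∀ w, st'.arr aHD j w = hd w := fun w => by
      rw [hf.arr _ (by norm_num) _ _ (by simp [Wr]), hhd]
    have hPP : ∀ w, st'.arr aPP j w = pp w := fun w => by
      rw [hf.arr _ (by norm_num) _ _ (by simp [Wr]), hpp]
    have hSD : ∀ w, st'.arr aSIDE 0 w = sd w := fun w => by
      rw [hS _ _ _ (by norm_num) (by norm_num) (by norm_num) (by norm_num) (by norm_num)
        (by norm_num) (by norm_num), hsd]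
    have hhm : hd v ∈ lst := hhd ▸ hc.hd_mem v hvl
    have hhN := hc.lt _ hhm
    obtain ⟨hu2, hv1, hv2, hl12⟩ := hc.parent_split hl
    have hsv := hsd1 v hvl
    have hsL : sd v ≤ e.L := by omega
    have hppv : 3 * pp v + 2 * sd v < e.V := by have := hppV v hvl; omega
    have key : ∀ (st'' : HS) (g : ℕ), st''.reg 8 = l1.length + 1 → st''.reg 12 = lst.length →
        Fr j lst st st'' → (∀ f k v, f ≠ aPP → f ≠ aCR → f ≠ aFH → f ≠ aSZ → f ≠ aNX → f ≠ aLS →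
          f ≠ aHD → st''.arr f k v = st'.arr f k v) →
        (st''.arr aPP (j + 1) v = 3 * pp v + 2 * sd v ∧ st''.arr aCR (j + 1) v = 0 ∧
          st''.arr aHD (j + 1) v = g) →
        (∀ w ≠ v, st''.arr aPP (j + 1) w = st'.arr aPP (j + 1) w ∧
          st''.arr aCR (j + 1) w = st'.arr aCR (j + 1) w ∧
          st''.arr aHD (j + 1) w = st'.arr aHD (j + 1) w ∧
          st''.arr aNX (j + 1) w = st'.arr aNX (j + 1) w) →
        (∀ w ≠ g, st''.arr aSZ (j + 1) w = st'.arr aSZ (j + 1) w ∧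
          st''.arr aLS (j + 1) w = st'.arr aLS (j + 1) w) →
        (st''.arr aFH (sd v) (hd v) = g + 1 ∧ ∀ h d, ¬ (d = sd v ∧ h = hd v) →
          st''.arr aFH d h = st'.arr aFH d h) →
        st''.arr aLS (j + 1) g = v →
        (st'.arr aFH (sd v) (hd v) = 0 ∧ g = v ∧ st''.arr aSZ (j + 1) v = 1 ∨
          st'.arr aFH (sd v) (hd v) = g + 1 ∧
            st''.arr aSZ (j + 1) g = st'.arr aSZ (j + 1) g + 1 ∧
            st''.arr aNX (j + 1) v = st'.arr aLS (j + 1) g) → Q st'' := by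
      intro st'' g h8' h12' hf' hS' hw hne hneg hfh' hls hcase
      have hgv := hG _ hhm (sd v) hsv
      refine hQ st'' h8' h12' ⟨hf', fun f k w h1 h2 h3 h4 h5 h6 h7 => by
        rw [hS' f k w h1 h2 h3 h4 h5 h6 h7, hS f k w h1 h2 h3 h4 h5 h6 h7], fun w hw' => ?_,
        fun h hhl d hd1 => ?_⟩
      · by_cases hwv : w = v
        · subst hwv
          exact ⟨hw.1, hw.2.1, by rw [hw.2.2, hfh'.1]⟩
        · have hw1 : w ∈ l1 := by simpa [hwv] using hw'
          obtain ⟨a1, a2, a3, _⟩ := hne w hwv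
          rw [a1, a2, a3]
          refine ⟨(hI w hw1).1, (hI w hw1).2.1, ?_⟩
          rw [(hI w hw1).2.2]
          by_cases hg : sd w = sd v ∧ hd w = hd v
          · rw [hg.1, hg.2, hfh'.1]
            rcases hcase with ⟨h0, _, _⟩ | ⟨h0, _⟩
            · rcases hgv with ⟨_, h1⟩ | ⟨g', h1, _⟩
              · have : w ∈ l1.filter (fun w => hd w = hd v ∧ sd w = sd v) := by
                  simp [hw1, hg.1, hg.2]
                rw [h1] at this
                simp at this
              · omega
            · rw [h0]
          · rw [hfh'.2 _ _ hg]
      · unfold Group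
        rw [List.filter_append]
        by_cases hg : d = sd v ∧ h = hd v
        · obtain ⟨rfl, rfl⟩ := hg
          right
          refine ⟨g, hfh'.1, ?_⟩
          have hs1 : List.filter (fun w => decide (hd w = hd v ∧ sd w = sd v)) [v] = [v] := by simp
          rw [hs1]
          rcases hcase with ⟨h0, rfl, h2⟩ | ⟨h0, h2, h3⟩
          · rcases hgv with ⟨_, h1⟩ | ⟨g', h1, _⟩
            · rw [h1]
              exact Linked.single h2 hls
            · omega
          · rcases hgv with ⟨h1, _⟩ | ⟨g', h1, h4⟩
            · omega
            · obtain rfl : g = g' := by omega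
              exact h4.snoc (by simp [hv1]) h2 hls h3 fun w hw' => (hne w hw').2.2.2
        · have hs1 : List.filter (fun w => decide (hd w = h ∧ sd w = d)) [v] = [] := by
            simp only [List.filter_eq_nil_iff, List.mem_singleton, forall_eq, decide_eq_true_eq]
            exact fun h1 => hg ⟨h1.2.symm, h1.1.symm⟩
          rw [hs1, List.append_nil, hfh'.2 _ _ hg]
          rcases hG h hhl d hd1 with ⟨h1, h2⟩ | ⟨g', h1, h2⟩
          · exact Or.inl ⟨h1, h2⟩
          · refine Or.inr ⟨g', h1, ?_⟩
            have hm := h2.mem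
            simp only [List.mem_filter, decide_eq_true_eq] at hm
            -- A head belongs to its own group, so different groups have different heads, and an
            -- update at one head leaves the other groups alone.
            have hgg : g' ≠ g := by
              rintro rfl
              rcases hcase with ⟨_, rfl, _⟩ | ⟨h0, _⟩
              · exact hv1 hm.1
              · rcases hgv with ⟨h3, _⟩ | ⟨g'', h3, h4⟩
                · omega
                · obtain rfl : g' = g'' := by omega
                  have hm' := h4.mem
                  simp only [List.mem_filter, decide_eq_true_eq] at hm'
                  exact hg ⟨hm.2.2.symm.trans hm'.2.2, hm.2.1.symm.trans hm'.2.1⟩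
            refine h2.congr (hneg _ hgg).1 (hneg _ hgg).2 fun w hw' => (hne w ?_).2.2.2
            rintro rfl
            exact hv1 (List.mem_filter.1 hw').1
    have hj1 : j + 1 < e.V := by omega
    have h1V : 1 < e.V := by omega
    simp only [linkBody, vc, Ex.rd0]
    rcases hG _ hhm (sd v) hsv with ⟨h0, hnil⟩ | ⟨g, h0, hlk⟩
    · simp +contextual [h8, hA, hj, hvN, hHD, hSD, hPP, hjL, hlN, hlV, hhN, hsL, hppv, hL,
        h0, hvV, hj1, h1V]
      intros
      refine key _ v (by simp) (by simp [h12]) ?_ ?_ ?_ ?_ ?_ ?_ ?_ ?_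
      · repeat first | exact hf | refine Fr.set ?_ (by simp) | refine Fr.wr ?_ (by simp [Wr, hvl])
      · simp +contextual
      · simp
      · simp +contextual
      · simp +contextual
      · simp +contextual
      · simp
      · simp [h0]
    · have hm := hlk.mem
      simp only [List.mem_filter, decide_eq_true_eq] at hm
      have hgl : g ∈ lst := by simp [hl, hm.1]
      have hgN := hc.lt g hgl
      have hgv : v ≠ g := by rintro rfl; exact hv1 hm.1
      have hsz := hlk.size
      have hszV : st'.arr aSZ (j + 1) g + 1 < e.V := by
        have := List.length_filter_le (fun w => decide (hd w = hd v ∧ sd w = sd v)) l1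
        omega
      simp +contextual [h8, hA, hj, hvN, hHD, hSD, hPP, hjL, hlN, hlV, hhN, hsL, hppv, hL,
        h0, hvV, hj1, hgN, hszV]
      intros
      refine key _ g (by simp) (by simp [h12]) ?_ ?_ ?_ ?_ ?_ ?_ ?_ ?_
      · repeat first | exact hf | refine Fr.set ?_ (by simp) | refine Fr.wr ?_ (by simp [Wr, hvl, hgl])
      · simp +contextual
      · simp
      · simp +contextual
      · simp +contextual
      · simp +contextual [h0]
      · simp
      · simp [h0]

/-! ### The levels of the decomposition -/

open IncTree

/-- The vertices in `o` form nodes of level `k` of the decomposition. -/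
structure LvlOn (T : IncTree) (o : List ℕ) (k : ℕ) (st : HS) : Prop where
  hd_mem : ∀ v ∈ o, st.arr aHD k v ∈ o
  hd_hd : ∀ v ∈ o, st.arr aHD k (st.arr aHD k v) = st.arr aHD k v
  code : ∀ v ∈ o, ∀ w ∈ o, st.arr aHD k v = st.arr aHD k w ↔ st.arr aPP k v = st.arr aPP k w
  code_lt : ∀ v ∈ o, st.arr aPP k v < 3 ^ k
  -- The parent of the head plays the role of the vertex `t` of the cluster.
  top : ∀ v ∈ o, (T.parent v ∈ o ∧ st.arr aHD k (T.parent v) = st.arr aHD k v) ∨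
    T.parent v = T.parent (st.arr aHD k v)
  node : ∀ v ∈ o, Linked (o.filter (fun w => st.arr aHD k w = st.arr aHD k v)) (st.arr aHD k v)
    (st.arr aSZ k) (st.arr aLS k) (st.arr aNX k)

/-- The nodes of level `k` formed by the vertices in `o` are split. -/
structure SplitOn (T : IncTree) (o : List ℕ) (k : ℕ) (st : HS) : Prop where
  digit : ∀ v ∈ o, st.arr aPP (k + 1) v = 3 * st.arr aPP k v ∨
    st.arr aPP (k + 1) v = 3 * st.arr aPP k v + 2
  sep : ∀ h ∈ o, ∃ c ∈ T.verts, ∀ v ∈ o, st.arr aHD k v = h →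
    T.IsCa v c (st.arr aIA k v) (st.arr aIX k v) (st.arr aIC k v) ∧
    (st.arr aPP (k + 1) v = 3 * st.arr aPP k v + 2 → st.arr aIA k v = c ∧ v ≠ c ∧
      -- The vertices on different sides enter different branches; this is the hypothesis `hne` of
      -- `Ordered.isCa_join`.
      ∀ w ∈ o, st.arr aHD k w = h → st.arr aPP (k + 1) w = 3 * st.arr aPP k w →
        st.arr aIX k v ≠ st.arr aIX k w)
  bal : ∀ v ∈ o, st.arr aSZ k (st.arr aHD k v) = 1 ∨
    -- The counter absorbs insertions: if a leaf joins both the node and its half, the left side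
    -- grows by `4`, the right side by `3 + 1`.
    4 * st.arr aSZ (k + 1) (st.arr aHD (k + 1) v) ≤
      3 * st.arr aSZ k (st.arr aHD k v) + st.arr aCR k (st.arr aHD k v)

theorem LvlOn.congr {T : IncTree} {o : List ℕ} {k : ℕ} {st st' : HS} (h : LvlOn T o k st)
    (hs : ∀ f ∈ [aHD, aNX, aLS, aSZ, aPP], ∀ v ∈ o, st'.arr f k v = st.arr f k v) :
    LvlOn T o k st' := by
  have hHD : ∀ v ∈ o, st'.arr aHD k v = st.arr aHD k v := hs _ (by simp)
  have hPP : ∀ v ∈ o, st'.arr aPP k v = st.arr aPP k v := hs _ (by simp)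
  refine ⟨fun v hv => ?_, fun v hv => ?_, fun v hv w hw => ?_, fun v hv => ?_, fun v hv => ?_,
    fun v hv => ?_⟩
  · rw [hHD v hv]; exact h.hd_mem v hv
  · rw [hHD v hv, hHD _ (h.hd_mem v hv)]; exact h.hd_hd v hv
  · rw [hHD v hv, hHD w hw, hPP v hv, hPP w hw]; exact h.code v hv w hw
  · rw [hPP v hv]; exact h.code_lt v hv
  · rw [hHD v hv]
    refine (h.top v hv).imp_left fun h1 => ⟨h1.1, ?_⟩
    rw [hHD _ h1.1]; exact h1.2
  · rw [hHD v hv]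
    have : o.filter (fun w => st'.arr aHD k w = st.arr aHD k v) =
        o.filter (fun w => st.arr aHD k w = st.arr aHD k v) :=
      List.filter_congr fun w hw => by rw [hHD w hw]
    rw [this]
    exact (h.node v hv).congr (hs _ (by simp) _ (h.hd_mem v hv))
      (hs _ (by simp) _ (h.hd_mem v hv))
      fun w hw => hs _ (by simp) _ (List.mem_filter.1 hw).1

theorem SplitOn.congr {T : IncTree} {o : List ℕ} {k : ℕ} {st st' : HS} (h : SplitOn T o k st)
    (hl : LvlOn T o k st) (hl' : ∀ v ∈ o, st.arr aHD (k + 1) v ∈ o)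
    (hs : ∀ f ∈ [aHD, aSZ, aPP, aCR, aIA, aIX, aIC], ∀ v ∈ o, st'.arr f k v = st.arr f k v)
    (hs' : ∀ f ∈ [aHD, aSZ, aPP], ∀ v ∈ o, st'.arr f (k + 1) v = st.arr f (k + 1) v) :
    SplitOn T o k st' := by
  have hHD : ∀ v ∈ o, st'.arr aHD k v = st.arr aHD k v := hs _ (by simp)
  have hPP : ∀ v ∈ o, st'.arr aPP k v = st.arr aPP k v := hs _ (by simp)
  have hPP' : ∀ v ∈ o, st'.arr aPP (k + 1) v = st.arr aPP (k + 1) v := hs' _ (by simp)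
  refine ⟨fun v hv => ?_, fun r hr => ?_, fun v hv => ?_⟩
  · rw [hPP v hv, hPP' v hv]; exact h.digit v hv
  · obtain ⟨c, hc, hv⟩ := h.sep r hr
    refine ⟨c, hc, fun v hvo hvr => ?_⟩
    rw [hHD v hvo] at hvr
    obtain ⟨h1, h2⟩ := hv v hvo hvr
    rw [hs aIA (by simp) v hvo, hs aIX (by simp) v hvo, hs aIC (by simp) v hvo, hPP v hvo,
      hPP' v hvo]
    refine ⟨h1, fun h3 => ⟨(h2 h3).1, (h2 h3).2.1, fun w hw hwr h4 => ?_⟩⟩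
    rw [hs aIX (by simp) w hw]
    rw [hHD w hw] at hwr
    rw [hPP w hw, hPP' w hw] at h4
    exact (h2 h3).2.2 w hw hwr h4
  · rw [hHD v hv, hs aSZ (by simp) _ (hl.hd_mem v hv), hs aCR (by simp) _ (hl.hd_mem v hv),
      hs' aHD (by simp) v hv, hs' aSZ (by simp) _ (hl' v hv)]
    exact h.bal v hv

theorem head_idx_le {ord l : List ℕ} (ho : ord.Nodup) (hl : l.Sublist ord) {g u : ℕ}
    (hg : l.head? = some g) (hu : u ∈ l) : ord.idxOf g ≤ ord.idxOf u := by
  have h1 : ord.Pairwise (fun a b => ord.idxOf a < ord.idxOf b) := by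
    rw [List.pairwise_iff_getElem]
    intro i j hi hj hij
    rw [ho.idxOf_getElem, ho.idxOf_getElem]
    exact hij
  have h2 := h1.sublist hl
  cases l with
  | nil => simp at hg
  | cons a l =>
    obtain rfl : a = g := by simpa using hg
    rcases List.mem_cons.1 hu with rfl | hu
    · exact le_rfl
    · exact ((List.pairwise_cons.1 h2).1 u hu).le

/-- The set of the members of a node. -/
def nodeSet (o : List ℕ) (hd : ℕ → ℕ) (h : ℕ) : Finset ℕ := (o.filter (fun w => hd w = h)).toFinset

theorem mem_nodeSet {o : List ℕ} {hd : ℕ → ℕ} {h v : ℕ} :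
    v ∈ nodeSet o hd h ↔ v ∈ o ∧ hd v = h := by
  simp [nodeSet]

section
variable {T : IncTree} {ord o : List ℕ} {k : ℕ} {st : HS}

/-- The head comes first among the members in a topological order, so no member can be an ancestor
of the parent of the head, unless the head is the root. -/
theorem LvlOn.cluster (hl : LvlOn T o k st) (hT : T.Ordered ord) (hs : o.Sublist ord) {h : ℕ}
    (hh : h ∈ o) (hhd : st.arr aHD k h = h) :
    T.Cluster (nodeSet o (st.arr aHD k) h) (T.parent h) := by
  have hv : ∀ v ∈ o, v ∈ T.verts := fun v hv => (hT.mem v).1 (hs.subset hv)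
  have hn := hl.node h hh
  rw [hhd] at hn
  have hfirst : ∀ w ∈ o, st.arr aHD k w = h → ord.idxOf h ≤ ord.idxOf w := fun w hw hwh =>
    head_idx_le hT.nodup (List.filter_sublist.trans hs) hn.head (by simp [hw, hwh])
  refine ⟨fun v h1 => hv v (mem_nodeSet.1 h1).1, hT.parent_mem _ (hv h hh), fun v h1 => ?_, ?_⟩
  · rw [mem_nodeSet] at h1 ⊢
    rw [← h1.2]
    exact (hl.top v h1.1).imp_left fun h2 => ⟨h2.1, h2.2⟩
  · by_cases hr : h = T.root
    · right
      rw [hr, hT.parent_root, ← hr]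
      exact ⟨mem_nodeSet.2 ⟨hh, hhd⟩, mem_nodeSet.2 ⟨hh, hhd⟩⟩
    · left
      have h1 := hT.idx_parent (hv h hh) hr
      refine ⟨fun h2 => ?_, fun v h2 h3 => ?_⟩
      · rw [mem_nodeSet] at h2
        have := hfirst _ h2.1 h2.2
        omega
      · rw [mem_nodeSet] at h2
        have := hfirst _ h2.1 h2.2
        rcases hT.idx_anc h3 with rfl | h4 <;> omega

theorem LvlOn.card (hl : LvlOn T o k st) (ho : o.Nodup) {h : ℕ}
    (hh : h ∈ o) (hhd : st.arr aHD k h = h) :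
    (nodeSet o (st.arr aHD k) h).card = st.arr aSZ k h := by
  have hn := hl.node h hh
  rw [hhd] at hn
  rw [hn.size, nodeSet, List.toFinset_card_of_nodup (ho.filter _)]

theorem sum_nodeSet (ho : o.Nodup) {hd : ℕ → ℕ} {h : ℕ} {f : ℕ → ℕ} {p : ℕ → Prop}
    [DecidablePred p] : ∑ v ∈ nodeSet o hd h with p v, f v =
      (o.map (fun v => if hd v = h ∧ p v then f v else 0)).sum := by
  rw [← List.sum_toFinset _ ho, nodeSet, Finset.sum_filter, List.toFinset_filter,
    Finset.sum_filter]
  refine Finset.sum_congr rfl fun v _ => ?_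
  by_cases h1 : hd v = h <;> by_cases h2 : p v <;> simp [h1, h2]

theorem root_heavy_of_sized {K : Finset ℕ} {t : ℕ} {sub : ℕ → ℕ} (hK : T.Cluster K t)
    (h : T.Ordered ord) (hs : Sized T K sub) (hr : T.root ∈ K) : K.card < 2 * sub T.root := by
  have h1 := hK.sub_eq h hs hr K fun w =>
    ⟨fun hw => ⟨hw, h.root_anc w (hK.verts w hw)⟩, fun hw => hw.1⟩
  have : 0 < K.card := Finset.card_pos.2 ⟨_, hr⟩
  omega

theorem LvlOn.sized (ho : o.Nodup) {sub hd : ℕ → ℕ}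
    (hsub : ∀ v ∈ o, sub v = 1 + chSum T hd sub v o) (h : ℕ) :
    Sized T (nodeSet o hd h) sub := by
  intro v hv
  obtain ⟨hvo, rfl⟩ := mem_nodeSet.1 hv
  rw [hsub v hvo, sum_nodeSet ho, chSum]
  congr 2
  refine List.map_congr_left fun u hu => ?_
  congr 1
  simp only [Ch, eq_iff_iff]
  tauto

/-- The passes test membership in a node by comparing heads. Translated to the set of the members of
one node, their results are precisely the data of a split. -/
theorem LvlOn.splitData (hl : LvlOn T o k st) (ho : o.Nodup) {hd sz sub dn tp cs ia ix ic sd : ℕ → ℕ}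
    (hhd : st.arr aHD k = hd) (hsz : st.arr aSZ k = sz)
    (hin : ∀ v ∈ o, hd (T.parent v) = hd v → T.parent v ∈ o)
    (hsub : ∀ v ∈ o, sub v = 1 + chSum T hd sub v o)
    {hv : ℕ → Prop} (hhv : ∀ v, hv v ↔ sz (hd v) < 2 * sub v)
    (hdn : ∀ v ∈ o, (∃ u ∈ o, Ch T hd u v ∧ hv u ∧ dn v = u) ∨
      ((∀ u ∈ o, Ch T hd u v → ¬ hv u) ∧ dn v = v))
    (htp : ∀ h ∈ o, (∃ v ∈ o, hd v = h ∧ hv v ∧ ¬ Ch T hd v (T.parent v) ∧ tp h = v) ∨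
      ((∀ v ∈ o, hd v = h → hv v → Ch T hd v (T.parent v)) ∧ tp h = T.parent h))
    (hcs : ∀ h ∈ o, (∃ v ∈ o, hd v = h ∧ hv v ∧ dn v = v ∧ cs h = v) ∨
      ((∀ v ∈ o, hd v = h → hv v → dn v ≠ v) ∧ cs h = T.parent h))
    (hinfo : ∀ v ∈ o, InfoAt T hd hv dn tp cs ia ix ic sd v)
    {acc : ℕ → ℕ}
    (hacc : ∀ h ∈ o, acc h = (o.map (fun v => if hd v = h ∧ ¬ sz h < 2 * sub v ∧
        T.parent v = cs h ∧ sd v = 1 then sub v else 0)).sum ∧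
      4 * acc h ≤ 3 * sz h ∧
      (4 * acc h < sz h → ∀ v ∈ o, hd v = h → ¬ hv v → T.parent v = cs h → sd v = 1))
    {h : ℕ} (hh : h ∈ o) (hhh : hd h = h) :
    SplitData T (nodeSet o hd h) (T.parent h) sub (cs h) (tp h) dn ia ix ic sd := by
  have hcard : (nodeSet o hd h).card = sz h := by
    rw [← hhd, ← hsz]; exact hl.card ho hh (hhd ▸ hhh)
  have hhv' : ∀ v ∈ nodeSet o hd h, (nodeSet o hd h).card < 2 * sub v ↔ hv v := by
    intro v hvm
    rw [hhv, hcard, (mem_nodeSet.1 hvm).2]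
  have hch : ∀ u ∈ o, ∀ v ∈ nodeSet o hd h, Ch T hd u v ↔
      u ∈ nodeSet o hd h ∧ T.parent u = v ∧ u ≠ v := by
    intro u hu v hvm
    rw [mem_nodeSet] at hvm ⊢
    rw [← hvm.2, Ch]
    tauto
  have hpar : ∀ v ∈ nodeSet o hd h, T.parent v ∈ nodeSet o hd h ↔ hd (T.parent v) = hd v := by
    intro v hvm
    have h1 := mem_nodeSet.1 hvm
    rw [mem_nodeSet, h1.2]
    exact ⟨fun h2 => h2.2, fun h2 => ⟨hin v h1.1 (h2.trans h1.2.symm), h2⟩⟩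
  have hchp : ∀ v ∈ nodeSet o hd h, Ch T hd v (T.parent v) ↔
      T.parent v ∈ nodeSet o hd h ∧ T.parent v ≠ v := by
    intro v hvm
    rw [hpar v hvm, Ch]
    constructor
    · exact fun h1 => ⟨h1.2.2.symm, h1.2.1.symm⟩
    · exact fun h1 => ⟨rfl, h1.2.symm, h1.1.symm⟩
  have hmo : ∀ v ∈ nodeSet o hd h, v ∈ o ∧ hd v = h := fun v => mem_nodeSet.1
  have hsum : ∑ v ∈ nodeSet o hd h with ¬ (nodeSet o hd h).card < 2 * sub v ∧ T.parent v = cs h ∧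
      sd v = 1, sub v = acc h := by
    rw [sum_nodeSet ho, (hacc h hh).1, hcard]
  constructor
  · exact LvlOn.sized ho hsub h
  · rcases hcs h hh with ⟨v, h1, h2, h3, h4, h5⟩ | ⟨h1, h2⟩
    · left
      have hvm : v ∈ nodeSet o hd h := mem_nodeSet.2 ⟨h1, h2⟩
      rw [h5]
      refine ⟨hvm, (hhv' v hvm).2 h3, fun u hu hp hne => ?_⟩
      rw [hhv' u hu]
      rcases hdn v h1 with ⟨w, h6, h7, _, h8⟩ | ⟨h6, _⟩
      · exact absurd (h8.symm.trans h4) h7.2.1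
      · exact h6 u (hmo u hu).1 ((hch u (hmo u hu).1 v hvm).2 ⟨hu, hp, hne⟩)
    · right
      refine ⟨h2, fun v hvm hvh => ?_⟩
      rw [hhv' v hvm] at hvh
      rcases hdn v (hmo v hvm).1 with ⟨w, h6, h7, h8, _⟩ | ⟨_, h6⟩
      · have h9 := (hch w h6 v hvm).1 h7
        exact ⟨w, h9.1, h9.2.1, h9.2.2, (hhv' w h9.1).2 h8⟩
      · exact absurd h6 (h1 v (hmo v hvm).1 (hmo v hvm).2 hvh)
  · intro v hvm _
    rcases hdn v (hmo v hvm).1 with ⟨w, h6, h7, h8, h9⟩ | ⟨h5, h6⟩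
    · have h10 := (hch w h6 v hvm).1 h7
      exact Or.inl ⟨w, h10.1, h10.2.1, h10.2.2, (hhv' w h10.1).2 h8, h9⟩
    · refine Or.inr ⟨fun u hu hp hne => ?_, h6⟩
      rw [hhv' u hu]
      exact h5 u (hmo u hu).1 ((hch u (hmo u hu).1 v hvm).2 ⟨hu, hp, hne⟩)
  · rcases htp h hh with ⟨v, h1, h2, h3, h4, h5⟩ | ⟨h1, h2⟩
    · have hvm : v ∈ nodeSet o hd h := mem_nodeSet.2 ⟨h1, h2⟩
      exact Or.inl ⟨v, hvm, (hhv' v hvm).2 h3, fun h6 => h4 ((hchp v hvm).2 h6), h5⟩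
    · refine Or.inr ⟨fun v hvm hvh => ?_, h2⟩
      exact (hchp v hvm).1 (h1 v (hmo v hvm).1 (hmo v hvm).2 ((hhv' v hvm).1 hvh))
  · intro v hvm hvh
    have h1 := (hinfo v (hmo v hvm).1).1 ((hhv' v hvm).1 hvh)
    exact ⟨h1.1, h1.2.1, h1.2.2.1⟩
  · intro v hvm hvh hp
    rw [hhv' v hvm] at hvh
    exact (hinfo v (hmo v hvm).1).2.1 hvh ((hpar v hvm).1 hp)
  · intro v hvm hvh hp
    rw [hhv' v hvm] at hvh
    have := (hinfo v (hmo v hvm).1).2.2.1 hvh fun h1 => hp ((hpar v hvm).2 h1)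
    rwa [(hmo v hvm).2] at this
  · intro v hvm hvh
    exact ((hinfo v (hmo v hvm).1).1 ((hhv' v hvm).1 hvh)).2.2.2
  · intro v hvm _ _
    have := (hinfo v (hmo v hvm).1).2.2.2.2.2
    omega
  · intro v hvm hvh hp hpm
    rw [hhv' v hvm] at hvh
    exact (hinfo v (hmo v hvm).1).2.2.2.1 hvh (by rwa [(hmo v hvm).2]) ((hpar v hvm).1 hpm)
  · intro v hvm hvh hp hpm
    rw [hhv' v hvm] at hvh
    exact (hinfo v (hmo v hvm).1).2.2.2.2.1 hvh (by rwa [(hmo v hvm).2])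
      fun h1 => hpm ((hpar v hvm).2 h1)
  · rw [hsum, hcard]
    exact (hacc h hh).2.1
  · rw [hsum, hcard]
    intro h1 v hvm hvh
    rw [← hcard, hhv' v hvm] at hvh
    exact (hacc h hh).2.2 h1 v (hmo v hvm).1 (hmo v hvm).2 hvh

end
variable {T : IncTree} {ord o : List ℕ} {k : ℕ} {st : HS}

/-- Side `0` inherits the outside parent `t` of the node, side `1` has the separator as its outside
parent; hence both halves are nodes again. -/
theorem LvlOn.next (hl : LvlOn T o k st) (hT : T.Ordered ord) (hs : o.Sublist ord)
    {sd : ℕ → ℕ} {fh : ℕ → ℕ → ℕ}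
    (hdata : ∀ h ∈ o, st.arr aHD k h = h → ∃ sub c tp dn,
      SplitData T (nodeSet o (st.arr aHD k) h) (T.parent h) sub c tp dn (st.arr aIA k)
        (st.arr aIX k) (st.arr aIC k) sd)
    (hG : ∀ h ∈ o, ∀ d ≤ 1, Group (st.arr aHD k) sd o h d (fh d h) (st.arr aSZ (k + 1))
          (st.arr aLS (k + 1)) (st.arr aNX (k + 1)))
    (hI : ∀ v ∈ o, st.arr aPP (k + 1) v = 3 * st.arr aPP k v + 2 * sd v ∧
      st.arr aHD (k + 1) v + 1 = fh (sd v) (st.arr aHD k v)) :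
    LvlOn T o (k + 1) st ∧ SplitOn T o k st := by
  have ho : o.Nodup := hT.nodup.sublist hs
  have hverts : ∀ v ∈ o, v ∈ T.verts := fun v hv => (hT.mem v).1 (hs.subset hv)
  have hmem : ∀ v ∈ o, v ∈ nodeSet o (st.arr aHD k) (st.arr aHD k v) := fun v hv =>
    mem_nodeSet.2 ⟨hv, rfl⟩
  have hK : ∀ v ∈ o, T.Cluster (nodeSet o (st.arr aHD k) (st.arr aHD k v))
      (T.parent (st.arr aHD k v)) := fun v hv =>
    hl.cluster hT hs (hl.hd_mem v hv) (hl.hd_hd v hv)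
  have hD := fun v (hv : v ∈ o) => hdata _ (hl.hd_mem v hv) (hl.hd_hd v hv)
  have hsd1 : ∀ v ∈ o, sd v ≤ 1 := by
    intro v hv
    obtain ⟨sub, c, tp, dn, hd⟩ := hD v hv
    rcases hd.side_le (hK v hv) hT v (hmem v hv) with h1 | h1 <;> omega
  have hLk : ∀ v ∈ o, Linked (o.filter (fun w => st.arr aHD k w = st.arr aHD k v ∧ sd w = sd v))
      (st.arr aHD (k + 1) v) (st.arr aSZ (k + 1)) (st.arr aLS (k + 1)) (st.arr aNX (k + 1)) := by
    intro v hv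
    rcases hG _ (hl.hd_mem v hv) (sd v) (hsd1 v hv) with ⟨_, h1⟩ | ⟨g, h1, h2⟩
    · have : v ∈ o.filter (fun w => st.arr aHD k w = st.arr aHD k v ∧ sd w = sd v) := by simp [hv]
      rw [h1] at this
      simp at this
    · obtain rfl : st.arr aHD (k + 1) v = g := by have := (hI v hv).2; omega
      exact h2
  have hg : ∀ v ∈ o, st.arr aHD (k + 1) v ∈ o ∧
      st.arr aHD k (st.arr aHD (k + 1) v) = st.arr aHD k v ∧ sd (st.arr aHD (k + 1) v) = sd v := by
    intro v hv
    simpa using (hLk v hv).mem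
  have heq : ∀ v ∈ o, ∀ w ∈ o, st.arr aHD (k + 1) v = st.arr aHD (k + 1) w ↔
      st.arr aHD k v = st.arr aHD k w ∧ sd v = sd w := by
    intro v hv w hw
    constructor
    · intro h1
      obtain ⟨_, h2, h3⟩ := hg v hv
      obtain ⟨_, h4, h5⟩ := hg w hw
      rw [h1] at h2 h3
      exact ⟨h2.symm.trans h4, h3.symm.trans h5⟩
    · rintro ⟨h1, h2⟩
      have h3 := (hI v hv).2
      have h4 := (hI w hw).2
      rw [h1, h2] at h3
      omega
  have hfil : ∀ v ∈ o, o.filter (fun w => st.arr aHD (k + 1) w = st.arr aHD (k + 1) v) =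
      o.filter (fun w => st.arr aHD k w = st.arr aHD k v ∧ sd w = sd v) := by
    intro v hv
    refine List.filter_congr fun w hw => ?_
    rw [decide_eq_decide]
    exact heq w hw v hv
  -- The head of a half is its first member in the order. Hence its parent is in the half only if
  -- the head is its own parent.
  have hnp : ∀ v ∈ o, ∀ u ∈ o, st.arr aHD k u = st.arr aHD k v → sd u = sd v →
      T.parent (st.arr aHD (k + 1) v) = u → u = st.arr aHD (k + 1) v := by
    intro v hv u hu h1 h2 h3
    by_contra hne
    have h4 := head_idx_le hT.nodup (List.filter_sublist.trans hs) (hLk v hv).head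
      (u := u) (by simp [hu, h1, h2])
    have hgv := hverts _ (hg v hv).1
    have h5 : st.arr aHD (k + 1) v ≠ T.root := by
      intro hr
      rw [hr, hT.parent_root] at h3
      exact hne (h3.symm.trans hr.symm)
    have h6 := hT.idx_parent hgv h5
    rw [h3] at h6
    omega
  refine ⟨⟨fun v hv => (hg v hv).1, fun v hv => ?_, fun v hv w hw => ?_, fun v hv => ?_,
    fun v hv => ?_, fun v hv => ?_⟩, ⟨fun v hv => ?_, fun h hh => ?_, fun v hv => ?_⟩⟩
  · exact (heq _ (hg v hv).1 v hv).2 (hg v hv).2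
  · rw [heq v hv w hw, hl.code v hv w hw, (hI v hv).1, (hI w hw).1]
    have := hsd1 v hv
    have := hsd1 w hw
    omega
  · rw [(hI v hv).1, pow_succ]
    have := hsd1 v hv
    have := hl.code_lt v hv
    omega
  · obtain ⟨sub, c, tp, dn, hd⟩ := hD v hv
    obtain ⟨hgo, hgh, hgs⟩ := hg v hv
    have hgm : st.arr aHD (k + 1) v ∈ nodeSet o (st.arr aHD k) (st.arr aHD k v) :=
      mem_nodeSet.2 ⟨hgo, hgh⟩
    rcases hd.side_le (hK v hv) hT v (hmem v hv) with h0 | h1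
    · rcases hd.side_zero_parent (hK v hv) hT (hmem v hv) h0 with ⟨h2, h3⟩ | ⟨h2, h3⟩
      · rw [mem_nodeSet] at h2
        exact Or.inl ⟨h2.1, (heq _ h2.1 v hv).2 ⟨h2.2, h3.trans h0.symm⟩⟩
      · right
        rw [h3]
        -- If the parent of the new head were in the half, the head would be the root. But the
        -- cluster of the root contains its vertex `t`, which is outside here.
        rcases hd.side_zero_parent (hK v hv) hT hgm (hgs.trans h0) with ⟨h4, h5⟩ | ⟨_, h5⟩
        · have h4' := mem_nodeSet.1 h4
          have h6 := hnp v hv _ h4'.1 h4'.2 (h5.trans h0.symm) rfl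
          exfalso
          have h7 : st.arr aHD (k + 1) v = T.root := by
            by_contra hr
            exact hT.parent_ne _ (hverts _ hgo) hr h6
          have h8 := hK v hv
          rcases h8.top with ⟨h9, h10⟩ | ⟨_, h9⟩
          · refine h10 _ hgm ?_
            rw [h7]
            exact hT.root_anc _ h8.top_mem
          · exact h2 (h3 ▸ h9)
        · exact h5.symm
    · rcases hd.side_one_parent (hmem v hv) h1 with h2 | ⟨h2, h3⟩
      · right
        -- On this side the head cannot be the root, because the root is heavy and heavy vertices
        -- are on side `0`.
        rcases hd.side_one_parent hgm (hgs.trans h1) with h4 | ⟨h4, h5⟩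
        · rw [h2, h4]
        · have h4' := mem_nodeSet.1 h4
          have h6 := hnp v hv _ h4'.1 h4'.2 (h5.trans h1.symm) rfl
          exfalso
          have h7 : st.arr aHD (k + 1) v = T.root := by
            by_contra hr
            exact hT.parent_ne _ (hverts _ hgo) hr h6
          have h8 := hd.side_heavy _ hgm
            (h7 ▸ hd.root_heavy (hK v hv) hT (h7 ▸ hgm))
          omega
      · rw [mem_nodeSet] at h2
        exact Or.inl ⟨h2.1, (heq _ h2.1 v hv).2 ⟨h2.2, h3.trans h1.symm⟩⟩
  · rw [hfil v hv]
    exact hLk v hv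
  · rw [(hI v hv).1]
    have := hsd1 v hv
    omega
  · by_cases hhh : st.arr aHD k h = h
    · obtain ⟨sub, c, tp, dn, hd⟩ := hdata h hh hhh
      have hKh := hl.cluster hT hs hh hhh
      refine ⟨c, hd.sep_mem hKh hT, fun v hv hvh => ?_⟩
      have hvm : v ∈ nodeSet o (st.arr aHD k) h := mem_nodeSet.2 ⟨hv, hvh⟩
      refine ⟨hd.isCa hKh hT v hvm, fun h2 => ?_⟩
      have h3 : sd v = 1 := by have := (hI v hv).1; omega
      obtain ⟨h4, h5⟩ := hd.side_anc hKh hT hvm h3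
      refine ⟨h4, h5, fun w hw hwh h6 => ?_⟩
      exact hd.side_ne hKh hT hvm (mem_nodeSet.2 ⟨hw, hwh⟩) h3
        (by have := (hI w hw).1; omega)
    · exact ⟨h, hverts h hh, fun v hv hvh => absurd (hvh ▸ hl.hd_hd v hv) hhh⟩
  · obtain ⟨sub, c, tp, dn, hd⟩ := hD v hv
    have hc := hl.card ho (hl.hd_mem v hv) (hl.hd_hd v hv)
    rw [← hc]
    have hsz : st.arr aSZ (k + 1) (st.arr aHD (k + 1) v) =
        {w ∈ nodeSet o (st.arr aHD k) (st.arr aHD k v) | sd w = sd v}.card := by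
      rw [(hLk v hv).size, ← List.toFinset_card_of_nodup (ho.filter _)]
      congr 1
      ext w
      simp [mem_nodeSet, and_assoc]
    rcases hd.balanced (hK v hv) hT with h1 | ⟨h1, h2⟩
    · exact Or.inl h1
    · right
      rw [hsz]
      rcases hd.side_le (hK v hv) hT v (hmem v hv) with h3 | h3 <;> rw [h3] <;> omega

/-! ### Splitting a level and rebuilding a node -/

/-- The parameters of the execution suit the tree. -/
structure Fits (e : Env) (T : IncTree) (ord : List ℕ) : Prop where
  ok : e.Ok
  N_lt : 8 * e.N + 8 < e.V
  pow_lt : 3 ^ e.L < e.V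
  ordered : T.Ordered ord
  lt : ∀ v ∈ ord, v < e.N

def splitCost : ℕ := blkCost resetBody + blkCost sizeBody + blkCost heavyBody + blkCost sepBody +
  blkCost infoBody + blkCost linkBody + 60

theorem splitLevel_wp {e : Env} {T : IncTree} {ord lst : List ℕ} (hF : Fits e T ord)
    (hs : lst.Sublist ord) {j : ℕ} {st : HS} (hl : LvlOn T lst j st) (hjL : j + 1 ≤ e.L)
    (h7 : st.reg 7 = j) (h12 : st.reg 12 = lst.length)
    (harr : ∀ i (h : i < lst.length), st.arr aARR 0 i = lst[i])
    (hpar : ∀ v ∈ ord, st.arr aPAR 0 v = T.parent v)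
    (hout : ∀ w ∈ ord, w ∉ lst → st.arr aHD j w ∉ lst) :
    WP e splitLevel ((lst.length + 1) * splitCost) st (fun st' => (Fr j lst st st' ∧
      LvlOn T lst (j + 1) st' ∧ SplitOn T lst j st' ∧ ∀ v ∈ lst, st'.arr aCR (j + 1) v = 0) ∧
      st'.reg 12 = lst.length) := by
  have hT := hF.ordered
  have hlo : ∀ v ∈ lst, v ∈ ord := fun v hv => hs.subset hv
  have hnd : lst.Nodup := hT.nodup.sublist hs
  have hpo : ∀ v ∈ lst, T.parent v ∈ ord := fun v hv =>
    (hT.mem _).2 (hT.parent_mem v ((hT.mem v).1 (hlo v hv)))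
  have hlen : lst.length ≤ e.N := by
    rw [← List.toFinset_card_of_nodup hnd, ← Finset.card_range e.N]
    refine Finset.card_le_card fun v hv => ?_
    exact Finset.mem_range.2 (hF.lt v (hlo v (List.mem_toFinset.1 hv)))
  have hc : LCtx e T lst j st := {
    level := hjL
    regJ := h7
    lt := fun v hv => hF.lt v (hlo v hv)
    parent_lt := fun v hv => hF.lt _ (hpo v hv)
    arr := harr
    par := fun v hv => hpar v (hlo v hv)
    hd_mem := hl.hd_mem
    hd_hd := hl.hd_hd
    out := fun v hv hp => hout _ (hpo v hv) hp
    nodup := hnd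
    topo := hT.topo.sublist hs
    length_le := hlen
    N_lt := hF.N_lt }
  have hin : ∀ v ∈ lst, st.arr aHD j (T.parent v) = st.arr aHD j v → T.parent v ∈ lst :=
    fun v hv => hc.hd_parent hv
  have he := hF.ok
  have hLV : e.L < e.V := lt_trans (Nat.lt_pow_self (by norm_num)) hF.pow_lt
  unfold splitLevel splitCost
  refine ((reset_wp he hc h12).seq (T₂ := (lst.length + 1) * (blkCost sizeBody + blkCost heavyBody +
    blkCost sepBody + blkCost infoBody + blkCost linkBody + 50)) ?_).mono (by
      rw [← Nat.mul_add]; exact Nat.mul_le_mul_left _ (by omega)) fun _ h => h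
  rintro st1 ⟨⟨f1, r1⟩, l1⟩
  have c1 := hc.of_fr f1
  refine ((size_wp he c1 l1 fun v hv => (r1 v hv).1).seq (T₂ := (lst.length + 1) *
    (blkCost heavyBody + blkCost sepBody + blkCost infoBody + blkCost linkBody + 40)) ?_).mono (by
      rw [← Nat.mul_add]; exact Nat.mul_le_mul_left _ (by omega)) fun _ h => h
  rintro st2 ⟨⟨f2, u2, r2⟩, l2⟩
  have c2 := c1.of_fr f2
  have F2 := f1.trans f2
  have hd2 : ∀ {st' : HS}, Fr j lst st st' → st'.arr aHD j = st.arr aHD j := fun f => by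
    funext v; exact f.arr _ (by norm_num) _ _ (by simp [Wr])
  have sz2 : ∀ {st' : HS}, Fr j lst st st' → st'.arr aSZ j = st.arr aSZ j := fun f => by
    funext v; exact f.arr _ (by norm_num) _ _ (by simp [Wr])
  obtain ⟨hd, hhd⟩ : ∃ hd, st.arr aHD j = hd := ⟨_, rfl⟩
  obtain ⟨sz, hsz⟩ : ∃ sz, st.arr aSZ j = sz := ⟨_, rfl⟩
  obtain ⟨sub, hsub⟩ : ∃ sub, st2.arr aSUB 0 = sub := ⟨_, rfl⟩
  have hsubr : ∀ v ∈ lst, sub v = 1 + chSum T hd sub v lst := by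
    intro v hv
    have := r2 v hv
    rwa [hsub, if_pos hv, hd2 f1, hhd] at this
  have hhv : ∀ v, (fun v => sz (hd v) < 2 * sub v) v ↔ st2.arr aSZ j (hd v) < 2 * sub v := by
    intro v; rw [sz2 F2, hsz]
  obtain ⟨hv, hhve⟩ : ∃ hv : ℕ → Prop, (fun v => sz (hd v) < 2 * sub v) = hv := ⟨_, rfl⟩
  rw [hhve] at hhv
  have hhv' : ∀ v, hv v ↔ sz (hd v) < 2 * sub v := fun v => by rw [← hhve]
  refine ((heavy_wp he c2 l2 (fun v hv => ⟨?_, ?_⟩) ((hd2 F2).trans hhd) hsub hhv).seq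
    (T₂ := (lst.length + 1) * (blkCost sepBody + blkCost infoBody + blkCost linkBody + 30)) ?_).mono
      (by rw [← Nat.mul_add]; exact Nat.mul_le_mul_left _ (by omega)) fun _ h => h
  · rw [u2 _ _ _ (by norm_num)]; exact (r1 v hv).2.2.2.2.2.2
  · rw [u2 _ _ _ (by norm_num)]; exact (r1 v hv).2.2.1
  rintro st3 ⟨⟨f3, u3, hdn, htp⟩, l3⟩
  have c3 := c2.of_fr f3
  have F3 := F2.trans f3
  have hsub3 : st3.arr aSUB 0 = sub := by
    rw [← hsub]; funext v; exact u3 _ _ _ (by norm_num) (by norm_num)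
  obtain ⟨dn, hdne⟩ : ∃ dn, st3.arr aIC j = dn := ⟨_, rfl⟩
  obtain ⟨tp, htpe⟩ : ∃ tp, st3.arr aTOP 0 = tp := ⟨_, rfl⟩
  rw [hdne] at hdn
  rw [htpe] at htp
  refine ((sep_wp he c3 l3 ((hd2 F3).trans hhd) hsub3 hdne (hv := hv) ?_).seq
    (T₂ := (lst.length + 1) * (blkCost infoBody + blkCost linkBody + 20)) ?_).mono
      (by rw [← Nat.mul_add]; exact Nat.mul_le_mul_left _ (by omega)) fun _ h => h
  · rw [sz2 F3, hsz]; exact hhv'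
  rintro st4 ⟨⟨f4, u4, hcs⟩, l4⟩
  have c4 := c3.of_fr f4
  have F4 := F3.trans f4
  obtain ⟨cs, hcse⟩ : ∃ cs, st4.arr aCS 0 = cs := ⟨_, rfl⟩
  rw [hcse] at hcs
  have hcs' : ∀ h ∈ lst, (∃ v ∈ lst, hd v = h ∧ hv v ∧ dn v = v ∧ cs h = v) ∨
      ((∀ v ∈ lst, hd v = h → hv v → dn v ≠ v) ∧ cs h = T.parent h) := by
    intro h hh
    have := hcs h hh
    rwa [u3 _ _ _ (by norm_num) (by norm_num), u2 _ _ _ (by norm_num), (r1 h hh).2.1] at this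
  have hnode : ∀ v ∈ lst, Linked (lst.filter (fun w => hd w = hd v)) (hd v) sz
      (st.arr aLS j) (st.arr aNX j) := by
    intro v hv
    have := hl.node v hv
    rwa [hhd, hsz] at this
  -- Only the root is its own parent, and the root is heavy because its subtree is its whole node.
  have hroot : ∀ v ∈ lst, ¬ hv v → T.parent v ≠ v := by
    intro v hvl hh hp
    have hr : v = T.root := by
      by_contra h
      exact hT.parent_ne v ((hT.mem v).1 (hlo v hvl)) h hp
    have h1 := hl.cluster hT hs (hl.hd_mem v hvl) (hl.hd_hd v hvl)
    have h2 := hl.card hnd (hl.hd_mem v hvl) (hl.hd_hd v hvl)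
    rw [hhd] at h1 h2
    have h3 := root_heavy_of_sized h1 hT (LvlOn.sized hnd hsubr (hd v))
      (mem_nodeSet.2 ⟨hr ▸ hvl, hr ▸ rfl⟩)
    rw [h2, hsz, ← hr] at h3
    exact hh ((hhv' v).2 h3)
  have hic4 : st4.arr aIC j = dn := by
    rw [← hdne]; funext v; exact u4 _ _ _ (by norm_num)
  have htp4 : st4.arr aTOP 0 = tp := by
    rw [← htpe]; funext v; exact u4 _ _ _ (by norm_num)
  have hsub4 : st4.arr aSUB 0 = sub := by
    rw [← hsub3]; funext v; exact u4 _ _ _ (by norm_num)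
  refine ((info_wp he c4 l4 ((hd2 F4).trans hhd) hsub4 hic4 htp4 hcse ((sz2 F4).trans hsz) hhv'
    (fun v hv => ?_) hroot (fun h hh => ?_)).seq
    (T₂ := (lst.length + 1) * (blkCost linkBody + 10)) ?_).mono
      (by rw [← Nat.mul_add]; exact Nat.mul_le_mul_left _ (by omega)) fun _ h => h
  · rw [(hnode v hv).size]
    exact (List.length_filter_le _ _).trans hlen
  · rw [u4 _ _ _ (by norm_num), u3 _ _ _ (by norm_num) (by norm_num), u2 _ _ _ (by norm_num)]
    exact (r1 h hh).2.2.2.1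
  rintro st5 ⟨⟨f5, u5, _, hinfo, hacc⟩, l5⟩
  have c5 := c4.of_fr f5
  have F5 := F4.trans f5
  have hpp2 : ∀ {st' : HS}, Fr j lst st st' → st'.arr aPP j = st.arr aPP j := fun f => by
    funext v; exact f.arr _ (by norm_num) _ _ (by simp [Wr])
  have hpow : 3 ^ (j + 1) < e.V := (Nat.pow_le_pow_right (by norm_num) hjL).trans_lt hF.pow_lt
  refine (link_wp he c5 l5 hLV ((hd2 F5).trans hhd) rfl (hpp2 F5) (fun v hv => ?_)
    (fun v hv => (hinfo v hv).2.2.2.2.2) fun v hv => ?_).mono le_rfl ?_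
  · have := hl.code_lt v hv
    rw [pow_succ] at hpow
    omega
  · rw [u5 _ _ _ (by norm_num) (by norm_num) (by norm_num) (by norm_num) (by norm_num),
      u5 _ _ _ (by norm_num) (by norm_num) (by norm_num) (by norm_num) (by norm_num),
      u4 _ _ _ (by norm_num), u4 _ _ _ (by norm_num),
      u3 _ _ _ (by norm_num) (by norm_num), u3 _ _ _ (by norm_num) (by norm_num),
      u2 _ _ _ (by norm_num), u2 _ _ _ (by norm_num)]
    exact ⟨(r1 v hv).2.2.2.2.1, (r1 v hv).2.2.2.2.2.1⟩
  rintro st6 ⟨⟨f6, u6, hI, hG⟩, l6⟩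
  have F6 := F5.trans f6
  have hd6 := hd2 F6
  have hl6 : LvlOn T lst j st6 := hl.congr fun f hf v hv => by
    refine F6.arr f ?_ j v ?_
    · simp at hf; omega
    · simp at hf; simp [Wr]; omega
  have hia : st6.arr aIA j = st5.arr aIA j := by
    funext v
    exact u6 _ _ _ (by norm_num) (by norm_num) (by norm_num) (by norm_num) (by norm_num)
      (by norm_num) (by norm_num)
  have hix : st6.arr aIX j = st5.arr aIX j := by
    funext v
    exact u6 _ _ _ (by norm_num) (by norm_num) (by norm_num) (by norm_num) (by norm_num)
      (by norm_num) (by norm_num)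
  have hic : st6.arr aIC j = st5.arr aIC j := by
    funext v
    exact u6 _ _ _ (by norm_num) (by norm_num) (by norm_num) (by norm_num) (by norm_num)
      (by norm_num) (by norm_num)
  have hnext := hl6.next hT hs (sd := st5.arr aSIDE 0) (fh := st6.arr aFH) ?_ ?_ ?_
  · exact ⟨⟨F6, hnext.1, hnext.2, fun v hv => (hI v hv).2.1⟩, l6⟩
  · intro h hh hhh
    rw [hd6, hhd] at hhh ⊢
    rw [hia, hix, hic]
    exact ⟨sub, cs h, tp h, dn, hl.splitData hnd hhd hsz (by rw [← hhd]; exact hin) hsubr hhv'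
      hdn htp hcs' hinfo hacc hh hhh⟩
  · rw [hd6, hhd]
    exact hG
  · intro v hv
    rw [hpp2 F6, hd6, hhd]
    exact ⟨(hI v hv).1, (hI v hv).2.2⟩

/-- `st` arises from `st₀` by changing registers and the list array. -/
structure FrL (st₀ st : HS) : Prop where
  reg : ∀ i ∈ [3, 4, 5, 12, 13, 14], st.reg i = st₀.reg i
  arr : ∀ f ≠ aARR, st.arr f = st₀.arr f

/-- Following `aNX` from the last member yields the members backwards. Filling `aARR` from its end
restores the order of insertion, in which parents precede children. -/
theorem list_wp {e : Env} (he : e.Ok) {lst : List ℕ} {k h : ℕ} {st : HS}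
    (hk : k ≤ e.L) (hl : Linked lst h (st.arr aSZ k) (st.arr aLS k) (st.arr aNX k))
    (hN : ∀ v ∈ lst, v < e.N) (hlen : lst.length ≤ e.N)
    (h14 : st.reg 14 = k) (h8 : st.reg 8 = lst.length)
    (h12 : st.reg 12 = lst.length) (h9 : st.reg 9 = st.arr aLS k h) :
    WP e (whl .lt (.num 0) xI (blk listBody)) ((lst.length + 1) * (blkCost listBody + 3)) st
      (fun st' => FrL st st' ∧ ∀ i (h : i < lst.length), st'.arr aARR 0 i = lst[i]) := by
  refine (bwd_loop_wp he lst (fun l2 st' => FrL st st' ∧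
    (∀ i (h : i < lst.length), lst.length ≤ i + l2.length → st'.arr aARR 0 i = lst[i]) ∧
    ∀ l1, lst = l1 ++ l2 → l1 ≠ [] → l1.getLast? = some (st'.reg 9)) rfl ?_ h8 h12
    ⟨⟨fun _ _ => rfl, fun _ _ => rfl⟩, fun i h h' => ?_, fun l1 h1 _ => ?_⟩).mono le_rfl ?_
  · rintro l1 v l2 st' hll h8 h12 ⟨hf, ha, hg⟩
    have hv : v ∈ lst := by simp [hll]
    have hvN := hN v hv
    have h9' : st'.reg 9 = v := by
      have := hg (l1 ++ [v]) (by simp [hll]) (by simp)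
      simpa using this.symm
    have h14' : st'.reg 14 = k := by rw [hf.reg 14 (by simp), h14]
    have hlN : l1.length < e.N := by
      have : l1.length + (l2.length + 1) ≤ e.N := by simpa [hll] using hlen
      omega
    have hnx : st'.arr aNX k v = st.arr aNX k v := by rw [hf.arr _ (by norm_num)]
    simp only [listBody, vc]
    simp +contextual [h8, h9', h14', hvN, hk, h12, hlN, hnx]
    intros
    refine ⟨⟨?_, ?_⟩, ?_, ?_⟩
    · intro i hi
      have := hf.reg i hi
      simp at hi
      rcases hi with rfl | rfl | rfl | rfl | rfl | rfl <;> simp [this]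
    · intro f hf'
      funext a b
      simp [hf', hf.arr f hf']
    · intro i hi hle
      by_cases hil : i = l1.length
      · simp [hil, hll]
      · rw [if_neg hil]
        refine ha i hi ?_
        have : lst.length = l1.length + (l2.length + 1) := by simp [hll]
        omega
    · intro l1' hl1 hne
      have hl1e : l1 = l1' := by
        have : l1 ++ v :: l2 = l1' ++ v :: l2 := by rw [← hll, ← hl1]
        exact List.append_cancel_right this
      subst hl1e
      rcases List.eq_nil_or_concat l1 with rfl | ⟨l0, a, rfl⟩
      · exact absurd rfl hne
      · have hch := hl.chain
        rw [hll, List.concat_eq_append, List.append_assoc, List.singleton_append,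
          List.isChain_append] at hch
        have := hch.2.1
        rw [List.isChain_cons_cons] at this
        simp [this.1]
  · simp at h'; omega
  · rw [List.append_nil] at h1
    rw [← h1, h9]
    exact hl.last
  · rintro st' ⟨⟨h1, h2, _⟩, _⟩
    exact ⟨h1, fun i hi => h2 i hi (by omega)⟩

/-- What the rebuilding of a node changes. -/
structure FrR (k₀ h₀ : ℕ) (lst : List ℕ) (st₀ st : HS) : Prop where
  reg : ∀ i ∈ [3, 4, 5], st.reg i = st₀.reg i
  arr : ∀ f < 11, ∀ k v, ¬ (f < 9 ∧ v ∈ lst ∧ k₀ ≤ k) → st.arr f k v = st₀.arr f k v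
  keep : ∀ f ∈ [aHD, aNX, aLS, aSZ, aPP], ∀ v, st.arr f k₀ v = st₀.arr f k₀ v
  cr : ∀ v ≠ h₀, st.arr aCR k₀ v = st₀.arr aCR k₀ v
  cr_zero : st.arr aCR k₀ h₀ = 0

def rebuildCost : ℕ := blkCost listBody + splitCost + 300

/-- Every round splits all the nodes of one level at once, always for the same list of vertices, so
it takes time linear in the length of the list. By `hout`, the stale entries of the other vertices
cannot be mistaken for nodes of the list. -/
theorem rebuild_wp {e : Env} {T : IncTree} {ord lst : List ℕ} (hF : Fits e T ord) {k₀ h₀ H : ℕ}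
    {st : HS} (hlv : LvlOn T ord k₀ st) (hh : h₀ ∈ ord) (hhh : st.arr aHD k₀ h₀ = h₀)
    (hlst : lst = ord.filter (fun w => st.arr aHD k₀ w = h₀)) (hk : k₀ ≤ H) (hH : H ≤ e.L)
    (h5 : st.reg 5 = H) (h13 : st.reg 13 = h₀) (h14 : st.reg 14 = k₀)
    (hpar : ∀ v ∈ ord, st.arr aPAR 0 v = T.parent v)
    (hout : ∀ w ∈ ord, w ∉ lst → ∀ k, k₀ ≤ k → k ≤ H → st.arr aHD k w ∉ lst) :
    WP e rebuild ((lst.length + 1) * (H - k₀ + 1) * rebuildCost) st (fun st' =>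
      FrR k₀ h₀ lst st st' ∧ (∀ k, k₀ ≤ k → k ≤ H → LvlOn T lst k st') ∧
      (∀ k, k₀ ≤ k → k < H → SplitOn T lst k st') ∧
      ∀ k, k₀ < k → k ≤ H → ∀ v ∈ lst, st'.arr aCR k v = 0) := by
  have hT := hF.ordered
  have hs : lst.Sublist ord := hlst ▸ List.filter_sublist
  have hnd : lst.Nodup := hT.nodup.sublist hs
  have hmem : ∀ v, v ∈ lst ↔ v ∈ ord ∧ st.arr aHD k₀ v = h₀ := by simp [hlst]
  have hlN : ∀ v ∈ lst, v < e.N := fun v hv => hF.lt v (hs.subset hv)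
  have hlen : lst.length ≤ e.N := by
    rw [← List.toFinset_card_of_nodup hnd, ← Finset.card_range e.N]
    refine Finset.card_le_card fun v hv => ?_
    exact Finset.mem_range.2 (hlN v (List.mem_toFinset.1 hv))
  have he := hF.ok
  have hhN := hF.lt _ hh
  have hkL : k₀ ≤ e.L := hk.trans hH
  have hlk : Linked lst h₀ (st.arr aSZ k₀) (st.arr aLS k₀) (st.arr aNX k₀) := by
    have := hlv.node h₀ hh
    rwa [hhh, ← hlst] at this
  have hlvl : LvlOn T lst k₀ st := by
    refine ⟨fun v hv => ?_, fun v hv => ?_, fun v hv w hw => ?_, fun v hv => ?_, fun v hv => ?_,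
      fun v hv => ?_⟩
    · rw [((hmem v).1 hv).2, hmem]; exact ⟨hh, hhh⟩
    · exact hlv.hd_hd v (hs.subset hv)
    · exact hlv.code v (hs.subset hv) w (hs.subset hw)
    · exact hlv.code_lt v (hs.subset hv)
    · refine (hlv.top v (hs.subset hv)).imp_left fun h1 => ⟨?_, h1.2⟩
      rw [hmem, h1.2]
      exact ⟨h1.1, ((hmem v).1 hv).2⟩
    · have : lst.filter (fun w => st.arr aHD k₀ w = st.arr aHD k₀ v) = lst := by
        rw [List.filter_eq_self]
        intro w hw
        simp [((hmem w).1 hw).2, ((hmem v).1 hv).2]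
      rw [this, ((hmem v).1 hv).2]
      exact hlk
  have hNV := hF.N_lt
  have hLV : e.L < e.V := lt_trans (Nat.lt_pow_self (by norm_num)) hF.pow_lt
  have hsz := hlk.size
  have h0V : 0 < e.V := by omega
  -- the list of the members
  unfold rebuild
  have hA : WP e (blk [.set 12 (.rd aSZ (.reg 14) (.reg 13)), .wr aCR (.reg 14) (.reg 13) (.num 0),
      .set 9 (.rd aLS (.reg 14) (.reg 13)), .set 8 (.reg 12)]) 100 st (fun st' => st' =
        (((st.set 12 lst.length).wr aCR k₀ h₀ 0).set 9 (st.arr aLS k₀ h₀)).set 8 lst.length) := by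
    refine (blk_wp he _ st _ rfl ?_).mono (by decide) fun _ h => h
    simp +contextual [vc, h13, h14, hkL, hhN, hsz]
  refine (hA.seq (T₂ := (lst.length + 1) * (blkCost listBody + 3) + (20 +
    (H - k₀ + 1) * ((lst.length + 1) * splitCost + 20))) ?_).mono ?_ fun _ h => h
  swap
  · unfold rebuildCost
    generalize H - k₀ = a
    generalize blkCost listBody = b
    generalize splitCost = c
    generalize lst.length = d
    nlinarith [Nat.zero_le (a * b), Nat.zero_le (a * d), Nat.zero_le (a * d * b)]
  rintro _ rfl
  refine (list_wp (h := h₀) he hkL ?_ hlN hlen (by simp [h14]) (by simp) (by simp) ?_).seq ?_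
  · exact hlk
  · rfl
  rintro st1 ⟨f1, ha1⟩
  have hB : WP e (blk [.set 7 (.reg 14)]) 20 st1 (fun st' => st' = st1.set 7 k₀) := by
    refine (blk_wp he _ st1 _ rfl ?_).mono (by decide) fun _ h => h
    have : st1.reg 14 = k₀ := by rw [f1.reg 14 (by simp)]; simp [h14]
    simp +contextual [vc, this]
  refine hB.seq ?_
  rintro _ rfl
  have hfr : FrR k₀ h₀ lst st (st1.set 7 k₀) := by
    refine ⟨fun i hi => ?_, fun f hf k v hn => ?_, fun f hf v => ?_, fun v hv => ?_, ?_⟩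
    · have := f1.reg i (by simp at hi ⊢; omega)
      simp at hi
      rcases hi with rfl | rfl | rfl <;> simp [this]
    · have hne : f ≠ aARR := by omega
      simp only [HS.set_arr, f1.arr f hne, HS.wr_arr]
      rw [if_neg]
      rintro ⟨rfl, rfl, rfl⟩
      exact hn ⟨by norm_num, (hmem _).2 ⟨hh, hhh⟩, le_rfl⟩
    · have hne : f ≠ aARR := by simp at hf; omega
      have hne' : f ≠ aCR := by simp at hf; omega
      simp [f1.arr f hne, hne']
    · simp [f1.arr aCR (by norm_num), hv]
    · simp [f1.arr aCR (by norm_num)]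
  refine (whl_wp he (fun n st' => ∃ j, st'.reg 7 = j ∧ n = H - j ∧ k₀ ≤ j ∧ j ≤ H ∧
    st'.reg 12 = lst.length ∧ FrR k₀ h₀ lst st st' ∧
    (∀ i (h : i < lst.length), st'.arr aARR 0 i = lst[i]) ∧
    (∀ k, k₀ ≤ k → k ≤ j → LvlOn T lst k st') ∧ (∀ k, k₀ ≤ k → k < j → SplitOn T lst k st') ∧
    ∀ k, k₀ < k → k ≤ j → ∀ v ∈ lst, st'.arr aCR k v = 0) ((lst.length + 1) * splitCost + 10)
    (by simp [Ex.wf, Ex.wgt])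
    (by simp [Ex.wf, Ex.wgt]) ?_ (n := H - k₀) ⟨k₀, by simp, rfl, le_rfl, hk, ?_, hfr, ?_, ?_, ?_,
      ?_⟩).mono ?_ ?_
  · rintro n st' ⟨j, h7, hn, hkj, hjH, h12, hfr, harr, hLv, hSp, hCR⟩
    refine ⟨trivial, trivial, fun hc => ?_⟩
    have h5' : st'.reg 5 = H := by rw [hfr.reg 5 (by simp), h5]
    simp only [Cmp.Holds, Ex.eval_reg, h7, h5'] at hc
    refine ⟨H - (j + 1), by omega, ?_⟩
    refine WP.seq (T₂ := 10) (splitLevel_wp hF hs (hLv j hkj le_rfl) (by omega) h7 h12 harr ?_ ?_) ?_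
    · intro v hv
      rw [hfr.arr _ (by norm_num) _ _ (by simp), hpar v hv]
    · intro w hw hwl
      rw [hfr.arr _ (by norm_num) _ _ (by simp [hwl])]
      exact hout w hw hwl j hkj hjH
    · rintro st2 ⟨⟨f2, hl2, hs2, hc2⟩, h12'⟩
      have h72 : st2.reg 7 = j := by rw [f2.reg 7 (by simp), h7]
      refine (blk_wp he _ st2 _ rfl ?_).mono (T' := 10) (by decide)
        fun _ h => h
      have hjV : j + 1 < e.V := by omega
      simp only [vc]
      refine ⟨by simp, Or.inr (by simpa [h72] using hjV), ?_⟩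
      rintro y hy -
      have hy' : y = j + 1 := by simpa [h72] using hy
      subst hy'
      refine ⟨j + 1, by simp, rfl, by omega, by omega, by simp [h12'], ?_, ?_, ?_, ?_, ?_⟩
      · refine ⟨fun i hi => ?_, fun f hf k v hn => ?_, fun f hf v => ?_, fun v hv => ?_, ?_⟩
        · have h1 := f2.reg i (by simp at hi ⊢; omega)
          have h2 := hfr.reg i hi
          simp at hi
          rcases hi with rfl | rfl | rfl <;> simp [h1, h2]
        · rw [HS.set_arr, f2.arr f (by omega) k v, hfr.arr f hf k v hn]
          rintro ⟨h1, h2⟩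
          exact hn ⟨by omega, h1, by omega⟩
        · rw [HS.set_arr, f2.arr f (by simp at hf; omega) k₀ v, hfr.keep f hf v]
          rintro ⟨h1, h2⟩
          simp at hf
          omega
        · rw [HS.set_arr, f2.arr aCR (by norm_num) k₀ v, hfr.cr v hv]
          rintro ⟨h1, h2⟩
          omega
        · rw [HS.set_arr, f2.arr aCR (by norm_num) k₀ h₀, hfr.cr_zero]
          rintro ⟨h1, h2⟩
          omega
      · intro i hi
        rw [HS.set_arr, f2.arr _ (by norm_num) _ _ (by simp [Wr]), harr i hi]
      · intro k h1 h2
        rcases Nat.lt_or_ge j k with h3 | h3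
        · obtain rfl : k = j + 1 := by omega
          exact hl2.congr fun _ _ _ _ => rfl
        · refine (hLv k h1 h3).congr fun f hf v hv => ?_
          rw [HS.set_arr, f2.arr f (by simp at hf; omega)]
          rintro ⟨_, h4⟩
          simp at hf
          omega
      · intro k h1 h2
        rcases Nat.lt_or_ge k j with h3 | h3
        · refine (hSp k h1 h3).congr (hLv k h1 h3.le)
            (hLv (k + 1) (by omega) (by omega)).hd_mem (fun f hf v hv => ?_) fun f hf v hv => ?_
          · rw [HS.set_arr, f2.arr f (by simp at hf; omega)]
            rintro ⟨_, h4⟩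
            simp at hf
            omega
          · rw [HS.set_arr, f2.arr f (by simp at hf; omega)]
            rintro ⟨_, h4⟩
            simp at hf
            omega
        · obtain rfl : k = j := by omega
          refine hs2.congr ((hLv k h1 le_rfl).congr fun f hf v hv => ?_) hl2.hd_mem
            (fun _ _ _ _ => rfl) fun _ _ _ _ => rfl
          rw [f2.arr f (by simp at hf; omega)]
          rintro ⟨_, h4⟩
          simp at hf
          omega
      · intro k h1 h2 v hv
        rcases Nat.lt_or_ge j k with h3 | h3
        · obtain rfl : k = j + 1 := by omega
          exact hc2 v hv
        · rw [HS.set_arr, f2.arr aCR (by norm_num), hCR k h1 h3 v hv]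
          rintro ⟨_, h4⟩
          omega
  · have : st1.reg 12 = lst.length := by rw [f1.reg 12 (by simp)]; simp
    simp [this]
  · exact ha1
  · intro k h1 h2
    obtain rfl : k = k₀ := by omega
    exact hlvl.congr fun f hf v hv => hfr.keep f hf v
  · intro k h1 h2; omega
  · intro k h1 h2; omega
  · simp only [Ex.cost]
    exact Nat.mul_le_mul_left _ (by omega)
  · rintro st' ⟨⟨n, j, h7, hn, hkj, hjH, h12, hfr, harr, hLv, hSp, hCR⟩, hc⟩
    have h5' : st'.reg 5 = H := by rw [hfr.reg 5 (by simp), h5]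
    simp only [Cmp.Holds, Ex.eval_reg, h7, h5'] at hc
    obtain rfl : j = H := by omega
    exact ⟨hfr, hLv, hSp, hCR⟩

/-! ### A new leaf in existing nodes; combining old and rebuilt nodes -/

/-- On level `k`, the vertex `y` has joined the node of `x`. -/
structure InsAt (x y k : ℕ) (st st' : HS) : Prop where
  new_hd : st'.arr aHD k y = st.arr aHD k x
  new_pp : st'.arr aPP k y = st.arr aPP k x
  new_nx : st'.arr aNX k y = st.arr aLS k (st.arr aHD k x)
  new_ia : st'.arr aIA k y = st.arr aIA k x
  new_ix : st'.arr aIX k y = if st.arr aIA k x = x then y else st.arr aIX k x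
  new_ic : st'.arr aIC k y = st.arr aIC k x
  new_cr : st'.arr aCR k y = 0
  ls : st'.arr aLS k (st.arr aHD k x) = y
  sz : st'.arr aSZ k (st.arr aHD k x) = st.arr aSZ k (st.arr aHD k x) + 1
  cr : st'.arr aCR k (st.arr aHD k x) = st.arr aCR k (st.arr aHD k x) + 1
  old : ∀ f ∈ [aHD, aPP, aNX, aIA, aIX, aIC], ∀ v ≠ y, st'.arr f k v = st.arr f k v
  old' : ∀ f ∈ [aLS, aSZ, aCR], ∀ v ≠ y, v ≠ st.arr aHD k x → st'.arr f k v = st.arr f k v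

section
variable {T : IncTree} {ord : List ℕ} {x y k : ℕ} {st st' : HS}

theorem parent_addLeaf {v : ℕ} (h : v ≠ y) : (T.addLeaf x y).parent v = T.parent v :=
  Function.update_of_ne h _ _

/-- The leaf `y` copies the head and the code of its parent, so every claim about heads and codes
reduces to a claim about an old vertex. In the linked list it is appended at the end. -/
theorem LvlOn.insert (hl : LvlOn T ord k st) (hx : x ∈ ord) (hy : y ∉ ord)
    (hi : InsAt x y k st st') : LvlOn (T.addLeaf x y) (ord ++ [y]) k st' := by
  have hne : ∀ v ∈ ord, v ≠ y := fun v hv h => hy (h ▸ hv)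
  have hhx := hl.hd_mem x hx
  have hHD : ∀ v ∈ ord, st'.arr aHD k v = st.arr aHD k v := fun v hv =>
    hi.old _ (by simp) v (hne v hv)
  have hPP : ∀ v ∈ ord, st'.arr aPP k v = st.arr aPP k v := fun v hv =>
    hi.old _ (by simp) v (hne v hv)
  have hrep : ∀ v ∈ ord ++ [y], ∃ w ∈ ord, st'.arr aHD k v = st.arr aHD k w ∧
      st'.arr aPP k v = st.arr aPP k w := by
    intro v hv
    rcases List.mem_append.1 hv with hv | hv
    · exact ⟨v, hv, hHD v hv, hPP v hv⟩
    · obtain rfl : v = y := by simpa using hv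
      exact ⟨x, hx, hi.new_hd, hi.new_pp⟩
  refine ⟨fun v hv => ?_, fun v hv => ?_, fun v hv w hw => ?_, fun v hv => ?_, fun v hv => ?_,
    fun v hv => ?_⟩
  · obtain ⟨w, hw, h1, _⟩ := hrep v hv
    rw [h1]
    exact List.mem_append_left _ (hl.hd_mem w hw)
  · obtain ⟨w, hw, h1, _⟩ := hrep v hv
    rw [h1, hHD _ (hl.hd_mem w hw)]
    exact hl.hd_hd w hw
  · obtain ⟨v', hv', h1, h2⟩ := hrep v hv
    obtain ⟨w', hw', h3, h4⟩ := hrep w hw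
    rw [h1, h2, h3, h4]
    exact hl.code v' hv' w' hw'
  · obtain ⟨w, hw, _, h1⟩ := hrep v hv
    rw [h1]
    exact hl.code_lt w hw
  · rcases List.mem_append.1 hv with hv | hv
    · rw [parent_addLeaf (hne v hv), hHD v hv, parent_addLeaf (hne _ (hl.hd_mem v hv))]
      refine (hl.top v hv).imp_left fun h1 => ⟨List.mem_append_left _ h1.1, ?_⟩
      rw [hHD _ h1.1]
      exact h1.2
    · obtain rfl : v = y := by simpa using hv
      left
      have : (T.addLeaf x v).parent v = x := Function.update_self _ _ _
      rw [this]
      exact ⟨List.mem_append_left _ hx, by rw [hHD x hx, hi.new_hd]⟩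
  · obtain ⟨w, hw, h1, _⟩ := hrep v hv
    rw [h1, List.filter_append]
    have hf : ord.filter (fun u => st'.arr aHD k u = st.arr aHD k w) =
        ord.filter (fun u => st.arr aHD k u = st.arr aHD k w) :=
      List.filter_congr fun u hu => by rw [hHD u hu]
    rw [hf]
    have hlw := hl.node w hw
    by_cases h2 : st.arr aHD k w = st.arr aHD k x
    · have : [y].filter (fun u => st'.arr aHD k u = st.arr aHD k w) = [y] := by
        simp [hi.new_hd, h2]
      rw [this]
      rw [h2] at hlw ⊢
      exact hlw.snoc (by simp [hy]) hi.sz hi.ls hi.new_nx fun u hu => hi.old _ (by simp) u hu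
    · have : [y].filter (fun u => st'.arr aHD k u = st.arr aHD k w) = [] := by
        simp [hi.new_hd, Ne.symm h2]
      rw [this, List.append_nil]
      exact hlw.congr (hi.old' _ (by simp) _ (hne _ (hl.hd_mem w hw)) h2)
        (hi.old' _ (by simp) _ (hne _ (hl.hd_mem w hw)) h2)
        fun u hu => hi.old _ (by simp) _ (hne _ (List.mem_filter.1 hu).1)

/-- The separators are kept. The leaf is on the side of its parent `x`, and its triple is that of
`x`, except that `y` itself enters if `x` is the nearest common ancestor. By `h8` the enlarged node
has more than eight vertices, so the old one was not a singleton. -/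
theorem SplitOn.insert (hs : SplitOn T ord k st) (hT : T.Ordered ord) (hl : LvlOn T ord k st)
    (hl' : LvlOn T ord (k + 1) st) (hx : x ∈ ord) (hy : y ∉ ord)
    (h8 : 8 * st'.arr aCR k (st.arr aHD k x) < st'.arr aSZ k (st.arr aHD k x))
    (hi : InsAt x y k st st') (hi' : InsAt x y (k + 1) st st') :
    SplitOn (T.addLeaf x y) (ord ++ [y]) k st' := by
  have hne : ∀ v ∈ ord, v ≠ y := fun v hv h => hy (h ▸ hv)
  have hxT := (hT.mem x).1 hx
  have hyT : y ∉ T.verts := fun h => hy ((hT.mem y).2 h)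
  have hHD : ∀ v ∈ ord, st'.arr aHD k v = st.arr aHD k v := fun v hv =>
    hi.old _ (by simp) v (hne v hv)
  have hPP : ∀ v ∈ ord, st'.arr aPP k v = st.arr aPP k v := fun v hv =>
    hi.old _ (by simp) v (hne v hv)
  have hPP' : ∀ v ∈ ord, st'.arr aPP (k + 1) v = st.arr aPP (k + 1) v := fun v hv =>
    hi'.old _ (by simp) v (hne v hv)
  have hHD' : ∀ v ∈ ord, st'.arr aHD (k + 1) v = st.arr aHD (k + 1) v := fun v hv =>
    hi'.old _ (by simp) v (hne v hv)
  have hIX : ∀ v ∈ ord, st'.arr aIX k v = st.arr aIX k v := fun v hv =>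
    hi.old _ (by simp) v (hne v hv)
  refine ⟨fun v hv => ?_, fun h hh => ?_, fun v hv => ?_⟩
  · rcases List.mem_append.1 hv with hv | hv
    · rw [hPP v hv, hPP' v hv]; exact hs.digit v hv
    · obtain rfl : v = y := by simpa using hv
      rw [hi.new_pp, hi'.new_pp]; exact hs.digit x hx
  · rcases List.mem_append.1 hh with hh | hh
    · obtain ⟨c, hc, hcv⟩ := hs.sep h hh
      -- The second characteristic ancestor of an old vertex is an old vertex, hence different from
      -- `y`.
      have hixm : ∀ v ∈ ord, st.arr aHD k v = h → st.arr aIX k v ≠ y := by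
        intro v hv hvh hy'
        have h1 := (hcv v hv hvh).1.2.1.anc
        rw [hy'] at h1
        exact hyT (hT.verts_of_anc h1 ((hT.mem v).1 hv))
      refine ⟨c, Finset.mem_insert_of_mem hc, fun v hv hvh => ?_⟩
      rcases List.mem_append.1 hv with hv | hv
      · rw [hHD v hv] at hvh
        obtain ⟨h1, h2⟩ := hcv v hv hvh
        rw [hIX v hv, hi.old aIA (by simp) v (hne v hv), hi.old aIC (by simp) v (hne v hv),
          hPP v hv, hPP' v hv]
        refine ⟨hT.isCa_addLeaf hyT ((hT.mem v).1 hv) hc h1, fun h3 => ?_⟩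
        obtain ⟨h4, h5, h6⟩ := h2 h3
        refine ⟨h4, h5, fun w hw hwh h7 => ?_⟩
        rcases List.mem_append.1 hw with hw' | hw'
        · rw [hHD w hw'] at hwh
          rw [hPP w hw', hPP' w hw'] at h7
          rw [hIX w hw']
          exact h6 w hw' hwh h7
        · obtain rfl : w = y := by simpa using hw'
          rw [hi.new_hd] at hwh
          rw [hi.new_pp, hi'.new_pp] at h7
          rw [hi.new_ix]
          split_ifs
          · exact hixm v ‹v ∈ ord› hvh
          · exact h6 x hx hwh h7
      · obtain rfl : v = y := by simpa using hv
        rw [hi.new_hd] at hvh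
        obtain ⟨h1, h2⟩ := hcv x hx hvh
        rw [hi.new_ia, hi.new_ix, hi.new_ic, hi.new_pp, hi'.new_pp]
        refine ⟨hT.isCa_leaf hxT hyT hc h1, fun h3 => ?_⟩
        obtain ⟨h4, h5, h6⟩ := h2 h3
        refine ⟨h4, fun h7 => hyT (h7 ▸ hc), fun w hw hwh h7 => ?_⟩
        have h8 : st.arr aIA k x ≠ x := fun h8 => h5 (h8.symm.trans h4)
        rw [if_neg h8]
        rcases List.mem_append.1 hw with hw | hw
        · rw [hHD w hw] at hwh
          rw [hPP w hw, hPP' w hw] at h7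
          rw [hIX w hw]
          exact h6 w hw hwh h7
        · obtain rfl : w = v := by simpa using hw
          rw [hi.new_pp, hi'.new_pp] at h7
          omega
    · obtain rfl : h = y := by simpa using hh
      refine ⟨h, Finset.mem_insert_self _ _, fun v hv hvh => ?_⟩
      exfalso
      rcases List.mem_append.1 hv with hv | hv
      · rw [hHD v hv] at hvh
        exact hy (hvh ▸ hl.hd_mem v hv)
      · obtain rfl : v = h := by simpa using hv
        rw [hi.new_hd] at hvh
        exact hy (hvh ▸ hl.hd_mem x hx)
  · have hx1 := hs.bal x hx
    have hsz := hi.sz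
    have hsz' := hi'.sz
    have hcr := hi.cr
    have key : st.arr aHD k x = st.arr aHD k x → st'.arr aSZ k (st.arr aHD k x) = 1 ∨
        4 * st'.arr aSZ (k + 1) (st.arr aHD (k + 1) x) ≤
          3 * st'.arr aSZ k (st.arr aHD k x) + st'.arr aCR k (st.arr aHD k x) := by
      intro _
      omega
    rcases List.mem_append.1 hv with hv | hv
    · rw [hHD v hv, hHD' v hv]
      by_cases h1 : st.arr aHD (k + 1) v = st.arr aHD (k + 1) x
      · have h2 : st.arr aHD k v = st.arr aHD k x := by
          rw [hl.code v hv x hx]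
          have := (hl'.code v hv x hx).1 h1
          have := hs.digit v hv
          have := hs.digit x hx
          omega
        rw [h1, h2]
        exact key rfl
      · rw [hi'.old' aSZ (by simp) _ (hne _ (hl'.hd_mem v hv)) h1]
        by_cases h2 : st.arr aHD k v = st.arr aHD k x
        · have := hs.bal v hv
          rw [h2] at this ⊢
          omega
        · rw [hi.old' aSZ (by simp) _ (hne _ (hl.hd_mem v hv)) h2,
            hi.old' aCR (by simp) _ (hne _ (hl.hd_mem v hv)) h2]
          exact hs.bal v hv
    · obtain rfl : v = y := by simpa using hv
      rw [hi.new_hd, hi'.new_hd]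
      exact key rfl

/-- Going down one level appends a ternary digit `0` or `2`, so dividing by a power of three cuts a
code back to a prefix. -/
theorem code_div {p : ℕ → ℕ} {k₀ K : ℕ}
    (h : ∀ k, k₀ ≤ k → k < K → p (k + 1) = 3 * p k ∨ p (k + 1) = 3 * p k + 2) :
    ∀ k, k₀ ≤ k → k ≤ K → p k / 3 ^ (k - k₀) = p k₀ := by
  intro k hk
  induction k, hk using Nat.le_induction with
  | base => intro _; simp
  | succ k hk ih =>
    intro hK
    rw [Nat.succ_sub hk, pow_succ', ← Nat.div_div_eq_div_mul, ← ih (by omega)]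
    congr 1
    rcases h k hk (by omega) with h1 | h1 <;> omega

/-- A union of nodes of level `k` has been built anew, and the vertex `y` has been added to it. -/
structure Glue (T T' : IncTree) (ord lst : List ℕ) (y k : ℕ) (st st' : HS) : Prop where
  new : y ∈ lst
  notMem : y ∉ ord
  filter : lst = (ord ++ [y]).filter (fun v => v ∈ lst)
  parent : ∀ v ∈ ord, T'.parent v = T.parent v
  rows : ∀ f < 9, ∀ v ∈ ord, v ∉ lst → st'.arr f k v = st.arr f k v
  closed : ∀ v ∈ ord, st.arr aHD k v ∈ lst ↔ v ∈ lst
  code : ∀ v ∈ ord, v ∉ lst → ∀ w ∈ lst, st.arr aPP k v ≠ st'.arr aPP k w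
  lvl : LvlOn T ord k st
  lvl' : LvlOn T' lst k st'

namespace Glue
variable {T' : IncTree} {lst : List ℕ}

theorem mem_ord (h : Glue T T' ord lst y k st st') {v : ℕ} (hv : v ∈ ord ++ [y]) (hl : v ∉ lst) :
    v ∈ ord := by
  rcases List.mem_append.1 hv with hv | hv
  · exact hv
  · obtain rfl : v = y := by simpa using hv
    exact absurd h.new hl

theorem sub (h : Glue T T' ord lst y k st st') {v : ℕ} (hv : v ∈ lst) : v ∈ ord ++ [y] := by
  rw [h.filter] at hv
  exact (List.mem_filter.1 hv).1

theorem hd_out (h : Glue T T' ord lst y k st st') {v : ℕ} (hv : v ∈ ord) (hl : v ∉ lst) :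
    st.arr aHD k v ∈ ord ∧ st.arr aHD k v ∉ lst :=
  ⟨h.lvl.hd_mem v hv, fun h1 => hl ((h.closed v hv).1 h1)⟩

theorem hd_ne (h : Glue T T' ord lst y k st st') {v w : ℕ} (hv : v ∈ ord) (hl : v ∉ lst)
    (hw : w ∈ lst) : st'.arr aHD k v ≠ st'.arr aHD k w := by
  rw [h.rows _ (by norm_num) v hv hl]
  exact fun h1 => (h.hd_out hv hl).2 (h1 ▸ h.lvl'.hd_mem w hw)

theorem lvlOn (h : Glue T T' ord lst y k st st') : LvlOn T' (ord ++ [y]) k st' := by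
  have hHD : ∀ v ∈ ord, v ∉ lst → st'.arr aHD k v = st.arr aHD k v := h.rows _ (by norm_num)
  have hPP : ∀ v ∈ ord, v ∉ lst → st'.arr aPP k v = st.arr aPP k v := h.rows _ (by norm_num)
  refine ⟨fun v hv => ?_, fun v hv => ?_, fun v hv w hw => ?_, fun v hv => ?_, fun v hv => ?_,
    fun v hv => ?_⟩
  · by_cases hl : v ∈ lst
    · exact h.sub (h.lvl'.hd_mem v hl)
    · have hv' := h.mem_ord hv hl
      rw [hHD v hv' hl]
      exact List.mem_append_left _ (h.hd_out hv' hl).1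
  · by_cases hl : v ∈ lst
    · exact h.lvl'.hd_hd v hl
    · have hv' := h.mem_ord hv hl
      have h1 := h.hd_out hv' hl
      rw [hHD v hv' hl, hHD _ h1.1 h1.2]
      exact h.lvl.hd_hd v hv'
  · by_cases hl : v ∈ lst
    · by_cases hl' : w ∈ lst
      · exact h.lvl'.code v hl w hl'
      · have hw' := h.mem_ord hw hl'
        refine iff_of_false (fun h1 => h.hd_ne hw' hl' hl h1.symm) fun h1 => ?_
        rw [hPP w hw' hl'] at h1
        exact h.code w hw' hl' v hl h1.symm
    · have hv' := h.mem_ord hv hl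
      by_cases hl' : w ∈ lst
      · refine iff_of_false (h.hd_ne hv' hl hl') fun h1 => ?_
        rw [hPP v hv' hl] at h1
        exact h.code v hv' hl w hl' h1
      · have hw' := h.mem_ord hw hl'
        rw [hHD v hv' hl, hHD w hw' hl', hPP v hv' hl, hPP w hw' hl']
        exact h.lvl.code v hv' w hw'
  · by_cases hl : v ∈ lst
    · exact h.lvl'.code_lt v hl
    · have hv' := h.mem_ord hv hl
      rw [hPP v hv' hl]
      exact h.lvl.code_lt v hv'
  · by_cases hl : v ∈ lst
    · exact (h.lvl'.top v hl).imp_left fun h1 => ⟨h.sub h1.1, h1.2⟩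
    · have hv' := h.mem_ord hv hl
      have h1 := h.hd_out hv' hl
      rw [h.parent v hv', hHD v hv' hl, h.parent _ h1.1]
      refine (h.lvl.top v hv').imp_left fun h2 => ?_
      have h3 : T.parent v ∉ lst := by
        rw [← h.closed _ h2.1, h2.2]
        exact h1.2
      exact ⟨List.mem_append_left _ h2.1, (hHD _ h2.1 h3).trans h2.2⟩
  · by_cases hl : v ∈ lst
    · have : (ord ++ [y]).filter (fun w => st'.arr aHD k w = st'.arr aHD k v) =
          lst.filter (fun w => st'.arr aHD k w = st'.arr aHD k v) := by
        conv_rhs => rw [h.filter, List.filter_filter]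
        refine List.filter_congr fun w hw => ?_
        by_cases hl' : w ∈ lst
        · simp [hl']
        · have := (h.hd_ne (h.mem_ord hw hl') hl' hl)
          simp [hl', this]
      rw [this]
      exact h.lvl'.node v hl
    · have hv' := h.mem_ord hv hl
      have h1 := h.hd_out hv' hl
      have hout : ∀ w ∈ ord, st.arr aHD k w = st.arr aHD k v → w ∉ lst := fun w hw hwv hwl =>
        h1.2 (hwv ▸ (h.closed w hw).2 hwl)
      have : (ord ++ [y]).filter (fun w => st'.arr aHD k w = st'.arr aHD k v) =
          ord.filter (fun w => st.arr aHD k w = st.arr aHD k v) := by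
        have h2 : [y].filter (fun w => st'.arr aHD k w = st'.arr aHD k v) = [] := by
          have := (h.hd_ne hv' hl h.new).symm
          simp [this]
        rw [List.filter_append, h2, List.append_nil]
        refine List.filter_congr fun w hw => ?_
        by_cases hl' : w ∈ lst
        · have h3 := (h.hd_ne hv' hl hl').symm
          have h4 : ¬ st.arr aHD k w = st.arr aHD k v := fun h4 => hout w hw h4 hl'
          simp [h3, h4]
        · rw [hHD w hw hl', hHD v hv' hl]
      rw [this, hHD v hv' hl]
      exact (h.lvl.node v hv').congr (h.rows _ (by norm_num) _ h1.1 h1.2)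
        (h.rows _ (by norm_num) _ h1.1 h1.2) fun w hw =>
          h.rows _ (by norm_num) _ (List.mem_filter.1 hw).1
            (hout w (List.mem_filter.1 hw).1 (by simpa using (List.mem_filter.1 hw).2))

/-- A node consists either of rebuilt or of untouched vertices, so each case is inherited from one
of the two hypotheses; for untouched nodes the triples survive the addition of a leaf. -/
theorem splitOn (h : Glue T (T.addLeaf x y) ord lst y k st st')
    (h' : Glue T (T.addLeaf x y) ord lst y (k + 1) st st') (hT : T.Ordered ord)
    (hs : SplitOn T ord k st) (hs' : SplitOn (T.addLeaf x y) lst k st') :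
    SplitOn (T.addLeaf x y) (ord ++ [y]) k st' := by
  have hyT : y ∉ T.verts := fun h1 => h.notMem ((hT.mem y).2 h1)
  have hrow : ∀ f < 9, ∀ v ∈ ord, v ∉ lst → st'.arr f k v = st.arr f k v := h.rows
  have hPP' : ∀ v ∈ ord, v ∉ lst → st'.arr aPP (k + 1) v = st.arr aPP (k + 1) v :=
    h'.rows _ (by norm_num)
  refine ⟨fun v hv => ?_, fun g hg => ?_, fun v hv => ?_⟩
  · by_cases hl : v ∈ lst
    · exact hs'.digit v hl
    · have hv' := h.mem_ord hv hl
      rw [hrow _ (by norm_num) v hv' hl, hPP' v hv' hl]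
      exact hs.digit v hv'
  · by_cases hl : g ∈ lst
    · obtain ⟨c, hc, hcv⟩ := hs'.sep g hl
      have hin : ∀ v ∈ ord ++ [y], st'.arr aHD k v = g → v ∈ lst := by
        intro v hv hvg
        by_contra hvl
        have hv' := h.mem_ord hv hvl
        rw [hrow _ (by norm_num) v hv' hvl] at hvg
        exact (h.hd_out hv' hvl).2 (hvg ▸ hl)
      refine ⟨c, hc, fun v hv hvg => ?_⟩
      obtain ⟨h1, h2⟩ := hcv v (hin v hv hvg) hvg
      refine ⟨h1, fun h3 => ⟨(h2 h3).1, (h2 h3).2.1, fun w hw hwg => ?_⟩⟩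
      exact (h2 h3).2.2 w (hin w hw hwg) hwg
    · have hg' := h.mem_ord hg hl
      obtain ⟨c, hc, hcv⟩ := hs.sep g hg'
      have hin : ∀ v ∈ ord ++ [y], st'.arr aHD k v = g →
          v ∈ ord ∧ v ∉ lst ∧ st.arr aHD k v = g := by
        intro v hv hvg
        have hvl : v ∉ lst := fun hvl => hl (hvg ▸ h.lvl'.hd_mem v hvl)
        have hv' := h.mem_ord hv hvl
        exact ⟨hv', hvl, (hrow _ (by norm_num) v hv' hvl).symm.trans hvg⟩
      refine ⟨c, Finset.mem_insert_of_mem hc, fun v hv hvg => ?_⟩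
      obtain ⟨hv', hvl, hvg'⟩ := hin v hv hvg
      obtain ⟨h1, h2⟩ := hcv v hv' hvg'
      rw [hrow aIA (by norm_num) v hv' hvl, hrow aIX (by norm_num) v hv' hvl,
        hrow aIC (by norm_num) v hv' hvl, hrow aPP (by norm_num) v hv' hvl, hPP' v hv' hvl]
      refine ⟨hT.isCa_addLeaf hyT ((hT.mem v).1 hv') hc h1, fun h3 =>
        ⟨(h2 h3).1, (h2 h3).2.1, fun w hw hwg => ?_⟩⟩
      obtain ⟨hw', hwl, hwg'⟩ := hin w hw hwg
      rw [hrow aIX (by norm_num) w hw' hwl, hrow aPP (by norm_num) w hw' hwl, hPP' w hw' hwl]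
      exact (h2 h3).2.2 w hw' hwg'
  · by_cases hl : v ∈ lst
    · exact hs'.bal v hl
    · have hv' := h.mem_ord hv hl
      have h1 := h.hd_out hv' hl
      have h2 := h'.hd_out hv' hl
      rw [hrow aHD (by norm_num) v hv' hl, h'.rows aHD (by norm_num) v hv' hl,
        hrow aSZ (by norm_num) _ h1.1 h1.2, hrow aCR (by norm_num) _ h1.1 h1.2,
        h'.rows aSZ (by norm_num) _ h2.1 h2.2]
      exact hs.bal v hv'

end Glue

end
-- Ternary lengths, the invariant, and the height of the decomposition
/-- The number of ternary digits. -/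
def tl (i : ℕ) : ℕ := (Nat.digits 3 i).length

theorem tl_zero : tl 0 = 0 := by simp [tl]

theorem tl_pos {i : ℕ} (h : 0 < i) : tl i = tl (i / 3) + 1 := by
  rw [tl, Nat.digits_def' (by norm_num) h, List.length_cons, tl]

theorem tl_eq {q i : ℕ} (h : 3 ^ q ≤ i) (h' : i < 3 ^ (q + 1)) : tl i = q + 1 := by
  have h1 := (Nat.lt_digits_length_iff (b := 3) (by norm_num) i (k := q)).2 h
  have h2 := (Nat.digits_length_le_iff (b := 3) (by norm_num) i (k := q + 1)).2 h'
  rw [tl]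
  omega

theorem tl_div {x i : ℕ} (h : 3 ^ x ≤ i) : tl i = x + tl (i / 3 ^ x) := by
  induction x generalizing i with
  | zero => simp
  | succ x ih =>
    have h0 : 0 < 3 ^ x := by positivity
    have h1 : 3 ^ x ≤ i / 3 := by
      rw [Nat.le_div_iff_mul_le (by norm_num)]; rw [pow_succ] at h; exact h
    rw [tl_pos (by rw [pow_succ] at h; omega), ih h1, Nat.div_div_eq_div_mul, ← pow_succ']
    omega

/-- The invariant of the data structure with capacity `3 ^ x`. -/
structure Inv (e : Env) (T : IncTree) (ord : List ℕ) (x : ℕ) (st : HS) : Prop where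
  fits : Fits e T ord
  N_eq : e.N = 3 ^ x
  le_L : 5 * x ≤ e.L
  reg4 : st.reg 4 = x
  reg5 : st.reg 5 = 5 * x
  par : ∀ v ∈ ord, st.arr aPAR 0 v = T.parent v
  tb : ∀ i < e.N, st.arr aTB 0 i = tl i
  lvl : ∀ k ≤ 5 * x, LvlOn T ord k st
  split : ∀ k < 5 * x, SplitOn T ord k st
  -- With `SplitOn.bal` this yields `32 * child ≤ 25 * node`, unless the node is a singleton.
  live : ∀ k ≤ 5 * x, ∀ v ∈ ord, 8 * st.arr aCR k (st.arr aHD k v) < st.arr aSZ k (st.arr aHD k v)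
  pp0 : ∀ v ∈ ord, st.arr aPP 0 v = 0

theorem Fits.length_le {e : Env} {T : IncTree} {ord l : List ℕ} (hF : Fits e T ord)
    (hl : l.Sublist ord) : l.length ≤ e.N := by
  rw [← List.toFinset_card_of_nodup (hF.ordered.nodup.sublist hl), ← Finset.card_range e.N]
  refine Finset.card_le_card fun v hv => ?_
  exact Finset.mem_range.2 (hF.lt v (hl.subset (List.mem_toFinset.1 hv)))

theorem LvlOn.size_le {e : Env} {T : IncTree} {ord : List ℕ} {k : ℕ} {st : HS}
    (h : LvlOn T ord k st) (hF : Fits e T ord) {v : ℕ} (hv : v ∈ ord) :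
    st.arr aSZ k (st.arr aHD k v) ≤ e.N := by
  rw [(h.node v hv).size]
  exact hF.length_le List.filter_sublist

theorem LvlOn.size_pos {T : IncTree} {ord : List ℕ} {k : ℕ} {st : HS}
    (h : LvlOn T ord k st) {v : ℕ} (hv : v ∈ ord) : 1 ≤ st.arr aSZ k (st.arr aHD k v) := by
  rw [(h.node v hv).size]
  exact List.length_pos_of_mem (h.node v hv).mem

namespace Inv
variable {e : Env} {T : IncTree} {ord : List ℕ} {x : ℕ} {st : HS}

/-- A code determines its prefix, so two vertices in one node of level `k + 1` are in one node of
level `k`. -/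
theorem size_next (h : Inv e T ord x st) {k : ℕ} (hk : k < 5 * x) {v : ℕ} (hv : v ∈ ord) :
    st.arr aSZ (k + 1) (st.arr aHD (k + 1) v) ≤ st.arr aSZ k (st.arr aHD k v) := by
  rw [((h.lvl k hk.le).node v hv).size, ((h.lvl (k + 1) hk).node v hv).size]
  rw [← List.countP_eq_length_filter, ← List.countP_eq_length_filter]
  refine List.countP_mono_left fun w hw hwv => ?_
  simp only [decide_eq_true_eq] at hwv ⊢
  rw [(h.lvl k hk.le).code w hw v hv]
  have := ((h.lvl (k + 1) hk).code w hw v hv).1 hwv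
  have := (h.split k hk).digit v hv
  have := (h.split k hk).digit w hw
  omega

theorem size_pow (h : Inv e T ord x st) {v : ℕ} (hv : v ∈ ord) : ∀ k ≤ 5 * x,
    st.arr aSZ k (st.arr aHD k v) = 1 ∨
      32 ^ k * st.arr aSZ k (st.arr aHD k v) ≤ 25 ^ k * e.N := by
  intro k
  induction k with
  | zero =>
    intro _
    right
    simpa using (h.lvl 0 (by omega)).size_le h.fits hv
  | succ k ih =>
    intro hk
    have h1 := h.size_next hk hv
    have h2 := (h.lvl (k + 1) hk).size_pos hv
    rcases ih (by omega) with h3 | h3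
    · left; omega
    · rcases (h.split k hk).bal v hv with h4 | h4
      · left; omega
      · right
        have h5 := h.live k (by omega) v hv
        have h6 : 32 * st.arr aSZ (k + 1) (st.arr aHD (k + 1) v) ≤
          25 * st.arr aSZ k (st.arr aHD k v) := by omega
        calc 32 ^ (k + 1) * st.arr aSZ (k + 1) (st.arr aHD (k + 1) v)
            = 32 ^ k * (32 * st.arr aSZ (k + 1) (st.arr aHD (k + 1) v)) := by ring
          _ ≤ 32 ^ k * (25 * st.arr aSZ k (st.arr aHD k v)) := Nat.mul_le_mul_left _ h6
          _ = 25 * (32 ^ k * st.arr aSZ k (st.arr aHD k v)) := by ring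
          _ ≤ 25 * (25 ^ k * e.N) := Nat.mul_le_mul_left _ h3
          _ = 25 ^ (k + 1) * e.N := by ring

theorem size_last (h : Inv e T ord x st) {v : ℕ} (hv : v ∈ ord) :
    st.arr aSZ (5 * x) (st.arr aHD (5 * x) v) = 1 := by
  have h2 := (h.lvl (5 * x) le_rfl).size_pos hv
  rcases h.size_pow hv (5 * x) le_rfl with h1 | h1
  · exact h1
  · rw [h.N_eq, pow_mul, pow_mul, ← mul_pow] at h1
    -- Five levels reduce the size by `(25 / 32) ^ 5 < 1 / 3`; here `25 ^ 5 * 3 = 29296875` and `32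
    -- ^ 5 = 33554432`.
    have h3 : (25 ^ 5 * 3) ^ x ≤ (32 ^ 5) ^ x := Nat.pow_le_pow_left (by norm_num) x
    have h4 : 0 < (32 ^ 5) ^ x := by positivity
    by_contra hne
    have h5 : (32 ^ 5) ^ x * 2 ≤ (32 ^ 5) ^ x * st.arr aSZ (5 * x) (st.arr aHD (5 * x) v) :=
      Nat.mul_le_mul_left _ (by omega)
    omega

theorem code_ne (h : Inv e T ord x st) {v w : ℕ} (hv : v ∈ ord) (hw : w ∈ ord) (hne : v ≠ w) :
    st.arr aPP (5 * x) v ≠ st.arr aPP (5 * x) w := by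
  have hl := h.lvl (5 * x) le_rfl
  rw [Ne, ← hl.code v hv w hw]
  intro hh
  have h1 := (hl.node v hv).size
  rw [h.size_last hv] at h1
  obtain ⟨a, ha⟩ := List.length_eq_one_iff.1 h1.symm
  have h2 : v ∈ [a] := ha ▸ List.mem_filter.2 ⟨hv, by simp⟩
  have h3 : w ∈ [a] := ha ▸ List.mem_filter.2 ⟨hw, by simp [hh]⟩
  simp only [List.mem_singleton] at h2 h3
  exact hne (h2.trans h3.symm)

theorem hd_lt (h : Inv e T ord x st) {k : ℕ} (hk : k ≤ 5 * x) {v : ℕ} (hv : v ∈ ord) :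
    st.arr aHD k v < e.N := h.fits.lt _ ((h.lvl k hk).hd_mem v hv)

end Inv

/-! ### Joining a new leaf to the nodes of its parent -/

/-- Register `25` tells whether to go on to the next level. The level in register `14` advances only
then, so on exit the registers `13` and `14` describe the node to be rebuilt. The flag in register
`24` forces the loop to stop on level `0`, after a growth. -/
def insertBody : List At :=
  [.set 13 (.rd aHD (.reg 14) (.reg 0)), .set 9 (.rd aLS (.reg 14) (.reg 13)),
   .wr aNX (.reg 14) (.reg 1) (.reg 9), .wr aLS (.reg 14) (.reg 13) (.reg 1),
   .wr aSZ (.reg 14) (.reg 13) (.rd aSZ (.reg 14) (.reg 13) + .num 1),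
   .wr aHD (.reg 14) (.reg 1) (.reg 13),
   .wr aPP (.reg 14) (.reg 1) (.rd aPP (.reg 14) (.reg 0)),
   .wr aCR (.reg 14) (.reg 1) (.num 0),
   .wr aCR (.reg 14) (.reg 13) (.rd aCR (.reg 14) (.reg 13) + .num 1),
   .set 26 (.rd aIA (.reg 14) (.reg 0)),
   .wr aIA (.reg 14) (.reg 1) (.reg 26),
   .wr aIX (.reg 14) (.reg 1) (.ite .eq (.reg 26) (.reg 0) (.reg 1) (.rd aIX (.reg 14) (.reg 0))),
   .wr aIC (.reg 14) (.reg 1) (.rd aIC (.reg 14) (.reg 0)),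
   .set 25 (.ite .eq (.reg 24) (.num 1) (.num 0)
     (.ite .lt (.num 8 * .rd aCR (.reg 14) (.reg 13)) (.rd aSZ (.reg 14) (.reg 13))
       (.num 1) (.num 0))),
   .set 14 (.reg 14 + .reg 25)]

def insertLoop : Prog := whl .eq (.reg 25) (.num 1) (blk insertBody)

/-- The registers that keep their values, and the rows `≥ k` are unchanged. -/
structure FrI (k : ℕ) (st₀ st : HS) : Prop where
  reg : ∀ i ∈ [0, 1, 3, 4, 5, 24], st.reg i = st₀.reg i
  arr : ∀ f j v, f ≥ 9 ∨ k ≤ j → st.arr f j v = st₀.arr f j v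

theorem insert_body_vc {e : Env} {x y k : ℕ} {st₀ st : HS} (hk : k ≤ e.L) (hkV : k + 1 < e.V)
    (hx : x < e.N) (hy : y < e.N) (hxy : x ≠ y) (hh : st₀.arr aHD k x < e.N)
    (hhy : st₀.arr aHD k x ≠ y) (hNV : 8 * e.N + 8 < e.V)
    (hsz : st₀.arr aSZ k (st₀.arr aHD k x) ≤ e.N)
    (hcr : st₀.arr aCR k (st₀.arr aHD k x) ≤ e.N)
    (h0 : st₀.reg 0 = x) (h1 : st₀.reg 1 = y) (hf : FrI k st₀ st) (h14 : st.reg 14 = k) :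
    vc e insertBody st (fun st' => FrI (k + 1) st₀ st' ∧ InsAt x y k st₀ st' ∧
      (∀ f j v, j ≠ k → st'.arr f j v = st.arr f j v) ∧
      st'.reg 13 = st₀.arr aHD k x ∧
      st'.reg 25 = (if st₀.reg 24 = 1 then 0 else
        if 8 * (st₀.arr aCR k (st₀.arr aHD k x) + 1) < st₀.arr aSZ k (st₀.arr aHD k x) + 1
          then 1 else 0) ∧ st'.reg 14 = k + st'.reg 25) := by
  have hA : ∀ f v, st.arr f k v = st₀.arr f k v := fun f v => hf.arr f k v (Or.inr le_rfl)
  have r0 : st.reg 0 = x := (hf.reg 0 (by simp)).trans h0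
  have r1 : st.reg 1 = y := (hf.reg 1 (by simp)).trans h1
  have r24 : st.reg 24 = st₀.reg 24 := hf.reg 24 (by simp)
  obtain ⟨h, hhe⟩ : ∃ h, st₀.arr aHD k x = h := ⟨_, rfl⟩
  rw [hhe] at hh hhy hsz hcr ⊢
  have hyh := Ne.symm hhy
  have hyx := Ne.symm hxy
  have hAh : st.arr aHD k x = h := (hA _ _).trans hhe
  have hsz' : st.arr aSZ k h + 1 < e.V := by rw [hA]; omega
  have hcr' : st.arr aCR k h + 1 < e.V := by rw [hA]; omega
  have hcr'' : 8 * (st.arr aCR k h + 1) < e.V := by rw [hA]; omega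
  have one : 1 < e.V := by omega
  have zero : 0 < e.V := by omega
  simp only [insertBody, vc]
  simp +contextual [r0, r1, r24, h14, hk, hx, hy, hh, hAh, hhy, hxy, hsz', hcr', zero]
  intros
  have hb : (if st₀.reg 24 = 1 then 0 else if 8 * (st.arr aCR k h + 1) ≤ st.arr aSZ k h
      then 1 else 0) ≤ 1 := by split_ifs <;> omega
  refine ⟨by omega, fun _ => ⟨⟨fun i hi => ?_, fun f j v hfj => ?_⟩, ?_, by simp only [hA]⟩⟩
  · have := hf.reg i hi
    simp at hi
    rcases hi with rfl | rfl | rfl | rfl | rfl | rfl <;> simp [this]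
  · have := hf.arr f j v (by omega)
    rcases hfj with hfj | hfj
    · have h1 : ∀ a, a < 9 → f ≠ a := fun a ha => by omega
      simp [h1, this]
    · have h1 : j ≠ k := by omega
      simp [h1, this]
  · constructor
    all_goals simp +contextual [hhe, hhy, hyh, hA]

/-- `M` is a level on which the loop is known to stop: the last one, where the nodes are singletons,
or level `0` after a growth. -/
theorem insertLoop_wp {e : Env} (he : e.Ok) {x y M : ℕ} {st : HS} (hM : M ≤ e.L)
    (hMV : M + 1 < e.V) (hx : x < e.N) (hy : y < e.N) (hxy : x ≠ y)
    (hh : ∀ k ≤ M, st.arr aHD k x < e.N) (hhy : ∀ k ≤ M, st.arr aHD k x ≠ y)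
    (hNV : 8 * e.N + 8 < e.V) (hsz : ∀ k ≤ M, st.arr aSZ k (st.arr aHD k x) ≤ e.N)
    (hcr : ∀ k ≤ M, st.arr aCR k (st.arr aHD k x) ≤ e.N)
    (hfull : st.reg 24 = 1 ∨ st.arr aSZ M (st.arr aHD M x) + 1 ≤
      8 * (st.arr aCR M (st.arr aHD M x) + 1))
    (h0 : st.reg 0 = x) (h1 : st.reg 1 = y) (h14 : st.reg 14 = 0) (h25 : st.reg 25 = 1) :
    WP e insertLoop ((M + 2) * (blkCost insertBody + 3)) st (fun st' => ∃ k ≤ M,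
      FrI (k + 1) st st' ∧ (∀ j ≤ k, InsAt x y j st st') ∧ st'.reg 14 = k ∧
      st'.reg 13 = st.arr aHD k x ∧
      (∀ j < k, 8 * (st.arr aCR j (st.arr aHD j x) + 1) < st.arr aSZ j (st.arr aHD j x) + 1) ∧
      (st.reg 24 = 1 ∨ st.arr aSZ k (st.arr aHD k x) + 1 ≤
        8 * (st.arr aCR k (st.arr aHD k x) + 1))) := by
  refine (whl_wp he (fun n st' => (∃ k ≤ M, n = M + 1 - k ∧ st'.reg 25 = 1 ∧ FrI k st st' ∧
      (∀ j < k, InsAt x y j st st') ∧ st'.reg 14 = k ∧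
      ∀ j < k, 8 * (st.arr aCR j (st.arr aHD j x) + 1) < st.arr aSZ j (st.arr aHD j x) + 1) ∨
    (st'.reg 25 = 0 ∧ ∃ k ≤ M,
      FrI (k + 1) st st' ∧ (∀ j ≤ k, InsAt x y j st st') ∧ st'.reg 14 = k ∧
      st'.reg 13 = st.arr aHD k x ∧
      (∀ j < k, 8 * (st.arr aCR j (st.arr aHD j x) + 1) < st.arr aSZ j (st.arr aHD j x) + 1) ∧
      (st.reg 24 = 1 ∨ st.arr aSZ k (st.arr aHD k x) + 1 ≤
        8 * (st.arr aCR k (st.arr aHD k x) + 1)))) (blkCost insertBody)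
    (by simp [Ex.wf, Ex.wgt]) (by simp [Ex.wf, Ex.wgt]) ?_ (n := M + 1)
    (Or.inl ⟨0, by omega, rfl, h25, ⟨fun _ _ => rfl, fun _ _ _ _ => rfl⟩, by simp, h14,
      by simp⟩)).mono (by simp [Ex.cost]) ?_
  · rintro n st' h
    refine ⟨trivial, trivial, fun hc => ?_⟩
    simp only [Cmp.Holds, Ex.eval_reg, Ex.eval_num] at hc
    rcases h with ⟨k, hk, rfl, _, hf, hi, h14', hl⟩ | ⟨h, _⟩
    swap
    · omega
    refine ⟨M - k, by omega, (blk_wp he _ _ _ rfl (insert_body_vc (hk.trans hM) (by omega) hx hy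
      hxy (hh k hk) (hhy k hk) hNV (hsz k hk) (hcr k hk) h0 h1 hf h14')).mono le_rfl ?_⟩
    rintro st'' ⟨g1, g2, g3, g4, g5, g6⟩
    have hi' : ∀ j ≤ k, InsAt x y j st st'' := by
      intro j hj
      rcases hj.lt_or_eq with hj | rfl
      · have := hi j hj
        have hg : ∀ f v, st''.arr f j v = st'.arr f j v := fun f v => g3 f j v hj.ne
        constructor
        all_goals simp only [hg]
        exacts [this.new_hd, this.new_pp, this.new_nx, this.new_ia, this.new_ix, this.new_ic,
          this.new_cr, this.ls, this.sz, this.cr, this.old, this.old']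
      · exact g2
    by_cases hcont : st.reg 24 ≠ 1 ∧
        8 * (st.arr aCR k (st.arr aHD k x) + 1) < st.arr aSZ k (st.arr aHD k x) + 1
    · left
      rw [if_neg hcont.1, if_pos hcont.2] at g5
      have hkM : k ≠ M := by
        rintro rfl
        rcases hfull with h | h
        · exact hcont.1 h
        · omega
      refine ⟨k + 1, by omega, by omega, g5, g1, fun j hj => hi' j (by omega), by omega,
        fun j hj => ?_⟩
      rcases (Nat.lt_succ_iff.1 hj).lt_or_eq with hj | rfl
      · exact hl j hj
      · exact hcont.2
    · right
      have h25' : st''.reg 25 = 0 := by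
        rw [g5]
        split_ifs with h1 h2
        · rfl
        · exact absurd ⟨h1, h2⟩ hcont
        · rfl
      refine ⟨h25', k, hk, g1, hi', by omega, g4, hl, ?_⟩
      by_contra hno
      push Not at hno
      exact hcont ⟨hno.1, by omega⟩
  · rintro st' ⟨⟨n, h | h⟩, hc⟩
    · obtain ⟨k, _, _, h, _⟩ := h
      exact absurd h hc
    · exact h.2

/-! ### Insertion of a leaf and the potential -/

/-- The sum of all counters. -/
def pot (T : IncTree) (x : ℕ) (st : HS) : ℕ :=
  ∑ k ∈ Finset.range (5 * x + 1), ∑ v ∈ T.verts, st.arr aCR k v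

/-- A vertex and its head on level `k` have the same code there, hence the same prefix on every
level `j ≤ k`. -/
theorem Inv.hd_hd_le {e : Env} {T : IncTree} {ord : List ℕ} {x : ℕ} {st : HS}
    (h : Inv e T ord x st) {j k : ℕ} (hj : j ≤ k) (hk : k ≤ 5 * x) {v : ℕ} (hv : v ∈ ord) :
    st.arr aHD j (st.arr aHD k v) = st.arr aHD j v := by
  have h1 := (h.lvl k hk).hd_mem v hv
  have hdiv : ∀ w ∈ ord, st.arr aPP k w / 3 ^ (k - j) = st.arr aPP j w := fun w hw =>
    code_div (p := fun k => st.arr aPP k w) (K := 5 * x)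
      (fun i _ hi => (h.split i hi).digit w hw) k hj hk
  rw [(h.lvl j (hj.trans hk)).code _ h1 v hv, ← hdiv _ h1, ← hdiv v hv,
    ((h.lvl k hk).code _ h1 v hv).1 ((h.lvl k hk).hd_hd v hv)]

/-- The leaf `y` with parent `p` has joined the nodes of levels `0, …, k₀`. -/
structure Joined (p y k₀ : ℕ) (st st' : HS) : Prop where
  fr : FrI (k₀ + 1) st st'
  ins : ∀ j ≤ k₀, InsAt p y j st st'

/-- What is known after the rebuilding of a node. -/
structure Rebuilt (T : IncTree) (lst : List ℕ) (k₀ h₀ H : ℕ) (st st' : HS) : Prop where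
  fr : FrR k₀ h₀ lst st st'
  lvl : ∀ k, k₀ ≤ k → k ≤ H → LvlOn T lst k st'
  split : ∀ k, k₀ ≤ k → k < H → SplitOn T lst k st'
  cr : ∀ k, k₀ < k → k ≤ H → ∀ v ∈ lst, st'.arr aCR k v = 0

section
variable {e : Env} {T : IncTree} {ord lst : List ℕ} {x p y k₀ : ℕ} {st stm st' : HS}

theorem mem_rebuilt (hy : y ∉ ord)
    (hj : Joined p y k₀ st stm)
    (hlst : lst = (ord ++ [y]).filter (fun w => stm.arr aHD k₀ w = st.arr aHD k₀ p)) :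
    y ∈ lst ∧ ∀ v ∈ ord, v ∈ lst ↔ st.arr aHD k₀ v = st.arr aHD k₀ p := by
  subst hlst
  refine ⟨by simp [(hj.ins k₀ le_rfl).new_hd], fun v hv => ?_⟩
  have hvy : v ≠ y := fun h => hy (h ▸ hv)
  simp [hv, (hj.ins k₀ le_rfl).old aHD (by simp) v hvy]

theorem closed_rebuilt (hI : Inv e T ord x st) (hy : y ∉ ord)
    (hj : Joined p y k₀ st stm)
    (hlst : lst = (ord ++ [y]).filter (fun w => stm.arr aHD k₀ w = st.arr aHD k₀ p))
    {k : ℕ} (hk : k₀ ≤ k) (hkH : k ≤ 5 * x) {v : ℕ} (hv : v ∈ ord) :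
    st.arr aHD k v ∈ lst ↔ v ∈ lst := by
  have h := (mem_rebuilt hy hj hlst).2
  rw [h _ ((hI.lvl k hkH).hd_mem v hv), h v hv, hI.hd_hd_le hk hkH hv]

theorem rows_rebuilt (hI : Inv e T ord x st) (hk₀ : k₀ ≤ 5 * x) (hp : p ∈ ord) (hy : y ∉ ord)
    (hj : Joined p y k₀ st stm)
    (hlst : lst = (ord ++ [y]).filter (fun w => stm.arr aHD k₀ w = st.arr aHD k₀ p))
    {k : ℕ} (hk : k₀ ≤ k) {v : ℕ} (hv : v ∈ ord) (hl : v ∉ lst) {f : ℕ} (hf : f < 9) :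
    stm.arr f k v = st.arr f k v := by
  rcases hk.lt_or_eq with hk | rfl
  · exact hj.fr.arr f k v (Or.inr hk)
  · have hvy : v ≠ y := fun h => hy (h ▸ hv)
    have hvh : v ≠ st.arr aHD k₀ p := by
      rintro rfl
      exact hl (((mem_rebuilt hy hj hlst).2 _ hv).2 ((hI.lvl k₀ hk₀).hd_hd p hp))
    have h1 := (hj.ins k₀ le_rfl).old f
    have h2 := (hj.ins k₀ le_rfl).old' f
    simp only [List.mem_cons, List.not_mem_nil, or_false] at h1 h2
    by_cases h3 : f = 2 ∨ f = 3 ∨ f = 4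
    · exact h2 h3 v hvy hvh
    · exact h1 (by omega) v hvy

theorem glue_rebuilt (hI : Inv e T ord x st) (hk₀ : k₀ ≤ 5 * x) (hp : p ∈ ord) (hy : y ∉ ord)
    (hj : Joined p y k₀ st stm)
    (hlst : lst = (ord ++ [y]).filter (fun w => stm.arr aHD k₀ w = st.arr aHD k₀ p))
    (hr : Rebuilt (T.addLeaf p y) lst k₀ (st.arr aHD k₀ p) (5 * x) stm st')
    {k : ℕ} (hk : k₀ ≤ k) (hkH : k ≤ 5 * x) :
    Glue T (T.addLeaf p y) ord lst y k st st' where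
  new := (mem_rebuilt hy hj hlst).1
  notMem := hy
  filter := by
    conv_lhs => rw [hlst]
    refine List.filter_congr fun w hw => ?_
    rw [hlst]
    simp only [List.mem_filter, hw, true_and, Bool.decide_eq_true]
  parent v hv := parent_addLeaf fun h => hy (h ▸ hv)
  rows f hf v hv hl := by
    rw [hr.fr.arr f (by omega) k v (fun h => hl h.2.1),
      rows_rebuilt hI hk₀ hp hy hj hlst hk hv hl hf]
  closed v hv := closed_rebuilt hI hy hj hlst hk hkH hv
  -- Equal codes on level `k` would have equal prefixes on level `k₀`, but there the rebuilt
  -- vertices are exactly those whose code is that of `p`.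
  code v hv hl w hw := by
    intro hvw
    have hm := (mem_rebuilt hy hj hlst).2
    have h1 := code_div (p := fun k => st.arr aPP k v) (k₀ := k₀) (K := 5 * x)
      (fun i _ hi => (hI.split i hi).digit v hv) k hk hkH
    have h2 := code_div (p := fun k => st'.arr aPP k w) (k₀ := k₀) (K := 5 * x)
      (fun i hi hi' => (hr.split i hi hi').digit w hw) k hk hkH
    rw [hvw, h2, hr.fr.keep _ (by simp)] at h1
    refine hl ((hm v hv).2 (((hI.lvl k₀ hk₀).code v hv p hp).2 (h1.symm.trans ?_)))
    have hw' : w ∈ ord ++ [y] := by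
      rw [hlst] at hw; exact (List.mem_filter.1 hw).1
    rcases List.mem_append.1 hw' with hwo | hwy
    · have hwy : w ≠ y := fun h => hy (h ▸ hwo)
      rw [(hj.ins k₀ le_rfl).old aPP (by simp) w hwy]
      exact ((hI.lvl k₀ hk₀).code w hwo p hp).1 ((hm w hwo).1 hw)
    · obtain rfl : w = y := by simpa using hwy
      exact (hj.ins k₀ le_rfl).new_pp
  lvl := hI.lvl k hkH
  lvl' := hr.lvl k hk hkH

/-- Above level `k₀` the leaf has merely joined the nodes of `p`, whose counters are still small
(`SplitOn.insert`). From level `k₀` on, rebuilt and untouched nodes are combined (`Glue`). -/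
theorem Inv.rebuilt (hI : Inv e T ord x st) (hF : Fits e (T.addLeaf p y) (ord ++ [y]))
    (hk₀ : k₀ ≤ 5 * x) (hp : p ∈ ord) (hy : y ∉ ord) (hpy : st.arr aPAR 0 y = p)
    (hj : Joined p y k₀ st stm)
    (hlive : ∀ j < k₀, 8 * (st.arr aCR j (st.arr aHD j p) + 1) < st.arr aSZ j (st.arr aHD j p) + 1)
    (hlst : lst = (ord ++ [y]).filter (fun w => stm.arr aHD k₀ w = st.arr aHD k₀ p))
    (hr : Rebuilt (T.addLeaf p y) lst k₀ (st.arr aHD k₀ p) (5 * x) stm st') :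
    Inv e (T.addLeaf p y) (ord ++ [y]) x st' := by
  have hne : ∀ v ∈ ord, v ≠ y := fun v hv h => hy (h ▸ hv)
  have hglue : ∀ k, k₀ ≤ k → k ≤ 5 * x → Glue T (T.addLeaf p y) ord lst y k st st' := fun k h1 h2 =>
    glue_rebuilt hI hk₀ hp hy hj hlst hr h1 h2
  have hlow : ∀ f < 11, ∀ k < k₀, ∀ v, st'.arr f k v = stm.arr f k v := fun f hf k hk v =>
    hr.fr.arr f hf k v (by omega)
  have hlvm : ∀ k ≤ k₀, LvlOn (T.addLeaf p y) (ord ++ [y]) k stm := fun k hk =>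
    (hI.lvl k (hk.trans hk₀)).insert hp hy (hj.ins k hk)
  have hlvl : ∀ k ≤ 5 * x, LvlOn (T.addLeaf p y) (ord ++ [y]) k st' := by
    intro k hk
    rcases lt_or_ge k k₀ with h | h
    · exact (hlvm k h.le).congr fun f hf v _ => hlow f
        (by simp only [List.mem_cons, List.not_mem_nil, or_false] at hf; omega) k h v
    · exact (hglue k h hk).lvlOn
  have hlive0 : ∀ k < k₀, 8 * stm.arr aCR k (st.arr aHD k p) < stm.arr aSZ k (st.arr aHD k p) := by
    intro k hk
    rw [(hj.ins k hk.le).cr, (hj.ins k hk.le).sz]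
    exact hlive k hk
  have hhd : ∀ k ≤ k₀, ∀ v ∈ ord ++ [y], ∃ w ∈ ord, stm.arr aHD k v = st.arr aHD k w := by
    intro k hk v hv
    rcases List.mem_append.1 hv with hv | hv
    · exact ⟨v, hv, (hj.ins k hk).old _ (by simp) v (hne v hv)⟩
    · obtain rfl : v = y := by simpa using hv
      exact ⟨p, hp, (hj.ins k hk).new_hd⟩
  refine ⟨hF, hI.N_eq, hI.le_L, ?_, ?_, fun v hv => ?_, fun i hi => ?_, hlvl, fun k hk => ?_,
    fun k hk v hv => ?_, fun v hv => ?_⟩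
  · rw [hr.fr.reg 4 (by simp), hj.fr.reg 4 (by simp), hI.reg4]
  · rw [hr.fr.reg 5 (by simp), hj.fr.reg 5 (by simp), hI.reg5]
  · rw [hr.fr.arr aPAR (by norm_num) _ _ (by omega), hj.fr.arr _ _ _ (Or.inl (by norm_num))]
    rcases List.mem_append.1 hv with hv | hv
    · rw [parent_addLeaf (hne v hv)]
      exact hI.par v hv
    · obtain rfl : v = y := by simpa using hv
      rw [hpy]
      change p = Function.update T.parent v p v
      rw [Function.update_self]
  · rw [hr.fr.arr aTB (by norm_num) _ _ (by omega), hj.fr.arr _ _ _ (Or.inl (by norm_num))]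
    exact hI.tb i hi
  · rcases lt_or_ge k k₀ with h | h
    · refine ((hI.split k hk).insert hI.fits.ordered (hI.lvl k hk.le) (hI.lvl (k + 1) hk) hp hy
        (hlive0 k h) (hj.ins k h.le) (hj.ins (k + 1) h)).congr (hlvm k h.le) (hlvm (k + 1) h).hd_mem
        (fun f hf v _ => hlow f (by simp only [List.mem_cons, List.not_mem_nil, or_false] at hf
                                    omega) k h v) fun f hf v _ => ?_
      rcases (Nat.succ_le_of_lt h).lt_or_eq with h1 | h1
      · exact hlow f (by simp only [List.mem_cons, List.not_mem_nil, or_false] at hf; omega) _ h1 v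
      · rw [Nat.succ_eq_add_one] at h1
        rw [h1]
        refine hr.fr.keep f ?_ v
        simp only [List.mem_cons, List.not_mem_nil, or_false] at hf ⊢
        omega
    · exact (hglue k h hk.le).splitOn (hglue (k + 1) (by omega) hk) hI.fits.ordered
        (hI.split k hk) (hr.split k h hk)
  · rcases lt_trichotomy k k₀ with h | h | h
    · obtain ⟨w, hw, hvw⟩ := hhd k h.le v hv
      rw [hlow _ (by norm_num) k h, hlow _ (by norm_num) k h, hlow _ (by norm_num) k h, hvw]
      by_cases hg : st.arr aHD k w = st.arr aHD k p
      · rw [hg]; exact hlive0 k h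
      · have hy' := hne _ ((hI.lvl k hk).hd_mem w hw)
        rw [(hj.ins k h.le).old' _ (by simp) _ hy' hg, (hj.ins k h.le).old' _ (by simp) _ hy' hg]
        exact hI.live k hk w hw
    · subst h
      have hpos := (hlvl k hk).size_pos hv
      rw [hr.fr.keep aHD (by simp)] at hpos ⊢
      obtain ⟨w, hw, hvw⟩ := hhd k le_rfl v hv
      rw [hvw] at hpos ⊢
      by_cases hg : st.arr aHD k w = st.arr aHD k p
      · rw [hg] at hpos ⊢
        rw [hr.fr.cr_zero]
        omega
      · have hy' := hne _ ((hI.lvl k hk).hd_mem w hw)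
        rw [hr.fr.cr _ hg, hr.fr.keep aSZ (by simp), (hj.ins k le_rfl).old' _ (by simp) _ hy' hg,
          (hj.ins k le_rfl).old' _ (by simp) _ hy' hg]
        exact hI.live k hk w hw
    · have hpos := (hlvl k hk).size_pos hv
      have hg := hglue k h.le hk
      by_cases hl : v ∈ lst
      · rw [hr.cr k h hk _ (hg.lvl'.hd_mem v hl)]
        omega
      · have hv' := hg.mem_ord hv hl
        have h2 := hg.hd_out hv' hl
        rw [hg.rows aHD (by norm_num) v hv' hl, hg.rows _ (by norm_num) _ h2.1 h2.2,
          hg.rows _ (by norm_num) _ h2.1 h2.2]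
        exact hI.live k hk v hv'
  · have h1 : st'.arr aPP 0 v = stm.arr aPP 0 v := by
      rcases Nat.eq_zero_or_pos k₀ with h | h
      · subst h; exact hr.fr.keep _ (by simp) v
      · exact hlow _ (by norm_num) 0 h v
    rw [h1]
    rcases List.mem_append.1 hv with hv | hv
    · rw [(hj.ins 0 (by omega)).old _ (by simp) v (hne v hv)]
      exact hI.pp0 v hv
    · obtain rfl : v = y := by simpa using hv
      rw [(hj.ins 0 (by omega)).new_pp]
      exact hI.pp0 p hp

/-- Each of the `5 * x + 1` levels contributes at most `1` to the increase. On level `k₀` the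
increased counter of the node is reset, and on the lower levels counters of rebuilt vertices only
drop to `0`. -/
theorem pot_rebuilt (hI : Inv e T ord x st) (hk₀ : k₀ ≤ 5 * x) (hp : p ∈ ord) (hy : y ∉ ord)
    (hj : Joined p y k₀ st stm)
    (hlst : lst = (ord ++ [y]).filter (fun w => stm.arr aHD k₀ w = st.arr aHD k₀ p))
    (hr : Rebuilt (T.addLeaf p y) lst k₀ (st.arr aHD k₀ p) (5 * x) stm st') :
    pot (T.addLeaf p y) x st' + (st.arr aCR k₀ (st.arr aHD k₀ p) + 1) ≤ pot T x st + 5 * x + 1 := by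
  have hm : ∀ v, v ∈ ord ↔ v ∈ T.verts := hI.fits.ordered.mem
  have hyT : y ∉ T.verts := fun h => hy ((hm y).2 h)
  have hne : ∀ v ∈ T.verts, v ≠ y := fun v hv h => hyT (h ▸ hv)
  have hh : ∀ k ≤ 5 * x, st.arr aHD k p ∈ T.verts := fun k hk =>
    (hm _).1 ((hI.lvl k hk).hd_mem p hp)
  have hml := mem_rebuilt hy hj hlst
  have hlev : ∀ k ∈ Finset.range (5 * x + 1),
      ∑ v ∈ insert y T.verts, st'.arr aCR k v +
        (if k = k₀ then st.arr aCR k₀ (st.arr aHD k₀ p) + 1 else 0) ≤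
      ∑ v ∈ T.verts, st.arr aCR k v + 1 := by
    intro k hk
    have hk' : k ≤ 5 * x := by simpa [Nat.lt_succ_iff] using hk
    rw [Finset.sum_insert hyT]
    rcases lt_trichotomy k k₀ with h | h | h
    · have hi := hj.ins k h.le
      have hlow : ∀ v, st'.arr aCR k v = stm.arr aCR k v := fun v =>
        hr.fr.arr _ (by norm_num) k v (by omega)
      rw [if_neg h.ne, hlow, hi.new_cr, ← Finset.sum_erase_add _ _ (hh k hk'),
        ← Finset.sum_erase_add T.verts (fun v => st.arr aCR k v) (hh k hk'), hlow, hi.cr]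
      have : ∑ v ∈ T.verts.erase (st.arr aHD k p), st'.arr aCR k v =
          ∑ v ∈ T.verts.erase (st.arr aHD k p), st.arr aCR k v :=
        Finset.sum_congr rfl fun v hv => by
          rw [Finset.mem_erase] at hv
          rw [hlow, hi.old' _ (by simp) v (hne v hv.2) hv.1]
      omega
    · subst h
      have hi := hj.ins k le_rfl
      rw [if_pos rfl, hr.fr.cr y (hne _ (hh k hk')).symm, hi.new_cr,
        ← Finset.sum_erase_add _ _ (hh k hk'),
        ← Finset.sum_erase_add T.verts (fun v => st.arr aCR k v) (hh k hk'), hr.fr.cr_zero]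
      have : ∑ v ∈ T.verts.erase (st.arr aHD k p), st'.arr aCR k v =
          ∑ v ∈ T.verts.erase (st.arr aHD k p), st.arr aCR k v :=
        Finset.sum_congr rfl fun v hv => by
          rw [Finset.mem_erase] at hv
          rw [hr.fr.cr v hv.1, hi.old' _ (by simp) v (hne v hv.2) hv.1]
      omega
    · rw [if_neg h.ne', hr.cr k h hk' y hml.1]
      have : ∑ v ∈ T.verts, st'.arr aCR k v ≤ ∑ v ∈ T.verts, st.arr aCR k v :=
        Finset.sum_le_sum fun v hv => by
          by_cases hl : v ∈ lst
          · rw [hr.cr k h hk' v hl]; omega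
          · rw [(glue_rebuilt hI hk₀ hp hy hj hlst hr h.le hk').rows _ (by norm_num) v
              ((hm v).2 hv) hl]
      omega
  have hs := Finset.sum_le_sum hlev
  rw [Finset.sum_add_distrib, Finset.sum_add_distrib, Finset.sum_ite_eq' , if_pos
    (Finset.mem_range.2 (by omega)), Finset.sum_const, Finset.card_range] at hs
  simp only [smul_eq_mul, mul_one] at hs
  have : (T.addLeaf p y).verts = insert y T.verts := rfl
  rw [pot, pot, this]
  omega

/-- The number `c` is the counter that is reset. The rebuilt node has at most `8 * c` vertices, so
the drop of the potential pays for the rebuilding. -/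
theorem insert_wp (hI : Inv e T ord x st) (hF : Fits e (T.addLeaf p y) (ord ++ [y]))
    (hp : p ∈ ord) (hy : y ∉ ord) (hpy : st.arr aPAR 0 y = p) (h0 : st.reg 0 = p)
    (h1 : st.reg 1 = y) (h14 : st.reg 14 = 0) (h24 : st.reg 24 = 0) (h25 : st.reg 25 = 1) :
    ∃ c, 1 ≤ c ∧ WP e (.seq insertLoop rebuild)
      ((5 * x + 2) * (blkCost insertBody + 3) + (8 * c + 1) * (5 * x + 1) * rebuildCost) st
      (fun st' => Inv e (T.addLeaf p y) (ord ++ [y]) x st' ∧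
        pot (T.addLeaf p y) x st' + c ≤ pot T x st + 5 * x + 1) := by
  have hend : ∃ k, k ≤ 5 * x ∧ st.arr aSZ k (st.arr aHD k p) + 1 ≤
      8 * (st.arr aCR k (st.arr aHD k p) + 1) :=
    ⟨5 * x, le_rfl, by rw [hI.size_last hp]; omega⟩
  -- The loop stops on the least overfull level. This level is fixed beforehand because the time
  -- bound must not depend on the execution.
  obtain ⟨k₀, ⟨hk₀, hfull⟩, hmin⟩ : ∃ k, (k ≤ 5 * x ∧ st.arr aSZ k (st.arr aHD k p) + 1 ≤
      8 * (st.arr aCR k (st.arr aHD k p) + 1)) ∧ ∀ j < k, ¬ (j ≤ 5 * x ∧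
      st.arr aSZ j (st.arr aHD j p) + 1 ≤ 8 * (st.arr aCR j (st.arr aHD j p) + 1)) := by
    classical
    exact ⟨Nat.find hend, Nat.find_spec hend, fun j hj => Nat.find_min hend hj⟩
  have hne : ∀ v ∈ ord, v ≠ y := fun v hv h => hy (h ▸ hv)
  have hV : e.L + 1 ≤ 3 ^ e.L := Nat.lt_pow_self (by norm_num)
  have hsz : ∀ k ≤ 5 * x, st.arr aSZ k (st.arr aHD k p) ≤ e.N := fun k hk =>
    (hI.lvl k hk).size_le hI.fits hp
  refine ⟨st.arr aCR k₀ (st.arr aHD k₀ p) + 1, by omega, ?_⟩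
  refine ((insertLoop_wp hF.ok hI.le_L (by have := hF.pow_lt; have := hI.le_L; omega)
    (hI.fits.lt p hp) (hF.lt y (by simp)) (hne p hp) (fun k hk => hI.hd_lt hk hp)
    (fun k hk => hne _ ((hI.lvl k hk).hd_mem p hp)) hF.N_lt hsz
    (fun k hk => ?_) (Or.inr (by rw [hI.size_last hp]; omega)) h0 h1 h14 h25).seq
    (T₂ := (8 * (st.arr aCR k₀ (st.arr aHD k₀ p) + 1) + 1) * (5 * x + 1) * rebuildCost)
    ?_).mono le_rfl fun _ h => h
  · have := hI.live k hk p hp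
    have := hsz k hk
    omega
  rintro stm ⟨k, hk, hfr, hins, g14, g13, hlive, hst⟩
  have hst' : st.arr aSZ k (st.arr aHD k p) + 1 ≤ 8 * (st.arr aCR k (st.arr aHD k p) + 1) :=
    hst.resolve_left (by omega)
  obtain rfl : k = k₀ := by
    rcases lt_trichotomy k k₀ with h | h | h
    · exact absurd ⟨hk, hst'⟩ (hmin k h)
    · exact h
    · have := hlive k₀ h
      omega
  have hj : Joined p y k st stm := ⟨hfr, hins⟩
  have hlvm := (hI.lvl k hk).insert hp hy (hins k le_rfl)
  have hh := (hI.lvl k hk).hd_mem p hp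
  obtain ⟨lst, hlst⟩ : ∃ lst, lst = (ord ++ [y]).filter
    (fun w => stm.arr aHD k w = st.arr aHD k p) := ⟨_, rfl⟩
  have hhm : stm.arr aHD k (st.arr aHD k p) = st.arr aHD k p := by
    rw [(hins k le_rfl).old _ (by simp) _ (hne _ hh), (hI.lvl k hk).hd_hd p hp]
  have hlen : lst.length ≤ 8 * (st.arr aCR k (st.arr aHD k p) + 1) := by
    have h2 := (hlvm.node _ (List.mem_append_left _ hh)).size
    rw [hhm, ← hlst, (hins k le_rfl).sz] at h2
    omega
  have hpar : ∀ v ∈ ord ++ [y], stm.arr aPAR 0 v = (T.addLeaf p y).parent v := by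
    intro v hv
    rw [hfr.arr _ _ _ (Or.inl (by norm_num))]
    rcases List.mem_append.1 hv with hv | hv
    · rw [parent_addLeaf (hne v hv)]
      exact hI.par v hv
    · obtain rfl : v = y := by simpa using hv
      rw [hpy]
      change p = Function.update T.parent v p v
      rw [Function.update_self]
  refine (rebuild_wp hF hlvm (List.mem_append_left _ hh) hhm hlst hk hI.le_L
    (by rw [hfr.reg 5 (by simp), hI.reg5]) g13 g14 hpar ?_).mono ?_ ?_
  · intro w hw hl j hj1 hj2
    have hm := mem_rebuilt hy hj hlst
    have hwo : w ∈ ord := by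
      rcases List.mem_append.1 hw with hw | hw
      · exact hw
      · obtain rfl : w = y := by simpa using hw
        exact absurd hm.1 hl
    rw [rows_rebuilt hI hk hp hy hj hlst hj1 hwo hl (by norm_num),
      closed_rebuilt hI hy hj hlst hj1 hj2 hwo]
    exact hl
  · exact Nat.mul_le_mul_right _ (Nat.mul_le_mul (by omega) (by omega))
  · rintro st' ⟨h3, h4, h5, h6⟩
    have hr : Rebuilt (T.addLeaf p y) lst k (st.arr aHD k p) (5 * x) stm st' := ⟨h3, h4, h5, h6⟩
    exact ⟨hI.rebuilt hF hk hp hy hpy hj hlive hlst hr, pot_rebuilt hI hk hp hy hj hlst hr⟩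

end
/-! ### The query -/

theorem exists_switch {P : ℕ → Prop} {H : ℕ} (h0 : P 0) (hH : ¬ P H) :
    ∃ m < H, P m ∧ ¬ P (m + 1) := by
  induction H with
  | zero => exact absurd h0 hH
  | succ H ih =>
    by_cases h : P H
    · exact ⟨H, by omega, h, hH⟩
    · obtain ⟨m, h1, h2⟩ := ih h
      exact ⟨m, by omega, h2⟩

/-- All codes agree on level `0` and differ on the last level, so there is a level `m` after which
they part, with the digit `2` for `b` and `0` for `s`. Thus `b` is on side `1` and `s` on side `0`,
and `Ordered.isCa_join` gives the answer. -/
theorem Inv.query {e : Env} {T : IncTree} {ord : List ℕ} {x : ℕ} {st : HS}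
    (hI : Inv e T ord x st) {b s : ℕ} (hb : b ∈ ord) (hs : s ∈ ord)
    (hlt : st.arr aPP (5 * x) s < st.arr aPP (5 * x) b) :
    ∃ k, k < 5 * x ∧ tl (st.arr aPP (5 * x) b - st.arr aPP (5 * x) s) = 5 * x - k ∧
      T.IsCa b s (st.arr aIA k s)
        (if st.arr aIC k s = st.arr aIA k s then st.arr aIX k b else st.arr aIC k s)
        (st.arr aIX k s) := by
  obtain ⟨m, hm, h1, h2⟩ := exists_switch (P := fun k => st.arr aPP k b = st.arr aPP k s)
    (H := 5 * x) (by rw [hI.pp0 b hb, hI.pp0 s hs]) hlt.ne'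
  have hdiv : ∀ v ∈ ord, st.arr aPP (5 * x) v / 3 ^ (5 * x - (m + 1)) = st.arr aPP (m + 1) v :=
    fun v hv => code_div (p := fun k => st.arr aPP k v) (K := 5 * x)
      (fun i _ hi => (hI.split i hi).digit v hv) _ hm le_rfl
  obtain ⟨q, hq⟩ : ∃ q, q = 3 ^ (5 * x - (m + 1)) := ⟨_, rfl⟩
  have hq0 : 0 < q := by rw [hq]; positivity
  have d1 := hdiv b hb
  have d2 := hdiv s hs
  rw [← hq] at d1 d2
  have hle : st.arr aPP (m + 1) s ≤ st.arr aPP (m + 1) b := by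
    rw [← d1, ← d2]; exact Nat.div_le_div_right hlt.le
  have g1 := (hI.split m hm).digit b hb
  have g2 := (hI.split m hm).digit s hs
  have e1 : st.arr aPP (m + 1) b = 3 * st.arr aPP m b + 2 := by omega
  have e2 : st.arr aPP (m + 1) s = 3 * st.arr aPP m s := by omega
  rw [e1, Nat.div_eq_iff hq0] at d1
  rw [e2, Nat.div_eq_iff hq0] at d2
  rw [h1] at d1
  have hpow : 3 ^ (5 * x - (m + 1) + 1) = 3 * q := by rw [pow_succ, hq, mul_comm]
  refine ⟨m, hm, ?_, ?_⟩
  -- With a common prefix `p`, the code of `b` is in `[(3p + 2)q, (3p + 3)q)` and that of `s` in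
  -- `[3pq, (3p + 1)q)`. So the difference lies between `q` and `3q`, and its number of ternary
  -- digits does not depend on the lower digits.
  · rw [tl_eq (q := 5 * x - (m + 1))]
    · omega
    · rw [← hq]
      have : (3 * st.arr aPP m s + 2) * q = 3 * st.arr aPP m s * q + 2 * q := by ring
      omega
    · rw [hpow]
      have : (3 * st.arr aPP m s + 2) * q = 3 * st.arr aPP m s * q + 2 * q := by ring
      omega
  · have hh := ((hI.lvl m hm.le).code b hb s hs).2 h1
    obtain ⟨c, hc, hcv⟩ := (hI.split m hm).sep _ ((hI.lvl m hm.le).hd_mem s hs)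
    obtain ⟨c1, c2⟩ := hcv b hb hh
    obtain ⟨c3, c4, c5⟩ := c2 e1
    rw [c3] at c1
    exact hI.fits.ordered.isCa_join c1 c4 (hcv s hs rfl).1 (c5 s hs rfl e2)

def queryStart : List At :=
  [.set 18 (.rd aPP (.reg 5) (.reg 0)), .set 19 (.rd aPP (.reg 5) (.reg 1)),
   .set 20 (.ite .lt (.reg 18) (.reg 19) (.reg 1) (.reg 0)),
   .set 21 (.ite .lt (.reg 18) (.reg 19) (.reg 0) (.reg 1)),
   .set 22 (.ite .lt (.reg 18) (.reg 19) (.reg 19 - .reg 18) (.reg 18 - .reg 19)),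
   .set 7 (.num 0)]

def queryStep : List At := [.set 22 (.reg 22 / .reg 3), .set 7 (.reg 7 + .reg 4)]

def queryEnd : List At :=
  [.set 7 (.reg 7 + .rd0 aTB (.reg 22)), .set 14 (.reg 5 - .reg 7),
   .set 23 (.rd aIA (.reg 14) (.reg 21)), .set 24 (.rd aIX (.reg 14) (.reg 21)),
   .set 25 (.rd aIC (.reg 14) (.reg 21)),
   .set 26 (.ite .eq (.reg 25) (.reg 23) (.rd aIX (.reg 14) (.reg 20)) (.reg 25))]

/-- Write the answer. -/
def queryAns : List At :=
  [.set 18 (.ite .eq (.reg 0) (.reg 1) (.reg 0) (.reg 23)),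
   .set 19 (.ite .eq (.reg 0) (.reg 1) (.reg 0) (.ite .eq (.reg 20) (.reg 0) (.reg 26) (.reg 24))),
   .set 2 (.ite .eq (.reg 0) (.reg 1) (.reg 0) (.ite .eq (.reg 20) (.reg 0) (.reg 24) (.reg 26))),
   .set 0 (.reg 18), .set 1 (.reg 19)]

def queryProg : Prog :=
  .seq (blk queryStart) (.seq (whl .le (.reg 3) (.reg 22) (blk queryStep))
    (.seq (blk queryEnd) (blk queryAns)))

def queryCost : ℕ := blkCost queryStart + 6 * (blkCost queryStep + 3) + blkCost queryEnd +
  blkCost queryAns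

theorem query_wp {e : Env} {T : IncTree} {ord : List ℕ} {x : ℕ} {st : HS}
    (hI : Inv e T ord x st) (h3 : st.reg 3 = e.N) {v w : ℕ} (hv : v ∈ ord) (hw : w ∈ ord)
    (h0 : st.reg 0 = v) (h1 : st.reg 1 = w) :
    WP e queryProg queryCost st (fun st' => st'.arr = st.arr ∧
      (∀ i ∈ [3, 4, 5], st'.reg i = st.reg i) ∧
      T.IsCa v w (st'.reg 0) (st'.reg 1) (st'.reg 2)) := by
  have he := hI.fits.ok
  have hvN := hI.fits.lt v hv
  have hwN := hI.fits.lt w hw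
  have hL := hI.le_L
  have hLV : e.L + 1 ≤ 3 ^ e.L := Nat.lt_pow_self (by norm_num)
  have hV := hI.fits.pow_lt
  obtain ⟨b, s, hbs, hb, hs, hd⟩ : ∃ b s, (b = v ∧ s = w ∨ b = w ∧ s = v) ∧ b ∈ ord ∧ s ∈ ord ∧
      (if st.arr aPP (5 * x) v < st.arr aPP (5 * x) w then w else v) = b ∧
      (if st.arr aPP (5 * x) v < st.arr aPP (5 * x) w then v else w) = s ∧
      (if st.arr aPP (5 * x) v < st.arr aPP (5 * x) w then
        st.arr aPP (5 * x) w - st.arr aPP (5 * x) v else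
        st.arr aPP (5 * x) v - st.arr aPP (5 * x) w) =
        st.arr aPP (5 * x) b - st.arr aPP (5 * x) s ∧
      (v ≠ w → st.arr aPP (5 * x) s < st.arr aPP (5 * x) b) := by
    by_cases h : st.arr aPP (5 * x) v < st.arr aPP (5 * x) w
    · exact ⟨w, v, Or.inr ⟨rfl, rfl⟩, hw, hv, by simp [h]⟩
    · exact ⟨v, w, Or.inl ⟨rfl, rfl⟩, hv, hw, by
        have := hI.code_ne hv hw
        simp only [h, if_false, true_and]
        intro hne
        have := this hne
        omega⟩
  obtain ⟨hd1, hd2, hd3, hd4⟩ := hd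
  obtain ⟨d, hde⟩ : ∃ d, d = st.arr aPP (5 * x) b - st.arr aPP (5 * x) s := ⟨_, rfl⟩
  rw [← hde] at hd3
  have hdlt : d < 3 ^ (5 * x) := by
    have := (hI.lvl (5 * x) le_rfl).code_lt b hb
    omega
  have htl : tl d ≤ 5 * x := (Nat.digits_length_le_iff (by norm_num) d).2 hdlt
  have hstart : WP e (blk queryStart) (blkCost queryStart) st (fun st' => st'.arr = st.arr ∧
      (∀ i ∈ [0, 1, 3, 4, 5], st'.reg i = st.reg i) ∧ st'.reg 20 = b ∧ st'.reg 21 = s ∧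
      st'.reg 22 = d ∧ st'.reg 7 = 0) := by
    refine blk_wp he _ _ _ rfl ?_
    simp only [queryStart, vc]
    simp +contextual [h0, h1, hI.reg5, hL, hvN, hwN]
    intros
    exact ⟨hd1, hd2, hd3⟩
  have hloop : ∀ st₁ : HS, st₁.arr = st.arr ∧
      (∀ i ∈ [0, 1, 3, 4, 5], st₁.reg i = st.reg i) ∧ st₁.reg 20 = b ∧ st₁.reg 21 = s ∧
      st₁.reg 22 = d ∧ st₁.reg 7 = 0 →
      WP e (whl .le (.reg 3) (.reg 22) (blk queryStep)) (6 * (blkCost queryStep + 3)) st₁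
      (fun st' => st'.arr = st.arr ∧
      (∀ i ∈ [0, 1, 3, 4, 5], st'.reg i = st.reg i) ∧ st'.reg 20 = b ∧ st'.reg 21 = s ∧
      st'.reg 22 < e.N ∧ st'.reg 7 + tl (st'.reg 22) = tl d) := by
    rintro st₁ ⟨g1, g2, g3, g4, g5, g6⟩
    -- The difference is less than `3 ^ (5 * x) = N ^ 5`, so five divisions by `N` bring it into the
    -- range of the table. Each division removes `x` digits, which register `7` counts.
    refine (whl_wp he (fun n st' => st'.arr = st.arr ∧
      (∀ i ∈ [0, 1, 3, 4, 5], st'.reg i = st.reg i) ∧ st'.reg 20 = b ∧ st'.reg 21 = s ∧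
      st'.reg 22 < e.N ^ n ∧ st'.reg 7 + tl (st'.reg 22) = tl d) (blkCost queryStep)
      (by simp [Ex.wf, Ex.wgt]) (by simp [Ex.wf, Ex.wgt]) ?_ (n := 5)
      ⟨g1, g2, g3, g4, ?_, by rw [g5, g6, zero_add]⟩).mono (by simp [Ex.cost]) ?_
    · rintro n st₂ ⟨f1, f2, f3, f4, f5, f6⟩
      refine ⟨trivial, trivial, fun hc => ?_⟩
      have f23 : st₂.reg 3 = e.N := (f2 3 (by simp)).trans h3
      have f24 : st₂.reg 4 = x := (f2 4 (by simp)).trans hI.reg4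
      simp only [Cmp.Holds, Ex.eval_reg, f23] at hc
      have hN0 := he.N_pos
      cases n with
      | zero => simp at f5; omega
      | succ n =>
        refine ⟨n, rfl, blk_wp he _ _ _ rfl ?_⟩
        have f7 : tl (st₂.reg 22) = x + tl (st₂.reg 22 / e.N) := by
          rw [hI.N_eq] at hc ⊢
          exact tl_div hc
        have f8 : st₂.reg 22 / e.N < e.N ^ n := by
          rw [Nat.div_lt_iff_lt_mul hN0, ← pow_succ]; exact f5
        simp only [queryStep, vc]
        simp +contextual [f23, f24]
        intros
        have := f2 0 (by simp)
        have := f2 1 (by simp)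
        have := f2 5 (by simp)
        refine ⟨by omega, fun _ => ⟨f1, ⟨by assumption, by assumption, h3.symm, hI.reg4.symm,
          by assumption⟩, f3, f4, f8, by omega⟩⟩
    · rw [g5, hI.N_eq, ← pow_mul, mul_comm]; exact hdlt
    · rintro st₂ ⟨⟨n, f1, f2, f3, f4, f5, f6⟩, hc⟩
      simp only [Cmp.Holds, Ex.eval_reg, (f2 3 (by simp)).trans h3] at hc
      exact ⟨f1, f2, f3, f4, by omega, f6⟩
  refine (hstart.seq (T₂ := 6 * (blkCost queryStep + 3) +
    (blkCost queryEnd + blkCost queryAns)) fun st₁ g => (hloop st₁ g).seq ?_).mono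
    (by rw [queryCost]; omega) fun _ h => h
  rintro st₂ ⟨f1, f2, f3, f4, f5, f6⟩
  have r0 := (f2 0 (by simp)).trans h0
  have r1 := (f2 1 (by simp)).trans h1
  have r5 := (f2 5 (by simp)).trans hI.reg5
  have htb : st₂.reg 7 + st.arr aTB 0 (st₂.reg 22) = tl d := by rw [hI.tb _ f5, f6]
  have hbN := hI.fits.lt b hb
  have hsN := hI.fits.lt s hs
  have htV : tl d < e.V := by omega
  have hkL : 5 * x - tl d ≤ e.L := by omega
  have hans : v ≠ w → T.IsCa b s (st.arr aIA (5 * x - tl d) s)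
        (if st.arr aIC (5 * x - tl d) s = st.arr aIA (5 * x - tl d) s
          then st.arr aIX (5 * x - tl d) b else st.arr aIC (5 * x - tl d) s)
        (st.arr aIX (5 * x - tl d) s) := by
    intro hne
    obtain ⟨k, h4, h5, h6⟩ := hI.query hb hs (hd4 hne)
    rw [← hde] at h5
    have : 5 * x - tl d = k := by omega
    rw [this]
    exact h6
  obtain ⟨k, hk⟩ : ∃ k, k = 5 * x - tl d := ⟨_, rfl⟩
  rw [← hk] at hkL hans
  have hend : WP e (blk queryEnd) (blkCost queryEnd) st₂ (fun st' => st'.arr = st.arr ∧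
      (∀ i ∈ [0, 1, 3, 4, 5], st'.reg i = st.reg i) ∧ st'.reg 20 = b ∧
      st'.reg 23 = st.arr aIA k s ∧ st'.reg 24 = st.arr aIX k s ∧
      st'.reg 26 = if st.arr aIC k s = st.arr aIA k s then st.arr aIX k b
        else st.arr aIC k s) := by
    refine blk_wp he _ _ _ rfl ?_
    simp only [queryEnd, vc, Ex.rd0]
    simp +contextual [r5, f1, f3, f4, f5, htb, htV, hkL, hbN, hsN, ← hk]
    intros
    have := f2 0 (by simp)
    have := f2 1 (by simp)
    have := f2 3 (by simp)
    have := f2 4 (by simp)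
    have := f2 5 (by simp)
    refine ⟨by assumption, by assumption, by assumption, by assumption, by omega⟩
  refine hend.seq ?_
  rintro st₃ ⟨q1, q2, q3, q4, q5, q6⟩
  refine blk_wp he _ _ _ rfl ?_
  have r0 := (q2 0 (by simp)).trans h0
  have r1 := (q2 1 (by simp)).trans h1
  have q33 := q2 3 (by simp)
  have q34 := q2 4 (by simp)
  have q35 := q2 5 (by simp)
  rw [← q6, ← q4, ← q5] at hans
  simp only [queryAns, vc]
  -- For equal vertices the difference is `0` and the last level has been consulted. This is
  -- harmless: `queryAns` discards what was read.
  by_cases hvw : v = w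
  · subst hvw
    simp +contextual [r0, r1, q1, q33, q34, q35]
    intros
    exact isCa_self v
  · have hans' := hans hvw
    rcases hbs with ⟨rfl, rfl⟩ | ⟨rfl, rfl⟩
    · simp +contextual [r0, r1, q1, q33, q34, q35, hvw, q3]
      intros
      exact hans'
    · simp +contextual [r0, r1, q1, q33, q34, q35, hvw, q3, Ne.symm hvw]
      intros
      exact hans'.symm

/-! ### Growth -/

/-- The parameters with another row length. -/
def Env.withN (e : Env) (N : ℕ) : Env := { e with N := N }

/-- The arrays are read off the same memory with a new row length. The addresses of row `0` do not
involve the row length, so this row survives; the others become arbitrary unless the length is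
unchanged. -/
theorem Rel.restride {e : Env} {st : HS} {s : Config} (h : Rel e st s) (d : ℕ) (hd : d < 40) :
    ∃ st', Rel (e.withN (st.reg d)) st' (s.setReg 3 (s.reg d)) ∧
      (∀ i < 40, i ≠ 3 → st'.reg i = st.reg i) ∧
      (∀ f < 19, ∀ v < e.N, v < st.reg d → st'.arr f 0 v = st.arr f 0 v) ∧
      (st.reg d = e.N → ∀ f < 19, ∀ k, ∀ v < e.N, st'.arr f k v = st.arr f k v) := by
  refine ⟨⟨(s.setReg 3 (s.reg d)).reg, fun f k v => s.mem ((k * st.reg d + v) * 19 + f)⟩,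
    ⟨fun _ _ => rfl, fun i hi => ?_, ?_, fun _ _ _ _ _ => rfl, h.mem_lt⟩, fun i hi h3 => ?_,
    fun f hf v hv _ => ?_, fun he f hf k v hv => ?_⟩
  · simp only [Config.setReg, Function.update_apply]
    split_ifs
    · rw [h.reg d hd]; exact h.reg_lt d hd
    · rw [h.reg i hi]; exact h.reg_lt i hi
  · simp [Config.setReg, h.reg d hd, Env.withN]
  · simp only [Config.setReg, Function.update_of_ne h3]
    exact h.reg i hi
  · have := h.arr f hf 0 v hv
    simpa using this
  · simp only [he]
    exact h.arr f hf k v hv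

def growStart : List At :=
  [.set 20 (.reg 3), .set 21 (.reg 3), .set 24 (.num 0)]

def growStep : List At :=
  [.set 20 (.num 3 * .reg 20), .set 4 (.reg 4 + .num 1), .set 24 (.num 1)]

def fillStep : List At :=
  [.wr aTB (.num 0) (.reg 21) (.rd0 aTB (.reg 21 / .num 3) + .num 1),
   .set 21 (.reg 21 + .num 1)]

def growEnd : List At :=
  [.set 5 (.num 5 * .reg 4), .wr aPAR (.num 0) (.reg 1) (.reg 0), .set 14 (.num 0),
   .set 25 (.num 1)]

def growCount : Prog := .seq (blk growStart) (whl .le (.reg 20) (.reg 1) (blk growStep))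

def growFill : Prog := .seq (whl .lt (.reg 21) (.reg 3) (blk fillStep)) (blk growEnd)

/-- Increase the capacity until it exceeds `reg 1`, whose parent becomes `reg 0`. -/
def grow : Prog := .seq growCount (.seq (.copy 3 20) growFill)

theorem growCount_wp {e : Env} (he : e.Ok) {x x' y : ℕ} {st : HS} (hxx : x ≤ x') (hy : y < 3 ^ x')
    (hmin : ∀ i, x ≤ i → i < x' → 3 ^ i ≤ y) (hV : 3 ^ x' < e.V) (h1 : st.reg 1 = y)
    (h3 : st.reg 3 = 3 ^ x) (h4 : st.reg 4 = x) :
    WP e growCount (blkCost growStart + (x' - x + 1) * (blkCost growStep + 3)) st (fun st' =>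
      st'.arr = st.arr ∧ (∀ i ∈ [0, 1, 3], st'.reg i = st.reg i) ∧ st'.reg 4 = x' ∧
      st'.reg 20 = 3 ^ x' ∧ st'.reg 21 = 3 ^ x ∧ st'.reg 24 = if x < x' then 1 else 0) := by
  have hx' : x' < 3 ^ x' := Nat.lt_pow_self (by norm_num)
  have hstart : WP e (blk growStart) (blkCost growStart) st (fun st' => st'.arr = st.arr ∧
      (∀ i ∈ [0, 1, 3], st'.reg i = st.reg i) ∧ st'.reg 4 = x ∧ st'.reg 20 = 3 ^ x ∧
      st'.reg 21 = 3 ^ x ∧ st'.reg 24 = 0) := by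
    refine blk_wp he _ _ _ rfl ?_
    simp only [growStart, vc]
    simp +contextual [h3, h4]
  refine hstart.seq ?_
  rintro st₁ ⟨g1, g2, g3, g4, g5, g6⟩
  refine (whl_wp he (fun n st' => st'.arr = st.arr ∧ (∀ i ∈ [0, 1, 3], st'.reg i = st.reg i) ∧
    st'.reg 21 = 3 ^ x ∧ ∃ i, x ≤ i ∧ i ≤ x' ∧ n = x' - i ∧ st'.reg 4 = i ∧ st'.reg 20 = 3 ^ i ∧
      st'.reg 24 = if x < i then 1 else 0) (blkCost growStep)
    (by simp [Ex.wf, Ex.wgt]) (by simp [Ex.wf, Ex.wgt]) ?_ (n := x' - x)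
    ⟨g1, g2, g5, x, le_rfl, hxx, rfl, g3, g4, by simpa using g6⟩).mono (by simp [Ex.cost]) ?_
  · rintro n st₂ ⟨f1, f2, f3, i, f4, f5, rfl, f6, f7, f8⟩
    refine ⟨trivial, trivial, fun hc => ?_⟩
    have r1 := (f2 1 (by simp)).trans h1
    simp only [Cmp.Holds, Ex.eval_reg, f7, r1] at hc
    have hi : i < x' := by
      by_contra hi
      have : i = x' := by omega
      subst this
      omega
    refine ⟨x' - (i + 1), by omega, blk_wp he _ _ _ rfl ?_⟩
    have h5 : 3 * 3 ^ i < e.V := by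
      rw [← pow_succ']
      exact (Nat.pow_le_pow_right (by norm_num) hi).trans_lt hV
    have h6 : i + 1 < e.V := by omega
    have q0 := f2 0 (by simp)
    have q3 := f2 3 (by simp)
    simp only [growStep, vc]
    simp +contextual [f6, f7, h5, h6, f1, f3, r1, h1, q0, q3]
    intros
    exact ⟨by omega, by omega, (pow_succ' _ _).symm, by omega⟩
  · rintro st₂ ⟨⟨n, f1, f2, f3, i, f4, f5, -, f6, f7, f8⟩, hc⟩
    have r1 := (f2 1 (by simp)).trans h1
    simp only [Cmp.Holds, Ex.eval_reg, f7, r1] at hc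
    have hi : i = x' := by
      by_contra hi
      exact hc (hmin i f4 (by omega))
    subst hi
    exact ⟨f1, f2, f6, f7, f3, f8⟩

/-- The table is continued by the recurrence `tl i = tl (i / 3) + 1`. The entry `i / 3` is present
since the old capacity is positive. -/
theorem growFill_wp {e : Env} (he : e.Ok) {N x y p : ℕ} {st : HS} (hN : 0 < N) (hNN : N ≤ e.N)
    (hNV : 8 * e.N + 8 < e.V) (hxV : 5 * x < e.V) (hy : y < e.N) (h0 : st.reg 0 = p)
    (h1 : st.reg 1 = y) (h3 : st.reg 3 = e.N) (h4 : st.reg 4 = x) (h21 : st.reg 21 = N)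
    (htb : ∀ i < N, st.arr aTB 0 i = tl i) :
    WP e growFill ((e.N - N + 1) * (blkCost fillStep + 3) + blkCost growEnd) st (fun st' =>
      (∀ f < 9, ∀ k v, st'.arr f k v = st.arr f k v) ∧ (∀ i < e.N, st'.arr aTB 0 i = tl i) ∧
      (∀ v ≠ y, st'.arr aPAR 0 v = st.arr aPAR 0 v) ∧ st'.arr aPAR 0 y = p ∧
      (∀ i ∈ [0, 1, 4, 24], st'.reg i = st.reg i) ∧ st'.reg 5 = 5 * x ∧ st'.reg 14 = 0 ∧
      st'.reg 25 = 1) := by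
  have htl : ∀ i < e.N, tl i + 1 < e.V := fun i hi => by
    have : tl i ≤ i + 1 := by
      have h5 : i < 3 ^ (i + 1) := by
        have : i + 1 < 3 ^ (i + 1) := Nat.lt_pow_self (by norm_num)
        omega
      exact (Nat.digits_length_le_iff (by norm_num) i).2 h5
    omega
  refine ((whl_wp he (fun n st' => (∀ f ≠ aTB, ∀ k v, st'.arr f k v = st.arr f k v) ∧
    (∀ i ∈ [0, 1, 3, 4, 24], st'.reg i = st.reg i) ∧ ∃ j, N ≤ j ∧ j ≤ e.N ∧ n = e.N - j ∧
      st'.reg 21 = j ∧ ∀ i < j, st'.arr aTB 0 i = tl i) (blkCost fillStep)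
    (by simp [Ex.wf, Ex.wgt]) (by simp [Ex.wf, Ex.wgt]) ?_ (n := e.N - N)
    ⟨fun _ _ _ _ => rfl, fun _ _ => rfl, N, le_rfl, hNN, rfl, h21, htb⟩).seq
    (T₂ := blkCost growEnd) ?_).mono (by simp [Ex.cost]) fun _ h => h
  · rintro n st₂ ⟨f1, f2, j, f3, f4, rfl, f5, f6⟩
    refine ⟨trivial, trivial, fun hc => ?_⟩
    have r3 := (f2 3 (by simp)).trans h3
    simp only [Cmp.Holds, Ex.eval_reg, f5, r3] at hc
    refine ⟨e.N - (j + 1), by omega, blk_wp he _ _ _ rfl ?_⟩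
    have h5 : j / 3 < j := by omega
    have h6 := f6 _ h5
    have h7 : tl (j / 3) + 1 < e.V := htl _ (by omega)
    have h8 : j / 3 < e.N := by omega
    have h9 : j + 1 < e.V := by omega
    simp only [fillStep, vc, Ex.rd0]
    simp +contextual [f5, h6, h7, h8, h9, hc]
    have q0 := f2 0 (by simp)
    have q1 := f2 1 (by simp)
    have q3 := f2 3 (by simp)
    have q4 := f2 4 (by simp)
    have q24 := f2 24 (by simp)
    refine ⟨fun f hf k v => f1 f hf k v, ⟨q0, q1, q3, q4, q24⟩, by omega, fun i hi => ?_⟩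
    split_ifs with hij
    · rw [hij, ← tl_pos (by omega)]
    · exact f6 i (by omega)
  · rintro st₂ ⟨⟨n, f1, f2, j, f3, f4, -, f5, f6⟩, hc⟩
    have r3 := (f2 3 (by simp)).trans h3
    simp only [Cmp.Holds, Ex.eval_reg, f5, r3] at hc
    obtain rfl : j = e.N := by omega
    have r0 := (f2 0 (by simp)).trans h0
    have r1 := (f2 1 (by simp)).trans h1
    have r4 := (f2 4 (by simp)).trans h4
    have r24 := f2 24 (by simp)
    have one : 1 < e.V := by omega
    refine blk_wp he _ _ _ rfl ?_
    simp only [growEnd, vc]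
    simp +contextual [r0, r1, r4, r24, hxV, hy, one, h0, h1, h4, f6]
    intros
    refine ⟨fun f hf k v => ?_, fun v hv => ?_⟩
    · have : f ≠ 9 := by omega
      simp [this, f1 f (by omega) k v]
    · exact f1 _ (by norm_num) 0 v

def growCost : ℕ := blkCost growStart + blkCost growStep + blkCost fillStep + blkCost growEnd + 10

/-- Straight-line programs may not assign register `3`, as they preserve the representation; hence
the row length is changed by a bare `copy` between two phases, each of which is verified for its own
environment. -/
theorem grow_exec {e : Env} (he : e.Ok) {x x' y p : ℕ} {st : HS} {s : Config} (hR : Rel e st s)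
    (hN : e.N = 3 ^ x) (hxx : x ≤ x') (hy : y < 3 ^ x')
    (hmin : ∀ i, x ≤ i → i < x' → 3 ^ i ≤ y) (hV : 8 * 3 ^ x' + 8 < e.V)
    (hS : (e.L + 1) * 3 ^ x' * 19 ≤ e.S) (h0 : st.reg 0 = p) (h1 : st.reg 1 = y)
    (h4 : st.reg 4 = x) (htb : ∀ i < 3 ^ x, st.arr aTB 0 i = tl i) :
    ∃ s' st' t, Exec e.W e.S grow s s' t ∧
      t ≤ growCost * (x' - x + (3 ^ x' - 3 ^ x) + 1) ∧ Rel (e.withN (3 ^ x')) st' s' ∧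
      (∀ f < 9, ∀ v < 3 ^ x, st'.arr f 0 v = st.arr f 0 v) ∧
      (∀ v < 3 ^ x, v ≠ y → st'.arr aPAR 0 v = st.arr aPAR 0 v) ∧ st'.arr aPAR 0 y = p ∧
      (∀ i < 3 ^ x', st'.arr aTB 0 i = tl i) ∧
      (x' = x → ∀ f < 9, ∀ k, ∀ v < 3 ^ x, st'.arr f k v = st.arr f k v) ∧
      st'.reg 0 = p ∧ st'.reg 1 = y ∧ st'.reg 4 = x' ∧ st'.reg 5 = 5 * x' ∧
      st'.reg 14 = 0 ∧ st'.reg 24 = (if x < x' then 1 else 0) ∧ st'.reg 25 = 1 := by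
  have hle : 3 ^ x ≤ 3 ^ x' := Nat.pow_le_pow_right (by norm_num) hxx
  have hx' : x' < 3 ^ x' := Nat.lt_pow_self (by norm_num)
  have h3 : st.reg 3 = 3 ^ x := hR.stride.trans hN
  obtain ⟨s₁, st₁, t₁, E₁, c₁, R₁, a₁, r₁, b1, b2, b3, b4⟩ :=
    growCount_wp he hxx hy hmin (by omega) h1 h3 h4 s hR
  obtain ⟨st₂, R₂, r₂, a₂, a₂'⟩ := R₁.restride 20 (by norm_num)
  rw [b2] at R₂ a₂ a₂'
  have he' : (e.withN (3 ^ x')).Ok := ⟨he.pow_le, he.le_V, by simp [Env.withN], hS⟩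
  have hrow : ∀ f < 19, ∀ v < 3 ^ x, st₂.arr f 0 v = st.arr f 0 v := fun f hf v hv => by
    rw [a₂ f hf v (hN ▸ hv) (by omega), a₁]
  obtain ⟨s₃, st₃, t₃, E₃, c₃, R₃, d1, d2, d3, d4, d5, d6, d7, d8⟩ :=
    growFill_wp he' (N := 3 ^ x) (x := x') (y := y) (p := p) (by positivity) hle hV
      (by simp only [Env.withN]; omega) hy
      (by rw [r₂ 0 (by norm_num) (by norm_num), r₁ 0 (by simp), h0])
      (by rw [r₂ 1 (by norm_num) (by norm_num), r₁ 1 (by simp), h1]) R₂.stride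
      (by rw [r₂ 4 (by norm_num) (by norm_num), b1])
      (by rw [r₂ 21 (by norm_num) (by norm_num), b3])
      (fun i hi => by rw [hrow _ (by norm_num) i hi, htb i hi]) _ R₂
  refine ⟨s₃, st₃, _, Exec.seq _ _ _ _ _ _ _ E₁ (Exec.seq _ _ _ _ _ _ _ (Exec.copy _ _ _) E₃), ?_,
    R₃, fun f hf v hv => ?_, fun v hv hvy => ?_, d4, d2, fun hx f hf k v hv => ?_, ?_, ?_, ?_, d6,
    d7, ?_, d8⟩
  · have c₃' : t₃ ≤ (3 ^ x' - 3 ^ x + 1) * (blkCost fillStep + 3) + blkCost growEnd := c₃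
    simp only [growCost]
    generalize 3 ^ x' - 3 ^ x = A at *
    generalize x' - x = B at *
    nlinarith
  · rw [d1 f hf, hrow f (by omega) v hv]
  · rw [d3 v hvy, hrow _ (by norm_num) v hv]
  · subst hx
    rw [d1 f hf, a₂' hN.symm f (by omega) k v (hN ▸ hv), a₁]
  · rw [d5 0 (by simp), r₂ 0 (by norm_num) (by norm_num), r₁ 0 (by simp), h0]
  · rw [d5 1 (by simp), r₂ 1 (by norm_num) (by norm_num), r₁ 1 (by simp), h1]
  · rw [d5 4 (by simp), r₂ 4 (by norm_num) (by norm_num), b1]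
  · rw [d5 24 (by simp), r₂ 24 (by norm_num) (by norm_num), b4]

theorem Inv.congr {e : Env} {T : IncTree} {ord : List ℕ} {x : ℕ} {st st' : HS}
    (h : Inv e T ord x st) (h4 : st'.reg 4 = st.reg 4) (h5 : st'.reg 5 = st.reg 5)
    (hs : ∀ f < 9, ∀ k, ∀ v < e.N, st'.arr f k v = st.arr f k v)
    (hpar : ∀ v ∈ ord, st'.arr aPAR 0 v = st.arr aPAR 0 v)
    (htb : ∀ i < e.N, st'.arr aTB 0 i = tl i) : Inv e T ord x st' where
  fits := h.fits
  N_eq := h.N_eq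
  le_L := h.le_L
  reg4 := h4.trans h.reg4
  reg5 := h5.trans h.reg5
  par v hv := (hpar v hv).trans (h.par v hv)
  tb := htb
  lvl k hk := (h.lvl k hk).congr fun f hf v hv => hs f
    (by simp only [List.mem_cons, List.not_mem_nil, or_false] at hf; omega) k v (h.fits.lt v hv)
  split k hk := (h.split k hk).congr (h.lvl k hk.le) (h.lvl (k + 1) hk).hd_mem
    (fun f hf v hv => hs f
      (by simp only [List.mem_cons, List.not_mem_nil, or_false] at hf; omega) k v (h.fits.lt v hv))
    (fun f hf v hv => hs f
      (by simp only [List.mem_cons, List.not_mem_nil, or_false] at hf; omega) _ v (h.fits.lt v hv))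
  live k hk v hv := by
    rw [hs _ (by norm_num) k v (h.fits.lt v hv), hs _ (by norm_num) k _ (h.hd_lt hk hv),
      hs _ (by norm_num) k _ (h.hd_lt hk hv)]
    exact h.live k hk v hv
  pp0 v hv := by rw [hs _ (by norm_num) 0 v (h.fits.lt v hv)]; exact h.pp0 v hv

/-- Row `0` and the tables suffice to establish the whole invariant. Below level `0` all counters
are reset, so the potential is what row `0` contributes outside the head. -/
theorem rebuildAll_wp {e : Env} {T : IncTree} {ord : List ℕ} {x h : ℕ} {st : HS}
    (hF : Fits e T ord) (hN : e.N = 3 ^ x) (hL : 5 * x ≤ e.L) (h4 : st.reg 4 = x)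
    (h5 : st.reg 5 = 5 * x) (h13 : st.reg 13 = h) (h14 : st.reg 14 = 0)
    (hpar : ∀ v ∈ ord, st.arr aPAR 0 v = T.parent v) (htb : ∀ i < e.N, st.arr aTB 0 i = tl i)
    (hlv : LvlOn T ord 0 st) (hpp : ∀ v ∈ ord, st.arr aPP 0 v = 0) (hh : h ∈ ord)
    (hall : ∀ v ∈ ord, st.arr aHD 0 v = h) :
    WP e rebuild ((ord.length + 1) * (5 * x + 1) * rebuildCost) st (fun st' =>
      Inv e T ord x st' ∧ pot T x st' ≤ ∑ v ∈ T.verts.erase h, st.arr aCR 0 v) := by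
  have hlst : ord = ord.filter (fun w => st.arr aHD 0 w = h) := by
    refine (List.filter_eq_self.2 fun v hv => ?_).symm
    simp [hall v hv]
  refine (rebuild_wp hF hlv hh (hall h hh) hlst (Nat.zero_le _) hL h5 h13 h14 hpar
    fun w hw hw' => absurd hw hw').mono le_rfl ?_
  rintro st' ⟨h1, h2, h3, h6⟩
  have hlv' : ∀ k ≤ 5 * x, LvlOn T ord k st' := fun k hk => h2 k (Nat.zero_le _) hk
  refine ⟨⟨hF, hN, hL, ?_, ?_, fun v hv => ?_, fun i hi => ?_, hlv',
    fun k hk => h3 k (Nat.zero_le _) hk, fun k hk v hv => ?_, fun v hv => ?_⟩, ?_⟩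
  · rw [h1.reg 4 (by simp), h4]
  · rw [h1.reg 5 (by simp), h5]
  · rw [h1.arr _ (by norm_num) _ _ (by omega), hpar v hv]
  · rw [h1.arr _ (by norm_num) _ _ (by omega), htb i hi]
  · have hpos := (hlv' k hk).size_pos hv
    have hm := (hlv' k hk).hd_mem v hv
    rcases Nat.eq_zero_or_pos k with rfl | hk0
    · rw [h1.keep aHD (by simp), hall v hv] at hpos ⊢
      rw [h1.cr_zero]
      omega
    · rw [h6 k hk0 hk _ hm]
      omega
  · rw [h1.keep _ (by simp), hpp v hv]
  · rw [pot, Finset.sum_range_succ']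
    have hz : ∑ k ∈ Finset.range (5 * x), ∑ v ∈ T.verts, st'.arr aCR (k + 1) v = 0 :=
      Finset.sum_eq_zero fun k hk => Finset.sum_eq_zero fun v hv =>
        h6 (k + 1) (by omega) (Finset.mem_range.1 hk) v ((hF.ordered.mem v).2 hv)
    have h0 : ∑ v ∈ T.verts.erase h, st'.arr aCR 0 v = ∑ v ∈ T.verts.erase h, st.arr aCR 0 v :=
      Finset.sum_congr rfl fun v hv => h1.cr v (Finset.ne_of_mem_erase hv)
    rw [hz, ← Finset.sum_erase_add _ _ ((hF.ordered.mem h).1 hh), h1.cr_zero, h0]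
    omega

/-- After a growth only row `0` is meaningful. The flag in register `24` stops the insertion at
level `0`, so the node of all vertices is rebuilt, including the new leaf. -/
theorem regrow_wp {e : Env} {T : IncTree} {ord : List ℕ} {x p y : ℕ} {st : HS}
    (hF : Fits e (T.addLeaf p y) (ord ++ [y])) (hN : e.N = 3 ^ x) (hL : 5 * x ≤ e.L)
    (h0 : st.reg 0 = p) (h1 : st.reg 1 = y) (h4 : st.reg 4 = x) (h5 : st.reg 5 = 5 * x)
    (h14 : st.reg 14 = 0) (h24 : st.reg 24 = 1) (h25 : st.reg 25 = 1)
    (hpar : ∀ v ∈ ord, st.arr aPAR 0 v = T.parent v) (hpy : st.arr aPAR 0 y = p)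
    (htb : ∀ i < e.N, st.arr aTB 0 i = tl i) (hlv : LvlOn T ord 0 st)
    (hpp : ∀ v ∈ ord, st.arr aPP 0 v = 0) (hm : ∀ v, v ∈ ord ↔ v ∈ T.verts) (hp : p ∈ ord)
    (hy : y ∉ ord) (hsz : st.arr aSZ 0 (st.arr aHD 0 p) ≤ e.N)
    (hcr : st.arr aCR 0 (st.arr aHD 0 p) ≤ e.N) :
    WP e (.seq insertLoop rebuild)
      (2 * (blkCost insertBody + 3) + (ord.length + 2) * (5 * x + 1) * rebuildCost) st
      (fun st' => Inv e (T.addLeaf p y) (ord ++ [y]) x st' ∧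
        pot (T.addLeaf p y) x st' ≤ ∑ v ∈ T.verts, st.arr aCR 0 v) := by
  have hne : ∀ v ∈ ord, v ≠ y := fun v hv h => hy (h ▸ hv)
  have hh := hlv.hd_mem p hp
  refine ((insertLoop_wp (M := 0) hF.ok (Nat.zero_le _) (by have := hF.N_lt; omega)
    (hF.lt p (by simp [hp])) (hF.lt y (by simp)) (hne p hp)
    (fun k hk => by
      obtain rfl : k = 0 := by omega
      exact hF.lt _ (by simp [hh]))
    (fun k hk => by
      obtain rfl : k = 0 := by omega
      exact hne _ hh) hF.N_lt
    (fun k hk => by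
      obtain rfl : k = 0 := by omega
      exact hsz)
    (fun k hk => by
      obtain rfl : k = 0 := by omega
      exact hcr) (Or.inl h24) h0 h1 h14 h25).seq
    (T₂ := (ord.length + 2) * (5 * x + 1) * rebuildCost) ?_).mono (by simp) fun _ h => h
  rintro stm ⟨k, hk, hfr, hins, g14, g13, -, -⟩
  obtain rfl : k = 0 := by omega
  have hi := hins 0 le_rfl
  have hlvm := hlv.insert hp hy hi
  have hppm : ∀ v ∈ ord ++ [y], stm.arr aPP 0 v = 0 := by
    intro v hv
    rcases List.mem_append.1 hv with hv | hv
    · rw [hi.old _ (by simp) v (hne v hv), hpp v hv]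
    · obtain rfl : v = y := by simpa using hv
      rw [hi.new_pp, hpp p hp]
  have hh' : st.arr aHD 0 p ∈ ord ++ [y] := List.mem_append_left _ hh
  have hhh : stm.arr aHD 0 (st.arr aHD 0 p) = st.arr aHD 0 p := by
    rw [hi.old _ (by simp) _ (hne _ hh), hlv.hd_hd p hp]
  refine (rebuildAll_wp hF hN hL (by rw [hfr.reg 4 (by simp), h4])
    (by rw [hfr.reg 5 (by simp), h5]) g13 g14 (fun v hv => ?_)
    (fun i hi => by rw [hfr.arr _ _ _ (Or.inl (by norm_num)), htb i hi]) hlvm hppm hh'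
    fun v hv => ?_).mono (by simp) ?_
  · rw [hfr.arr _ _ _ (Or.inl (by norm_num))]
    rcases List.mem_append.1 hv with hv | hv
    · rw [parent_addLeaf (hne v hv)]
      exact hpar v hv
    · obtain rfl : v = y := by simpa using hv
      rw [hpy]
      change p = Function.update T.parent v p v
      rw [Function.update_self]
  · rw [← hhh, hlvm.code v hv _ hh', hppm v hv, hppm _ hh']
  · rintro st' ⟨h6, h7⟩
    refine ⟨h6, h7.trans ?_⟩
    have hyT : y ∉ T.verts := fun h => hy ((hm y).2 h)
    have hv : (T.addLeaf p y).verts = insert y T.verts := rfl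
    rw [hv, Finset.erase_insert_of_ne (hne _ hh).symm, Finset.sum_insert (by simp [hyT]),
      hi.new_cr, zero_add]
    refine (Finset.sum_le_sum fun v hv => ?_).trans
      (Finset.sum_le_sum_of_subset (Finset.erase_subset _ _))
    rw [Finset.mem_erase] at hv
    exact (hi.old' _ (by simp) v (fun h => hyT (h ▸ hv.2)) hv.1).le

/-! ### Amortized analysis -/

/-- The parameters of the machine suit `n` vertices. -/
structure Base (W S V n : ℕ) : Prop where
  n_pos : 0 < n
  pow_le : V ^ 40 ≤ W
  le_V : 100 ≤ V
  N_lt : 24 * n + 8 < V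
  pow_lt : 3 ^ (5 * lg n) < V
  space : (5 * lg n + 1) * (3 * n) * 19 ≤ S

/-- This bounds the number of growths and, as the capacity is at most `3 * n`, the number of rows.
-/
theorem le_lg {n x : ℕ} (hn : 0 < n) (h : 3 ^ x ≤ 3 * n) : x ≤ lg n := by
  rcases x with _ | x
  · omega
  · have h1 : 2 ^ x ≤ n := by
      have : 2 ^ x ≤ 3 ^ x := Nat.pow_le_pow_left (by norm_num) x
      rw [pow_succ] at h
      omega
    have := (Nat.le_log_iff_pow_le (by norm_num) (by omega)).2 h1
    rw [lg]
    omega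

theorem length_le_of_lt {l : List ℕ} {n : ℕ} (hl : l.Nodup) (h : ∀ v ∈ l, v < n) : l.length ≤ n := by
  rw [← List.toFinset_card_of_nodup hl, ← Finset.card_range n]
  refine Finset.card_le_card fun v hv => ?_
  exact Finset.mem_range.2 (h v (List.mem_toFinset.1 hv))

theorem Base.fits {W S V n N : ℕ} (h : Base W S V n) {T : IncTree} {ord : List ℕ} (hN : 0 < N)
    (hNn : N ≤ 3 * n) (hT : T.Ordered ord) (ho : ∀ v ∈ ord, v < N) :
    Fits ⟨W, S, V, N, 5 * lg n⟩ T ord where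
  ok := ⟨h.pow_le, h.le_V, hN, le_trans (Nat.mul_le_mul_right _ (Nat.mul_le_mul_left _ hNn)) h.space⟩
  N_lt := by have := h.N_lt; simp only; omega
  pow_lt := h.pow_lt
  ordered := hT
  lt := ho

/-- The cost of building everything anew. -/
def growthCost (n : ℕ) : ℕ := growCost * (lg n + 3 * n + 1) + 2 * (blkCost insertBody + 3) +
  (n + 1) * (5 * lg n + 1) * rebuildCost

def potFactor (n : ℕ) : ℕ := 9 * (5 * lg n + 1) * rebuildCost

/-- The amortized cost of an insertion. -/
def leafCost (n : ℕ) : ℕ := growCost + (5 * lg n + 2) * (blkCost insertBody + 3) +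
  potFactor n * (5 * lg n + 1)

/-- The configuration `s` represents the tree `T`, with potential at most `P`. -/
def Ready (W S V n : ℕ) (T : IncTree) (s : Config) (P : ℕ) : Prop :=
  ∃ x ord st, Rel ⟨W, S, V, 3 ^ x, 5 * lg n⟩ st s ∧ Inv ⟨W, S, V, 3 ^ x, 5 * lg n⟩ T ord x st ∧
    3 ^ x ≤ 3 * n ∧ (∀ v ∈ ord, v < n) ∧
    -- The potential has two parts: the counters pay for the rebuilding of nodes, and every value
    -- that the exponent can still take up to `lg n` pays for one growth.
    potFactor n * pot T x st + (lg n - x) * growthCost n ≤ P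

theorem args_rel {e : Env} {st : HS} {s : Config} (h : Rel e st s) {v w : ℕ} (hv : v < e.V)
    (hw : w < e.V) : Rel e ((st.set 0 v).set 1 w) ((s.setReg 0 v).setReg 1 w) := by
  have h1 : Rel e (st.set 0 v) (s.setReg 0 v) :=
    h.set (by norm_num) hv rfl (fun j _ hj => by simp [Config.setReg, Function.update_of_ne hj])
      (by simp [Config.setReg])
  exact h1.set (by norm_num) hw rfl
    (fun j _ hj => by simp [Config.setReg, Function.update_of_ne hj]) (by simp [Config.setReg])

/-- For the least suitable exponent, either nothing changes or a third of the new capacity is at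
most `y < n`. -/
theorem exists_exponent {n x y : ℕ} (hy : y < n) (hx : 3 ^ x ≤ 3 * n) :
    ∃ x', x ≤ x' ∧ y < 3 ^ x' ∧ (∀ i, x ≤ i → i < x' → 3 ^ i ≤ y) ∧ 3 ^ x' ≤ 3 * n := by
  have hex : ∃ j, x ≤ j ∧ y < 3 ^ j := by
    refine ⟨x + y, by omega, ?_⟩
    have : x + y < 3 ^ (x + y) := Nat.lt_pow_self (by norm_num)
    omega
  classical
  refine ⟨Nat.find hex, (Nat.find_spec hex).1, (Nat.find_spec hex).2, fun i h1 h2 => ?_, ?_⟩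
  · have := Nat.find_min hex h2
    omega
  · rcases (Nat.find_spec hex).1.eq_or_lt with h | h
    · rw [← h]; exact hx
    · have h1 := Nat.find_min hex (m := Nat.find hex - 1) (by omega)
      have h2 : 3 ^ Nat.find hex = 3 * 3 ^ (Nat.find hex - 1) := by
        rw [← pow_succ']; congr 1; omega
      omega

theorem Ready.query {W S V n : ℕ} {T : IncTree} {s : Config} {P : ℕ} (hB : Base W S V n)
    (h : Ready W S V n T s P) {v w : ℕ} (hv : v ∈ T.verts) (hw : w ∈ T.verts) :
    ∃ s' t, Exec W S queryProg ((s.setReg 0 v).setReg 1 w) s' t ∧ t ≤ queryCost ∧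
      T.IsCa v w (s'.reg 0) (s'.reg 1) (s'.reg 2) ∧ Ready W S V n T s' P := by
  obtain ⟨x, ord, st, hR, hI, hx, hn, hP⟩ := h
  have hv' := (hI.fits.ordered.mem v).2 hv
  have hw' := (hI.fits.ordered.mem w).2 hw
  have hnV := hB.N_lt
  have hvn := hn v hv'
  have hwn := hn w hw'
  have hR₂ := args_rel hR (v := v) (w := w) (by simp only; omega) (by simp only; omega)
  have hI₂ : Inv ⟨W, S, V, 3 ^ x, 5 * lg n⟩ T ord x ((st.set 0 v).set 1 w) :=
    hI.congr rfl rfl (fun _ _ _ _ _ => rfl) (fun _ _ => rfl) hI.tb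
  obtain ⟨s', st', t, E, c, R, h1, h2, h3⟩ :=
    query_wp hI₂ hR₂.stride hv' hw' (by simp) (by simp) _ hR₂
  rw [← R.reg 0 (by norm_num), ← R.reg 1 (by norm_num), ← R.reg 2 (by norm_num)] at h3
  refine ⟨s', t, E, c, h3, x, ord, st', R, hI.congr ?_ ?_ (fun _ _ _ _ _ => by rw [h1]; rfl)
    (fun _ _ => by rw [h1]; rfl) (fun i hi => by rw [h1]; exact hI.tb i hi), hx, hn, ?_⟩
  · rw [h2 4 (by simp)]; rfl
  · rw [h2 5 (by simp)]; rfl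
  · rw [pot, h1]; exact hP

def addLeafProg : Prog := .seq grow (.seq insertLoop rebuild)

theorem Ready.addLeaf {W S V n : ℕ} {T : IncTree} {s : Config} {P : ℕ} (hB : Base W S V n)
    (h : Ready W S V n T s P) {p y : ℕ} (hp : p ∈ T.verts) (hy : y ∉ T.verts) (hyn : y < n) :
    ∃ s' t P', Exec W S addLeafProg ((s.setReg 0 p).setReg 1 y) s' t ∧
      Ready W S V n (T.addLeaf p y) s' P' ∧ t + P' ≤ P + leafCost n := by
  obtain ⟨x, ord, st, hR, hI, hx, hn, hP⟩ := h
  have hp' := (hI.fits.ordered.mem p).2 hp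
  have hy' : y ∉ ord := fun h => hy ((hI.fits.ordered.mem y).1 h)
  have hnV := hB.N_lt
  have hpn := hn p hp'
  have hR₂ := args_rel hR (v := p) (w := y) (by simp only; omega) (by simp only; omega)
  have hI₂ : Inv ⟨W, S, V, 3 ^ x, 5 * lg n⟩ T ord x ((st.set 0 p).set 1 y) :=
    hI.congr rfl rfl (fun _ _ _ _ _ => rfl) (fun _ _ => rfl) hI.tb
  obtain ⟨x', hxx, hyx, hmin, hx'⟩ := exists_exponent hyn hx
  have hxl := le_lg hB.n_pos hx'
  have hn' : ∀ v ∈ ord ++ [y], v < n := by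
    intro v hv
    rcases List.mem_append.1 hv with hv | hv
    · exact hn v hv
    · obtain rfl : v = y := by simpa using hv
      exact hyn
  have hle : 3 ^ x ≤ 3 ^ x' := Nat.pow_le_pow_right (by norm_num) hxx
  have hlt : ∀ v ∈ ord, v < 3 ^ x := hI.fits.lt
  have hT' := hI.fits.ordered.addLeaf hp hy
  have hF' : Fits ⟨W, S, V, 3 ^ x', 5 * lg n⟩ (T.addLeaf p y) (ord ++ [y]) := by
    refine hB.fits (by positivity) hx' hT' fun v hv => ?_
    rcases List.mem_append.1 hv with hv | hv
    · exact (hlt v hv).trans_le hle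
    · obtain rfl : v = y := by simpa using hv
      exact hyx
  obtain ⟨s₁, st₁, t₁, E₁, c₁, R₁, a1, a2, a3, a4, a5, r0, r1, r4, r5, r14, r24, r25⟩ :=
    grow_exec hI.fits.ok hR₂ rfl hxx hyx hmin (by simp only; omega)
      (le_trans (Nat.mul_le_mul_right _ (Nat.mul_le_mul_left _ hx')) hB.space)
      (by simp : _ = p) (by simp) hI₂.reg4 hI.tb
  rcases hxx.eq_or_lt with rfl | hxx
  · have hI₁ : Inv ⟨W, S, V, 3 ^ x, 5 * lg n⟩ T ord x st₁ :=
      hI.congr (r4.trans hI.reg4.symm) (r5.trans hI.reg5.symm) (a5 rfl)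
        (fun v hv => a2 v (hlt v hv) fun h => hy' (h ▸ hv)) a4
    obtain ⟨c, hc, hw⟩ := insert_wp hI₁ hF' hp' hy' a3 r0 r1 r14 (by simpa using r24) r25
    obtain ⟨s₂, st₂, t₂, E₂, c₂, R₂, hI', hpot⟩ := hw s₁ R₁
    refine ⟨s₂, t₁ + t₂, _, Exec.seq _ _ _ _ _ _ _ E₁ E₂, ⟨x, _, st₂, R₂, hI', hx, hn', le_rfl⟩, ?_⟩
    have hpe : pot T x st₁ = pot T x st := by
      refine Finset.sum_congr rfl fun k _ => Finset.sum_congr rfl fun v hv => ?_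
      exact a5 rfl _ (by norm_num) k v (hlt v ((hI.fits.ordered.mem v).2 hv))
    rw [hpe] at hpot
    have c₁' : t₁ ≤ growCost := by simpa using c₁
    have b1 : (5 * x + 2) * (blkCost insertBody + 3) ≤ (5 * lg n + 2) * (blkCost insertBody + 3) :=
      Nat.mul_le_mul_right _ (by omega)
    -- Since `1 ≤ c`, the factor `8 * c + 1` is at most `9 * c`; this is the `9` in `potFactor`.
    have b2 : (8 * c + 1) * (5 * x + 1) * rebuildCost ≤ potFactor n * c := by
      have : (8 * c + 1) * (5 * x + 1) * rebuildCost ≤ 9 * c * (5 * lg n + 1) * rebuildCost :=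
        Nat.mul_le_mul_right _ (Nat.mul_le_mul (by omega) (by omega))
      refine this.trans (le_of_eq ?_)
      rw [potFactor]
      ring
    have b3 := Nat.mul_le_mul_left (potFactor n)
      (hpot.trans (by omega : _ ≤ pot T x st + (5 * lg n + 1)))
    rw [mul_add, mul_add] at b3
    rw [leafCost]
    omega
  · rw [if_pos hxx] at r24
    have hlv₁ : LvlOn T ord 0 st₁ := (hI.lvl 0 (Nat.zero_le _)).congr fun f hf v hv => a1 f
      (by simp only [List.mem_cons, List.not_mem_nil, or_false] at hf; omega) v (hlt v hv)
    have hhd := (hI.lvl 0 (Nat.zero_le _)).hd_mem p hp'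
    have hsz := (hI.lvl 0 (Nat.zero_le _)).size_le hI.fits hp'
    have hcr := hI.live 0 (Nat.zero_le _) p hp'
    have e1 : st₁.arr aHD 0 p = st.arr aHD 0 p := a1 _ (by norm_num) p (hlt p hp')
    have e2 : st₁.arr aSZ 0 (st.arr aHD 0 p) = st.arr aSZ 0 (st.arr aHD 0 p) :=
      a1 _ (by norm_num) _ (hlt _ hhd)
    have e3 : st₁.arr aCR 0 (st.arr aHD 0 p) = st.arr aCR 0 (st.arr aHD 0 p) :=
      a1 _ (by norm_num) _ (hlt _ hhd)
    simp only at hsz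
    obtain ⟨s₂, st₂, t₂, E₂, c₂, R₂, hI', hpot⟩ :=
      regrow_wp hF' rfl (Nat.mul_le_mul_left 5 hxl) r0 r1 r4 r5 r14 r24 r25
        (fun v hv => (a2 v (hlt v hv) fun h => hy' (h ▸ hv)).trans (hI.par v hv)) a3 a4 hlv₁
        (fun v hv => (a1 _ (by norm_num) v (hlt v hv)).trans (hI.pp0 v hv)) hI.fits.ordered.mem
        hp' hy' (by rw [e1, e2]; exact hsz.trans hle) (by rw [e1, e3]; simp only; omega) s₁ R₁
    refine ⟨s₂, t₁ + t₂, _, Exec.seq _ _ _ _ _ _ _ E₁ E₂, ⟨x', _, st₂, R₂, hI', hx', hn', le_rfl⟩,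
      ?_⟩
    have hpe : ∑ v ∈ T.verts, st₁.arr aCR 0 v ≤ pot T x st := by
      rw [pot, Finset.sum_range_succ']
      refine le_trans (le_of_eq ?_) (Nat.le_add_left _ _)
      exact Finset.sum_congr rfl fun v hv =>
        a1 _ (by norm_num) v (hlt v ((hI.fits.ordered.mem v).2 hv))
    have hlen := length_le_of_lt hT'.nodup hn'
    rw [List.length_append, List.length_singleton] at hlen
    have b1 : growCost * (x' - x + (3 ^ x' - 3 ^ x) + 1) ≤ growCost * (lg n + 3 * n + 1) :=
      Nat.mul_le_mul_left _ (by omega)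
    have b2 : (ord.length + 2) * (5 * x' + 1) * rebuildCost ≤
        (n + 1) * (5 * lg n + 1) * rebuildCost :=
      Nat.mul_le_mul_right _ (Nat.mul_le_mul (by omega) (by omega))
    have b3 := Nat.mul_le_mul_left (potFactor n) (hpot.trans hpe)
    -- The exponent has increased by at least one and is still at most `lg n`, so one `growthCost`
    -- is released.
    have b4 : (lg n - x' + 1) * growthCost n ≤ (lg n - x) * growthCost n :=
      Nat.mul_le_mul_right _ (by omega)
    rw [add_mul, one_mul] at b4
    have b5 : t₁ + t₂ ≤ growthCost n := by
      rw [growthCost]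
      omega
    omega

/-! ### Initialization -/

def initBody : List At :=
  [.wr aHD (.num 0) (.reg 0) (.reg 0), .wr aLS (.num 0) (.reg 0) (.reg 0),
   .wr aSZ (.num 0) (.reg 0) (.num 1), .wr aPP (.num 0) (.reg 0) (.num 0), .set 13 (.reg 0)]

def initProg : Prog :=
  .seq (.const 3 1) (.seq (.copy 1 0) (.seq grow (.seq (blk initBody) rebuild)))

theorem single_lvlOn {r : ℕ} {st : HS} (hd : st.arr aHD 0 r = r) (hl : st.arr aLS 0 r = r)
    (hs : st.arr aSZ 0 r = 1) (hp : st.arr aPP 0 r = 0) : LvlOn (single r) [r] 0 st where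
  hd_mem v hv := by
    obtain rfl : v = r := by simpa using hv
    simp [hd]
  hd_hd v hv := by
    obtain rfl : v = r := by simpa using hv
    rw [hd, hd]
  code v hv w hw := by
    obtain rfl : v = r := by simpa using hv
    obtain rfl : w = v := by simpa using hw
    simp
  code_lt v hv := by
    obtain rfl : v = r := by simpa using hv
    simp [hp]
  top v hv := by
    obtain rfl : v = r := by simpa using hv
    right
    rw [hd]
  node v hv := by
    obtain rfl : v = r := by simpa using hv
    rw [hd]
    simpa [hd] using Linked.single hs hl

theorem init_exec {W S V n r : ℕ} (hB : Base W S V n) (hr : r < n) :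
    ∃ s t, Exec W S initProg (Config.zero.setReg 0 r) s t ∧
      Ready W S V n (single r) s (lg n * growthCost n) ∧
      t ≤ growthCost n + (blkCost initBody + 2) := by
  have hnV := hB.N_lt
  have hVW : V ≤ W := (Nat.le_self_pow (by norm_num) V).trans hB.pow_le
  obtain ⟨x, -, hrx, hmin, hx⟩ := exists_exponent (x := 0) hr (by simp; omega)
  have hxl := le_lg hB.n_pos hx
  obtain ⟨s₀, hs₀⟩ : ∃ s₀ : Config, s₀ = ((Config.zero.setReg 0 r).setReg 3 1).setReg 1 r :=
    ⟨_, rfl⟩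
  -- The zero memory represents zero arrays with capacity `3 ^ 0 = 1`. With `r` in the registers `0`
  -- and `1`, `grow` makes room for the name `r` and makes `r` its own parent.
  have hR : Rel ⟨W, S, V, 3 ^ 0, 5 * lg n⟩ ⟨s₀.reg, fun _ _ _ => 0⟩ s₀ := by
    refine ⟨fun _ _ => rfl, fun i _ => ?_, ?_, fun _ _ _ _ _ => ?_, fun p => ?_⟩
    · simp only [hs₀, Config.setReg, Function.update_apply, Config.zero]
      split_ifs <;> omega
    · simp [hs₀, Config.setReg]
    · simp [hs₀, Config.setReg, Config.zero]
    · simp [hs₀, Config.setReg, Config.zero]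
      omega
  have hok : Env.Ok ⟨W, S, V, 3 ^ 0, 5 * lg n⟩ :=
    ⟨hB.pow_le, hB.le_V, by norm_num, le_trans (Nat.mul_le_mul_right _ (Nat.mul_le_mul_left _
      (by have := hB.n_pos; simp only [pow_zero]; omega))) hB.space⟩
  obtain ⟨s₁, st₁, t₁, E₁, c₁, R₁, a1, a2, a3, a4, a5, r0, r1, r4, r5, r14, r24, r25⟩ :=
    grow_exec hok hR rfl (Nat.zero_le x) hrx hmin (by simp only; omega)
      (le_trans (Nat.mul_le_mul_right _ (Nat.mul_le_mul_left _ hx)) hB.space)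
      (by simp [hs₀, Config.setReg] : _ = r) (by simp [hs₀, Config.setReg])
      (by simp [hs₀, Config.setReg, Config.zero]) (fun i hi => by
        obtain rfl : i = 0 := by simpa using hi
        exact tl_zero.symm)
  have hF : Fits ⟨W, S, V, 3 ^ x, 5 * lg n⟩ (single r) [r] :=
    hB.fits (by positivity) hx (single_ordered r) fun v hv => by
      obtain rfl : v = r := by simpa using hv
      exact hrx
  have hbody : WP ⟨W, S, V, 3 ^ x, 5 * lg n⟩ (blk initBody) (blkCost initBody) st₁ (fun st' =>
      st'.reg 4 = x ∧ st'.reg 5 = 5 * x ∧ st'.reg 13 = r ∧ st'.reg 14 = 0 ∧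
      st'.arr aPAR 0 r = r ∧ (∀ i < 3 ^ x, st'.arr aTB 0 i = tl i) ∧ st'.arr aHD 0 r = r ∧
      st'.arr aLS 0 r = r ∧ st'.arr aSZ 0 r = 1 ∧ st'.arr aPP 0 r = 0) := by
    refine blk_wp hF.ok _ _ _ rfl ?_
    simp only [initBody, vc]
    simp +contextual [r0, r4, r5, r14, hrx, a3, a4]
  obtain ⟨s₂, st₂, t₂, E₂, c₂, R₂, b1, b2, b3, b4, b5, b6, b7, b8, b9, b10⟩ := hbody s₁ R₁
  have hsing : ∀ {Q : ℕ → Prop}, Q r → ∀ v ∈ [r], Q v := by simp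
  obtain ⟨s₃, st₃, t₃, E₃, c₃, R₃, hI, hpot⟩ :=
    rebuildAll_wp hF rfl (Nat.mul_le_mul_left 5 hxl) b1 b2 b3 b4 (hsing (Q := fun v => _ = _) b5) b6
      (single_lvlOn b7 b8 b9 b10) (hsing (Q := fun v => _ = _) b10) (by simp)
      (hsing (Q := fun v => _ = _) b7) s₂ R₂
  have hz : pot (single r) x st₃ = 0 := by
    simpa [single] using hpot
  have E₁' : Exec W S grow (((Config.zero.setReg 0 r).setReg 3 1).setReg 1
      (((Config.zero.setReg 0 r).setReg 3 1).reg 0)) s₁ t₁ := by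
    convert E₁ using 1
    rw [hs₀]
    simp [Config.setReg, Config.zero]
  refine ⟨s₃, _, Exec.seq _ _ _ _ _ _ _ (Exec.const _ _ _ (by omega)) (Exec.seq _ _ _ _ _ _ _
    (Exec.copy _ _ _) (Exec.seq _ _ _ _ _ _ _ E₁' (Exec.seq _ _ _ _ _ _ _ E₂ E₃))),
    ⟨x, [r], st₃, R₃, hI, hx, by simpa using hr, ?_⟩, ?_⟩
  · rw [hz, mul_zero, zero_add]
    exact Nat.mul_le_mul_right _ (by omega)
  · have d1 : growCost * (x - 0 + (3 ^ x - 3 ^ 0) + 1) ≤ growCost * (lg n + 3 * n + 1) :=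
      Nat.mul_le_mul_left _ (by omega)
    have d2 : ([r].length + 1) * (5 * x + 1) * rebuildCost ≤
        (n + 1) * (5 * lg n + 1) * rebuildCost := by
      have := hB.n_pos
      exact Nat.mul_le_mul_right _ (Nat.mul_le_mul (by simp; omega) (by omega))
    rw [growthCost]
    omega

/-! ### The data structure -/

/-- The data structure. -/
def incNca : DataStructure := ⟨initProg, addLeafProg, queryProg⟩

theorem performs_incNca {W S V n : ℕ} (hB : Base W S V n) (ops : List Op) :
    ∀ (T : IncTree) (s : Config) (P : ℕ), Ready W S V n T s P → Legal n T ops →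
      ∃ t, Performs W S incNca T s ops t ∧
        t ≤ P + (ops.map Op.leafCount).sum * leafCost n + numCa ops * queryCost := by
  have hnV := hB.N_lt
  have hVW : V ≤ W := (Nat.le_self_pow (by norm_num) V).trans hB.pow_le
  have hlt : ∀ {T s P v}, Ready W S V n T s P → v ∈ T.verts → v < W := by
    rintro T s P v ⟨x, ord, st, -, hI, -, hn, -⟩ hv
    have := hn v ((hI.fits.ordered.mem v).2 hv)
    omega
  induction ops with
  | nil =>
    intro T s P _ _
    exact ⟨0, rfl, Nat.zero_le _⟩
  | cons op ops ih =>
    intro T s P hr hl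
    cases op with
    | addLeaf p y =>
      obtain ⟨hp, hy, hyn, hl⟩ := hl
      obtain ⟨s', t, P', E, hr', ht⟩ := hr.addLeaf hB hp hy hyn
      obtain ⟨t', hpf, ht'⟩ := ih _ s' P' hr' hl
      refine ⟨t + t', ⟨hlt hr hp, by omega, s', t, t', E, hpf, rfl⟩, ?_⟩
      simp only [numCa, List.map_cons, List.sum_cons, Op.leafCount, Op.caCount, add_mul, one_mul,
        zero_add] at ht' ⊢
      omega
    | ca v w =>
      obtain ⟨hv, hw, hl⟩ := hl
      obtain ⟨s', t, E, ht, hca, hr'⟩ := hr.query hB hv hw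
      obtain ⟨t', hpf, ht'⟩ := ih _ s' P hr' hl
      refine ⟨t + t', ⟨hlt hr hv, hlt hr hw, s', t, t', E, hca, hpf, rfl⟩, ?_⟩
      simp only [numCa, List.map_cons, List.sum_cons, Op.leafCount, Op.caCount, add_mul, one_mul,
        zero_add] at ht' ⊢
      omega

/-- With `V = 2 ^ (20 * lg n)`, the power `V ^ 40` needs `800 * lg n` bits, whence `800 ≤ C`. The
codes fit because `3 ^ 5 < 2 ^ 20`. -/
theorem base_of_pow {C n : ℕ} (hn : 0 < n) (hC : 800 ≤ C) :
    Base (2 ^ (C * lg n)) (C * (n * lg n)) (2 ^ (20 * lg n)) n := by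
  have hl : 1 ≤ lg n := by simp [lg]
  have h1 : n < 2 ^ lg n := Nat.lt_pow_succ_log_self (by norm_num) n
  refine ⟨hn, ?_, ?_, ?_, ?_, ?_⟩
  · rw [← pow_mul]
    exact Nat.pow_le_pow_right (by norm_num) (by nlinarith)
  · calc 100 ≤ 2 ^ 20 := by norm_num
      _ ≤ 2 ^ (20 * lg n) := Nat.pow_le_pow_right (by norm_num) (by omega)
  · calc 24 * n + 8 < 2 ^ 5 * 2 ^ lg n := by omega
      _ = 2 ^ (5 + lg n) := (pow_add _ _ _).symm
      _ ≤ 2 ^ (20 * lg n) := Nat.pow_le_pow_right (by norm_num) (by omega)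
  · rw [pow_mul, pow_mul]
    exact Nat.pow_lt_pow_left (by norm_num) (by omega)
  · have h2 : (5 * lg n + 1) * (3 * n) * 19 ≤ 342 * (n * lg n) := by nlinarith
    exact h2.trans (Nat.mul_le_mul_right _ (by omega))

/-- The constant of the time bound. -/
def timeFactor : ℕ := 800 + (blkCost initBody + 2) +
  2 * (5 * growCost + 2 * (blkCost insertBody + 3) + 12 * rebuildCost) +
  (growCost + 7 * (blkCost insertBody + 3) + 324 * rebuildCost) + queryCost

/-- Initialization and the at most `ℓ` growths cost `O(n * ℓ)` each, the insertions `O(ℓ ^ 2)` each,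
the queries `O(1)` each. The summand `800` only serves the word size. -/
theorem time_le {n m ℓ G B R I Q : ℕ} (hn : 1 ≤ n) (hl : 1 ≤ ℓ) :
    G * (ℓ + 3 * n + 1) + 2 * B + (n + 1) * (5 * ℓ + 1) * R + I +
      (ℓ * (G * (ℓ + 3 * n + 1) + 2 * B + (n + 1) * (5 * ℓ + 1) * R) +
        n * (G + (5 * ℓ + 2) * B + 9 * (5 * ℓ + 1) * R * (5 * ℓ + 1)) + m * Q) ≤
    (800 + I + 2 * (5 * G + 2 * B + 12 * R) + (G + 7 * B + 324 * R) + Q) * (m + n * ℓ ^ 2) := by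
  obtain ⟨p, hp⟩ : ∃ p, p = n * ℓ := ⟨_, rfl⟩
  have h1 : ℓ ≤ p := hp ▸ Nat.le_mul_of_pos_left ℓ hn
  have h2 : n ≤ p := hp ▸ Nat.le_mul_of_pos_right n hl
  have h3 : (n + 1) * (5 * ℓ + 1) ≤ 12 * p :=
    (Nat.mul_le_mul (by omega : n + 1 ≤ 2 * n) (by omega : 5 * ℓ + 1 ≤ 6 * ℓ)).trans
      (le_of_eq (by rw [hp]; ring))
  obtain ⟨X, hX⟩ : ∃ X, X = G * (ℓ + 3 * n + 1) + 2 * B + (n + 1) * (5 * ℓ + 1) * R := ⟨_, rfl⟩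
  have hXp : X ≤ p * (5 * G + 2 * B + 12 * R) := by
    have a1 : G * (ℓ + 3 * n + 1) ≤ G * (5 * p) := Nat.mul_le_mul_left _ (by omega)
    have a2 : 2 * B ≤ p * (2 * B) := Nat.le_mul_of_pos_left _ (by omega)
    have a3 := Nat.mul_le_mul_right R h3
    calc X ≤ G * (5 * p) + p * (2 * B) + 12 * p * R := by omega
      _ = p * (5 * G + 2 * B + 12 * R) := by ring
  obtain ⟨q, hq⟩ : ∃ q, q = n * ℓ ^ 2 := ⟨_, rfl⟩
  have hpq : ℓ * p = q := by rw [hp, hq]; ring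
  have hpq' : p ≤ q := hpq ▸ Nat.le_mul_of_pos_left p hl
  have b1 : ℓ * X ≤ q * (5 * G + 2 * B + 12 * R) := by
    rw [← hpq, mul_assoc]
    exact Nat.mul_le_mul_left _ hXp
  have b2 : X ≤ q * (5 * G + 2 * B + 12 * R) := hXp.trans (Nat.mul_le_mul_right _ hpq')
  have b3 : n * (G + (5 * ℓ + 2) * B + 9 * (5 * ℓ + 1) * R * (5 * ℓ + 1)) ≤
      q * (G + 7 * B + 324 * R) := by
    refine (Nat.mul_le_mul_left n (m := ℓ ^ 2 * (G + 7 * B + 324 * R)) ?_).trans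
      (le_of_eq (by rw [hq]; ring))
    have c1 : 1 ≤ ℓ ^ 2 := Nat.one_le_pow _ _ hl
    have c2 : ℓ ≤ ℓ ^ 2 := Nat.le_self_pow (by norm_num) ℓ
    have c3 : G ≤ ℓ ^ 2 * G := Nat.le_mul_of_pos_left _ c1
    have c4 : (5 * ℓ + 2) * B ≤ (7 * ℓ ^ 2) * B := Nat.mul_le_mul_right _ (by omega)
    have c5 : (5 * ℓ + 1) * (5 * ℓ + 1) ≤ 36 * ℓ ^ 2 :=
      (Nat.mul_le_mul (by omega : 5 * ℓ + 1 ≤ 6 * ℓ) (by omega : 5 * ℓ + 1 ≤ 6 * ℓ)).trans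
        (le_of_eq (by ring))
    have c6 : 9 * (5 * ℓ + 1) * R * (5 * ℓ + 1) ≤ 9 * R * (36 * ℓ ^ 2) := by
      refine le_trans (le_of_eq ?_) (Nat.mul_le_mul_left (9 * R) c5)
      ring
    calc _ ≤ ℓ ^ 2 * G + (7 * ℓ ^ 2) * B + 9 * R * (36 * ℓ ^ 2) := by omega
      _ = ℓ ^ 2 * (G + 7 * B + 324 * R) := by ring
  have b4 : I ≤ q * I := Nat.le_mul_of_pos_left _ (by omega)
  rw [← hX, ← hq]
  calc _ ≤ q * (5 * G + 2 * B + 12 * R) + q * I + (q * (5 * G + 2 * B + 12 * R) +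
        q * (G + 7 * B + 324 * R) + m * Q) := by omega
    _ ≤ q * (5 * G + 2 * B + 12 * R) + q * I + (q * (5 * G + 2 * B + 12 * R) +
        q * (G + 7 * B + 324 * R) + m * Q) +
        (m * (800 + I + 2 * (5 * G + 2 * B + 12 * R) + (G + 7 * B + 324 * R)) +
          q * (800 + Q)) := Nat.le_add_right _ _
    _ = _ := by ring

end IncNca

theorem lemma3p5 :
    ∃ (D : IncNca.DataStructure) (C : ℕ), ∀ (r : ℕ) (ops : List IncNca.Op) (n m : ℕ),
      n = IncNca.numVerts ops → m = IncNca.numCa ops →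
      r < n → IncNca.Legal n (IncNca.IncTree.single r) ops →
      ∃ t : ℕ, t ≤ C * (m + n * IncNca.lg n ^ 2) ∧
        IncNca.Solves (2 ^ (C * IncNca.lg n)) (C * (n * IncNca.lg n)) D r ops t := by
  refine ⟨IncNca.incNca, IncNca.timeFactor, fun r ops n m hn hm hr hl => ?_⟩
  have hn0 : 0 < n := by omega
  have hB := IncNca.base_of_pow (C := IncNca.timeFactor) hn0 (by rw [IncNca.timeFactor]; omega)
  obtain ⟨s, t₀, E, hR, ht₀⟩ := IncNca.init_exec hB hr
  obtain ⟨t₁, hP, ht₁⟩ := IncNca.performs_incNca hB ops _ s _ hR hl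
  have hW : r < 2 ^ (IncNca.timeFactor * IncNca.lg n) := by
    have h1 := hB.N_lt
    have h2 := (Nat.le_self_pow (by norm_num) _).trans hB.pow_le
    omega
  refine ⟨t₀ + t₁, ?_, hW, s, t₀, t₁, E, hP, rfl⟩
  have hle : (ops.map IncNca.Op.leafCount).sum ≤ n := by rw [hn, IncNca.numVerts]; omega
  have h1 := Nat.mul_le_mul_right (IncNca.leafCost n) hle
  have h2 := IncNca.time_le (n := n) (m := m) (ℓ := IncNca.lg n) (G := IncNca.growCost)
    (B := IncNca.blkCost IncNca.insertBody + 3) (R := IncNca.rebuildCost)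
    (I := IncNca.blkCost IncNca.initBody + 2) (Q := IncNca.queryCost) hn0 (by simp [IncNca.lg])
  rw [← hm] at ht₁
  refine le_trans ?_ h2
  rw [IncNca.growthCost] at ht₀ ht₁
  rw [IncNca.leafCost, IncNca.potFactor] at h1 ht₁
  omega
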